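/- **Setting.** Let $n\ge 0$ be an integer, let $\phi$ be a smooth ($C^\infty$) real-valued strictly plurisubharmonic function on an open neighbourhood $\Omega$ of $0$ in $\mathbb C^n$ (the local weight of a smooth positively curved metric on a line bundle $L$), let $\omega=\frac i2\partial\bar\partial\phi$ and $\omega_n=\omega^n/n!=\det(\phi_{x_i\bar x_j})\,d\lambda$. For $r>0$ let $B_r=\{|y|<r\}$; for an integer $k\ge1$ let $(f,g)_{k\phi}=\int_{B_r}f\bar g\,e^{-k\phi}\omega_n$, let $\|u\|_{k\phi}$ be the corresponding norm, and let $H_{k\phi}(B_r)$ be the space of holomorphic $u$ on $B_r$ with $\|u\|_{k\phi}<\infty$. An almost holomorphic extension of $\phi$ is a smooth function $\psi(x,z)$ on an open neighbourhood $W$ of $(0,0)$ in $\mathbb C^n\times\mathbb C^n$ such that, at all points $(y,\bar y)\in W$ with $y\in\Omega$, one has $\psi(y,\bar y)=\phi(y)$ and all real derivatives, of every order, of the components of $\bar\partial\psi$ (in both variables) vanish. **Proposition.** For each $n$ there are polynomials $P_0=1,P_1,P_2,\dots$ with complex coefficients, depending only on $n$, in variables indexed by the derivatives $\partial_x^\alpha\bar\partial_y^\beta$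 ($\alpha,\beta\in\mathbb N^n$) and one further variable, such that the following holds for every $\phi$ as above. The function $\phi$ has an almost holomorphic extension, and for every almost holomorphic extension $\psi$ of $\phi$ there is $r_0>0$ with $B_{r_0}\subset\Omega$ and, for all $x,y\in B_{r_0}$, $(x,\bar y)\in W$ and $\det\big(\partial_{x_i}\bar\partial_{y_j}\psi(x,\bar y)\big)\neq0$, such that, if $b_m(x,\bar y)$ denotes the value of $P_m$ at the derivatives $\partial_x^\alpha\bar\partial_y^\beta\psi(x,\bar y)$ and at $\det\big(\partial_{x_i}\bar\partial_{y_j}\psi(x,\bar y)\big)^{-1}$, and $$K_k^{(N)}(x,\bar y)=(k/\pi)^n e^{k\psi(x,\bar y)}\big(b_0+b_1k^{-1}+\dots+b_Nk^{-N}\big)(x,\bar y),$$ then: 1. $K_k^{(N)}$ is an asymptotic reproducing kernel mod $O(k^{n-N-1})$: for every $0<r\le r_0$ there is $0<\varepsilon<r$ such that for every real-valued smooth function $\chi$ with compact support in $B_r$ and equal to $1$ on $B_{r/2}$, and every $N\ge0$, there is a constant $C$ with $$\big|u(x)-(\chi u,K^{(N)}_{k,x})_{k\phi}\big|\le C\,k^{n-N-1}e^{k\phi(x)/2}\|u\|_{k\phi},\qquad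 K^{(N)}_{k,x}(y):=\overline{K^{(N)}_k(x,\bar y)},$$ for all integers $k\ge1$, all $u\in H_{k\phi}(B_r)$ and all $|x|<\varepsilon$. 2. For every $N\ge0$, every order $l\ge 0$ and every $M\ge 0$ there is a constant $C$ such that, for every real partial derivative $D^\alpha_{x,y}$ of order $l$ and every component of $(\bar\partial_x,\partial_y)$, $$e^{-k(\phi(x)/2+\phi(y)/2)}\big|D^\alpha_{x,y}(\bar\partial_x,\partial_y)K_k^{(N)}(x,\bar y)\big|\le C\,k^{-M}$$ for all integers $k\ge1$ and all $x,y\in B_{r_0}$. -/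

import Mathlib

open scoped ContDiff ComplexConjugate ComplexOrder

noncomputable section

/-- `ℂⁿ` with its Euclidean norm; `volume` on it is Lebesgue measure. -/
abbrev Cn (n : ℕ) := EuclideanSpace ℂ (Fin n)

/-- The `j`-th coordinate vector of `ℂⁿ`. -/
def coordVec {n : ℕ} (j : Fin n) : Cn n := EuclideanSpace.single j (1 : ℂ)

/-- Coordinatewise complex conjugation `y ↦ ȳ` on `ℂⁿ`. -/
def conjVec {n : ℕ} (y : Cn n) : Cn n := WithLp.toLp 2 (fun j => conj (y j))

section Wirtinger

variable {V : Type*} [NormedAddCommGroup V] [NormedSpace ℂ V]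

/-- The `(1,0)`-derivative of `f` in the direction `v`; for a coordinate vector `v` this is
`∂f/∂v = (∂f/∂(re) - i ∂f/∂(im)) / 2`. -/
def delHol (v : V) (f : V → ℂ) (p : V) : ℂ :=
  (fderiv ℝ f p v - Complex.I * fderiv ℝ f p (Complex.I • v)) / 2

/-- The `(0,1)`-derivative of `f` in the direction `v`; for a coordinate vector `v` this is
`∂f/∂v̄ = (∂f/∂(re) + i ∂f/∂(im)) / 2`. -/
def delBar (v : V) (f : V → ℂ) (p : V) : ℂ :=
  (fderiv ℝ f p v + Complex.I * fderiv ℝ f p (Complex.I • v)) / 2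

end Wirtinger

/-- The complex Hessian `(∂²φ / ∂x_i ∂x̄_j)`. -/
def complexHessian {n : ℕ} (φ : Cn n → ℝ) (x : Cn n) : Matrix (Fin n) (Fin n) ℂ :=
  Matrix.of fun i j => delHol (coordVec i) (delBar (coordVec j) fun y => (φ y : ℂ)) x

/-- `φ` is smooth and strictly plurisubharmonic on `Ω`. -/
def IsSmoothStrictlyPSHOn {n : ℕ} (φ : Cn n → ℝ) (Ω : Set (Cn n)) : Prop :=
  ContDiffOn ℝ ∞ φ Ω ∧ ∀ x ∈ Ω, (complexHessian φ x).PosDef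

/-- The density of `ω_n = ωⁿ / n!`, `ω = (i/2) ∂∂̄φ`, with respect to Lebesgue measure. -/
def volDensity {n : ℕ} (φ : Cn n → ℝ) (x : Cn n) : ℝ := (complexHessian φ x).det.re

/-- `(f, g)_{kφ} = ∫_{|y| < r} f ḡ e^{-kφ} ω_n`. -/
def weightedInner {n : ℕ} (φ : Cn n → ℝ) (r : ℝ) (k : ℕ) (f g : Cn n → ℂ) : ℂ :=
  ∫ y in Metric.ball (0 : Cn n) r,
    f y * conj (g y) * ((Real.exp (-(k * φ y)) * volDensity φ y : ℝ) : ℂ)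

/-- `u ∈ H_{kφ}(B_r)`: `u` is holomorphic on the ball of radius `r`, with finite weighted norm. -/
def MemWeightedHol {n : ℕ} (φ : Cn n → ℝ) (r : ℝ) (k : ℕ) (u : Cn n → ℂ) : Prop :=
  DifferentiableOn ℂ u (Metric.ball 0 r) ∧
    MeasureTheory.IntegrableOn
      (fun y => ‖u y‖ ^ 2 * (Real.exp (-(k * φ y)) * volDensity φ y)) (Metric.ball 0 r)

/-- `‖u‖_{kφ}`, the square root of `∫_{|y| < r} |u|² e^{-kφ} ω_n`. -/
def weightedNorm {n : ℕ} (φ : Cn n → ℝ) (r : ℝ) (k : ℕ) (u : Cn n → ℂ) : ℝ :=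
  Real.sqrt (∫ y in Metric.ball (0 : Cn n) r,
    ‖u y‖ ^ 2 * (Real.exp (-(k * φ y)) * volDensity φ y))

/-- `χ` is a cut-off function for the ball of radius `r`: smooth, compactly supported in that
ball, and equal to one on the ball of half the radius. -/
def IsCutoff {n : ℕ} (r : ℝ) (χ : Cn n → ℝ) : Prop :=
  ContDiff ℝ ∞ χ ∧ tsupport χ ⊆ Metric.ball 0 r ∧ ∀ y ∈ Metric.ball (0 : Cn n) (r / 2), χ y = 1

/-- The family `K k x y` (standing for `K_k(x, ȳ)`, the complex conjugate of `K_{k,x}(y)`) is a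
reproducing kernel mod `O(k^s)` for `H_{kφ}(B_r)`, uniformly for `|x| < ε`:
`u(x) = (χ u, K_{k,x})_{kφ} + O(k^s e^{kφ(x)/2}) ‖u‖_{kφ}`. -/
def IsReproducingKernelMod {n : ℕ} (φ : Cn n → ℝ) (r ε : ℝ) (χ : Cn n → ℝ) (s : ℤ)
    (K : ℕ → Cn n → Cn n → ℂ) : Prop :=
  ∃ C : ℝ, ∀ k : ℕ, 1 ≤ k → ∀ u : Cn n → ℂ, MemWeightedHol φ r k u →
    ∀ x ∈ Metric.ball (0 : Cn n) ε,
      ‖u x - weightedInner φ r k (fun y => (χ y : ℂ) * u y) (fun y => conj (K k x y))‖ ≤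
        C * (k : ℝ) ^ s * Real.exp (k * φ x / 2) * weightedNorm φ r k u

/-- `ψ`, smooth on the neighbourhood `W` of the origin, is an almost holomorphic extension of `φ`
from `{z = ȳ}`: `ψ(y, ȳ) = φ(y)`, and all real derivatives of all components of `∂̄ψ` vanish at the
points of `W` with `z = ȳ`. -/
structure IsAlmostHolExtension {n : ℕ} (Ω : Set (Cn n)) (φ : Cn n → ℝ)
    (W : Set (Cn n × Cn n)) (ψ : Cn n × Cn n → ℂ) : Prop where
  isOpen : IsOpen W
  zero_mem : (0, 0) ∈ W
  smooth : ContDiffOn ℝ ∞ ψ W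
  extends_phi : ∀ y ∈ Ω, (y, conjVec y) ∈ W → ψ (y, conjVec y) = (φ y : ℂ)
  flat : ∀ y ∈ Ω, (y, conjVec y) ∈ W → ∀ (v : Cn n × Cn n) (m : ℕ),
    iteratedFDeriv ℝ m (delBar v ψ) (y, conjVec y) = 0

/-- The function `(x, y) ↦ ψ(x, ȳ)`. -/
def polarized {n : ℕ} (ψ : Cn n × Cn n → ℂ) (p : Cn n × Cn n) : ℂ := ψ (p.1, conjVec p.2)

/-- `∂_x^α ∂̄_y^β F` for a function `F` of `(x, y)`. -/
def mixedDeriv {n : ℕ} (α β : Fin n → ℕ) (F : Cn n × Cn n → ℂ) : Cn n × Cn n → ℂ :=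
  (List.finRange n).foldr (fun j G => (delHol ((coordVec j, 0) : Cn n × Cn n))^[α j] G)
    ((List.finRange n).foldr (fun j G => (delBar ((0, coordVec j) : Cn n × Cn n))^[β j] G) F)

/-- The determinant of the matrix `(∂_{x_i} ∂̄_{y_j} F)`. -/
def mixedHessianDet {n : ℕ} (F : Cn n × Cn n → ℂ) (p : Cn n × Cn n) : ℂ :=
  (Matrix.of fun i j : Fin n =>
    delHol ((coordVec i, 0) : Cn n × Cn n) (delBar ((0, coordVec j) : Cn n × Cn n) F) p).det

/-- Polynomials in one variable for each derivative `∂_x^α ∂̄_y^β ψ(x, ȳ)` (`some (α, β)`), and one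
further variable (`none`) for the inverse of `det (∂_{x_i} ∂̄_{y_j} ψ(x, ȳ))`. -/
abbrev JetPolynomial (n : ℕ) := MvPolynomial (Option ((Fin n → ℕ) × (Fin n → ℕ))) ℂ

/-- The value at `(x, y)` of the differential expression in `ψ` given by a jet polynomial. -/
def JetPolynomial.evalAt {n : ℕ} (P : JetPolynomial n) (ψ : Cn n × Cn n → ℂ)
    (p : Cn n × Cn n) : ℂ :=
  MvPolynomial.eval
    (fun a => a.elim (mixedHessianDet (polarized ψ) p)⁻¹
      (fun αβ => mixedDeriv αβ.1 αβ.2 (polarized ψ) p)) P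

/-- `K_k^{(N)}(x, ȳ) = (k/π)ⁿ e^{kψ(x, ȳ)} (b_0 + b_1 k⁻¹ + ⋯ + b_N k^{-N})`, where `b_m` is the
differential expression in `ψ` given by `P m`. -/
def asymptoticKernel {n : ℕ} (P : ℕ → JetPolynomial n) (ψ : Cn n × Cn n → ℂ) (N k : ℕ)
    (x y : Cn n) : ℂ :=
  ((k / Real.pi : ℝ) : ℂ) ^ n * Complex.exp (k * ψ (x, conjVec y)) *
    ∑ m ∈ Finset.range (N + 1), (P m).evalAt ψ (x, y) * ((k : ℂ) ^ m)⁻¹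

/-- All real derivatives of the components of `(∂̄_x, ∂_y) K_k(x, ȳ)`, multiplied by
`e^{-k(φ(x)/2 + φ(y)/2)}`, are `O(k^{-∞})` uniformly for `|x| < r` and `|y| < r`. -/
def IsAlmostHolKernel {n : ℕ} (φ : Cn n → ℝ) (r : ℝ) (K : ℕ → Cn n → Cn n → ℂ) : Prop :=
  ∀ l M : ℕ, ∃ C : ℝ, ∀ k : ℕ, 1 ≤ k →
    ∀ x ∈ Metric.ball (0 : Cn n) r, ∀ y ∈ Metric.ball (0 : Cn n) r, ∀ j : Fin n,
      Real.exp (-(k * (φ x / 2 + φ y / 2))) *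
          ‖iteratedFDeriv ℝ l (delBar ((coordVec j, 0) : Cn n × Cn n)
            (fun p => K k p.1 p.2)) (x, y)‖ ≤ C / (k : ℝ) ^ M ∧
      Real.exp (-(k * (φ x / 2 + φ y / 2))) *
          ‖iteratedFDeriv ℝ l (delHol ((0, coordVec j) : Cn n × Cn n)
            (fun p => K k p.1 p.2)) (x, y)‖ ≤ C / (k : ℝ) ^ M

end

/-! Write w = y - x. The source of every reproducing formula here is the density det(∂̄θ) e^{-kθ·w},
for a vector θ(x, y) whose phase satisfies Re(θ·w) ≥ (φ(y) - φ(x))/2 + c|w|². Its variation in θ is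
a ∂̄-divergence (`hasDerivAt_det_mul_exp`, which rests on the Piola identity `sum_wirt_adjugate`). A
holomorphic u integrates to zero against such a divergence (`integral_holomorphic_mul_delBar`),
except where the cut-off varies; there |w| is bounded below and the integrand is negligible. So θ
can be deformed to the model θ = a + c w̄, a constant, for which averaging over the circle action
gives (π/k)^n u(x) times a truncated gaussian mass, which is exponentially close to 1
(`integral_model`, `abs_one_sub_gaussianMass_le`).

Choose θ with θ·w = ψ(y, ȳ) - ψ(x, ȳ). The exponential is then e^{kψ(x,ȳ)} e^{-kφ(y)}, as in the
pairing with the kernel, but the amplitude det(∂̄θ) is not of the required form b(x, ȳ) times the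
volume density at y. It is brought to that form by a division algorithm. Given an amplitude A_m,
choose b_m so that A_m - b_m·vol vanishes at w = 0, write the difference as ∑ q_j w_j, and solve
∂̄θ·V = q, so that it becomes ∑ V_i ∂̄_i(θ·w). Integration by parts turns this into k^{-1} div V,
and A_{m+1} = div V is the next amplitude. Since A_0 and vol agree at w = 0, b_0 = 1. The whole
algorithm is carried out on formal series in w whose coefficients are polynomials in the jet of ψ at
(x, ȳ) and in the inverse mixed Hessian determinant (`amplitude`, `kernelCoeff`), and this is why
the b_m are universal.

As ψ is only almost holomorphic, its series need not converge. They are truncated, and evaluation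
modulo O(|w|^L) is a ring homomorphism (`serHom`), so formal identities become estimates
(`exists_amplitude_bound`); `exists_taylor_bound` compares the truncations with true values at (y,
ȳ). Errors are harmless because of the phase inequality 2 Re ψ(x, ȳ) ≤ φ(x) + φ(y) - δ|w|²
(`IsPolarizedWeight.exists_phase_bound`), a consequence of strict plurisubharmonicity: a factor
|w|^{2b} against the resulting gaussian gains k^{-b}.

The second assertion uses the same inequality. The derivatives ∂̄_x and ∂_y of ψ(x, ȳ), and of every
jet polynomial in it, vanish to infinite order on the diagonal (`flatOn_wirt_jetVal`), and a flat
factor against the gaussian is O(k^{-∞}) (`FlatOn.isNegligible`).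

An almost holomorphic extension exists by Borel summation of the formal extension ∑ (i^m/m!) D^m
f(a)(c, …, c) from a real space to its complexification (`exists_almostHolomorphic`). -/

noncomputable section

/-! ### Wirtinger derivatives: calculus rules, commutation and linearity in the direction. -/

section WirtingerCalculus

variable {V : Type*} [NormedAddCommGroup V] [NormedSpace ℂ V]

/-- Common form of `delHol` (`s = -i`) and `delBar` (`s = i`). -/
def wirt (s : ℂ) (v : V) (f : V → ℂ) (p : V) : ℂ :=
  (fderiv ℝ f p v + s * fderiv ℝ f p (Complex.I • v)) / 2

theorem delHol_eq_wirt (v : V) : delHol v = wirt (-Complex.I) v := by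
  funext f p; simp only [delHol, wirt]; ring

theorem delBar_eq_wirt (v : V) : delBar v = wirt Complex.I v := rfl

variable {s t : ℂ} {v w : V} {f g : V → ℂ} {p : V}

theorem wirt_congr (h : f =ᶠ[nhds p] g) : wirt s v f p = wirt s v g p := by
  simp only [wirt, h.fderiv_eq]

theorem wirt_const (c : ℂ) : wirt s v (fun _ => c) p = 0 := by
  simp [wirt]

theorem wirt_add (hf : DifferentiableAt ℝ f p) (hg : DifferentiableAt ℝ g p) :
    wirt s v (fun q => f q + g q) p = wirt s v f p + wirt s v g p := by
  simp only [wirt, fderiv_fun_add hf hg, add_apply]; ring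

theorem wirt_sum {ι : Type*} {F : ι → V → ℂ} (u : Finset ι)
    (hf : ∀ i ∈ u, DifferentiableAt ℝ (F i) p) :
    wirt s v (fun q => ∑ i ∈ u, F i q) p = ∑ i ∈ u, wirt s v (F i) p := by
  simp only [wirt, fderiv_fun_sum hf, sum_apply]
  rw [← Finset.sum_div, Finset.sum_add_distrib, Finset.mul_sum]

theorem wirt_mul (hf : DifferentiableAt ℝ f p) (hg : DifferentiableAt ℝ g p) :
    wirt s v (fun q => f q * g q) p = wirt s v f p * g p + f p * wirt s v g p := by
  simp only [wirt, fderiv_fun_mul hf hg, add_apply,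
    smul_apply, smul_eq_mul]
  ring

theorem wirt_const_mul (c : ℂ) (hf : DifferentiableAt ℝ f p) :
    wirt s v (fun q => c * f q) p = c * wirt s v f p := by
  rw [wirt_mul (differentiableAt_const c) hf, wirt_const]; ring

theorem wirt_comp {h : ℂ → ℂ} {h' : ℂ} (hh : HasDerivAt h h' (f p))
    (hf : DifferentiableAt ℝ f p) :
    wirt s v (fun q => h (f q)) p = h' * wirt s v f p := by
  have h1 : HasFDerivAt (fun q => h (f q)) (h' • fderiv ℝ f p) p :=
    hh.comp_hasFDerivAt p hf.hasFDerivAt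
  simp only [wirt, h1.fderiv, smul_apply, smul_eq_mul]
  ring

theorem wirt_cexp (hf : DifferentiableAt ℝ f p) :
    wirt s v (fun q => Complex.exp (f q)) p = Complex.exp (f p) * wirt s v f p :=
  wirt_comp (Complex.hasDerivAt_exp _) hf

theorem wirt_inv (hf : DifferentiableAt ℝ f p) (h0 : f p ≠ 0) :
    wirt s v (fun q => (f q)⁻¹) p = -((f p)⁻¹) ^ 2 * wirt s v f p := by
  rw [wirt_comp (hasDerivAt_inv h0) hf, inv_pow]

theorem delBar_holomorphic (hf : DifferentiableAt ℂ f p) : delBar v f p = 0 := by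
  have h : fderiv ℝ f p = (fderiv ℂ f p).restrictScalars ℝ :=
    (hf.hasFDerivAt.restrictScalars ℝ).fderiv
  simp only [delBar, h, ContinuousLinearMap.coe_restrictScalars', map_smul, smul_eq_mul]
  rw [← mul_assoc, Complex.I_mul_I]; ring

theorem fderiv_eq_delHol_add_delBar : fderiv ℝ f p v = delHol v f p + delBar v f p := by
  simp only [delHol, delBar]; ring

theorem contDiff_wirt (hf : ContDiff ℝ ∞ f) : ContDiff ℝ ∞ (wirt s v f) := by
  have h : ContDiff ℝ ∞ (fderiv ℝ f) := hf.fderiv_right (by simp)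
  unfold wirt
  fun_prop

theorem contDiffAt_wirt (hf : ContDiffAt ℝ ∞ f p) : ContDiffAt ℝ ∞ (wirt s v f) p := by
  have h : ContDiffAt ℝ ∞ (fderiv ℝ f) p := hf.fderiv_right (by simp)
  unfold wirt
  fun_prop

theorem fderiv_wirt (hf : ContDiffAt ℝ ∞ f p) (u : V) :
    fderiv ℝ (wirt s v f) p u =
      (fderiv ℝ (fderiv ℝ f) p u v + s * fderiv ℝ (fderiv ℝ f) p u (Complex.I • v)) / 2 := by
  have h : DifferentiableAt ℝ (fderiv ℝ f) p :=
    (hf.fderiv_right (m := 1) (by norm_cast)).differentiableAt (by simp)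
  have h1 : ∀ z : V, HasFDerivAt (fun q => fderiv ℝ f q z)
      ((fderiv ℝ (fderiv ℝ f) p).flip z) p := fun z => by
    simpa using h.hasFDerivAt.clm_apply (hasFDerivAt_const z p)
  have h2 : HasFDerivAt (wirt s v f) ((2⁻¹ : ℂ) • ((fderiv ℝ (fderiv ℝ f) p).flip v +
      s • (fderiv ℝ (fderiv ℝ f) p).flip (Complex.I • v))) p := by
    have := ((h1 v).add ((h1 (Complex.I • v)).const_mul s)).const_mul (2⁻¹ : ℂ)
    refine this.congr_of_eventuallyEq (Filter.Eventually.of_forall fun q => ?_)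
    simp only [wirt, Pi.add_apply]; ring
  rw [h2.fderiv]
  simp
  ring

theorem wirt_comm (hf : ContDiffAt ℝ ∞ f p) :
    wirt s v (wirt t w f) p = wirt t w (wirt s v f) p := by
  have hs : IsSymmSndFDerivAt ℝ f p := hf.isSymmSndFDerivAt (by simp; norm_cast)
  conv_lhs => rw [wirt]
  conv_rhs => rw [wirt]
  simp only [fderiv_wirt hf]
  rw [hs.eq v w, hs.eq v (Complex.I • w), hs.eq (Complex.I • v) w,
    hs.eq (Complex.I • v) (Complex.I • w)]
  ring

theorem delHol_smul (c : ℂ) : delHol (c • v) f p = c * delHol v f p := by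
  have h1 : c • v = c.re • v + c.im • (Complex.I • v) := by
    rw [← Complex.coe_smul, ← Complex.coe_smul, smul_smul, ← add_smul, Complex.re_add_im]
  have h2 : Complex.I • (c • v) = c.re • (Complex.I • v) + -c.im • v := by
    rw [h1, smul_add, smul_comm Complex.I c.re, smul_comm Complex.I c.im, smul_smul,
      Complex.I_mul_I, neg_one_smul, neg_smul, smul_neg]
  have h3 : c = c.re + c.im * Complex.I := (Complex.re_add_im c).symm
  simp only [delHol]
  rw [h2, h1, map_add, map_add]
  simp only [map_smul, Complex.real_smul]
  generalize fderiv ℝ f p v = a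
  generalize fderiv ℝ f p (Complex.I • v) = b
  conv_rhs => rw [h3]
  push_cast
  linear_combination ((c.im:ℂ) * b/2) * Complex.I_mul_I

theorem delBar_smul (c : ℂ) : delBar (c • v) f p = conj c * delBar v f p := by
  have h1 : c • v = c.re • v + c.im • (Complex.I • v) := by
    rw [← Complex.coe_smul, ← Complex.coe_smul, smul_smul, ← add_smul, Complex.re_add_im]
  have h2 : Complex.I • (c • v) = c.re • (Complex.I • v) + -c.im • v := by
    rw [h1, smul_add, smul_comm Complex.I c.re, smul_comm Complex.I c.im, smul_smul,
      Complex.I_mul_I, neg_one_smul, neg_smul, smul_neg]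
  have h3 : conj c = c.re - c.im * Complex.I := by
    apply Complex.ext <;> simp
  simp only [delBar]
  rw [h2, h1, map_add, map_add]
  simp only [map_smul, Complex.real_smul]
  generalize fderiv ℝ f p v = a
  generalize fderiv ℝ f p (Complex.I • v) = b
  rw [h3]
  push_cast
  linear_combination ((c.im:ℂ) * b/2) * Complex.I_mul_I

theorem delHol_add_dir : delHol (v + w) f p = delHol v f p + delHol w f p := by
  simp only [delHol, smul_add, map_add]; ring

theorem delBar_add_dir : delBar (v + w) f p = delBar v f p + delBar w f p := by
  simp only [delBar, smul_add, map_add]; ring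

theorem delHol_sum_smul {ι : Type*} (u : Finset ι) (c : ι → ℂ) (e : ι → V) :
    delHol (∑ i ∈ u, c i • e i) f p = ∑ i ∈ u, c i * delHol (e i) f p := by
  classical
  induction u using Finset.induction_on with
  | empty => simp [delHol]
  | insert a u ha ih =>
    rw [Finset.sum_insert ha, Finset.sum_insert ha, delHol_add_dir, delHol_smul, ih]

theorem delBar_sum_smul {ι : Type*} (u : Finset ι) (c : ι → ℂ) (e : ι → V) :
    delBar (∑ i ∈ u, c i • e i) f p = ∑ i ∈ u, conj (c i) * delBar (e i) f p := by
  classical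
  induction u using Finset.induction_on with
  | empty => simp [delBar]
  | insert a u ha ih =>
    rw [Finset.sum_insert ha, Finset.sum_insert ha, delBar_add_dir, delBar_smul, ih]

end WirtingerCalculus

/-! ### Mixed derivatives ∂_x^α ∂̄_y^β and how they combine. -/

section Jets

variable {n : ℕ}

theorem sum_smul_coordVec (v : Cn n) : ∑ j, v j • (coordVec j : Cn n) = v := by
  ext i
  simp [coordVec, Finset.sum_apply, Pi.single_apply]

theorem fderiv_eq_sum_wirtinger (f : Cn n → ℂ) (p v : Cn n) :
    fderiv ℝ f p v = ∑ j, (v j * delHol (coordVec j) f p + conj (v j) * delBar (coordVec j) f p) := by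
  conv_lhs => rw [fderiv_eq_delHol_add_delBar, ← sum_smul_coordVec v]
  rw [delHol_sum_smul, delBar_sum_smul, Finset.sum_add_distrib]

section Operators

variable {X ι : Type*} [DecidableEq ι] {T : ι → X → X}

omit [DecidableEq ι] in
theorem iterate_foldr_comm (α : ι → ℕ) (l : List ι)
    (S : X → X) (hS : ∀ i x, S (T i x) = T i (S x)) (x : X) :
    S (l.foldr (fun j G => (T j)^[α j] G) x) = l.foldr (fun j G => (T j)^[α j] G) (S x) := by
  induction l with
  | nil => rfl
  | cons a l ih =>
    have h : Function.Commute S (T a) := fun y => hS a y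
    simp only [List.foldr_cons]
    rw [← ih]
    exact h.iterate_right (α a) _

theorem foldr_update_of_notMem (α : ι → ℕ) (i : ι) (l : List ι) (hi : i ∉ l) (x : X) :
    l.foldr (fun j G => (T j)^[(α + Pi.single i 1 : ι → ℕ) j] G) x =
      l.foldr (fun j G => (T j)^[α j] G) x := by
  induction l with
  | nil => rfl
  | cons a l ih =>
    simp only [List.mem_cons, not_or] at hi
    simp only [List.foldr_cons, ih hi.2]
    simp [Ne.symm hi.1]

/-- The operators commute, so an extra factor can be carried to its own slot in the ordered product;
a list without repetitions has exactly one such slot. -/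
theorem foldr_shift (hT : ∀ i j x, T i (T j x) = T j (T i x)) (α : ι → ℕ) (i : ι) (l : List ι)
    (hi : i ∈ l) (hl : l.Nodup) (x : X) :
    T i (l.foldr (fun j G => (T j)^[α j] G) x) =
      l.foldr (fun j G => (T j)^[(α + Pi.single i 1 : ι → ℕ) j] G) x := by
  induction l with
  | nil => simp at hi
  | cons a l ih =>
    simp only [List.foldr_cons]
    by_cases h : i = a
    · subst h
      rw [foldr_update_of_notMem α i l (List.nodup_cons.mp hl).1]
      simp only [Pi.add_apply, Pi.single_eq_same, Function.iterate_succ', Function.comp_apply]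
    · have hil : i ∈ l := by simpa [h] using hi
      rw [← ih hil (List.nodup_cons.mp hl).2]
      have hc : Function.Commute (T i) (T a) := fun y => hT i a y
      simp only [Pi.add_apply, Pi.single_apply, if_neg (Ne.symm h), add_zero]
      exact hc.iterate_right (α a) _

end Operators

/-- Smooth functions, on which the Wirtinger operators act and commute. -/
abbrev SmoothFun (n : ℕ) := {F : Cn n × Cn n → ℂ // ContDiff ℝ ∞ F}

/-- `wirt s v` as an operator on smooth functions. -/
def wirtOp (s : ℂ) (v : Cn n × Cn n) (F : SmoothFun n) : SmoothFun n :=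
  ⟨wirt s v F.1, contDiff_wirt F.2⟩

/-- Wirtinger operators commute only on smooth functions. With smoothness built into the type the
commutation is unconditional, as the lemmas on ordered products of operators demand. -/
theorem wirtOp_comm (s t : ℂ) (v w : Cn n × Cn n) (F : SmoothFun n) :
    wirtOp s v (wirtOp t w F) = wirtOp t w (wirtOp s v F) := by
  apply Subtype.ext
  funext p
  exact wirt_comm F.2.contDiffAt

theorem coe_foldr_wirtOp (s : ℂ) (e : Fin n → Cn n × Cn n) (α : Fin n → ℕ) (l : List (Fin n))
    (F : SmoothFun n) :
    (l.foldr (fun j G => (wirtOp s (e j))^[α j] G) F).1 =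
      l.foldr (fun j G => (wirt s (e j))^[α j] G) F.1 := by
  induction l with
  | nil => rfl
  | cons a l ih =>
    simp only [List.foldr_cons, ← ih]
    generalize l.foldr (fun j G => (wirtOp s (e j))^[α j] G) F = H
    induction α a with
    | zero => rfl
    | succ m ihm => simp only [Function.iterate_succ', Function.comp_apply, ← ihm]; rfl

/-- `mixedDeriv` as an operator on smooth functions. -/
def jetOp (α β : Fin n → ℕ) (F : SmoothFun n) : SmoothFun n :=
  (List.finRange n).foldr (fun j G => (wirtOp (-Complex.I) (coordVec j, 0))^[α j] G)
    ((List.finRange n).foldr (fun j G => (wirtOp Complex.I (0, coordVec j))^[β j] G) F)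

theorem coe_jetOp (α β : Fin n → ℕ) (F : SmoothFun n) : (jetOp α β F).1 = mixedDeriv α β F.1 := by
  simp only [jetOp, mixedDeriv, coe_foldr_wirtOp, delHol_eq_wirt, delBar_eq_wirt]

theorem wirtOp_jetOp_comm (s : ℂ) (v : Cn n × Cn n) (α β : Fin n → ℕ) (F : SmoothFun n) :
    wirtOp s v (jetOp α β F) = jetOp α β (wirtOp s v F) := by
  unfold jetOp
  rw [iterate_foldr_comm (T := fun j => wirtOp (-Complex.I) (coordVec j, 0)) (S := wirtOp s v)
      (hS := fun _ _ => wirtOp_comm _ _ _ _ _),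
    iterate_foldr_comm (T := fun j => wirtOp Complex.I (0, coordVec j)) (S := wirtOp s v)
      (hS := fun _ _ => wirtOp_comm _ _ _ _ _)]

theorem delHol_jetOp (α β : Fin n → ℕ) (i : Fin n) (F : SmoothFun n) :
    wirtOp (-Complex.I) (coordVec i, 0) (jetOp α β F) = jetOp (α + Pi.single i 1) β F := by
  unfold jetOp
  exact foldr_shift (T := fun j => wirtOp (-Complex.I) (coordVec j, 0))
    (fun _ _ _ => wirtOp_comm _ _ _ _ _) _ _ _ (List.mem_finRange i) (List.nodup_finRange n) _

theorem delBar_jetOp (α β : Fin n → ℕ) (i : Fin n) (F : SmoothFun n) :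
    wirtOp Complex.I (0, coordVec i) (jetOp α β F) = jetOp α (β + Pi.single i 1) F := by
  unfold jetOp
  rw [iterate_foldr_comm (T := fun j => wirtOp (-Complex.I) (coordVec j, 0)) (S := wirtOp Complex.I (0, coordVec i))
      (hS := fun _ _ => wirtOp_comm _ _ _ _ _)]
  congr 1
  exact foldr_shift (T := fun j => wirtOp Complex.I (0, coordVec j))
    (fun _ _ _ => wirtOp_comm _ _ _ _ _) _ _ _ (List.mem_finRange i) (List.nodup_finRange n) _

variable {F : Cn n × Cn n → ℂ}

theorem contDiff_mixedDeriv (hF : ContDiff ℝ ∞ F) (α β : Fin n → ℕ) :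
    ContDiff ℝ ∞ (mixedDeriv α β F) := by
  rw [← coe_jetOp α β ⟨F, hF⟩]; exact (jetOp α β ⟨F, hF⟩).2

theorem delHol_mixedDeriv (hF : ContDiff ℝ ∞ F) (α β : Fin n → ℕ) (i : Fin n) :
    delHol ((coordVec i, 0) : Cn n × Cn n) (mixedDeriv α β F) =
      mixedDeriv (α + Pi.single i 1) β F := by
  have := congrArg Subtype.val (delHol_jetOp α β i ⟨F, hF⟩)
  rw [delHol_eq_wirt]
  simpa only [coe_jetOp, wirtOp] using this

theorem delBar_mixedDeriv (hF : ContDiff ℝ ∞ F) (α β : Fin n → ℕ) (i : Fin n) :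
    delBar ((0, coordVec i) : Cn n × Cn n) (mixedDeriv α β F) =
      mixedDeriv α (β + Pi.single i 1) F := by
  have := congrArg Subtype.val (delBar_jetOp α β i ⟨F, hF⟩)
  rw [delBar_eq_wirt]
  simpa only [coe_jetOp, wirtOp] using this

theorem wirt_mixedDeriv_comm (hF : ContDiff ℝ ∞ F) (s : ℂ) (v : Cn n × Cn n) (α β : Fin n → ℕ) :
    wirt s v (mixedDeriv α β F) = mixedDeriv α β (wirt s v F) := by
  have := congrArg Subtype.val (wirtOp_jetOp_comm s v α β ⟨F, hF⟩)
  simpa only [coe_jetOp, wirtOp] using this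

theorem mixedDeriv_zero (F : Cn n × Cn n → ℂ) : mixedDeriv 0 0 F = F := by
  have h : ∀ (l : List (Fin n)) (G : Cn n × Cn n → ℂ), l.foldr (fun _ G => G) G = G := by
    intro l G; induction l <;> simp_all
  simp [mixedDeriv, h]

theorem mixedHessianDet_eq (hF : ContDiff ℝ ∞ F) (p : Cn n × Cn n) :
    mixedHessianDet F p =
      (Matrix.of fun i j : Fin n => mixedDeriv (Pi.single i 1) (Pi.single j 1) F p).det := by
  unfold mixedHessianDet
  congr 2
  funext i j
  have h1 := delBar_mixedDeriv hF 0 0 j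
  have h2 := delHol_mixedDeriv hF 0 (0 + Pi.single j 1) i
  rw [mixedDeriv_zero] at h1
  rw [h1, h2, zero_add, zero_add]

end Jets

/-! ### The formal division algorithm on power series with jet polynomial coefficients. -/

section FormalJets

variable {n : ℕ}

/-- The variable standing for `∂_x^α ∂̄_y^β ψ`. -/
def jetVar (α β : Fin n → ℕ) : JetPolynomial n := MvPolynomial.X (some (α, β))

/-- The polynomial giving the determinant of the mixed Hessian. -/
def hessPoly (n : ℕ) : JetPolynomial n :=
  (Matrix.of fun i j : Fin n => jetVar (Pi.single i 1) (Pi.single j 1)).det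

/-- Formal `∂̄_{y_i}`, with the inverse determinant treated as a constant. -/
def jetDerivAux (i : Fin n) : Derivation ℂ (JetPolynomial n) (JetPolynomial n) :=
  MvPolynomial.mkDerivation ℂ fun a => a.elim 0 fun γ => jetVar γ.1 (γ.2 + Pi.single i 1)

/-- Formal `∂̄_{y_i}` on jet polynomials. -/
def jetDeriv (i : Fin n) : Derivation ℂ (JetPolynomial n) (JetPolynomial n) :=
  MvPolynomial.mkDerivation ℂ fun a => a.elim
    (-(MvPolynomial.X none) ^ 2 * jetDerivAux i (hessPoly n))
    fun γ => jetVar γ.1 (γ.2 + Pi.single i 1)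

/-- Formal power series in `w = y - x` with jet polynomials as coefficients. -/
abbrev JetSeries (n : ℕ) := MvPowerSeries (Fin n) (JetPolynomial n)

/-- Coefficientwise `∂̄_{y_i}`. -/
def seriesDeriv (i : Fin n) (G : JetSeries n) : JetSeries n := fun α => jetDeriv i (G α)

/-- The Taylor series of `∂_x^γ ∂̄_y^β ψ` in its first variable. -/
def taylorSeries (γ β : Fin n → ℕ) : JetSeries n := fun α =>
  MvPolynomial.C ((α.prod fun _ m => (m.factorial : ℂ))⁻¹) * jetVar (γ + ⇑α) β

/-- A quotient by the `j`-th variable: every series is its constant term plus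
`∑ j, X j * seriesQuot j G`. -/
def seriesQuot (j : Fin n) (G : JetSeries n) : JetSeries n := fun α =>
  MvPolynomial.C (((α j : ℂ) + 1) / (α.degree + 1)) * G (α + Finsupp.single j 1)

/-- The coefficients of `seriesQuot` are those of Hadamard's quotient ∫₀¹ ∂_jG(tw) dt. In degree β
the j-th summand carries the weight β_j/|β|, and these weights add up to 1. -/
theorem series_eq_const_add_sum (G : JetSeries n) :
    G = MvPowerSeries.C (MvPowerSeries.constantCoeff G) +
      ∑ j, MvPowerSeries.X j * seriesQuot j G := by
  classical
  ext1 β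
  rw [map_add, map_sum, MvPowerSeries.coeff_C]
  by_cases hβ : β = 0
  · subst hβ
    simp [MvPowerSeries.coeff_zero_X_mul]
  rw [if_neg hβ, zero_add]
  have hdeg : (β.degree : ℂ) ≠ 0 := by
    rw [Nat.cast_ne_zero, ne_eq, Finsupp.degree_eq_zero_iff]; exact hβ
  have key : ∀ j, MvPowerSeries.coeff β (MvPowerSeries.X j * seriesQuot j G) =
      MvPolynomial.C ((β j : ℂ) / β.degree) * MvPowerSeries.coeff β G := by
    intro j
    rw [mul_comm, MvPowerSeries.X, MvPowerSeries.coeff_mul_monomial]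
    by_cases hj : β j = 0
    · have : ¬ Finsupp.single j 1 ≤ β := by
        simp [hj]
      rw [if_neg this, hj]; simp
    · have hle : Finsupp.single j 1 ≤ β := by
        simp; omega
      rw [if_pos hle, mul_one]
      have h1 : β - Finsupp.single j 1 + Finsupp.single j 1 = β := tsub_add_cancel_of_le hle
      have h2 : (((β - Finsupp.single j 1 : Fin n →₀ ℕ) j : ℕ) : ℂ) + 1 = β j := by
        conv_rhs => rw [← h1]
        simp [-Finsupp.coe_tsub]
      have h3 : ((β - Finsupp.single j 1).degree : ℂ) + 1 = β.degree := by
        conv_rhs => rw [← h1]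
        simp [-Finsupp.coe_tsub]
      change MvPolynomial.C _ * G (β - Finsupp.single j 1 + Finsupp.single j 1) = _
      rw [h1, h2, h3]; rfl
  simp only [key]
  rw [← Finset.sum_mul, ← map_sum, ← Finset.sum_div]
  have : ∑ j, (β j : ℂ) = β.degree := by
    rw [Finsupp.degree_eq_sum]; push_cast; rfl
  rw [this, div_self hdeg]; simp

/-- The series `θ_j` with `ψ(y, ȳ) - ψ(x, ȳ) = ∑ j, θ_j w_j`. -/
def thetaSeries (j : Fin n) : JetSeries n := seriesQuot j (taylorSeries 0 0)

/-- The matrix `∂̄_{y_i} θ_j`. -/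
def thetaMatrix (n : ℕ) : Matrix (Fin n) (Fin n) (JetSeries n) :=
  Matrix.of fun j i => seriesDeriv i (thetaSeries j)

/-- The series of the mixed Hessian determinant at `(y, ȳ)`. -/
def volSeries (n : ℕ) : JetSeries n :=
  (Matrix.of fun j i : Fin n => taylorSeries (Pi.single j 1) (Pi.single i 1)).det

/-- A series with constant term one which represents `det (∂̄θ) / det (∂̄θ)(x, x, ȳ)`. -/
def detRatio (n : ℕ) : JetSeries n :=
  1 + MvPowerSeries.C (MvPolynomial.X none) * ((thetaMatrix n).det -
    MvPowerSeries.C (MvPowerSeries.constantCoeff (thetaMatrix n).det))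

/-- The inverse of `thetaMatrix`. -/
def thetaInv (n : ℕ) : Matrix (Fin n) (Fin n) (JetSeries n) :=
  (MvPowerSeries.C (MvPolynomial.X none) * (detRatio n).invOfUnit 1) • (thetaMatrix n).adjugate

/-- The coefficient `b_m` read off from an amplitude. -/
def leadCoeff (m : ℕ) (G : JetSeries n) : JetPolynomial n :=
  if m = 0 then 1 else MvPolynomial.X none * MvPowerSeries.constantCoeff G

/-- The vector field by which an amplitude is integrated by parts. -/
def fieldSeries (m : ℕ) (G : JetSeries n) (i : Fin n) : JetSeries n :=
  (thetaInv n).mulVec (fun j => seriesQuot j (G - MvPowerSeries.C (leadCoeff m G) * volSeries n)) i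

/-- The successive amplitudes of the division algorithm. -/
def amplitude (n : ℕ) : ℕ → JetSeries n
  | 0 => (thetaMatrix n).det
  | m + 1 => ∑ i, seriesDeriv i (fieldSeries m (amplitude n m) i)

/-- The coefficients of the asymptotic kernel. -/
def kernelCoeff (n m : ℕ) : JetPolynomial n := leadCoeff m (amplitude n m)

/-- The variable `none` is not formally inverse to `hessPoly`. `detRatio` is arranged to have
constant term literally 1, so that it can be inverted as a power series. -/
theorem constantCoeff_detRatio : MvPowerSeries.constantCoeff (detRatio n) = 1 := by
  simp [detRatio]

/-- Only an approximate inverse exists formally: the defect is a multiple of `X none * constantCoeff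
det - 1`, which is not zero as a polynomial but vanishes as soon as the jet variables are evaluated.
-/
theorem thetaMatrix_mul_thetaInv : thetaMatrix n * thetaInv n =
    (1 + (detRatio n).invOfUnit 1 * MvPowerSeries.C (MvPolynomial.X none *
      MvPowerSeries.constantCoeff (thetaMatrix n).det - 1)) • (1 : Matrix _ _ (JetSeries n)) := by
  rw [thetaInv, Matrix.mul_smul, Matrix.mul_adjugate, smul_smul]
  congr 1
  have h := MvPowerSeries.mul_invOfUnit (detRatio n) 1 (by simp [constantCoeff_detRatio])
  have h2 : MvPowerSeries.C (MvPolynomial.X none) * (thetaMatrix n).det = detRatio n +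
      MvPowerSeries.C (MvPolynomial.X none *
      MvPowerSeries.constantCoeff (thetaMatrix n).det - 1) := by
    simp only [detRatio, map_sub, map_mul, map_one]; ring
  calc _ = (detRatio n).invOfUnit 1 * (MvPowerSeries.C (MvPolynomial.X none) *
      (thetaMatrix n).det) := by ring
    _ = detRatio n * (detRatio n).invOfUnit 1 + (detRatio n).invOfUnit 1 *
      MvPowerSeries.C (MvPolynomial.X none *
        MvPowerSeries.constantCoeff (thetaMatrix n).det - 1) := by rw [h2]; ring
    _ = _ := by rw [h]

theorem constantCoeff_eq (G : JetSeries n) : MvPowerSeries.constantCoeff G = G 0 := rfl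

/-- The constant term of θ_j is ∂_{x_j}ψ(x, ȳ), so that of ∂̄_iθ_j is an entry of the mixed Hessian.
As the volume series begins with the same polynomial, the coefficient b_0 may be taken to be 1. -/
theorem constantCoeff_det_thetaMatrix :
    MvPowerSeries.constantCoeff (thetaMatrix n).det = hessPoly n := by
  rw [RingHom.map_det, hessPoly]
  congr 1
  ext1 j i
  simp only [thetaMatrix, RingHom.mapMatrix_apply, Matrix.map_apply, Matrix.of_apply,
    constantCoeff_eq, seriesDeriv, thetaSeries, seriesQuot, taylorSeries]
  simp [jetDeriv, jetVar, Finsupp.prod_single_index, MvPolynomial.mkDerivation_X,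
    Finsupp.single_eq_pi_single]

theorem constantCoeff_volSeries : MvPowerSeries.constantCoeff (volSeries n) = hessPoly n := by
  rw [volSeries, RingHom.map_det, hessPoly]
  congr 1
  ext1 j i
  simp [constantCoeff_eq, taylorSeries]

end FormalJets

/-! ### Evaluation of jet polynomials, and its compatibility with ∂̄_y. -/

section JetEvaluation

variable {n : ℕ} {F : Cn n × Cn n → ℂ} {p : Cn n × Cn n}

/-- The value of jet polynomials at the jet of `F` in `p`. -/
def jetVal (F : Cn n × Cn n → ℂ) (p : Cn n × Cn n) : JetPolynomial n →+* ℂ :=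
  MvPolynomial.eval fun a => a.elim (mixedHessianDet F p)⁻¹ fun γ => mixedDeriv γ.1 γ.2 F p

theorem evalAt_eq_jetVal (P : JetPolynomial n) (ψ : Cn n × Cn n → ℂ) :
    P.evalAt ψ p = jetVal (polarized ψ) p P := rfl

@[simp] theorem jetVal_jetVar (α β : Fin n → ℕ) :
    jetVal F p (jetVar α β) = mixedDeriv α β F p := by
  simp [jetVal, jetVar]

@[simp] theorem jetVal_none : jetVal F p (MvPolynomial.X none) = (mixedHessianDet F p)⁻¹ := by
  simp [jetVal]

@[simp] theorem jetVal_C (c : ℂ) : jetVal F p (MvPolynomial.C c) = c := by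
  simp [jetVal]

theorem jetVal_hessPoly (hF : ContDiff ℝ ∞ F) : jetVal F p (hessPoly n) = mixedHessianDet F p := by
  rw [hessPoly, RingHom.map_det, mixedHessianDet_eq hF]
  congr 1
  ext i j
  simp

theorem contDiffAt_det {V : Type*} [NormedAddCommGroup V] [NormedSpace ℝ V] {m : ℕ∞ω}
    {N : V → Matrix (Fin n) (Fin n) ℂ} {q : V} (h : ∀ i j, ContDiffAt ℝ m (fun x => N x i j) q) :
    ContDiffAt ℝ m (fun x => (N x).det) q := by
  simp only [Matrix.det_apply]
  refine ContDiffAt.sum fun σ _ => ?_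
  have : ContDiffAt ℝ m (fun x => ∏ i, N x (σ i) i) q := contDiffAt_prod fun i _ => h _ _
  simp only [Units.smul_def, zsmul_eq_mul]
  exact contDiffAt_const.mul this

theorem contDiff_mixedHessianDet (hF : ContDiff ℝ ∞ F) : ContDiff ℝ ∞ (mixedHessianDet F) := by
  have : mixedHessianDet F = fun p => (Matrix.of fun i j : Fin n =>
      mixedDeriv (Pi.single i 1) (Pi.single j 1) F p).det := funext fun p => mixedHessianDet_eq hF p
  rw [this, contDiff_iff_contDiffAt]
  exact fun p => contDiffAt_det fun i j => (contDiff_mixedDeriv hF _ _).contDiffAt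

theorem contDiffAt_eval {V ι : Type*} [NormedAddCommGroup V] [NormedSpace ℝ V] {m : ℕ∞ω}
    {val : ι → V → ℂ} {q : V} (h : ∀ a, ContDiffAt ℝ m (val a) q) (P : MvPolynomial ι ℂ) :
    ContDiffAt ℝ m (fun x => MvPolynomial.eval (fun a => val a x) P) q := by
  induction P using MvPolynomial.induction_on with
  | C c => simpa using contDiffAt_const
  | add P Q hP hQ => simpa using hP.add hQ
  | mul_X P a hP => simpa using hP.mul (h a)

/-- Both sides obey the Leibniz rule in P, so agreement on the variables is enough. -/
theorem wirt_eval {V ι : Type*} [NormedAddCommGroup V] [NormedSpace ℂ V] {val : ι → V → ℂ} {q v : V}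
    {s : ℂ} (f : ι → MvPolynomial ι ℂ) (h : ∀ a, ContDiffAt ℝ 1 (val a) q)
    (hf : ∀ a, wirt s v (val a) q = MvPolynomial.eval (fun a => val a q) (f a))
    (P : MvPolynomial ι ℂ) :
    wirt s v (fun x => MvPolynomial.eval (fun a => val a x) P) q =
      MvPolynomial.eval (fun a => val a q) (MvPolynomial.mkDerivation ℂ f P) := by
  have hd : ∀ P : MvPolynomial ι ℂ,
      DifferentiableAt ℝ (fun x => MvPolynomial.eval (fun a => val a x) P) q :=
    fun P => (contDiffAt_eval h P).differentiableAt one_ne_zero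
  induction P using MvPolynomial.induction_on with
  | C c => simp [wirt_const]
  | add P Q hP hQ =>
    simp only [map_add]
    rw [wirt_add (hd P) (hd Q), hP, hQ]
  | mul_X P a hP =>
    have h1 := wirt_mul (s := s) (v := v) (hd P) ((h a).differentiableAt one_ne_zero)
    simp only [map_mul, MvPolynomial.eval_X, Derivation.leibniz, MvPolynomial.mkDerivation_X,
      smul_eq_mul, map_add]
    rw [h1, hP, hf]; ring

theorem contDiffAt_jetVal (hF : ContDiff ℝ ∞ F) (h0 : mixedHessianDet F p ≠ 0)
    (P : JetPolynomial n) : ContDiffAt ℝ ∞ (fun q => jetVal F q P) p := by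
  refine contDiffAt_eval (val := fun (a : Option ((Fin n → ℕ) × (Fin n → ℕ))) q =>
    a.elim (mixedHessianDet F q)⁻¹ fun γ => mixedDeriv γ.1 γ.2 F q) ?_ P
  rintro (_ | γ)
  · exact (contDiff_mixedHessianDet hF).contDiffAt.inv h0
  · exact (contDiff_mixedDeriv hF _ _).contDiffAt

theorem delBar_jetVal (hF : ContDiff ℝ ∞ F) (h0 : mixedHessianDet F p ≠ 0) (i : Fin n)
    (P : JetPolynomial n) :
    delBar ((0, coordVec i) : Cn n × Cn n) (fun q => jetVal F q P) p =
      jetVal F p (jetDeriv i P) := by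
  have hs : ∀ γ : (Fin n → ℕ) × (Fin n → ℕ), ContDiff ℝ 1 (mixedDeriv γ.1 γ.2 F) :=
    fun γ => (contDiff_mixedDeriv hF _ _).of_le (by norm_cast)
  have hd : ContDiff ℝ 1 (mixedHessianDet F) := (contDiff_mixedHessianDet hF).of_le (by norm_cast)
  have hdet : wirt Complex.I ((0, coordVec i) : Cn n × Cn n) (mixedHessianDet F) p =
      jetVal F p (jetDerivAux i (hessPoly n)) := by
    -- The polynomial `hessPoly` does not involve the inverse determinant. That variable is frozen
    -- at its value in p, since differentiating it would presuppose the formula being proved.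
    have h := wirt_eval (q := p) (v := ((0, coordVec i) : Cn n × Cn n)) (s := Complex.I)
      (val := fun (a : Option ((Fin n → ℕ) × (Fin n → ℕ))) q =>
        a.elim (mixedHessianDet F p)⁻¹ fun γ => mixedDeriv γ.1 γ.2 F q)
      (fun a => a.elim 0 fun γ => jetVar γ.1 (γ.2 + Pi.single i 1)) ?_ ?_ (hessPoly n)
    · rw [jetVal, jetDerivAux, ← h]
      congr 1
      funext q
      rw [hessPoly, RingHom.map_det, mixedHessianDet_eq hF]
      congr 1
      ext i j
      simp [jetVar]
    · rintro (_ | γ)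
      · exact contDiffAt_const
      · exact (hs γ).contDiffAt
    · rintro (_ | γ)
      · simp [wirt_const]
      · have := congrFun (delBar_mixedDeriv hF γ.1 γ.2 i) p
        rw [delBar_eq_wirt] at this
        simpa [jetVar] using this
  refine wirt_eval (val := fun (a : Option ((Fin n → ℕ) × (Fin n → ℕ))) q =>
    a.elim (mixedHessianDet F q)⁻¹ fun γ => mixedDeriv γ.1 γ.2 F q) _ ?_ ?_ P
  · rintro (_ | γ)
    · exact hd.contDiffAt.inv h0
    · exact (hs γ).contDiffAt
  · rintro (_ | γ)
    · change wirt Complex.I _ (fun q => (mixedHessianDet F q)⁻¹) p = jetVal F p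
        (-(MvPolynomial.X none) ^ 2 * jetDerivAux i (hessPoly n))
      rw [wirt_inv (hd.differentiable one_ne_zero p) h0, hdet]
      simp
    · have := congrFun (delBar_mixedDeriv hF γ.1 γ.2 i) p
      rw [delBar_eq_wirt] at this
      simpa [jetVar] using this

end JetEvaluation

/-! ### Truncated evaluation as a ring homomorphism modulo O(|w|^L). -/

section Truncation

variable {n : ℕ} {F : Cn n × Cn n → ℂ} {p : Cn n × Cn n} {K : Set (Cn n × Cn n)}

/-- Multi-indices with all entries at most `L`. -/
def box (n L : ℕ) : Finset (Fin n →₀ ℕ) :=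
  Finset.Iic (Finsupp.equivFunOnFinite.symm fun _ => L)

theorem mem_box {L : ℕ} {α : Fin n →₀ ℕ} : α ∈ box n L ↔ ∀ j, α j ≤ L := by
  simp [box, Finsupp.le_def]

/-- The monomial `w^α`. -/
def monom (w : Cn n) (α : Fin n →₀ ℕ) : ℂ := ∏ j, w j ^ α j

theorem monom_add (w : Cn n) (α β : Fin n →₀ ℕ) : monom w (α + β) = monom w α * monom w β := by
  simp [monom, pow_add, Finset.prod_mul_distrib]

theorem monom_zero (w : Cn n) : monom w 0 = 1 := by simp [monom]

theorem monom_single (w : Cn n) (j : Fin n) : monom w (Finsupp.single j 1) = w j := by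
  rw [monom, Finset.prod_eq_single j]
  · simp
  · intro b _ hb; simp [Ne.symm hb]
  · simp

theorem norm_monom_le_one {w : Cn n} (hw : ‖w‖ ≤ 1) (α : Fin n →₀ ℕ) : ‖monom w α‖ ≤ 1 := by
  rw [monom, norm_prod]
  refine Finset.prod_le_one (fun _ _ => norm_nonneg _) fun j _ => ?_
  rw [norm_pow]
  exact pow_le_one₀ (norm_nonneg _) ((PiLp.norm_apply_le w j).trans hw)

theorem norm_monom_le {w : Cn n} (hw : ‖w‖ ≤ 1) {α : Fin n →₀ ℕ} {L : ℕ} {j : Fin n}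
    (hj : L ≤ α j) : ‖monom w α‖ ≤ ‖w‖ ^ L := by
  rw [monom, norm_prod, ← Finset.mul_prod_erase _ _ (Finset.mem_univ j)]
  have h1 : ∏ i ∈ Finset.univ.erase j, ‖w i ^ α i‖ ≤ 1 := by
    refine Finset.prod_le_one (fun _ _ => norm_nonneg _) fun i _ => ?_
    rw [norm_pow]
    exact pow_le_one₀ (norm_nonneg _) ((PiLp.norm_apply_le w i).trans hw)
  have h2 : ‖w j ^ α j‖ ≤ ‖w‖ ^ L := by
    rw [norm_pow]
    exact (pow_le_pow_of_le_one (norm_nonneg _) ((PiLp.norm_apply_le w j).trans hw) hj).trans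
      (pow_le_pow_left₀ (norm_nonneg _) (PiLp.norm_apply_le w j) L)
  calc _ ≤ ‖w‖ ^ L * 1 := by gcongr
    _ = _ := mul_one _

/-- The value at `(x, y)` of the truncation of a jet series, with `w = y - x`. -/
def serVal (F : Cn n × Cn n → ℂ) (L : ℕ) (G : JetSeries n) (p : Cn n × Cn n) : ℂ :=
  ∑ α ∈ box n L, monom (p.2 - p.1) α * jetVal F p (G α)

/-- `K` is a set on which jet polynomials of `F` are bounded. -/
structure JetDomain (F : Cn n × Cn n → ℂ) (K : Set (Cn n × Cn n)) : Prop where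
  smooth : ContDiff ℝ ∞ F
  bdd : ∀ P : JetPolynomial n, ∃ C : ℝ, ∀ p ∈ K, ‖jetVal F p P‖ ≤ C
  small : ∀ p ∈ K, ‖p.2 - p.1‖ ≤ 1
  hess : ∀ p ∈ K, mixedHessianDet F p ≠ 0

/-- The ring of functions bounded on `K`. -/
def bddOn (K : Set (Cn n × Cn n)) : Subring (Cn n × Cn n → ℂ) where
  carrier := {f | ∃ C : ℝ, ∀ p ∈ K, ‖f p‖ ≤ C}
  mul_mem' := by
    rintro f g ⟨C, hC⟩ ⟨D, hD⟩
    refine ⟨C * D, fun p hp => ?_⟩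
    rw [Pi.mul_apply, norm_mul]
    exact mul_le_mul (hC p hp) (hD p hp) (norm_nonneg _) ((norm_nonneg _).trans (hC p hp))
  one_mem' := ⟨1, fun p _ => by simp⟩
  add_mem' := by
    rintro f g ⟨C, hC⟩ ⟨D, hD⟩
    exact ⟨C + D, fun p hp => (norm_add_le _ _).trans (add_le_add (hC p hp) (hD p hp))⟩
  zero_mem' := ⟨0, fun p _ => by simp⟩
  neg_mem' := by
    rintro f ⟨C, hC⟩
    exact ⟨C, fun p hp => by simpa using hC p hp⟩

/-- The ideal of functions which are `O(|w|^L)` on `K`. -/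
def errIdeal (K : Set (Cn n × Cn n)) (L : ℕ) : Ideal (bddOn K) where
  carrier := {f | ∃ C : ℝ, ∀ p ∈ K, ‖f.1 p‖ ≤ C * ‖p.2 - p.1‖ ^ L}
  add_mem' := by
    rintro f g ⟨C, hC⟩ ⟨D, hD⟩
    refine ⟨C + D, fun p hp => (norm_add_le _ _).trans ?_⟩
    rw [add_mul]
    exact add_le_add (hC p hp) (hD p hp)
  zero_mem' := ⟨0, fun p _ => by simp⟩
  smul_mem' := by
    rintro ⟨f, C, hC⟩ ⟨g, hg⟩ ⟨D, hD⟩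
    refine ⟨C * D, fun p hp => ?_⟩
    change ‖f p * g p‖ ≤ _
    rw [norm_mul, mul_assoc]
    exact mul_le_mul (hC p hp) (hD p hp) (norm_nonneg _) ((norm_nonneg _).trans (hC p hp))

theorem serVal_mem_bddOn (hK : JetDomain F K) (L : ℕ) (G : JetSeries n) :
    serVal F L G ∈ bddOn K := by
  choose C hC using fun α => hK.bdd (G α)
  refine ⟨∑ α ∈ box n L, C α, fun p hp => (norm_sum_le _ _).trans (Finset.sum_le_sum fun α _ => ?_)⟩
  rw [norm_mul]
  calc _ ≤ 1 * ‖jetVal F p (G α)‖ := by gcongr; exact norm_monom_le_one (hK.small p hp) α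
    _ ≤ C α := by rw [one_mul]; exact hC α p hp

/-- The box is closed downwards, so every splitting of an exponent in the box stays in the box. The
truncated product is therefore fully contained in the product of truncations, and only pairs with
sum outside the box remain. -/
theorem serVal_mul (L : ℕ) (G H : JetSeries n) (p : Cn n × Cn n) :
    serVal F L G p * serVal F L H p - serVal F L (G * H) p =
      ∑ x ∈ (box n L ×ˢ box n L).filter (fun x => x.1 + x.2 ∉ box n L),
        monom (p.2 - p.1) (x.1 + x.2) * (jetVal F p (G x.1) * jetVal F p (H x.2)) := by
  classical
  have h1 : serVal F L G p * serVal F L H p = ∑ x ∈ box n L ×ˢ box n L,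
      monom (p.2 - p.1) (x.1 + x.2) * (jetVal F p (G x.1) * jetVal F p (H x.2)) := by
    rw [serVal, serVal, Finset.sum_mul_sum, ← Finset.sum_product']
    refine Finset.sum_congr rfl fun x _ => ?_
    rw [monom_add]; ring
  have h2 : serVal F L (G * H) p = ∑ x ∈ (box n L ×ˢ box n L).filter (fun x => x.1 + x.2 ∈ box n L),
      monom (p.2 - p.1) (x.1 + x.2) * (jetVal F p (G x.1) * jetVal F p (H x.2)) := by
    have h3 : ∀ α, (G * H) α = ∑ x ∈ Finset.HasAntidiagonal.antidiagonal α, G x.1 * H x.2 := fun α =>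
      MvPowerSeries.coeff_mul α G H
    have h4 : ∀ α ∈ box n L, monom (p.2 - p.1) α * jetVal F p ((G * H) α) =
        ∑ x ∈ ((box n L ×ˢ box n L).filter (fun x => x.1 + x.2 ∈ box n L)).filter
          (fun x => x.1 + x.2 = α),
          monom (p.2 - p.1) (x.1 + x.2) * (jetVal F p (G x.1) * jetVal F p (H x.2)) := by
      intro α hα
      rw [h3, map_sum, Finset.mul_sum]
      refine Finset.sum_congr ?_ fun x hx => ?_
      · ext x
        simp only [Finset.HasAntidiagonal.mem_antidiagonal, Finset.mem_filter, Finset.mem_product, mem_box] at hα ⊢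
        constructor
        · rintro rfl
          refine ⟨⟨⟨fun j => ?_, fun j => ?_⟩, hα⟩, rfl⟩
          · exact (Nat.le_add_right _ _).trans (hα j)
          · exact (Nat.le_add_left _ _).trans (hα j)
        · exact fun h => h.2
      · rw [(Finset.mem_filter.mp hx).2, map_mul]
    rw [serVal, Finset.sum_congr rfl h4]
    exact Finset.sum_fiberwise_of_maps_to (fun x hx => (Finset.mem_filter.mp hx).2) _
  rw [h1, h2, ← Finset.sum_filter_add_sum_filter_not _ (fun x => x.1 + x.2 ∈ box n L)]
  ring

/-- Evaluation of jet series modulo `O(|w|^L)` is a ring homomorphism. -/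
def serHom (hK : JetDomain F K) (L : ℕ) : JetSeries n →+* bddOn K ⧸ errIdeal K L where
  toFun G := Ideal.Quotient.mk _ ⟨serVal F L G, serVal_mem_bddOn hK L G⟩
  map_one' := by
    classical
    rw [← map_one (Ideal.Quotient.mk (errIdeal K L))]
    congr 1
    apply Subtype.ext
    funext p
    have h : ∀ α, (1 : JetSeries n) α = if α = 0 then 1 else 0 := fun α =>
      MvPowerSeries.coeff_one (R := JetPolynomial n) α
    simp only [serVal, h]
    rw [Finset.sum_eq_single 0]
    · simp [monom_zero]
    · intro b _ hb; simp [hb]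
    · intro h0; simp [mem_box] at h0
  map_zero' := by
    rw [← map_zero (Ideal.Quotient.mk (errIdeal K L))]
    congr 1
    apply Subtype.ext
    funext p
    have h : ∀ α, (0 : JetSeries n) α = 0 := fun α => rfl
    simp [serVal, h]
  map_add' G H := by
    rw [← map_add]
    congr 1
    apply Subtype.ext
    funext p
    have h : ∀ α, (G + H) α = G α + H α := fun α => rfl
    simp [serVal, h, mul_add, Finset.sum_add_distrib]
  map_mul' G H := by
    rw [← map_mul, eq_comm, Ideal.Quotient.mk_eq_mk_iff_sub_mem]
    choose C hC using fun α => hK.bdd (G α)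
    choose D hD using fun α => hK.bdd (H α)
    refine ⟨∑ x ∈ (box n L ×ˢ box n L).filter (fun x => x.1 + x.2 ∉ box n L), C x.1 * D x.2,
      fun p hp => ?_⟩
    change ‖serVal F L G p * serVal F L H p - serVal F L (G * H) p‖ ≤ _
    rw [serVal_mul, Finset.sum_mul]
    refine (norm_sum_le _ _).trans (Finset.sum_le_sum fun x hx => ?_)
    -- An exponent outside the box has an entry larger than L, and all other factors of the monomial
    -- are at most 1 because |w| ≤ 1.
    have hx' := (Finset.mem_filter.mp hx).2
    simp only [mem_box, not_forall, not_le] at hx'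
    obtain ⟨j, hj⟩ := hx'
    rw [norm_mul, norm_mul, mul_comm]
    have h1 := norm_monom_le (hK.small p hp) hj.le
    have hC0 : 0 ≤ C x.1 := (norm_nonneg _).trans (hC x.1 p hp)
    exact mul_le_mul (mul_le_mul (hC _ p hp) (hD _ p hp) (norm_nonneg _) hC0) h1 (norm_nonneg _)
      (mul_nonneg hC0 ((norm_nonneg _).trans (hD _ p hp)))

theorem serHom_apply (hK : JetDomain F K) (L : ℕ) (G : JetSeries n) :
    serHom hK L G = Ideal.Quotient.mk _ ⟨serVal F L G, serVal_mem_bddOn hK L G⟩ := rfl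

theorem jetVal_mem_bddOn (hK : JetDomain F K) (P : JetPolynomial n) :
    (fun p => jetVal F p P) ∈ bddOn K := hK.bdd P

theorem coord_mem_bddOn (hK : JetDomain F K) (j : Fin n) :
    (fun p : Cn n × Cn n => (p.2 - p.1) j) ∈ bddOn K :=
  ⟨1, fun p hp => (PiLp.norm_apply_le _ j).trans (hK.small p hp)⟩

theorem serVal_C (L : ℕ) (P : JetPolynomial n) :
    serVal F L (MvPowerSeries.C P) p = jetVal F p P := by
  classical
  have h : ∀ α, (MvPowerSeries.C P : JetSeries n) α = if α = 0 then P else 0 := fun α =>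
    MvPowerSeries.coeff_C α P
  simp only [serVal, h]
  rw [Finset.sum_eq_single 0]
  · simp [monom_zero]
  · intro b _ hb; simp [hb]
  · intro h0; simp [mem_box] at h0

theorem serVal_X {L : ℕ} (hL : 1 ≤ L) (j : Fin n) :
    serVal F L (MvPowerSeries.X j) p = (p.2 - p.1) j := by
  classical
  have h : ∀ α, (MvPowerSeries.X j : JetSeries n) α = if α = Finsupp.single j 1 then 1 else 0 :=
    fun α => MvPowerSeries.coeff_X α j
  simp only [serVal, h]
  rw [Finset.sum_eq_single (Finsupp.single j 1)]
  · simp [monom_single]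
  · intro b _ hb; simp [hb]
  · intro h0
    refine absurd (mem_box.mpr fun i => ?_) h0
    rw [Finsupp.single_apply]; split_ifs <;> omega

theorem serHom_C (hK : JetDomain F K) (L : ℕ) (P : JetPolynomial n) :
    serHom hK L (MvPowerSeries.C P) = Ideal.Quotient.mk _ ⟨_, jetVal_mem_bddOn hK P⟩ := by
  rw [serHom_apply]; congr 1; apply Subtype.ext; funext p; exact serVal_C L P

theorem serHom_X (hK : JetDomain F K) {L : ℕ} (hL : 1 ≤ L) (j : Fin n) :
    serHom hK L (MvPowerSeries.X j) = Ideal.Quotient.mk _ ⟨_, coord_mem_bddOn hK j⟩ := by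
  rw [serHom_apply]; congr 1; apply Subtype.ext; funext p; exact serVal_X hL j

/-- The relation between `none` and `hessPoly` holds only after evaluation; this is how it enters
computations in the quotient ring. -/
theorem serHom_C_eq_zero (hK : JetDomain F K) (L : ℕ) {P : JetPolynomial n}
    (h : ∀ p ∈ K, jetVal F p P = 0) : serHom hK L (MvPowerSeries.C P) = 0 := by
  rw [serHom_C, Ideal.Quotient.eq_zero_iff_mem]
  exact ⟨0, fun p hp => by simp [h p hp]⟩

theorem exists_bound_of_mk_eq {L : ℕ} {f g : bddOn K}
    (h : Ideal.Quotient.mk (errIdeal K L) f = Ideal.Quotient.mk (errIdeal K L) g) :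
    ∃ C : ℝ, ∀ p ∈ K, ‖f.1 p - g.1 p‖ ≤ C * ‖p.2 - p.1‖ ^ L := by
  rw [Ideal.Quotient.mk_eq_mk_iff_sub_mem] at h
  exact h

theorem serHom_eq_sum_quot (hK : JetDomain F K) {L : ℕ} (hL : 1 ≤ L) (G : JetSeries n) :
    serHom hK L G = serHom hK L (MvPowerSeries.C (MvPowerSeries.constantCoeff G)) +
      ∑ j, Ideal.Quotient.mk _ ⟨_, coord_mem_bddOn hK j⟩ * serHom hK L (seriesQuot j G) := by
  conv_lhs => rw [series_eq_const_add_sum G]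
  rw [map_add, map_sum]
  simp only [map_mul, serHom_X hK hL]

/-- The defining property of the amplitudes, modulo `O(|w|^L)`. -/
theorem exists_amplitude_bound (hK : JetDomain F K) {L : ℕ} (hL : 1 ≤ L) (m : ℕ) :
    ∃ C : ℝ, ∀ p ∈ K, ‖jetVal F p (kernelCoeff n m) * serVal F L (volSeries n) p -
      (serVal F L (amplitude n m) p - ∑ i, serVal F L (fieldSeries m (amplitude n m) i) p *
        ∑ j, serVal F L (thetaMatrix n j i) p * (p.2 - p.1) j)‖ ≤ C * ‖p.2 - p.1‖ ^ L := by
  set A := amplitude n m with hA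
  set G := A - MvPowerSeries.C (leadCoeff m A) * volSeries n with hG
  -- The choice of b_m: for m = 0 both amplitude and volume begin with `hessPoly`; for m > 0 the
  -- constant term of the amplitude was divided by the Hessian determinant.
  have hG0 : serHom hK L (MvPowerSeries.C (MvPowerSeries.constantCoeff G)) = 0 := by
    refine serHom_C_eq_zero hK L fun p hp => ?_
    have h1 : jetVal F p (hessPoly n) ≠ 0 := by
      rw [jetVal_hessPoly hK.smooth]; exact hK.hess p hp
    rw [hG, map_sub, map_mul, MvPowerSeries.constantCoeff_C, constantCoeff_volSeries]
    rcases m with _ | m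
    · rw [hA, amplitude, constantCoeff_det_thetaMatrix]; simp [leadCoeff]
    · simp only [leadCoeff, Nat.add_eq_zero_iff, one_ne_zero, and_false, if_false, map_sub, map_mul,
        jetVal_none]
      rw [jetVal_hessPoly hK.smooth] at h1 ⊢
      field_simp
      ring
  -- The field solves ∂̄θ·V = q in the quotient ring, since the defect of `thetaMatrix_mul_thetaInv`
  -- evaluates to zero.
  have hinv : ∀ j, ∑ i, serHom hK L (thetaMatrix n j i) * serHom hK L (fieldSeries m A i) =
      serHom hK L (seriesQuot j G) := by
    intro j
    have h1 : ((thetaMatrix n).mulVec (fieldSeries m A)) j =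
        (1 + (detRatio n).invOfUnit 1 * MvPowerSeries.C (MvPolynomial.X none *
          MvPowerSeries.constantCoeff (thetaMatrix n).det - 1)) * seriesQuot j G := by
      have h2 : fieldSeries m A = (thetaInv n).mulVec fun j => seriesQuot j G := by
        funext i; rfl
      rw [h2, Matrix.mulVec_mulVec, thetaMatrix_mul_thetaInv, Matrix.smul_mulVec, Matrix.one_mulVec]
      rfl
    have h3 : serHom hK L (MvPowerSeries.C (MvPolynomial.X none *
        MvPowerSeries.constantCoeff (thetaMatrix n).det - 1)) = 0 := by
      refine serHom_C_eq_zero hK L fun p hp => ?_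
      rw [constantCoeff_det_thetaMatrix, map_sub, map_mul, jetVal_hessPoly hK.smooth, jetVal_none,
        inv_mul_cancel₀ (hK.hess p hp), map_one, sub_self]
    have h4 := congrArg (serHom hK L) h1
    rw [map_mul, map_add, map_mul, h3, mul_zero, map_one, add_zero, one_mul] at h4
    rw [← h4, Matrix.mulVec, dotProduct, map_sum]
    simp only [map_mul]
  have hmain : serHom hK L (MvPowerSeries.C (leadCoeff m A)) * serHom hK L (volSeries n) =
      serHom hK L A - ∑ i, serHom hK L (fieldSeries m A i) *
        ∑ j, serHom hK L (thetaMatrix n j i) * Ideal.Quotient.mk _ ⟨_, coord_mem_bddOn hK j⟩ := by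
    have h1 := serHom_eq_sum_quot hK hL G
    rw [hG0, zero_add] at h1
    simp only [← hinv] at h1
    rw [hG, map_sub, map_mul] at h1
    have h2 : ∑ i, serHom hK L (fieldSeries m A i) *
        ∑ j, serHom hK L (thetaMatrix n j i) * Ideal.Quotient.mk _ ⟨_, coord_mem_bddOn hK j⟩ =
        ∑ j, Ideal.Quotient.mk (errIdeal K L) ⟨_, coord_mem_bddOn hK j⟩ *
          ∑ i, serHom hK L (thetaMatrix n j i) * serHom hK L (fieldSeries m A i) := by
      simp only [Finset.mul_sum]
      rw [Finset.sum_comm]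
      refine Finset.sum_congr rfl fun j _ => Finset.sum_congr rfl fun i _ => by ring
    rw [h2, ← h1]; ring
  rw [serHom_C] at hmain
  simp only [serHom_apply, ← map_mul, ← map_sum, ← map_sub] at hmain
  obtain ⟨C, hC⟩ := exists_bound_of_mk_eq hmain
  refine ⟨C, fun p hp => ?_⟩
  have := hC p hp
  simpa [kernelCoeff, ← hA] using this

/-- Ring homomorphisms commute with determinants, so it does not matter modulo O(|w|^L) whether one
truncates before or after. -/
theorem exists_det_bound (hK : JetDomain F K) (L : ℕ) (N : Matrix (Fin n) (Fin n) (JetSeries n)) :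
    ∃ C : ℝ, ∀ p ∈ K, ‖serVal F L N.det p -
      (Matrix.of fun i j => serVal F L (N i j) p).det‖ ≤ C * ‖p.2 - p.1‖ ^ L := by
  have h : serHom hK L N.det = Ideal.Quotient.mk (errIdeal K L)
      (Matrix.of fun i j => (⟨_, serVal_mem_bddOn hK L (N i j)⟩ : bddOn K)).det := by
    rw [RingHom.map_det, RingHom.map_det]; rfl
  rw [serHom_apply] at h
  obtain ⟨C, hC⟩ := exists_bound_of_mk_eq h
  refine ⟨C, fun p hp => ?_⟩
  have h1 := hC p hp
  have h2 : (Matrix.of fun i j => (⟨_, serVal_mem_bddOn hK L (N i j)⟩ : bddOn K)).det.1 p =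
      (Matrix.of fun i j => serVal F L (N i j) p).det := by
    have := RingHom.map_det ((Pi.evalRingHom (fun _ => ℂ) p).comp (bddOn K).subtype)
      (Matrix.of fun i j => (⟨_, serVal_mem_bddOn hK L (N i j)⟩ : bddOn K))
    exact this
  rwa [h2] at h1

theorem exists_quot_bound (hK : JetDomain F K) {L : ℕ} (hL : 1 ≤ L) (G : JetSeries n) :
    ∃ C : ℝ, ∀ p ∈ K, ‖serVal F L G p - (jetVal F p (MvPowerSeries.constantCoeff G) +
      ∑ j, (p.2 - p.1) j * serVal F L (seriesQuot j G) p)‖ ≤ C * ‖p.2 - p.1‖ ^ L := by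
  have h := serHom_eq_sum_quot hK hL G
  rw [serHom_C] at h
  simp only [serHom_apply, ← map_mul, ← map_sum, ← map_add] at h
  obtain ⟨C, hC⟩ := exists_bound_of_mk_eq h
  exact ⟨C, fun p hp => by simpa using hC p hp⟩

end Truncation

/-! ### Functions vanishing to infinite order on the diagonal. -/

section Flat

variable {n : ℕ} {f g : Cn n × Cn n → ℂ} {R r : ℝ}

/-- The product of two balls of radius `R` about the origin. -/
def biball (n : ℕ) (R : ℝ) : Set (Cn n × Cn n) := Metric.ball 0 R ×ˢ Metric.ball 0 R

theorem isOpen_biball : IsOpen (biball n R) := Metric.isOpen_ball.prod Metric.isOpen_ball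

/-- A smooth function on `biball n R` all of whose derivatives vanish on the diagonal. -/
structure FlatOn (R : ℝ) (f : Cn n × Cn n → ℂ) : Prop where
  smooth : ContDiffOn ℝ ∞ f (biball n R)
  flat : ∀ y ∈ Metric.ball (0 : Cn n) R, ∀ m : ℕ, iteratedFDeriv ℝ m f (y, y) = 0

theorem FlatOn.contDiffAt (hf : FlatOn R f) {p : Cn n × Cn n} (hp : p ∈ biball n R) :
    ContDiffAt ℝ ∞ f p := hf.smooth.contDiffAt (isOpen_biball.mem_nhds hp)

theorem FlatOn.apply_eq_zero (hf : FlatOn R f) {y : Cn n} (hy : y ∈ Metric.ball (0 : Cn n) R) :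
    f (y, y) = 0 := by
  have := norm_iteratedFDeriv_zero (𝕜 := ℝ) (f := f) (x := (y, y))
  rw [hf.flat y hy 0, norm_zero] at this
  exact norm_eq_zero.mp this.symm

theorem FlatOn.fderiv_eq_zero (hf : FlatOn R f) {y : Cn n} (hy : y ∈ Metric.ball (0 : Cn n) R) :
    fderiv ℝ f (y, y) = 0 := by
  have := norm_iteratedFDeriv_one (𝕜 := ℝ) f (x := (y, y))
  rw [hf.flat y hy 1, norm_zero] at this
  exact norm_eq_zero.mp this.symm

theorem FlatOn.wirt (hf : FlatOn R f) (s : ℂ) (v : Cn n × Cn n) : FlatOn R (wirt s v f) := by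
  refine ⟨fun p hp => (contDiffAt_wirt (hf.contDiffAt hp)).contDiffWithinAt, fun y hy m => ?_⟩
  have hp : ((y, y) : Cn n × Cn n) ∈ biball n R := ⟨hy, hy⟩
  let Λ : ((Cn n × Cn n) →L[ℝ] ℂ) →L[ℝ] ℂ :=
    (2⁻¹ : ℂ) • (ContinuousLinearMap.apply ℝ ℂ v + s • ContinuousLinearMap.apply ℝ ℂ (Complex.I • v))
  have h1 : _root_.wirt s v f = Λ ∘ fderiv ℝ f := by
    funext q
    simp [Λ, _root_.wirt]; ring
  have h2 : ContDiffAt ℝ ∞ (fderiv ℝ f) (y, y) := (hf.contDiffAt hp).fderiv_right (by simp)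
  have h3 : iteratedFDeriv ℝ m (fderiv ℝ f) (y, y) = 0 := by
    rw [← norm_eq_zero, norm_iteratedFDeriv_fderiv, hf.flat y hy, norm_zero]
  rw [h1, Λ.iteratedFDeriv_comp_left (h2.of_le (m := m) (by norm_cast; exact le_top)) le_rfl, h3]
  ext; simp

theorem FlatOn.mul (hf : FlatOn R f) (hg : ContDiffOn ℝ ∞ g (biball n R)) :
    FlatOn R (fun p => g p * f p) := by
  refine ⟨hg.mul hf.smooth, fun y hy m => ?_⟩
  have hp : ((y, y) : Cn n × Cn n) ∈ biball n R := ⟨hy, hy⟩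
  have hu := (isOpen_biball (n := n) (R := R)).uniqueDiffOn (𝕜 := ℝ)
  have h := norm_iteratedFDerivWithin_mul_le hg hf.smooth hu hp (n := m) (by norm_cast; exact le_top)
  rw [iteratedFDerivWithin_of_isOpen m isOpen_biball hp] at h
  rw [← norm_le_zero_iff]
  refine h.trans (le_of_eq (Finset.sum_eq_zero fun i _ => ?_))
  rw [iteratedFDerivWithin_of_isOpen (m - i) isOpen_biball hp, hf.flat y hy, norm_zero, mul_zero]

theorem FlatOn.add (hf : FlatOn R f) (hg : FlatOn R g) : FlatOn R (fun p => f p + g p) := by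
  refine ⟨hf.smooth.add hg.smooth, fun y hy m => ?_⟩
  have hp : ((y, y) : Cn n × Cn n) ∈ biball n R := ⟨hy, hy⟩
  have hm : ((m : ℕ∞) : ℕ∞ω) ≤ ∞ := by norm_cast; exact le_top
  have := iteratedFDeriv_add_apply (𝕜 := ℝ) (i := m) (((hf.contDiffAt hp).of_le hm))
    ((hg.contDiffAt hp).of_le hm)
  rw [hf.flat y hy, hg.flat y hy, add_zero] at this
  exact this

theorem flatOn_zero : FlatOn R (fun _ : Cn n × Cn n => (0 : ℂ)) :=
  ⟨contDiffOn_const, fun y _ m => by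
    have := iteratedFDeriv_fun_zero (𝕜 := ℝ) (E := Cn n × Cn n) (F := ℂ) (n := m)
    exact congrFun this _⟩

theorem FlatOn.congr (hf : FlatOn R f) (h : ∀ p ∈ biball n R, g p = f p) : FlatOn R g := by
  refine ⟨hf.smooth.congr h, fun y hy m => ?_⟩
  have hp : ((y, y) : Cn n × Cn n) ∈ biball n R := ⟨hy, hy⟩
  rw [← hf.flat y hy m]
  exact Filter.EventuallyEq.eq_of_nhds (Filter.EventuallyEq.iteratedFDeriv ℝ
    (Filter.eventuallyEq_of_mem (isOpen_biball.mem_nhds hp) h) m)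

theorem FlatOn.mono (hf : FlatOn R f) (hr : r ≤ R) : FlatOn r f :=
  ⟨hf.smooth.mono (Set.prod_mono (Metric.ball_subset_ball hr) (Metric.ball_subset_ball hr)),
    fun y hy => hf.flat y (Metric.ball_subset_ball hr hy)⟩

theorem exists_bound_biball {E : Type*} [NormedAddCommGroup E] (hr : r < R)
    {h : Cn n × Cn n → E} (hh : ContinuousOn h (biball n R)) :
    ∃ C : ℝ, 0 ≤ C ∧ ∀ p ∈ biball n r, ‖h p‖ ≤ C := by
  have hc : IsCompact (Metric.closedBall (0 : Cn n) r ×ˢ Metric.closedBall (0 : Cn n) r) :=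
    (isCompact_closedBall _ _).prod (isCompact_closedBall _ _)
  obtain ⟨C, hC⟩ := hc.exists_bound_of_continuousOn (hh.mono
    (Set.prod_mono (Metric.closedBall_subset_ball hr) (Metric.closedBall_subset_ball hr)))
  exact ⟨max C 0, le_max_right _ _, fun p hp => (hC p ⟨Metric.ball_subset_closedBall hp.1,
    Metric.ball_subset_closedBall hp.2⟩).trans (le_max_left _ _)⟩

theorem continuousOn_iteratedFDeriv_biball (hf : ContDiffOn ℝ ∞ f (biball n R)) (i : ℕ) :
    ContinuousOn (iteratedFDeriv ℝ i f) (biball n R) := by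
  refine (hf.continuousOn_iteratedFDerivWithin (m := i) (by norm_cast; exact le_top)
    isOpen_biball.uniqueDiffOn).congr fun p hp => ?_
  rw [iteratedFDerivWithin_of_isOpen i isOpen_biball hp]

theorem segment_mem_ball {x y z : Cn n} (hx : x ∈ Metric.ball (0 : Cn n) r)
    (hy : y ∈ Metric.ball (0 : Cn n) r) (hz : z ∈ segment ℝ y x) :
    z ∈ Metric.ball (0 : Cn n) r ∧ ‖y - z‖ ≤ ‖y - x‖ := by
  refine ⟨(convex_ball (0 : Cn n) r).segment_subset hy hx hz, ?_⟩
  obtain ⟨a, b, ha, hb, hab, rfl⟩ := hz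
  have h1 : y - (a • y + b • x) = b • (y - x) := by
    have h2 : y = a • y + b • y := by rw [← add_smul, hab, one_smul]
    conv_lhs => rw [h2]
    rw [smul_sub]
    nth_rewrite 2 [← h2]
    abel
  rw [h1, norm_smul, Real.norm_of_nonneg hb]
  exact mul_le_of_le_one_left (norm_nonneg _) (by linarith)

/-- Induction on M for all i simultaneously: if the derivative of order i + 1 is O(|y - z|^M) on the
segment from (y, y) to (x, y), the mean value inequality gives the derivative of order i one more
power, starting from the value 0 at (y, y). -/
theorem FlatOn.exists_bound (hf : FlatOn R f) (hr : r < R) (M : ℕ) : ∀ i : ℕ,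
    ∃ C : ℝ, 0 ≤ C ∧ ∀ x ∈ Metric.ball (0 : Cn n) r, ∀ y ∈ Metric.ball (0 : Cn n) r,
      ‖iteratedFDeriv ℝ i f (x, y)‖ ≤ C * ‖y - x‖ ^ M := by
  induction M with
  | zero =>
    intro i
    obtain ⟨C, hC, h⟩ := exists_bound_biball hr (continuousOn_iteratedFDeriv_biball hf.smooth i)
    exact ⟨C, hC, fun x hx y hy => by simpa using h (x, y) ⟨hx, hy⟩⟩
  | succ M ih =>
    intro i
    obtain ⟨C, hC, h⟩ := ih (i + 1)
    refine ⟨C, hC, fun x hx y hy => ?_⟩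
    have hsub : ∀ z ∈ Metric.ball (0 : Cn n) r, ((z, y) : Cn n × Cn n) ∈ biball n R := fun z hz =>
      ⟨Metric.ball_subset_ball hr.le hz, Metric.ball_subset_ball hr.le hy⟩
    have hd : ∀ z ∈ segment ℝ y x, HasFDerivWithinAt (fun z => iteratedFDeriv ℝ i f (z, y))
        ((fderiv ℝ (iteratedFDeriv ℝ i f) (z, y)).comp (ContinuousLinearMap.inl ℝ (Cn n) (Cn n)))
        (segment ℝ y x) z := by
      intro z hz
      have h1 : DifferentiableAt ℝ (iteratedFDeriv ℝ i f) (z, y) :=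
        (hf.contDiffAt (hsub z (segment_mem_ball hx hy hz).1)).differentiableAt_iteratedFDeriv
          (by norm_cast; exact ENat.natCast_lt_top i)
      exact (h1.hasFDerivAt.comp z (hasFDerivAt_prodMk_left z y)).hasFDerivWithinAt
    have hb : ∀ z ∈ segment ℝ y x, ‖(fderiv ℝ (iteratedFDeriv ℝ i f) (z, y)).comp
        (ContinuousLinearMap.inl ℝ (Cn n) (Cn n))‖ ≤ C * ‖y - x‖ ^ M := by
      intro z hz
      obtain ⟨hz1, hz2⟩ := segment_mem_ball hx hy hz
      calc _ ≤ ‖fderiv ℝ (iteratedFDeriv ℝ i f) (z, y)‖ * ‖ContinuousLinearMap.inl ℝ (Cn n) (Cn n)‖ :=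
            ContinuousLinearMap.opNorm_comp_le _ _
        _ ≤ ‖fderiv ℝ (iteratedFDeriv ℝ i f) (z, y)‖ * 1 := by
            gcongr; exact ContinuousLinearMap.norm_inl_le_one ℝ _ _
        _ = ‖iteratedFDeriv ℝ (i + 1) f (z, y)‖ := by rw [mul_one, norm_fderiv_iteratedFDeriv]
        _ ≤ C * ‖y - z‖ ^ M := h z hz1 y hy
        _ ≤ C * ‖y - x‖ ^ M := by gcongr
    have := (convex_segment y x).norm_image_sub_le_of_norm_hasFDerivWithin_le hd hb
      (left_mem_segment ℝ y x) (right_mem_segment ℝ y x)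
    rw [hf.flat y (Metric.ball_subset_ball hr.le hy), sub_zero] at this
    refine this.trans (le_of_eq ?_)
    rw [norm_sub_rev x y]; ring

end Flat

/-- `F` behaves on `biball n R` like `(x, y) ↦ ψ(x, ȳ)` for an almost holomorphic extension `ψ` of
the strictly plurisubharmonic weight `y ↦ F (y, y)`. -/
structure IsPolarizedWeight {n : ℕ} (R : ℝ) (F : Cn n × Cn n → ℂ) : Prop where
  pos : 0 < R
  smooth : ContDiff ℝ ∞ F
  real : ∀ y ∈ Metric.ball (0 : Cn n) R, (F (y, y)).im = 0
  flatX : ∀ j, FlatOn R (delBar ((coordVec j, 0) : Cn n × Cn n) F)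
  flatY : ∀ j, FlatOn R (delHol ((0, coordVec j) : Cn n × Cn n) F)
  posDef : (Matrix.of fun i j : Fin n => delHol ((coordVec i, 0) : Cn n × Cn n)
    (delBar ((0, coordVec j) : Cn n × Cn n) F) (0, 0)).PosDef
  hessPos : ∀ y ∈ Metric.ball (0 : Cn n) R, 0 < mixedHessianDet F (y, y)

/-! ### Taylor expansion in the first variable for almost holomorphic functions. -/

section Taylor

variable {n : ℕ} {F : Cn n × Cn n → ℂ} {R r : ℝ}

theorem wirt_slice_left {G : Cn n × Cn n → ℂ} {x y : Cn n} (s : ℂ) (v : Cn n)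
    (hG : DifferentiableAt ℝ G (x, y)) :
    wirt s v (fun z => G (z, y)) x = wirt s ((v, 0) : Cn n × Cn n) G (x, y) := by
  have h : HasFDerivAt (fun z => G (z, y)) _ x :=
    hG.hasFDerivAt.comp x (hasFDerivAt_prodMk_left x y)
  simp [wirt, h.fderiv]

theorem wirt_slice_right {G : Cn n × Cn n → ℂ} {x y : Cn n} (s : ℂ) (v : Cn n)
    (hG : DifferentiableAt ℝ G (x, y)) :
    wirt s v (fun z => G (x, z)) y = wirt s ((0, v) : Cn n × Cn n) G (x, y) := by
  have h : HasFDerivAt (fun z => G (x, z)) _ y :=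
    hG.hasFDerivAt.comp y (hasFDerivAt_prodMk_right x y)
  simp [wirt, h.fderiv]

theorem flatOn_mixedDeriv (h : FlatOn R F) (α β : Fin n → ℕ) :
    FlatOn R (mixedDeriv α β F) := by
  have key : ∀ (s : ℂ) (e : Fin n → Cn n × Cn n) (α : Fin n → ℕ) (l : List (Fin n)) (G),
      FlatOn R G → FlatOn R (l.foldr (fun j G => (wirt s (e j))^[α j] G) G) := by
    intro s e α l G hG
    induction l with
    | nil => exact hG
    | cons a l ih =>
      simp only [List.foldr_cons]
      generalize l.foldr (fun j G => (wirt s (e j))^[α j] G) G = H at ih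
      induction α a with
      | zero => exact ih
      | succ m ihm => rw [Function.iterate_succ_apply']; exact ihm.wirt _ _
  simp only [mixedDeriv, delHol_eq_wirt, delBar_eq_wirt]
  exact key _ (fun j => (coordVec j, 0)) _ _ _ (key _ (fun j => (0, coordVec j)) _ _ _ h)

theorem fderiv_coord_sub (x y v : Cn n) (a : Fin n) :
    fderiv ℝ (fun z : Cn n => (y - z) a) x v = -v a := by
  have h1 : HasFDerivAt (fun z : Cn n => y - z) (-ContinuousLinearMap.id ℝ (Cn n)) x :=
    (hasFDerivAt_id x).const_sub y
  have h2 : HasFDerivAt (fun z : Cn n => (y - z) a) _ x :=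
    ((EuclideanSpace.proj (𝕜 := ℂ) a).restrictScalars ℝ).hasFDerivAt.comp x h1
  rw [h2.fderiv]; simp

theorem contDiff_monom_left (y : Cn n) (α : Fin n →₀ ℕ) :
    ContDiff ℝ ∞ (fun x : Cn n => monom (y - x) α) := by
  unfold monom
  have h : ∀ j, ContDiff ℝ ∞ (fun x : Cn n => (y - x) j) := fun j =>
    ((EuclideanSpace.proj (𝕜 := ℂ) j).restrictScalars ℝ).contDiff.comp (contDiff_const.sub contDiff_id)
  exact contDiff_prod fun j _ => (h j).pow _

theorem monom_eq_eval (w : Cn n) (α : Fin n →₀ ℕ) :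
    monom w α = MvPolynomial.eval (fun a => w a) (MvPolynomial.monomial α 1) := by
  rw [MvPolynomial.eval_monomial, one_mul, monom, Finsupp.prod_fintype]
  simp

theorem delHol_monom_left (x y : Cn n) (j : Fin n) (α : Fin n →₀ ℕ) :
    delHol (coordVec j) (fun x : Cn n => monom (y - x) α) x =
      -(α j : ℂ) * monom (y - x) (α - Finsupp.single j 1) := by
  rw [delHol_eq_wirt]
  simp only [monom_eq_eval]
  rw [wirt_eval (val := fun a z => (y - z) a) (fun a => if a = j then -1 else 0)
    (fun a => ?_) (fun a => ?_)]
  · have : MvPolynomial.mkDerivation ℂ (fun a => if a = j then -1 else 0) =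
        -MvPolynomial.pderiv (R := ℂ) j := by
      apply MvPolynomial.derivation_ext
      intro a
      by_cases h : a = j
      · subst h; simp
      · simp [MvPolynomial.mkDerivation_X, h]
    rw [this]
    simp [MvPolynomial.pderiv_monomial, MvPolynomial.eval_monomial]
  · exact (((EuclideanSpace.proj (𝕜 := ℂ) a).restrictScalars ℝ).contDiff.comp
      (contDiff_const.sub contDiff_id)).contDiffAt
  · simp only [wirt, fderiv_coord_sub, coordVec]
    by_cases h : a = j
    · subst h; simp
    · simp [h]

theorem delBar_monom_left (x y : Cn n) (v : Cn n) (α : Fin n →₀ ℕ) :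
    delBar v (fun x : Cn n => monom (y - x) α) x = 0 := by
  apply delBar_holomorphic
  unfold monom
  have h : ∀ j, ContDiff ℂ 1 (fun x : Cn n => (y - x) j) := fun j =>
    (EuclideanSpace.proj (𝕜 := ℂ) j).contDiff.comp (contDiff_const.sub contDiff_id)
  exact (contDiff_prod fun j _ => (h j).pow _).differentiable one_ne_zero x

/-- Shifting exponents by e_j matches each subtracted term with an earlier one; only the face α_j =
L of the box has no partner. -/
theorem sum_box_telescope (L : ℕ) (j : Fin n) (U : (Fin n →₀ ℕ) → ℂ) :
    ∑ α ∈ box n L, (U α - if α j = 0 then 0 else U (α - Finsupp.single j 1)) =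
      ∑ α ∈ (box n L).filter (fun α => α j = L), U α := by
  classical
  rw [Finset.sum_sub_distrib, sub_eq_iff_eq_add,
    ← Finset.sum_filter_add_sum_filter_not (box n L) (fun α => α j = L)]
  congr 1
  have h1 : ∑ α ∈ box n L, (if α j = 0 then 0 else U (α - Finsupp.single j 1)) =
      ∑ α ∈ (box n L).filter (fun α => ¬ α j = 0), U (α - Finsupp.single j 1) := by
    rw [Finset.sum_filter]
    exact Finset.sum_congr rfl fun α _ => by split_ifs <;> simp_all
  rw [h1]
  refine Finset.sum_bij' (fun α _ => α + Finsupp.single j 1) (fun α _ => α - Finsupp.single j 1)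
    ?_ ?_ ?_ ?_ ?_
  · intro α hα
    simp only [Finset.mem_filter, mem_box] at hα ⊢
    refine ⟨fun i => ?_, by simp⟩
    by_cases h : i = j
    · subst h
      have := hα.1 i
      simp; omega
    · simpa [Finsupp.single_apply, Ne.symm h] using hα.1 i
  · intro α hα
    simp only [Finset.mem_filter, mem_box] at hα ⊢
    refine ⟨fun i => (by simpa using (Nat.sub_le _ _).trans (hα.1 i)), ?_⟩
    have h1 := hα.1 j
    have h2 := hα.2
    simp; omega
  · intro α _; simp
  · intro α hα
    have h2 := (Finset.mem_filter.mp hα).2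
    exact tsub_add_cancel_of_le (by simp; omega)
  · intro α _; simp

/-- Taylor's formula in the first variable, for almost holomorphic functions. -/
theorem exists_taylor_bound (hF : IsPolarizedWeight R F) (hr : r < R) (hr2 : r ≤ 1 / 2) (L : ℕ)
    (γ β : Fin n → ℕ) :
    ∃ C : ℝ, ∀ p ∈ biball n r, ‖serVal F L (taylorSeries γ β) p - mixedDeriv γ β F (p.2, p.2)‖ ≤
      C * ‖p.2 - p.1‖ ^ L := by
  classical
  set fact : (Fin n →₀ ℕ) → ℂ := fun α => (α.prod fun _ m => (m.factorial : ℂ))⁻¹ with hfact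
  set J : (Fin n →₀ ℕ) → Cn n × Cn n → ℂ := fun α => mixedDeriv (γ + ⇑α) β F with hJ
  have hJs : ∀ α, ContDiff ℝ ∞ (J α) := fun α => contDiff_mixedDeriv hF.smooth _ _
  have hser : ∀ x y, serVal F L (taylorSeries γ β) (x, y) =
      ∑ α ∈ box n L, monom (y - x) α * (fact α * J α (x, y)) := by
    intro x y
    simp [serVal, taylorSeries, fact, J]
  have hJb : ∀ (j : Fin n) α, ∃ C : ℝ, 0 ≤ C ∧ ∀ p ∈ biball n r,
      ‖fact α * J (α + Finsupp.single j 1) p‖ ≤ C := fun j α =>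
    exists_bound_biball hr ((contDiff_const.mul (hJs _)).continuous.continuousOn)
  have hJf : ∀ (j : Fin n) α, ∃ C : ℝ, 0 ≤ C ∧ ∀ x ∈ Metric.ball (0 : Cn n) r,
      ∀ y ∈ Metric.ball (0 : Cn n) r,
      ‖delBar ((coordVec j, 0) : Cn n × Cn n) (J α) (x, y)‖ ≤ C * ‖y - x‖ ^ L := by
    intro j α
    have h1 : FlatOn R (delBar ((coordVec j, 0) : Cn n × Cn n) (J α)) := by
      have := flatOn_mixedDeriv (hF.flatX j) (γ + ⇑α) β
      simp only [delBar_eq_wirt] at this ⊢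
      rwa [← wirt_mixedDeriv_comm hF.smooth] at this
    obtain ⟨C, hC, h⟩ := h1.exists_bound hr L 0
    exact ⟨C, hC, fun x hx y hy => by simpa using h x hx y hy⟩
  choose B hB0 hB using hJb
  choose A hA0 hA using hJf
  set Ctot := ∑ j : Fin n, (∑ α ∈ box n L, B j α + ∑ α ∈ box n L, ‖fact α‖ * A j α) with hCtot
  have hC0 : 0 ≤ Ctot := Finset.sum_nonneg fun j _ => add_nonneg
    (Finset.sum_nonneg fun α _ => hB0 j α)
    (Finset.sum_nonneg fun α _ => mul_nonneg (norm_nonneg _) (hA0 j α))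
  refine ⟨Ctot, ?_⟩
  rintro ⟨x, y⟩ ⟨hx, hy⟩
  change ‖serVal F L _ (x, y) - mixedDeriv γ β F (y, y)‖ ≤ Ctot * ‖y - x‖ ^ L
  simp only at hx hy
  have hsm : ∀ a ∈ Metric.ball (0 : Cn n) r, ‖y - a‖ ≤ 1 := by
    intro a ha
    have h1 := norm_sub_le y a
    rw [mem_ball_zero_iff] at ha hy
    linarith
  -- The Taylor sum as a function of its base point z, with y fixed. It is the true value at z = y
  -- and the truncated series at z = x, so it remains to bound its derivative on the segment.
  set rem : Cn n → ℂ := fun z => ∑ α ∈ box n L, monom (y - z) α * (fact α * J α (z, y)) with hrem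
  have hterm : ∀ α, ContDiff ℝ ∞ (fun z => fact α * J α (z, y)) := fun α =>
    contDiff_const.mul ((hJs α).comp (contDiff_id.prodMk contDiff_const))
  have hremd : Differentiable ℝ rem := by
    refine ContDiff.differentiable (n := ∞) (ContDiff.sum fun α _ => ?_) (by simp)
    exact (contDiff_monom_left y α).mul (hterm α)
  have hJd : ∀ α z, DifferentiableAt ℝ (J α) (z, y) := fun α z =>
    (hJs α).differentiable (by simp) _
  have hmd : ∀ α z, DifferentiableAt ℝ (fun z => monom (y - z) α) z := fun α z =>
    (contDiff_monom_left y α).differentiable (by simp) _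
  have htd : ∀ α z, DifferentiableAt ℝ (fun z => fact α * J α (z, y)) z := fun α z =>
    (hterm α).differentiable (by simp) _
  have hJz : ∀ α z, DifferentiableAt ℝ (fun z => J α (z, y)) z := fun α z =>
    ((hJs α).comp (contDiff_id.prodMk contDiff_const)).differentiable (by simp) _
  -- Differentiating (y - z)^α cancels against raising the order of the jet, so only the terms with
  -- α_j = L survive, and these are O(|y - z|^L).
  have hHol : ∀ (j : Fin n) z, delHol (coordVec j) rem z =
      ∑ α ∈ (box n L).filter (fun α => α j = L), monom (y - z) α *
        (fact α * J (α + Finsupp.single j 1) (z, y)) := by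
    intro j z
    rw [← sum_box_telescope L j fun α => monom (y - z) α *
        (fact α * J (α + Finsupp.single j 1) (z, y)), delHol_eq_wirt, hrem,
      wirt_sum _ fun α _ => (hmd α z).fun_mul (htd α z)]
    refine Finset.sum_congr rfl fun α _ => ?_
    rw [wirt_mul (hmd α z) (htd α z), wirt_const_mul _ (hJz α z), wirt_slice_left _ _ (hJd α z),
      ← delHol_eq_wirt, ← delHol_eq_wirt, delHol_monom_left]
    have h1 : delHol ((coordVec j, 0) : Cn n × Cn n) (J α) = J (α + Finsupp.single j 1) := by
      simp only [hJ]
      rw [delHol_mixedDeriv hF.smooth, add_assoc, Finsupp.coe_add, Finsupp.single_eq_pi_single]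
    rw [h1, add_comm, sub_eq_add_neg]
    by_cases h0 : α j = 0
    · simp [h0]
    · rw [if_neg h0]
      have hle : Finsupp.single j 1 ≤ α := by simp; omega
      have h2 : α - Finsupp.single j 1 + Finsupp.single j 1 = α := tsub_add_cancel_of_le hle
      have h3 : (α j : ℂ) * fact α = fact (α - Finsupp.single j 1) := by
        simp only [hfact]
        have h4 : ∀ ν : Fin n →₀ ℕ, (ν + Finsupp.single j 1).prod
            (fun _ m => (m.factorial : ℂ)) = ((ν j : ℂ) + 1) * ν.prod
            (fun _ m => (m.factorial : ℂ)) := by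
          intro ν
          rw [Finsupp.prod_fintype _ _ (by simp), Finsupp.prod_fintype _ _ (by simp),
            ← Finset.mul_prod_erase _ _ (Finset.mem_univ j),
            ← Finset.mul_prod_erase (a := j) _ (fun i => ((ν i).factorial : ℂ)) (Finset.mem_univ j),
            ← mul_assoc]
          congr 1
          · simp [Nat.factorial_succ]
          · refine Finset.prod_congr rfl fun i hi => ?_
            simp [Ne.symm (Finset.ne_of_mem_erase hi)]
        have h5 := h4 (α - Finsupp.single j 1)
        rw [h2] at h5
        have h6 : ((α - Finsupp.single j 1 : Fin n →₀ ℕ) j : ℂ) + 1 = α j := by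
          conv_rhs => rw [← h2]
          simp [-Finsupp.coe_tsub]
        rw [h5, h6, mul_inv, ← mul_assoc, mul_inv_cancel₀ (by exact_mod_cast h0), one_mul]
      rw [h2, ← h3]; ring
  -- The monomials are holomorphic in z, so ∂̄_z falls on the jets alone, where it is flat on the
  -- diagonal.
  have hBar : ∀ (j : Fin n) z, delBar (coordVec j) rem z =
      ∑ α ∈ box n L, monom (y - z) α *
        (fact α * delBar ((coordVec j, 0) : Cn n × Cn n) (J α) (z, y)) := by
    intro j z
    rw [delBar_eq_wirt, hrem, wirt_sum _ fun α _ => (hmd α z).fun_mul (htd α z)]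
    refine Finset.sum_congr rfl fun α _ => ?_
    rw [wirt_mul (hmd α z) (htd α z), wirt_const_mul _ (hJz α z), wirt_slice_left _ _ (hJd α z),
      ← delBar_eq_wirt, delBar_monom_left, zero_mul, zero_add, delBar_eq_wirt]
  have hfd : ∀ z ∈ segment ℝ y x, ‖fderiv ℝ rem z‖ ≤ Ctot * ‖y - x‖ ^ L := by
    intro z hz
    obtain ⟨hz1, hz2⟩ := segment_mem_ball hx hy hz
    have hz3 : ‖y - z‖ ^ L ≤ ‖y - x‖ ^ L := pow_le_pow_left₀ (norm_nonneg _) hz2 L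
    refine ContinuousLinearMap.opNorm_le_bound _ (by positivity) fun v => ?_
    rw [fderiv_eq_sum_wirtinger, hCtot, Finset.sum_mul, Finset.sum_mul]
    refine (norm_sum_le _ _).trans (Finset.sum_le_sum fun j _ => ?_)
    have hv : ‖v j‖ ≤ ‖v‖ := PiLp.norm_apply_le v j
    have e1 : ‖delHol (coordVec j) rem z‖ ≤ (∑ α ∈ box n L, B j α) * ‖y - x‖ ^ L := by
      rw [hHol, Finset.sum_mul]
      calc _ ≤ ∑ α ∈ (box n L).filter (fun α => α j = L), B j α * ‖y - x‖ ^ L := by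
            refine (norm_sum_le _ _).trans (Finset.sum_le_sum fun α hα => ?_)
            rw [norm_mul, mul_comm]
            refine mul_le_mul (hB j α (z, y) ⟨hz1, hy⟩) ?_ (norm_nonneg _) (hB0 j α)
            exact (norm_monom_le (hsm z hz1) (Finset.mem_filter.mp hα).2.ge).trans hz3
        _ ≤ _ := Finset.sum_le_sum_of_subset_of_nonneg (Finset.filter_subset _ _)
            fun α _ _ => mul_nonneg (hB0 j α) (by positivity)
    have e2 : ‖delBar (coordVec j) rem z‖ ≤ (∑ α ∈ box n L, ‖fact α‖ * A j α) * ‖y - x‖ ^ L := by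
      rw [hBar, Finset.sum_mul]
      refine (norm_sum_le _ _).trans (Finset.sum_le_sum fun α _ => ?_)
      rw [norm_mul, norm_mul]
      calc _ ≤ 1 * (‖fact α‖ * (A j α * ‖y - x‖ ^ L)) := by
            have h1 := hA j α z hz1 y hy
            have h2 := hA0 j α
            refine mul_le_mul (norm_monom_le_one (hsm z hz1) α) ?_ (by positivity) zero_le_one
            refine mul_le_mul_of_nonneg_left (h1.trans ?_) (norm_nonneg _)
            exact mul_le_mul_of_nonneg_left hz3 h2
        _ = _ := by ring
    calc _ ≤ ‖v j‖ * ‖delHol (coordVec j) rem z‖ + ‖v j‖ * ‖delBar (coordVec j) rem z‖ := by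
          refine (norm_add_le _ _).trans (le_of_eq ?_)
          rw [norm_mul, norm_mul, RCLike.norm_conj]
      _ ≤ ‖v‖ * ((∑ α ∈ box n L, B j α) * ‖y - x‖ ^ L) +
          ‖v‖ * ((∑ α ∈ box n L, ‖fact α‖ * A j α) * ‖y - x‖ ^ L) := by gcongr
      _ = _ := by ring
  have hmv := (convex_segment y x).norm_image_sub_le_of_norm_hasFDerivWithin_le
    (fun z _ => (hremd z).hasFDerivAt.hasFDerivWithinAt) hfd
    (left_mem_segment ℝ y x) (right_mem_segment ℝ y x)
  have hry : rem y = mixedDeriv γ β F (y, y) := by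
    simp only [hrem, sub_self]
    rw [Finset.sum_eq_single 0]
    · simp [monom_zero, fact, J]
    · intro α _ hα
      obtain ⟨j, hj⟩ : ∃ j, α j ≠ 0 := by
        by_contra! h; exact hα (Finsupp.ext h)
      have : monom (0 : Cn n) α = 0 := by
        rw [monom, Finset.prod_eq_zero (Finset.mem_univ j)]
        simp [hj]
      rw [this, zero_mul]
    · intro h0; simp [mem_box] at h0
  rw [hser, ← hry]
  refine hmv.trans ?_
  calc _ ≤ Ctot * ‖y - x‖ ^ L * 1 := by
        gcongr
        rw [norm_sub_rev]; exact hsm x hx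
    _ = _ := mul_one _

/-- Boundedness comes from compactness of the closed balls inside the larger biball; r ≤ 1/2 ensures
|y - x| ≤ 1. -/
theorem jetDomain_biball (hF : IsPolarizedWeight R F) (hr : r < R) (hr2 : r ≤ 1 / 2)
    (hdet : ∀ p ∈ biball n R, mixedHessianDet F p ≠ 0) : JetDomain F (biball n r) where
  smooth := hF.smooth
  bdd P := by
    obtain ⟨C, -, h⟩ := exists_bound_biball hr (h := fun p => jetVal F p P) fun p hp =>
      (contDiffAt_jetVal hF.smooth (hdet p hp) P).continuousAt.continuousWithinAt
    exact ⟨C, h⟩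
  small := by
    rintro ⟨x, y⟩ ⟨hx, hy⟩
    have h1 := norm_sub_le y x
    simp only [mem_ball_zero_iff] at hx hy
    change ‖y - x‖ ≤ 1
    linarith
  hess p hp := hdet p ⟨Metric.ball_subset_ball hr.le hp.1, Metric.ball_subset_ball hr.le hp.2⟩

end Taylor

/-! ### The gaussian bound on Re F off the diagonal. -/

section Phase

variable {n : ℕ} {F : Cn n × Cn n → ℂ} {R r : ℝ}

theorem FlatOn.sum {ι : Type*} (u : Finset ι) {f : ι → Cn n × Cn n → ℂ} (c : ι → ℂ)
    (h : ∀ i ∈ u, FlatOn R (f i)) : FlatOn R (fun p => ∑ i ∈ u, c i * f i p) := by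
  classical
  induction u using Finset.induction_on with
  | empty => simpa using flatOn_zero
  | insert a u ha ih =>
    simp only [Finset.sum_insert ha]
    exact ((h a (Finset.mem_insert_self a u)).mul (g := fun _ => c a) contDiffOn_const).add
      (ih fun i hi => h i (Finset.mem_insert_of_mem hi))

theorem prod_left_eq_sum (h : Cn n) :
    ((h, 0) : Cn n × Cn n) = ∑ j, h j • ((coordVec j, 0) : Cn n × Cn n) := by
  refine Prod.ext ?_ ?_
  · simp [Prod.fst_sum, sum_smul_coordVec]
  · simp [Prod.snd_sum]

theorem prod_right_eq_sum (h : Cn n) :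
    ((0, h) : Cn n × Cn n) = ∑ j, h j • ((0, coordVec j) : Cn n × Cn n) := by
  refine Prod.ext ?_ ?_
  · simp [Prod.fst_sum]
  · simp [Prod.snd_sum, sum_smul_coordVec]

theorem IsPolarizedWeight.flat_left (hF : IsPolarizedWeight R F) (h : Cn n) :
    FlatOn R (delBar ((h, 0) : Cn n × Cn n) F) := by
  have : delBar ((h, 0) : Cn n × Cn n) F =
      fun p => ∑ j, conj (h j) * delBar ((coordVec j, 0) : Cn n × Cn n) F p := by
    funext p; rw [prod_left_eq_sum, delBar_sum_smul]
  rw [this]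
  exact FlatOn.sum _ _ fun j _ => hF.flatX j

theorem IsPolarizedWeight.flat_right (hF : IsPolarizedWeight R F) (h : Cn n) :
    FlatOn R (delHol ((0, h) : Cn n × Cn n) F) := by
  have : delHol ((0, h) : Cn n × Cn n) F =
      fun p => ∑ j, h j * delHol ((0, coordVec j) : Cn n × Cn n) F p := by
    funext p; rw [prod_right_eq_sum, delHol_sum_smul]
  rw [this]
  exact FlatOn.sum _ _ fun j _ => hF.flatY j

/-- Since F is real on the diagonal, the imaginary parts of D_xF(h) and D_yF(h) cancel there. At
such points D_xF is complex linear and D_yF antilinear, so applying this to ih turns it into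
equality of the real parts. -/
theorem IsPolarizedWeight.fderiv_diag (hF : IsPolarizedWeight R F) {y : Cn n}
    (hy : y ∈ Metric.ball (0 : Cn n) R) (h : Cn n) :
    (fderiv ℝ F (y, y) (h, 0)).re = (fderiv ℝ F (y, y) (0, h)).re := by
  have key : ∀ h : Cn n, (fderiv ℝ F (y, y) (h, 0)).im + (fderiv ℝ F (y, y) (0, h)).im = 0 := by
    intro h
    have h0 : HasFDerivAt F (fderiv ℝ F (y, y)) ((fun z : Cn n => (z, z)) y) :=
      (hF.smooth.differentiable (by simp) (y, y)).hasFDerivAt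
    have h1 : HasFDerivAt (fun z => (F (z, z)).im) _ y :=
      Complex.imCLM.hasFDerivAt.comp y (HasFDerivAt.comp (f := fun z : Cn n => (z, z)) y h0
        ((hasFDerivAt_id y).prodMk (hasFDerivAt_id y)))
    have h2 : (fun z => (F (z, z)).im) =ᶠ[nhds y] fun _ => 0 :=
      Filter.eventually_of_mem (Metric.isOpen_ball.mem_nhds hy) hF.real
    have h3 := h1.fderiv
    rw [h2.fderiv_eq, fderiv_fun_const] at h3
    have h4 := DFunLike.congr_fun h3 h
    have h5 : ((h, h) : Cn n × Cn n) = (h, 0) + (0, h) := by simp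
    simp only [Pi.zero_apply, ContinuousLinearMap.comp_apply, ContinuousLinearMap.prod_apply,
      ContinuousLinearMap.id_apply, h5, map_add, Complex.imCLM_apply, zero_apply]
      at h4
    exact h4.symm
  have h1 := (hF.flat_left h).apply_eq_zero hy
  have h2 := (hF.flat_right h).apply_eq_zero hy
  have h3 := key (Complex.I • h)
  simp only [delBar, delHol, Prod.smul_mk, smul_zero] at h1 h2
  have h1' : fderiv ℝ F (y, y) (Complex.I • h, 0) = Complex.I * fderiv ℝ F (y, y) (h, 0) := by
    linear_combination (-2 * Complex.I) * h1 + fderiv ℝ F (y, y) (Complex.I • h, 0) * Complex.I_mul_I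
  have h2' : fderiv ℝ F (y, y) (0, Complex.I • h) = -Complex.I * fderiv ℝ F (y, y) (0, h) := by
    linear_combination (2 * Complex.I) * h2 + fderiv ℝ F (y, y) (0, Complex.I • h) * Complex.I_mul_I
  rw [h1', h2'] at h3
  simp at h3
  linarith

/-- At the origin all contributions containing ∂̄_x or ∂_y vanish by flatness, so the mixed real
second derivative reduces to the Levi form. -/
theorem IsPolarizedWeight.second_fderiv (hF : IsPolarizedWeight R F) (h : Cn n) :
    fderiv ℝ (fderiv ℝ F) (0, 0) (h, 0) (0, h) =
      ∑ i, ∑ j, h i * (conj (h j) * delHol ((coordVec i, 0) : Cn n × Cn n)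
        (delBar ((0, coordVec j) : Cn n × Cn n) F) (0, 0)) := by
  have h0 : (0 : Cn n) ∈ Metric.ball (0 : Cn n) R := Metric.mem_ball_self hF.pos
  have h1 : fderiv ℝ (delHol ((0, h) : Cn n × Cn n) F) (0, 0) (h, 0) = 0 := by
    rw [(hF.flat_right h).fderiv_eq_zero h0]; rfl
  have h2 : fderiv ℝ (fderiv ℝ F) (0, 0) (h, 0) (0, h) =
      fderiv ℝ (delBar ((0, h) : Cn n × Cn n) F) (0, 0) (h, 0) := by
    rw [delHol_eq_wirt, fderiv_wirt hF.smooth.contDiffAt] at h1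
    rw [delBar_eq_wirt, fderiv_wirt hF.smooth.contDiffAt]
    linear_combination h1
  have hs : ∀ j : Fin n, ContDiff ℝ ∞ (delBar ((0, coordVec j) : Cn n × Cn n) F) := fun j =>
    contDiff_wirt hF.smooth
  rw [h2, fderiv_eq_delHol_add_delBar]
  have h3 : delBar ((h, 0) : Cn n × Cn n) (delBar ((0, h) : Cn n × Cn n) F) (0, 0) = 0 := by
    rw [delBar_eq_wirt, delBar_eq_wirt, wirt_comm hF.smooth.contDiffAt, ← delBar_eq_wirt,
      ← delBar_eq_wirt, delBar, (hF.flat_left h).fderiv_eq_zero h0]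
    simp
  rw [h3, add_zero, prod_left_eq_sum h, delHol_sum_smul]
  refine Finset.sum_congr rfl fun i _ => ?_
  rw [← Finset.mul_sum]
  congr 1
  have h4 : delBar ((0, h) : Cn n × Cn n) F =
      fun p => ∑ j, conj (h j) * delBar ((0, coordVec j) : Cn n × Cn n) F p := by
    funext p; rw [prod_right_eq_sum, delBar_sum_smul]
  rw [h4, delHol_eq_wirt, wirt_sum]
  · refine Finset.sum_congr rfl fun j _ => wirt_const_mul _ ((hs j).differentiable (by simp) _)
  · exact fun j _ => ((hs j).differentiable (by simp) _).const_mul _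

/-- The minimum over the unit sphere is positive by compactness, and quadratic homogeneity extends
the bound to all vectors. -/
theorem exists_pos_lower_bound {H : Matrix (Fin n) (Fin n) ℂ} (hH : H.PosDef) :
    ∃ c : ℝ, 0 < c ∧ ∀ h : Cn n, c * ‖h‖ ^ 2 ≤ (∑ i, ∑ j, h i * (conj (h j) * H i j)).re := by
  set q : Cn n → ℝ := fun h => (∑ i, ∑ j, h i * (conj (h j) * H i j)).re with hq
  have hpos : ∀ h : Cn n, h ≠ 0 → 0 < q h := by
    intro h hh
    have h1 : (fun j => conj (h j)) ≠ 0 := by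
      intro h2
      apply hh
      ext j
      simpa using congrFun h2 j
    have h2 := hH.dotProduct_mulVec_pos h1
    have h3 := (Complex.lt_def.mp h2).1
    simp only [dotProduct, Matrix.mulVec, Pi.star_apply, Complex.zero_re] at h3
    refine h3.trans_le (le_of_eq ?_)
    simp only [hq]
    congr 1
    refine Finset.sum_congr rfl fun i _ => ?_
    rw [Finset.mul_sum]
    refine Finset.sum_congr rfl fun j _ => ?_
    have : star (conj (h i)) = h i := Complex.conj_conj _
    rw [this]; ring
  have hcont : Continuous q := by
    simp only [hq]
    refine Complex.continuous_re.comp (continuous_finsetSum _ fun i _ => continuous_finsetSum _ fun j _ => ?_)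
    have hp : ∀ j, Continuous fun h : Cn n => h j := fun j => (EuclideanSpace.proj (𝕜 := ℂ) j).continuous
    exact (hp i).mul (((Complex.continuous_conj.comp (hp j))).mul continuous_const)
  have hhom : ∀ (t : ℝ) (h : Cn n), q (t • h) = t ^ 2 * q h := by
    intro t h
    simp only [hq]
    rw [← Complex.re_ofReal_mul, Finset.mul_sum]
    congr 1
    refine Finset.sum_congr rfl fun i _ => ?_
    rw [Finset.mul_sum]
    refine Finset.sum_congr rfl fun j _ => ?_
    simp; ring
  obtain ⟨c, hc, hb⟩ : ∃ c : ℝ, 0 < c ∧ ∀ h ∈ Metric.sphere (0 : Cn n) 1, c ≤ q h := by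
    -- For n = 0 the sphere is empty and any positive constant serves.
    rcases (Metric.sphere (0 : Cn n) 1).eq_empty_or_nonempty with he | hne
    · exact ⟨1, one_pos, fun h hh => by simp [he] at hh⟩
    · obtain ⟨h0, hh0, hmin⟩ := (isCompact_sphere (0 : Cn n) 1).exists_isMinOn hne hcont.continuousOn
      refine ⟨q h0, hpos h0 ?_, fun h hh => hmin hh⟩
      rintro rfl
      simp at hh0
  refine ⟨c, hc, fun h => ?_⟩
  by_cases hh : h = 0
  · subst hh; simp
  have hn : ‖h‖ ≠ 0 := norm_ne_zero_iff.mpr hh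
  have h1 := hb (‖h‖⁻¹ • h) (by simp [norm_smul, hn])
  rw [hhom] at h1
  have h2 : ‖h‖⁻¹ ^ 2 * ‖h‖ ^ 2 = 1 := by field_simp
  calc c * ‖h‖ ^ 2 ≤ ‖h‖⁻¹ ^ 2 * q h * ‖h‖ ^ 2 := by gcongr
    _ = q h := by linear_combination q h * h2

theorem le_of_second_deriv_le {h h' h'' : ℝ → ℝ} {A : ℝ} (h1 : ∀ t, HasDerivAt h (h' t) t)
    (h2 : ∀ t, HasDerivAt h' (h'' t) t) (hA : ∀ t ∈ Set.Icc (0 : ℝ) 1, h'' t ≤ A) :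
    h 1 ≤ h 0 + h' 0 + A / 2 := by
  have k1 : ∀ t, HasDerivAt (fun t => h t - h' 0 * t - A / 2 * t ^ 2) (h' t - h' 0 - A * t) t := by
    intro t
    refine (((h1 t).sub ((hasDerivAt_id t).const_mul (h' 0))).sub
      ((hasDerivAt_pow 2 t).const_mul (A / 2))).congr_deriv ?_
    simp; ring
  have k2 : ∀ t, HasDerivAt (fun t => h' t - h' 0 - A * t) (h'' t - A) t := by
    intro t
    refine (((h2 t).sub_const (h' 0)).sub ((hasDerivAt_id t).const_mul A)).congr_deriv ?_
    simp
  have a2 : AntitoneOn (fun t => h' t - h' 0 - A * t) (Set.Icc 0 1) := by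
    refine antitoneOn_of_hasDerivWithinAt_nonpos (convex_Icc 0 1)
      (fun t _ => (k2 t).continuousAt.continuousWithinAt) (fun t _ => (k2 t).hasDerivWithinAt)
      fun t ht => ?_
    rw [interior_Icc] at ht
    linarith [hA t ⟨ht.1.le, ht.2.le⟩]
  have a1 : AntitoneOn (fun t => h t - h' 0 * t - A / 2 * t ^ 2) (Set.Icc 0 1) := by
    refine antitoneOn_of_hasDerivWithinAt_nonpos (convex_Icc 0 1)
      (fun t _ => (k1 t).continuousAt.continuousWithinAt) (fun t _ => (k1 t).hasDerivWithinAt)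
      fun t ht => ?_
    rw [interior_Icc] at ht
    have := a2 ⟨le_rfl, zero_le_one⟩ ⟨ht.1.le, ht.2.le⟩ ht.1.le
    simp only at this
    linarith
  have := a1 ⟨le_rfl, zero_le_one⟩ ⟨zero_le_one, le_rfl⟩ zero_le_one
  simp only at this
  linarith

theorem hasDerivAt_line {V E : Type*} [NormedAddCommGroup V] [NormedSpace ℝ V]
    [NormedAddCommGroup E] [NormedSpace ℝ E] {G : V → E} (hG : Differentiable ℝ G) (q v : V) (t : ℝ) :
    HasDerivAt (fun t : ℝ => G (q + t • v)) (fderiv ℝ G (q + t • v) v) t := by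
  have h1 : HasDerivAt (fun t : ℝ => q + t • v) v t := by
    simpa using ((hasDerivAt_id t).smul_const v).const_add q
  exact (hG _).hasFDerivAt.comp_hasDerivAt t h1

theorem hasDerivAt_line_two (hF : ContDiff ℝ ∞ F) (q v : Cn n × Cn n) (t : ℝ) :
    HasDerivAt (fun t : ℝ => (fderiv ℝ F (q + t • v) v).re)
      (fderiv ℝ (fderiv ℝ F) (q + t • v) v v).re t := by
  have h1 : Differentiable ℝ (fderiv ℝ F) :=
    (hF.fderiv_right (m := 1) (by norm_cast)).differentiable (by simp)
  have h2 := (hasDerivAt_line h1 q v t).clm_apply (hasDerivAt_const t v)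
  simp only [map_zero, add_zero] at h2
  exact Complex.reCLM.hasFDerivAt.comp_hasDerivAt t h2

theorem hasDerivAt_line_re (hF : ContDiff ℝ ∞ F) (q v : Cn n × Cn n) (t : ℝ) :
    HasDerivAt (fun t : ℝ => (F (q + t • v)).re) (fderiv ℝ F (q + t • v) v).re t :=
  Complex.reCLM.hasFDerivAt.comp_hasDerivAt t (hasDerivAt_line (hF.differentiable (by simp)) q v t)

/-- With midpoint a and half difference h, consider 2 Re F(a+th, a-th) - Re F(a+th, a+th) - Re
F(a-th, a-th). It vanishes to first order at t = 0, and its second derivative at the origin is -8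
times the Levi form in h, hence at most -4c|h|² nearby. -/
theorem IsPolarizedWeight.exists_phase_bound (hF : IsPolarizedWeight R F) :
    ∃ δ : ℝ, 0 < δ ∧ ∃ r₁ : ℝ, 0 < r₁ ∧ r₁ < R ∧ ∀ x ∈ Metric.ball (0 : Cn n) r₁,
      ∀ y ∈ Metric.ball (0 : Cn n) r₁,
        2 * (F (x, y)).re ≤ (F (x, x)).re + (F (y, y)).re - δ * ‖y - x‖ ^ 2 := by
  obtain ⟨c, hc, hH⟩ := exists_pos_lower_bound hF.posDef
  set B := fderiv ℝ (fderiv ℝ F) with hB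
  have hBc : Continuous B := ((hF.smooth.fderiv_right (m := 1) (by norm_cast)).fderiv_right
    (m := 0) (by norm_cast)).continuous
  obtain ⟨ρ, hρ, hball⟩ := (Metric.continuousAt_iff (f := B)).mp (hBc.continuousAt (x := (0, 0))) c hc
  -- The bound -4c|h|² on the second derivative integrates to -2c|h|², which is -(c/2)|y - x|²
  -- because h is half of x - y.
  refine ⟨c / 2, by positivity, min ρ (R / 2), lt_min hρ (by linarith [hF.pos]),
    (min_le_right _ _).trans_lt (by linarith [hF.pos]), fun x hx y hy => ?_⟩
  set a : Cn n := (2⁻¹ : ℝ) • (x + y) with ha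
  set h : Cn n := (2⁻¹ : ℝ) • (x - y) with hh
  have hax : a + h = x := by rw [ha, hh, ← smul_add]; simp [← two_smul ℝ x, smul_smul]
  have hay : a - h = y := by rw [ha, hh, ← smul_sub]; simp [← two_smul ℝ y, smul_smul]
  have hseg : ∀ t ∈ Set.Icc (0 : ℝ) 1, a + t • h ∈ Metric.ball (0 : Cn n) (min ρ (R / 2)) ∧
      a - t • h ∈ Metric.ball (0 : Cn n) (min ρ (R / 2)) := by
    intro t ht
    have e1 : a + t • h = ((1 + t) / 2) • x + ((1 - t) / 2) • y := by
      rw [ha, hh]; module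
    have e2 : a - t • h = ((1 - t) / 2) • x + ((1 + t) / 2) • y := by
      rw [ha, hh]; module
    have t0 := ht.1
    have t1 := ht.2
    exact ⟨e1 ▸ (convex_ball (0 : Cn n) _) hx hy (by linarith) (by linarith) (by ring),
      e2 ▸ (convex_ball (0 : Cn n) _) hx hy (by linarith) (by linarith) (by ring)⟩
  set u : Cn n × Cn n := (h, h) with hu
  set v : Cn n × Cn n := (h, -h) with hv
  set u' : Cn n × Cn n := (-h, -h) with hu'
  set q : Cn n × Cn n := (a, a) with hq
  have hclose : ∀ p : Cn n × Cn n, p ∈ biball n (min ρ (R / 2)) → ∀ z : Cn n × Cn n, ‖z‖ ≤ ‖h‖ →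
      |(B p z z).re - (B (0, 0) z z).re| ≤ c * ‖h‖ ^ 2 := by
    intro p hp z hz
    have h1 : ‖B p - B (0, 0)‖ ≤ c := by
      have h2 : dist p ((0, 0) : Cn n × Cn n) < ρ := by
        rw [Prod.dist_eq]
        exact max_lt ((Metric.mem_ball.mp hp.1).trans_le (min_le_left _ _))
          ((Metric.mem_ball.mp hp.2).trans_le (min_le_left _ _))
      exact (le_of_eq (dist_eq_norm (B p) (B (0, 0))).symm).trans (hball h2).le
    have h3 : (B p z z).re - (B (0, 0) z z).re = ((B p - B (0, 0)) z z).re := by simp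
    rw [h3]
    refine (Complex.abs_re_le_norm _).trans (((B p - B (0, 0)).le_opNorm₂ z z).trans ?_)
    rw [mul_assoc, ← sq]
    gcongr
  have nu : ‖u‖ ≤ ‖h‖ := by simp [hu, Prod.norm_def]
  have nv : ‖v‖ ≤ ‖h‖ := by simp [hv, Prod.norm_def]
  have nu' : ‖u'‖ ≤ ‖h‖ := by simp [hu', Prod.norm_def]
  -- The pure terms cancel between v = (h, -h) and u = (h, h), which leaves four times the mixed
  -- term.
  have hB0 : (B (0, 0) v v).re - (B (0, 0) u u).re ≤ -4 * c * ‖h‖ ^ 2 := by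
    have hsym : IsSymmSndFDerivAt ℝ F (0, 0) :=
      hF.smooth.contDiffAt.isSymmSndFDerivAt (by simp; norm_cast)
    have ev : v = (h, 0) - (0, h) := by simp [hv]
    have eu : u = (h, 0) + (0, h) := by simp [hu]
    have e1 : B (0, 0) v v - B (0, 0) u u = -4 * B (0, 0) (h, 0) (0, h) := by
      rw [ev, eu]
      simp only [map_add, map_sub, add_apply, sub_apply]
      rw [hB, hsym.eq (0, h) (h, 0)]
      ring
    have e2 := hH h
    have e3 := hF.second_fderiv h
    simp only [Matrix.of_apply] at e2
    rw [← e3] at e2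
    have e4 := congrArg Complex.re e1
    have e5 : (-4 * B (0, 0) (h, 0) (0, h)).re = -4 * (B (0, 0) (h, 0) (0, h)).re := by
      rw [← Complex.re_ofReal_mul]; simp
    rw [Complex.sub_re, e5] at e4
    rw [e4]
    linarith
  have hBu : B (0, 0) u' u' = B (0, 0) u u := by
    have : u' = -u := by simp [hu, hu']
    rw [this]; simp
  have key := le_of_second_deriv_le
    (h := fun t => 2 * (F (q + t • v)).re - (F (q + t • u)).re - (F (q + t • u')).re)
    (h' := fun t => 2 * (fderiv ℝ F (q + t • v) v).re - (fderiv ℝ F (q + t • u) u).re -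
      (fderiv ℝ F (q + t • u') u').re)
    (h'' := fun t => 2 * (B (q + t • v) v v).re - (B (q + t • u) u u).re -
      (B (q + t • u') u' u').re)
    (A := -4 * c * ‖h‖ ^ 2)
    (fun t => (((hasDerivAt_line_re hF.smooth q v t).const_mul 2).sub
      (hasDerivAt_line_re hF.smooth q u t)).sub (hasDerivAt_line_re hF.smooth q u' t))
    (fun t => (((hasDerivAt_line_two hF.smooth q v t).const_mul 2).sub
      (hasDerivAt_line_two hF.smooth q u t)).sub (hasDerivAt_line_two hF.smooth q u' t)) ?_
  · have haR : a ∈ Metric.ball (0 : Cn n) R := by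
      have := (hseg 0 ⟨le_rfl, zero_le_one⟩).1
      rw [zero_smul, add_zero] at this
      exact Metric.ball_subset_ball ((min_le_right _ _).trans (by linarith [hF.pos])) this
    have hd := hF.fderiv_diag haR h
    have e1 : q + (1 : ℝ) • v = (x, y) := by
      simp [hq, hv, hax, ← sub_eq_add_neg, hay]
    have e2 : q + (1 : ℝ) • u = (x, x) := by simp [hq, hu, hax]
    have e3 : q + (1 : ℝ) • u' = (y, y) := by simp [hq, hu', ← sub_eq_add_neg, hay]
    have e4 : (fderiv ℝ F q v).re = 0 := by
      have ev : v = (h, 0) - (0, h) := by simp [hv]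
      rw [ev, map_sub, Complex.sub_re, hq, hd, sub_self]
    have e5 : fderiv ℝ F q u' = - fderiv ℝ F q u := by
      have : u' = -u := by simp [hu, hu']
      rw [this, map_neg]
    have e6 : ‖h‖ ^ 2 = ‖y - x‖ ^ 2 / 4 := by
      rw [hh, norm_smul, norm_sub_rev]; norm_num; ring
    simp only [e1, e2, e3, zero_smul, add_zero, e4, e5, Complex.neg_re] at key
    rw [e6] at key
    linarith
  · intro t ht
    obtain ⟨s1, s2⟩ := hseg t ht
    have m1 : q + t • v ∈ biball n (min ρ (R / 2)) := by
      refine ⟨by simpa [hq, hv] using s1, ?_⟩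
      have : (q + t • v).2 = a - t • h := by simp [hq, hv, sub_eq_add_neg]
      rw [this]; exact s2
    have m2 : q + t • u ∈ biball n (min ρ (R / 2)) := by
      exact ⟨by simpa [hq, hu] using s1, by simpa [hq, hu] using s1⟩
    have m3 : q + t • u' ∈ biball n (min ρ (R / 2)) := by
      have : q + t • u' = (a - t • h, a - t • h) := by simp [hq, hu', sub_eq_add_neg]
      rw [this]; exact ⟨s2, s2⟩
    have b1 := abs_le.mp (hclose _ m1 v nv)
    have b2 := abs_le.mp (hclose _ m2 u nu)
    have b3 := abs_le.mp (hclose _ m3 u' nu')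
    rw [hBu] at b3
    linarith [b1.2, b2.1, b3.1]

/-- Second order Taylor expansion of y ↦ F(y, y), where `fderiv_diag` merges the two first
derivatives into twice the one in x. It is used to choose a model phase compatible with the weight.
-/
theorem IsPolarizedWeight.exists_linear_bound (hF : IsPolarizedWeight R F) (hr : r < R) :
    ∃ C : ℝ, 0 ≤ C ∧ ∀ x ∈ Metric.ball (0 : Cn n) r, ∀ y ∈ Metric.ball (0 : Cn n) r,
      (F (y, y)).re ≤ (F (x, x)).re + 2 * (fderiv ℝ F (x, x) (y - x, 0)).re + C * ‖y - x‖ ^ 2 := by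
  have hBc : Continuous (fderiv ℝ (fderiv ℝ F)) :=
    ((hF.smooth.fderiv_right (m := 1) (by norm_cast)).fderiv_right (m := 0) (by norm_cast)).continuous
  obtain ⟨C, hC, hb⟩ := exists_bound_biball (h := fderiv ℝ (fderiv ℝ F)) hr hBc.continuousOn
  refine ⟨C / 2, by positivity, fun x hx y hy => ?_⟩
  set w := y - x with hw
  have key := le_of_second_deriv_le (A := C * ‖w‖ ^ 2)
    (hasDerivAt_line_re hF.smooth (x, x) (w, w)) (hasDerivAt_line_two hF.smooth (x, x) (w, w)) ?_
  · have e1 : ((x, x) : Cn n × Cn n) + (1 : ℝ) • (w, w) = (y, y) := by simp [hw]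
    have e2 : ((w, w) : Cn n × Cn n) = (w, 0) + (0, w) := by simp
    have hd := hF.fderiv_diag (Metric.ball_subset_ball hr.le hx) w
    rw [e1, zero_smul, add_zero] at key
    rw [e2, map_add, Complex.add_re, ← hd] at key
    linarith
  · intro t ht
    have hm : x + t • w ∈ Metric.ball (0 : Cn n) r := by
      have : x + t • w = (1 - t) • x + t • y := by rw [hw]; module
      rw [this]
      exact (convex_ball (0 : Cn n) r) hx hy (by linarith [ht.2]) ht.1 (by ring)
    refine (Complex.re_le_norm _).trans ((ContinuousLinearMap.le_opNorm₂ _ _ _).trans ?_)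
    have hn : ‖((w, w) : Cn n × Cn n)‖ = ‖w‖ := by simp [Prod.norm_def]
    rw [hn, mul_assoc, ← sq]
    gcongr
    refine hb _ ?_
    simpa [biball] using hm

end Phase

/-! ### Flat factors against the gaussian are negligible. -/

section AlmostHolomorphicKernel

variable {n : ℕ} {F f g : Cn n × Cn n → ℂ} {R r : ℝ}

/-- This is s^a/a! ≤ e^s at s = kδt. Applied with t = |y - x|², it converts vanishing on the
diagonal into powers of 1/k. -/
theorem exists_pow_mul_exp_le {δ : ℝ} (hδ : 0 < δ) (a : ℕ) :
    ∃ C : ℝ, 0 ≤ C ∧ ∀ k : ℕ, 1 ≤ k → ∀ t : ℝ, 0 ≤ t →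
      t ^ a * Real.exp (-(k * (δ * t))) ≤ C / (k : ℝ) ^ a := by
  refine ⟨a.factorial / δ ^ a, by positivity, fun k hk t ht => ?_⟩
  have hk0 : (0 : ℝ) < k := by exact_mod_cast hk
  have h1 := Real.pow_div_factorial_le_exp (x := k * (δ * t)) (by positivity) a
  rw [Real.exp_neg, div_div, ← div_eq_mul_inv, div_le_div_iff₀ (Real.exp_pos _) (by positivity)]
  rw [div_le_iff₀ (by positivity)] at h1
  calc t ^ a * (δ ^ a * k ^ a) = (k * (δ * t)) ^ a := by ring
    _ ≤ _ := h1
    _ = _ := by ring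

theorem norm_iteratedFDeriv_cexp_le (i : ℕ) (z : ℂ) :
    ‖iteratedFDeriv ℝ i Complex.exp z‖ ≤ ‖Complex.exp z‖ := by
  induction i with
  | zero => simp
  | succ i ih =>
    let Λ : ℂ →L[ℝ] ℂ →L[ℝ] ℂ := ContinuousLinearMap.mul ℝ ℂ
    have h1 : fderiv ℝ Complex.exp = Λ ∘ Complex.exp := by
      funext w
      have h2 : HasFDerivAt Complex.exp _ w := (Complex.hasDerivAt_exp w).hasFDerivAt.restrictScalars ℝ
      rw [h2.fderiv]
      ext
      simp [Λ, mul_comm]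
    have hs : ContDiff ℝ ∞ Complex.exp := Complex.contDiff_exp
    rw [← norm_iteratedFDeriv_fderiv, h1]
    refine (Λ.norm_iteratedFDeriv_comp_left hs.contDiffAt (n := i)
      (by norm_cast; exact le_top)).trans ?_
    calc _ ≤ 1 * ‖iteratedFDeriv ℝ i Complex.exp z‖ := by
          gcongr; exact ContinuousLinearMap.opNorm_mul_le ℝ ℂ
      _ ≤ _ := by rw [one_mul]; exact ih

/-- All derivatives of `h k` are `O(k^{-∞} e^{k(φ(x) + φ(y))/2})` on `biball n r`, where
`φ(y) = F(y, y)`. -/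
structure IsNegligible (F : Cn n × Cn n → ℂ) (r : ℝ) (h : ℕ → Cn n × Cn n → ℂ) : Prop where
  smooth : ∀ k, ContDiffOn ℝ ∞ (h k) (biball n r)
  bound : ∀ l M : ℕ, ∃ C : ℝ, ∀ k : ℕ, 1 ≤ k → ∀ x ∈ Metric.ball (0 : Cn n) r,
    ∀ y ∈ Metric.ball (0 : Cn n) r,
      Real.exp (-(k * ((F (x, x)).re / 2 + (F (y, y)).re / 2))) * ‖iteratedFDeriv ℝ l (h k) (x, y)‖ ≤
        C / (k : ℝ) ^ M

theorem isNegligible_zero : IsNegligible F r (fun _ _ => 0) := by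
  refine ⟨fun _ => contDiffOn_const, fun l M => ⟨0, fun k _ x _ y _ => ?_⟩⟩
  have := iteratedFDeriv_fun_zero (𝕜 := ℝ) (E := Cn n × Cn n) (F := ℂ) (n := l)
  rw [this]; simp

theorem IsNegligible.add {h₁ h₂ : ℕ → Cn n × Cn n → ℂ} (H₁ : IsNegligible F r h₁)
    (H₂ : IsNegligible F r h₂) : IsNegligible F r (fun k p => h₁ k p + h₂ k p) := by
  refine ⟨fun k => (H₁.smooth k).add (H₂.smooth k), fun l M => ?_⟩
  obtain ⟨C₁, hC₁⟩ := H₁.bound l M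
  obtain ⟨C₂, hC₂⟩ := H₂.bound l M
  refine ⟨C₁ + C₂, fun k hk x hx y hy => ?_⟩
  have hp : ((x, y) : Cn n × Cn n) ∈ biball n r := ⟨hx, hy⟩
  have hl : ((l : ℕ∞) : ℕ∞ω) ≤ ∞ := by norm_cast; exact le_top
  have e := iteratedFDeriv_add_apply (𝕜 := ℝ) (i := l)
    (((H₁.smooth k).contDiffAt (isOpen_biball.mem_nhds hp)).of_le hl)
    (((H₂.smooth k).contDiffAt (isOpen_biball.mem_nhds hp)).of_le hl)
  change _ * ‖iteratedFDeriv ℝ l (h₁ k + h₂ k) (x, y)‖ ≤ _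
  rw [e, add_div]
  refine (mul_le_mul_of_nonneg_left (norm_add_le _ _) (Real.exp_pos _).le).trans ?_
  rw [mul_add]
  exact add_le_add (hC₁ k hk x hx y hy) (hC₂ k hk x hx y hy)

/-- The order M is arbitrary, so a factor of size k^q is absorbed by using M + q. -/
theorem IsNegligible.const_mul {h : ℕ → Cn n × Cn n → ℂ} (H : IsNegligible F r h) {c : ℕ → ℂ}
    {A : ℝ} {q : ℕ} (hc : ∀ k : ℕ, 1 ≤ k → ‖c k‖ ≤ A * (k : ℝ) ^ q) :
    IsNegligible F r (fun k p => c k * h k p) := by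
  refine ⟨fun k => contDiffOn_const.mul (H.smooth k), fun l M => ?_⟩
  obtain ⟨C, hC⟩ := H.bound l (M + q)
  refine ⟨A * C, fun k hk x hx y hy => ?_⟩
  have hp : ((x, y) : Cn n × Cn n) ∈ biball n r := ⟨hx, hy⟩
  have hk0 : (0 : ℝ) < k := by exact_mod_cast hk
  have hl : ((l : ℕ∞) : ℕ∞ω) ≤ ∞ := by norm_cast; exact le_top
  have e := iteratedFDeriv_const_smul_apply (𝕜 := ℝ) (i := l) (a := c k)
    (((H.smooth k).contDiffAt (isOpen_biball.mem_nhds hp)).of_le hl)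
  change _ * ‖iteratedFDeriv ℝ l (c k • h k) (x, y)‖ ≤ _
  rw [e, norm_smul]
  have h1 := hC k hk x hx y hy
  calc _ = ‖c k‖ * (Real.exp (-(k * ((F (x, x)).re / 2 + (F (y, y)).re / 2))) *
        ‖iteratedFDeriv ℝ l (h k) (x, y)‖) := by ring
    _ ≤ (A * k ^ q) * (C / (k : ℝ) ^ (M + q)) := by
        refine mul_le_mul (hc k hk) h1 (by positivity) ((norm_nonneg _).trans (hc k hk))
    _ = _ := by rw [pow_add]; field_simp

theorem IsNegligible.sum {ι : Type*} (u : Finset ι) {h : ι → ℕ → Cn n × Cn n → ℂ}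
    (H : ∀ i ∈ u, IsNegligible F r (h i)) : IsNegligible F r (fun k p => ∑ i ∈ u, h i k p) := by
  classical
  induction u using Finset.induction_on with
  | empty => simpa using isNegligible_zero
  | insert a u ha ih =>
    simp only [Finset.sum_insert ha]
    exact (H a (Finset.mem_insert_self a u)).add
      (ih fun i hi => H i (Finset.mem_insert_of_mem hi))

/-- In the Leibniz formula, derivatives of the exponential cost at most k^l, while the flat factor
supplies any power of |y - x|, which the gaussian from the phase bound turns into powers of 1/k. -/
theorem FlatOn.isNegligible (hf : FlatOn R f) (hF : ContDiff ℝ ∞ F) (hr : r < R) {δ : ℝ}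
    (hδ : 0 < δ) (hph : ∀ x ∈ Metric.ball (0 : Cn n) r, ∀ y ∈ Metric.ball (0 : Cn n) r,
        2 * (F (x, y)).re ≤ (F (x, x)).re + (F (y, y)).re - δ * ‖y - x‖ ^ 2) :
    IsNegligible F r (fun k p => Complex.exp (k * F p) * f p) := by
  have hex : ∀ k : ℕ, ContDiff ℝ ∞ (fun p => Complex.exp (k * F p)) := fun k =>
    (contDiff_const.mul hF).cexp
  have hfr : FlatOn r f := hf.mono hr.le
  refine ⟨fun k => (hex k).contDiffOn.mul hfr.smooth, fun l M => ?_⟩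
  obtain ⟨A, hA1, hA⟩ : ∃ A : ℝ, 1 ≤ A ∧ ∀ i ≤ l, ∀ p ∈ biball n r, ‖iteratedFDeriv ℝ i F p‖ ≤ A := by
    choose A hA0 hA using fun i => exists_bound_biball hr
      ((continuousOn_iteratedFDeriv_biball (R := R) hF.contDiffOn i))
    refine ⟨1 + ∑ i ∈ Finset.range (l + 1), A i, ?_, fun i hi p hp => ?_⟩
    · linarith [Finset.sum_nonneg fun i (_ : i ∈ Finset.range (l + 1)) => hA0 i]
    · have := Finset.single_le_sum (fun i _ => hA0 i) (Finset.mem_range_succ_iff.mpr hi)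
      linarith [hA i p hp]
  -- Of the M + l factors |y - x|², l pay for the differentiated exponential and M give the decay.
  choose B hB0 hB using hf.exists_bound hr (2 * (M + l))
  obtain ⟨D, hD0, hD⟩ := exists_pow_mul_exp_le (half_pos hδ) (M + l)
  refine ⟨∑ i ∈ Finset.range (l + 1), (l.choose i) * (i.factorial * A ^ i) * B (l - i) * D,
    fun k hk x hx y hy => ?_⟩
  have hp : ((x, y) : Cn n × Cn n) ∈ biball n r := ⟨hx, hy⟩
  have hk1 : (1 : ℝ) ≤ k := by exact_mod_cast hk
  have hk0 : (0 : ℝ) < k := by linarith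
  -- Allows kA to be replaced by (kA)^j, the geometric form needed in the bound for derivatives of a
  -- composition.
  have hkA : 1 ≤ k * A := by nlinarith
  have hl : ((l : ℕ∞) : ℕ∞ω) ≤ ∞ := by norm_cast; exact le_top
  have h1 := norm_iteratedFDerivWithin_mul_le (hex k).contDiffOn hfr.smooth
    isOpen_biball.uniqueDiffOn hp (n := l) hl
  rw [iteratedFDerivWithin_of_isOpen l isOpen_biball hp] at h1
  have hkF : ∀ i, ‖iteratedFDeriv ℝ i (fun p => (k : ℂ) * F p) (x, y)‖ =
      k * ‖iteratedFDeriv ℝ i F (x, y)‖ := by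
    intro i
    have e := iteratedFDeriv_const_smul_apply (𝕜 := ℝ) (i := i) (a := (k : ℂ))
      ((hF.contDiffAt (x := (x, y))).of_le (m := i) (by norm_cast; exact le_top))
    change ‖iteratedFDeriv ℝ i ((k : ℂ) • F) (x, y)‖ = _
    rw [e, norm_smul]; simp
  have h2 : ∀ i ≤ l, ‖iteratedFDeriv ℝ i (fun p => Complex.exp (k * F p)) (x, y)‖ ≤
      i.factorial * Real.exp (k * (F (x, y)).re) * (k * A) ^ i := by
    intro i hi
    refine norm_iteratedFDeriv_comp_le (g := Complex.exp) (f := fun p => (k : ℂ) * F p) (N := ∞)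
      Complex.contDiff_exp (contDiff_const.mul hF) (by norm_cast; exact le_top) (x, y) ?_ ?_
    · intro j _
      refine (norm_iteratedFDeriv_cexp_le j _).trans (le_of_eq ?_)
      rw [Complex.norm_exp]; simp
    · intro j hj1 hj
      rw [hkF]
      calc (k : ℝ) * ‖iteratedFDeriv ℝ j F (x, y)‖ ≤ k * A := by
            gcongr; exact hA j (hj.trans hi) _ hp
        _ ≤ (k * A) ^ j := le_self_pow₀ hkA (by omega)
  have h3 : Real.exp (-(k * ((F (x, x)).re / 2 + (F (y, y)).re / 2))) *
      Real.exp (k * (F (x, y)).re) ≤ Real.exp (-(k * (δ / 2 * ‖y - x‖ ^ 2))) := by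
    rw [← Real.exp_add]
    refine Real.exp_le_exp.mpr ?_
    have := mul_le_mul_of_nonneg_left (hph x hx y hy) hk0.le
    linarith
  have h4 := hD k hk (‖y - x‖ ^ 2) (by positivity)
  refine (mul_le_mul_of_nonneg_left h1 (Real.exp_pos _).le).trans ?_
  rw [Finset.mul_sum, Finset.sum_div]
  refine Finset.sum_le_sum fun i hi => ?_
  have hil : i ≤ l := Finset.mem_range_succ_iff.mp hi
  rw [iteratedFDerivWithin_of_isOpen i isOpen_biball hp,
    iteratedFDerivWithin_of_isOpen (l - i) isOpen_biball hp]
  have h5 := hB (l - i) x hx y hy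
  have h6 := hB0 (l - i)
  have hpow : (k : ℝ) ^ i ≤ k ^ l := pow_le_pow_right₀ hk1 hil
  calc _ ≤ Real.exp (-(k * ((F (x, x)).re / 2 + (F (y, y)).re / 2))) * ((l.choose i) *
        (i.factorial * Real.exp (k * (F (x, y)).re) * (k * A) ^ i) *
        (B (l - i) * ‖y - x‖ ^ (2 * (M + l)))) := by
        gcongr
        exact h2 i hil
    _ = (l.choose i) * (i.factorial * A ^ i) * B (l - i) * (k ^ i * ((‖y - x‖ ^ 2) ^ (M + l) *
        (Real.exp (-(k * ((F (x, x)).re / 2 + (F (y, y)).re / 2))) *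
          Real.exp (k * (F (x, y)).re)))) := by
        rw [pow_mul, mul_pow]; ring
    _ ≤ (l.choose i) * (i.factorial * A ^ i) * B (l - i) * (k ^ l * ((‖y - x‖ ^ 2) ^ (M + l) *
        Real.exp (-(k * (δ / 2 * ‖y - x‖ ^ 2))))) := by gcongr
    _ ≤ (l.choose i) * (i.factorial * A ^ i) * B (l - i) * (k ^ l * (D / (k : ℝ) ^ (M + l))) := by
        gcongr
    _ = _ := by rw [pow_add]; field_simp

/-- The property is stable under sums and products, and holds for the jet variables because mixed
derivatives commute with Wirtinger operators. For the inverse determinant it follows from the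
determinant by the rule for 1/f. -/
theorem flatOn_wirt_jetVal (hF : ContDiff ℝ ∞ F) (hdet : ∀ p ∈ biball n R, mixedHessianDet F p ≠ 0)
    {s : ℂ} {v : Cn n × Cn n} (h : FlatOn R (wirt s v F)) (P : JetPolynomial n) :
    FlatOn R (wirt s v fun p => jetVal F p P) := by
  have hs : ∀ P : JetPolynomial n, ContDiffOn ℝ ∞ (fun p => jetVal F p P) (biball n R) := fun P p hp =>
    (contDiffAt_jetVal hF (hdet p hp) P).contDiffWithinAt
  have hd : ∀ (P : JetPolynomial n), ∀ p ∈ biball n R, DifferentiableAt ℝ (fun p => jetVal F p P) p :=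
    fun P p hp => (contDiffAt_jetVal hF (hdet p hp) P).differentiableAt (by simp)
  have hC : ∀ c : ℂ, FlatOn R (wirt s v fun p => jetVal F p (MvPolynomial.C c)) := fun c => by
    refine flatOn_zero.congr fun p _ => ?_
    simp only [jetVal_C, wirt_const]
  have hadd : ∀ P Q : JetPolynomial n, FlatOn R (wirt s v fun p => jetVal F p P) →
      FlatOn R (wirt s v fun p => jetVal F p Q) → FlatOn R (wirt s v fun p => jetVal F p (P + Q)) := by
    intro P Q hP hQ
    refine (hP.add hQ).congr fun p hp => ?_
    simp only [map_add]
    exact wirt_add (hd P p hp) (hd Q p hp)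
  have hmul : ∀ P Q : JetPolynomial n, FlatOn R (wirt s v fun p => jetVal F p P) →
      FlatOn R (wirt s v fun p => jetVal F p Q) → FlatOn R (wirt s v fun p => jetVal F p (P * Q)) := by
    intro P Q hP hQ
    refine ((hP.mul (hs Q)).add (hQ.mul (hs P))).congr fun p hp => ?_
    simp only [map_mul]
    rw [wirt_mul (hd P p hp) (hd Q p hp)]; ring
  have hvar : ∀ α β, FlatOn R (wirt s v fun p => jetVal F p (jetVar α β)) := by
    intro α β
    simp only [jetVal_jetVar]
    have := flatOn_mixedDeriv h α β
    rwa [← wirt_mixedDeriv_comm hF] at this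
  have hprod : ∀ (u : Finset (Fin n)) (G : Fin n → JetPolynomial n),
      (∀ i ∈ u, FlatOn R (wirt s v fun p => jetVal F p (G i))) →
      FlatOn R (wirt s v fun p => jetVal F p (∏ i ∈ u, G i)) := by
    classical
    intro u G
    induction u using Finset.induction_on with
    | empty => intro _; simpa using hC 1
    | insert a u ha ih =>
      intro hG
      rw [Finset.prod_insert ha]
      exact hmul _ _ (hG a (Finset.mem_insert_self a u))
        (ih fun i hi => hG i (Finset.mem_insert_of_mem hi))
  have hhess : FlatOn R (wirt s v fun p => jetVal F p (hessPoly n)) := by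
    rw [hessPoly, Matrix.det_apply]
    have : ∀ u : Finset (Equiv.Perm (Fin n)), FlatOn R (wirt s v fun p => jetVal F p
        (∑ σ ∈ u, Equiv.Perm.sign σ • ∏ i, (Matrix.of fun i j : Fin n =>
          (jetVar (Pi.single i 1) (Pi.single j 1) : JetPolynomial n)) (σ i) i)) := by
      classical
      intro u
      induction u using Finset.induction_on with
      | empty => simpa using hC 0
      | insert a u ha ih =>
        rw [Finset.sum_insert ha]
        refine hadd _ _ ?_ ih
        have e : ∀ Q : JetPolynomial n, Equiv.Perm.sign a • Q =
            MvPolynomial.C ((Equiv.Perm.sign a : ℤ) : ℂ) * Q := by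
          intro Q
          rw [Units.smul_def, zsmul_eq_mul]; simp
        rw [e]
        exact hmul _ _ (hC _) (hprod _ _ fun i _ => hvar _ _)
    exact this _
  induction P using MvPolynomial.induction_on with
  | C c => exact hC c
  | add P Q hP hQ => exact hadd P Q hP hQ
  | mul_X P a hP =>
    refine hmul P _ hP ?_
    rcases a with _ | γ
    · refine (hhess.mul (g := fun p => -((mixedHessianDet F p)⁻¹) ^ 2) ?_).congr fun p hp => ?_
      · exact fun p hp => ((((contDiff_mixedHessianDet hF).contDiffAt.inv (hdet p hp)).pow 2).neg).contDiffWithinAt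
      · simp only [jetVal_none, jetVal_hessPoly hF]
        exact wirt_inv ((contDiff_mixedHessianDet hF).differentiable (by simp) p) (hdet p hp)
    · exact hvar γ.1 γ.2

/-- The asymptotic kernel in terms of `F`. -/
def polarKernel (F : Cn n × Cn n → ℂ) (N k : ℕ) (p : Cn n × Cn n) : ℂ :=
  ((k / Real.pi : ℝ) : ℂ) ^ n * Complex.exp (k * F p) *
    ∑ m ∈ Finset.range (N + 1), jetVal F p (kernelCoeff n m) * ((k : ℂ) ^ m)⁻¹

/-- By the product rule the derivative hits the exponent, at the cost of a factor k, or a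
coefficient b_m; in both cases a flat factor appears. -/
theorem isNegligible_wirt_polarKernel (hF : ContDiff ℝ ∞ F)
    (hdet : ∀ p ∈ biball n R, mixedHessianDet F p ≠ 0)
    {s : ℂ} {v : Cn n × Cn n} (h : FlatOn R (wirt s v F)) (hr : r < R) {δ : ℝ}
    (hδ : 0 < δ) (hph : ∀ x ∈ Metric.ball (0 : Cn n) r, ∀ y ∈ Metric.ball (0 : Cn n) r,
        2 * (F (x, y)).re ≤ (F (x, x)).re + (F (y, y)).re - δ * ‖y - x‖ ^ 2) (N : ℕ) :
    IsNegligible F r (fun k => wirt s v (polarKernel F N k)) := by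
  set b : ℕ → Cn n × Cn n → ℂ := fun m p => jetVal F p (kernelCoeff n m) with hb
  have hbs : ∀ m, ContDiffOn ℝ ∞ (b m) (biball n R) := fun m p hp =>
    (contDiffAt_jetVal hF (hdet p hp) _).contDiffWithinAt
  have h1 : ∀ m, IsNegligible F r (fun k p => Complex.exp (k * F p) * (b m p * wirt s v F p)) :=
    fun m => (h.mul (hbs m)).isNegligible hF hr hδ hph
  have h2 : ∀ m, IsNegligible F r (fun k p => Complex.exp (k * F p) * wirt s v (b m) p) :=
    fun m => (flatOn_wirt_jetVal hF hdet h _).isNegligible hF hr hδ hph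
  have c1 : ∀ m k : ℕ, 1 ≤ k →
      ‖((k / Real.pi : ℝ) : ℂ) ^ n * k * ((k : ℂ) ^ m)⁻¹‖ ≤ 1 * (k : ℝ) ^ (n + 1) := by
    intro m k hk
    have hk1 : (1 : ℝ) ≤ k := by exact_mod_cast hk
    have e1 : (k : ℝ) / Real.pi ≤ k := div_le_self (by linarith) (by linarith [Real.pi_gt_three])
    simp only [norm_mul, norm_pow, norm_inv, Complex.norm_natCast, Complex.norm_real]
    rw [Real.norm_of_nonneg (by positivity), pow_succ, one_mul]
    calc _ ≤ (k : ℝ) ^ n * k * 1 := by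
          gcongr
          exact inv_le_one_of_one_le₀ (one_le_pow₀ hk1)
      _ = _ := mul_one _
  have c2 : ∀ m k : ℕ, 1 ≤ k →
      ‖((k / Real.pi : ℝ) : ℂ) ^ n * ((k : ℂ) ^ m)⁻¹‖ ≤ 1 * (k : ℝ) ^ n := by
    intro m k hk
    have hk1 : (1 : ℝ) ≤ k := by exact_mod_cast hk
    have e1 : (k : ℝ) / Real.pi ≤ k := div_le_self (by linarith) (by linarith [Real.pi_gt_three])
    simp only [norm_mul, norm_pow, norm_inv, Complex.norm_natCast, Complex.norm_real]
    rw [Real.norm_of_nonneg (by positivity), one_mul]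
    calc _ ≤ (k : ℝ) ^ n * 1 := by
          gcongr
          exact inv_le_one_of_one_le₀ (one_le_pow₀ hk1)
      _ = _ := mul_one _
  have hsum := IsNegligible.sum (Finset.range (N + 1)) fun m _ =>
    ((h1 m).const_mul (c1 m)).add ((h2 m).const_mul (c2 m))
  have heq : ∀ k, ∀ p ∈ biball n r, wirt s v (polarKernel F N k) p =
      ∑ m ∈ Finset.range (N + 1),
        (((k / Real.pi : ℝ) : ℂ) ^ n * k * ((k : ℂ) ^ m)⁻¹ *
          (Complex.exp (k * F p) * (b m p * wirt s v F p)) +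
        ((k / Real.pi : ℝ) : ℂ) ^ n * ((k : ℂ) ^ m)⁻¹ *
          (Complex.exp (k * F p) * wirt s v (b m) p)) := by
    intro k p hp
    have hpR : p ∈ biball n R :=
      ⟨Metric.ball_subset_ball hr.le hp.1, Metric.ball_subset_ball hr.le hp.2⟩
    have hFd : DifferentiableAt ℝ F p := hF.differentiable (by simp) p
    have hkF : DifferentiableAt ℝ (fun p => (k : ℂ) * F p) p := hFd.const_mul _
    have hE : DifferentiableAt ℝ (fun p => Complex.exp (k * F p)) p := hkF.cexp
    have hbd : ∀ m, DifferentiableAt ℝ (b m) p := fun m =>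
      ((hbs m).contDiffAt (isOpen_biball.mem_nhds hpR)).differentiableAt (by simp)
    have e : polarKernel F N k = fun p => ∑ m ∈ Finset.range (N + 1),
        (((k / Real.pi : ℝ) : ℂ) ^ n * ((k : ℂ) ^ m)⁻¹) * (Complex.exp (k * F p) * b m p) := by
      funext q
      rw [polarKernel, Finset.mul_sum]
      exact Finset.sum_congr rfl fun m _ => by simp only [hb]; ring
    rw [e, wirt_sum _ fun m _ => (hE.fun_mul (hbd m)).const_mul _]
    refine Finset.sum_congr rfl fun m _ => ?_
    rw [wirt_const_mul _ (hE.fun_mul (hbd m)), wirt_mul hE (hbd m), wirt_cexp hkF,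
      wirt_const_mul _ hFd]
    ring
  refine ⟨fun k => (hsum.smooth k).congr (heq k), fun l M => ?_⟩
  obtain ⟨C, hC⟩ := hsum.bound l M
  refine ⟨C, fun k hk x hx y hy => ?_⟩
  have hp : ((x, y) : Cn n × Cn n) ∈ biball n r := ⟨hx, hy⟩
  have e := (Filter.EventuallyEq.iteratedFDeriv ℝ
    (Filter.eventuallyEq_of_mem (isOpen_biball.mem_nhds hp) (heq k)) l).eq_of_nhds
  rw [e]
  exact hC k hk x hx y hy

end AlmostHolomorphicKernel

/-! ### Derivatives of determinants and the Piola identity. -/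

section Determinants

variable {ι : Type*} [Fintype ι] [DecidableEq ι]

/-- Jacobi's formula, kept in the form where one column at a time is differentiated, since the Piola
identity is read off from columns. -/
theorem exists_hasFDerivAt_det {V : Type*} [NormedAddCommGroup V] [NormedSpace ℝ V]
    {A : V → Matrix ι ι ℂ} {A' : ι → ι → V →L[ℝ] ℂ} {p : V}
    (hA : ∀ i j, HasFDerivAt (fun q => A q i j) (A' i j) p) :
    ∃ f' : V →L[ℝ] ℂ, HasFDerivAt (fun q => (A q).det) f' p ∧
      ∀ v, f' v = ∑ l, ((A p).updateCol l fun i => A' i l v).det := by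
  have h1 : ∀ σ : Equiv.Perm ι, HasFDerivAt (fun q => ∏ i, A q (σ i) i)
      (∑ i, (∏ j ∈ Finset.univ.erase i, A p (σ j) j) • A' (σ i) i) p := fun σ => by
    simpa using HasFDerivAt.finsetProd (u := Finset.univ) (g := fun i q => A q (σ i) i)
      (g' := fun i => A' (σ i) i) (fun i _ => hA (σ i) i)
  refine ⟨∑ σ : Equiv.Perm ι, ((Equiv.Perm.sign σ : ℤ) : ℂ) •
    ∑ i, (∏ j ∈ Finset.univ.erase i, A p (σ j) j) • A' (σ i) i, ?_, fun v => ?_⟩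
  · simp only [Matrix.det_apply']
    exact HasFDerivAt.fun_sum fun σ _ => (h1 σ).const_mul _
  · simp only [Matrix.det_apply', sum_apply, smul_apply, smul_eq_mul]
    rw [Finset.sum_comm]
    refine Finset.sum_congr rfl fun σ _ => ?_
    rw [Finset.mul_sum]
    refine Finset.sum_congr rfl fun l _ => ?_
    rw [← Finset.prod_erase_mul _ _ (Finset.mem_univ l)]
    congr 2
    · refine Finset.prod_congr rfl fun i hi => ?_
      rw [Matrix.updateCol_ne (Finset.ne_of_mem_erase hi)]
    · rw [Matrix.updateCol_self]

theorem wirt_det {V : Type*} [NormedAddCommGroup V] [NormedSpace ℂ V]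
    {A : V → Matrix ι ι ℂ} {p : V} {s : ℂ} {v : V}
    (hA : ∀ i j, DifferentiableAt ℝ (fun q => A q i j) p) :
    wirt s v (fun q => (A q).det) p =
      ∑ l, ((A p).updateCol l fun i => wirt s v (fun q => A q i l) p).det := by
  obtain ⟨f', hf, hf'⟩ := exists_hasFDerivAt_det (fun i j => (hA i j).hasFDerivAt)
  rw [wirt, hf.fderiv, hf', hf', Finset.mul_sum, ← Finset.sum_add_distrib, Finset.sum_div]
  refine Finset.sum_congr rfl fun l _ => ?_
  simp only [← Matrix.cramer_apply]
  have : (fun i => wirt s v (fun q => A q i l) p) = (2⁻¹ : ℂ) •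
      ((fun i => fderiv ℝ (fun q => A q i l) p v) +
        s • fun i => fderiv ℝ (fun q => A q i l) p (Complex.I • v)) := by
    funext i; simp [wirt]; ring
  rw [this, map_smul, map_add, map_smul]
  simp; ring

theorem adjugate_eq_det_updateCol (A : Matrix ι ι ℂ) (i j : ι) :
    A.adjugate j i = (A.updateCol j (Pi.single i 1)).det := by
  rw [← Matrix.cramer_apply, Matrix.cramer_eq_adjugate_mulVec]
  simp

theorem sum_adjugate_mul (A : Matrix ι ι ℂ) (b : ι → ℂ) (j : ι) :
    ∑ i, A.adjugate j i * b i = (A.updateCol j b).det := by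
  rw [← Matrix.cramer_apply, Matrix.cramer_eq_adjugate_mulVec]
  rfl

/-- Expanding column l gives the contraction of the symmetric H with determinants that change sign
when the basis vectors in columns j and l are exchanged. -/
theorem sum_det_updateCol_symm (A : Matrix ι ι ℂ) {H : ι → ι → ℂ} (hH : ∀ i m, H i m = H m i)
    {j l : ι} (hjl : j ≠ l) :
    ∑ i, ((A.updateCol j (Pi.single i 1)).updateCol l (H i)).det = 0 := by
  set B : ι → ι → ℂ := fun i m =>
    ((A.updateCol j (Pi.single i 1)).updateCol l (Pi.single m 1)).det with hB
  have h1 : ∀ i, ((A.updateCol j (Pi.single i 1)).updateCol l (H i)).det =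
      ∑ m, H i m * B i m := fun i => by
    rw [← sum_adjugate_mul]
    refine Finset.sum_congr rfl fun m _ => ?_
    rw [adjugate_eq_det_updateCol, mul_comm]
  have h2 : ∀ i m, B m i = -B i m := fun i m => by
    have : ((A.updateCol j (Pi.single m 1)).updateCol l (Pi.single i 1)) =
        ((A.updateCol j (Pi.single i 1)).updateCol l (Pi.single m 1)).submatrix id
          (Equiv.swap j l) := by
      ext a b
      simp only [Matrix.submatrix_apply, id, Matrix.updateCol_apply]
      by_cases hb : b = l
      · subst hb; simp [hjl]
      · by_cases hb' : b = j
        · subst hb'; simp [hjl]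
        · simp [Equiv.swap_apply_of_ne_of_ne hb' hb, hb, hb']
    simp only [hB]
    rw [this, Matrix.det_permute', Equiv.Perm.sign_swap hjl]
    simp
  simp only [h1]
  have h3 : ∑ i, ∑ m, H i m * B i m = -∑ i, ∑ m, H i m * B i m := by
    conv_lhs => rw [Finset.sum_comm]
    rw [← Finset.sum_neg_distrib]
    refine Finset.sum_congr rfl fun i _ => ?_
    rw [← Finset.sum_neg_distrib]
    refine Finset.sum_congr rfl fun m _ => ?_
    rw [h2, hH]; ring
  linear_combination h3 / 2

/-- The **Piola identity** for Wirtinger derivatives. -/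
theorem sum_wirt_adjugate {V : Type*} [NormedAddCommGroup V] [NormedSpace ℂ V]
    {θ : ι → V → ℂ} {e : ι → V} {s : ℂ} {p : V} (hθ : ∀ j, ContDiffAt ℝ ∞ (θ j) p) (j : ι) :
    ∑ i, wirt s (e i) (fun q => (Matrix.of fun i j => wirt s (e i) (θ j) q).adjugate j i) p
      = 0 := by
  have hd : ∀ i m, DifferentiableAt ℝ (wirt s (e i) (θ m)) p := fun i m =>
    (contDiffAt_wirt (hθ m)).differentiableAt (by simp)
  -- The adjugate entry is a determinant whose column j is a constant basis vector, so only columns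
  -- l ≠ j contribute, each with second derivatives of θ_l, symmetric in the two directions.
  have h1 : ∀ i, wirt s (e i)
      (fun q => (Matrix.of fun i j => wirt s (e i) (θ j) q).adjugate j i) p =
      ∑ l ∈ Finset.univ.erase j, (((Matrix.of fun i j => wirt s (e i) (θ j) p).updateCol j
        (Pi.single i 1)).updateCol l fun m => wirt s (e i) (wirt s (e m) (θ l)) p).det := by
    intro i
    simp only [adjugate_eq_det_updateCol]
    rw [wirt_det]
    · rw [← Finset.sum_erase_add _ _ (Finset.mem_univ j)]
      have : ((Matrix.updateCol (Matrix.of fun i j => wirt s (e i) (θ j) p) j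
          (Pi.single i 1)).updateCol j fun m => wirt s (e i) (fun q =>
            (Matrix.updateCol (Matrix.of fun i j => wirt s (e i) (θ j) q) j
              (Pi.single i (1 : ℂ))) m j) p).det = 0 := by
        apply Matrix.det_eq_zero_of_column_eq_zero j
        intro a
        rw [Matrix.updateCol_self]
        simp only [Matrix.updateCol_self]
        exact wirt_const _
      rw [this, add_zero]
      refine Finset.sum_congr rfl fun l hl => ?_
      simp only [Matrix.updateCol_ne (Finset.ne_of_mem_erase hl), Matrix.of_apply]
    · intro a b
      by_cases hb : b = j
      · subst hb; simp only [Matrix.updateCol_self]; exact differentiableAt_const _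
      · simp only [Matrix.updateCol_ne hb, Matrix.of_apply]; exact hd a b
  simp only [h1]
  rw [Finset.sum_comm]
  refine Finset.sum_eq_zero fun l hl => ?_
  exact sum_det_updateCol_symm _ (fun i m => wirt_comm (hθ l)) (Finset.ne_of_mem_erase hl).symm

theorem contDiffAt_adjugate {V : Type*} [NormedAddCommGroup V] [NormedSpace ℝ V]
    {A : V → Matrix ι ι ℂ} {p : V} (hA : ∀ i j, ContDiffAt ℝ ∞ (fun q => A q i j) p) (i j : ι) :
    ContDiffAt ℝ ∞ (fun q => (A q).adjugate j i) p := by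
  simp only [adjugate_eq_det_updateCol]
  simp only [Matrix.det_apply']
  refine ContDiffAt.sum fun σ _ => contDiffAt_const.mul (contDiffAt_prod fun l _ => ?_)
  by_cases hb : l = j
  · subst hb; simp only [Matrix.updateCol_self]; exact contDiffAt_const
  · simp only [Matrix.updateCol_ne hb]; exact hA _ l

end Determinants

/-! ### The variation of det(∂̄θ) e^{-kθ·w} as a divergence. -/

section Homotopy

variable {n : ℕ}

theorem differentiableAt_coord_sub (x y : Cn n) (j : Fin n) :
    DifferentiableAt ℂ (fun z : Cn n => z j - x j) y :=
  ((EuclideanSpace.proj j : Cn n →L[ℂ] ℂ).differentiableAt).sub_const _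

theorem contDiffAt_coord_sub (x y : Cn n) (j : Fin n) :
    ContDiffAt ℝ ∞ (fun z : Cn n => z j - x j) y := by
  have : ContDiff ℝ ∞ (fun z : Cn n => z j) :=
    ((EuclideanSpace.proj j : Cn n →L[ℂ] ℂ).restrictScalars ℝ).contDiff
  exact (this.sub contDiff_const).contDiffAt

theorem delBar_sum_mul_coord {θ : Fin n → Cn n → ℂ} {x y v : Cn n}
    (hθ : ∀ j, ContDiffAt ℝ ∞ (θ j) y) :
    delBar v (fun z => ∑ j, θ j z * (z j - x j)) y = ∑ j, delBar v (θ j) y * (y j - x j) := by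
  have hd := fun j => (hθ j).differentiableAt (n := ∞) (by simp)
  have hw := fun j => (contDiffAt_coord_sub x y j).differentiableAt (n := ∞) (by simp)
  rw [delBar_eq_wirt, wirt_sum _ fun j _ => (hd j).fun_mul (hw j)]
  refine Finset.sum_congr rfl fun j _ => ?_
  rw [wirt_mul (hd j) (hw j), ← delBar_eq_wirt, delBar_holomorphic (differentiableAt_coord_sub x y j),
    mul_zero, add_zero]

/-- The variation of `det (∂̄θ) e^{-kθ·w}` with `θ` is a `∂̄`-divergence. -/
theorem hasDerivAt_det_mul_exp {θ τ : Fin n → Cn n → ℂ} {x y : Cn n} (k : ℂ) (t : ℝ)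
    (hθ : ∀ j, ContDiffAt ℝ ∞ (θ j) y) (hτ : ∀ j, ContDiffAt ℝ ∞ (τ j) y) :
    HasDerivAt (fun t : ℝ => (Matrix.of fun i j =>
        delBar (coordVec i) (fun z => θ j z + t * τ j z) y).det *
          Complex.exp (-(k * ∑ j, (θ j y + t * τ j y) * (y j - x j))))
      (∑ i, delBar (coordVec i) (fun z => (∑ j, (Matrix.of fun i j =>
        delBar (coordVec i) (fun z => θ j z + t * τ j z) z).adjugate j i * τ j z) *
          Complex.exp (-(k * ∑ j, (θ j z + t * τ j z) * (z j - x j)))) y) t := by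
  set Θ : Fin n → Cn n → ℂ := fun j z => θ j z + t * τ j z with hΘdef
  have hΘ : ∀ j, ContDiffAt ℝ ∞ (Θ j) y := fun j => (hθ j).add (contDiffAt_const.mul (hτ j))
  set N : Cn n → Matrix (Fin n) (Fin n) ℂ := fun z =>
    Matrix.of fun i j => delBar (coordVec i) (Θ j) z with hN
  have hw := fun j => contDiffAt_coord_sub x y j
  have hlin : ∀ (i j : Fin n) (t : ℝ), delBar (coordVec i) (fun z => θ j z + t * τ j z) y =
      delBar (coordVec i) (θ j) y + t * delBar (coordVec i) (τ j) y := fun i j t => by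
    have h1 := (hθ j).differentiableAt (n := ∞) (by simp)
    have h2 := (hτ j).differentiableAt (n := ∞) (by simp)
    rw [delBar_eq_wirt, wirt_add h1 (h2.const_mul _), wirt_const_mul _ h2]
  have hof : HasDerivAt (fun t : ℝ => (t : ℂ)) 1 t := Complex.ofRealCLM.hasDerivAt
  have hdet : HasDerivAt (fun t : ℝ => (Matrix.of fun i j =>
        delBar (coordVec i) (fun z => θ j z + t * τ j z) y).det)
      (∑ j, ∑ i, (N y).adjugate j i * delBar (coordVec i) (τ j) y) t := by
    have h1 : ∀ i j : Fin n, HasFDerivAt (fun t : ℝ => (Matrix.of fun i j =>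
        delBar (coordVec i) (fun z => θ j z + t * τ j z) y) i j)
        (ContinuousLinearMap.toSpanSingleton ℝ (delBar (coordVec i) (τ j) y)) t := fun i j => by
      simp only [Matrix.of_apply, hlin]
      have := (hof.mul_const (delBar (coordVec i) (τ j) y)).const_add (delBar (coordVec i) (θ j) y)
      rw [one_mul] at this
      exact this.hasFDerivAt
    obtain ⟨f', h2, h3⟩ := exists_hasFDerivAt_det h1
    have h4 := h2.hasDerivAt
    rw [h3] at h4
    convert h4 using 2 with j
    rw [sum_adjugate_mul]
    simp [hN, hΘdef]
  have hexp : HasDerivAt (fun t : ℝ =>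
      Complex.exp (-(k * ∑ j, (θ j y + t * τ j y) * (y j - x j))))
      (Complex.exp (-(k * ∑ j, Θ j y * (y j - x j))) *
        (-(k * ∑ j, τ j y * (y j - x j)))) t := by
    refine HasDerivAt.cexp (HasDerivAt.neg (HasDerivAt.const_mul _ (HasDerivAt.fun_sum
      fun j _ => ?_)))
    have := ((hof.mul_const (τ j y)).const_add (θ j y)).mul_const (y j - x j)
    rwa [one_mul] at this
  refine (hdet.mul hexp).congr_deriv ?_
  change _ = ∑ i, delBar (coordVec i) (fun z => (∑ j, (N z).adjugate j i * τ j z) *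
          Complex.exp (-(k * ∑ j, Θ j z * (z j - x j)))) y
  have hadj : ∀ i j, ContDiffAt ℝ ∞ (fun z => (N z).adjugate j i) y := fun i j =>
    contDiffAt_adjugate (fun i j => contDiffAt_wirt (hΘ j)) i j
  have hS : DifferentiableAt ℝ (fun z => ∑ j, Θ j z * (z j - x j)) y :=
    (ContDiffAt.sum fun j _ => (hΘ j).mul (hw j)).differentiableAt (n := ∞) (by simp)
  have hE : DifferentiableAt ℝ (fun z => -(k * ∑ j, Θ j z * (z j - x j))) y :=
    (hS.const_mul k).fun_neg
  set E := Complex.exp (-(k * ∑ j, Θ j y * (y j - x j))) with hEdef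
  have hd := fun i j => (hadj i j).differentiableAt (n := ∞) (by simp)
  have hd' := fun j => (hτ j).differentiableAt (n := ∞) (by simp)
  have hterm : ∀ i, delBar (coordVec i) (fun z => (∑ j, (N z).adjugate j i * τ j z) *
          Complex.exp (-(k * ∑ j, Θ j z * (z j - x j)))) y =
      (∑ j, (delBar (coordVec i) (fun z => (N z).adjugate j i) y * τ j y +
        (N y).adjugate j i * delBar (coordVec i) (τ j) y)) * E +
      (∑ j, (N y).adjugate j i * τ j y) * (E * (-k * ∑ l, N y i l * (y l - x l))) := fun i => by
    have h1 : wirt Complex.I (coordVec i) (fun z => -(k * ∑ j, Θ j z * (z j - x j))) y =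
        -k * ∑ l, N y i l * (y l - x l) := by
      have h0 : (fun z : Cn n => -(k * ∑ j, Θ j z * (z j - x j))) =
          fun z => (-k) * ∑ j, Θ j z * (z j - x j) := by funext z; ring
      rw [h0, wirt_const_mul _ hS, ← delBar_eq_wirt, delBar_sum_mul_coord hΘ]; rfl
    rw [delBar_eq_wirt, wirt_mul (DifferentiableAt.fun_sum fun j _ => (hd i j).fun_mul (hd' j))
      hE.cexp, wirt_cexp hE, h1, wirt_sum _ fun j _ => (hd i j).fun_mul (hd' j)]
    simp only [wirt_mul (hd i _) (hd' _)]
    rfl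
  simp only [hterm, Finset.sum_add_distrib, add_mul]
  -- The terms in which the adjugate is differentiated vanish by the Piola identity.
  have hP : ∑ i, (∑ j, delBar (coordVec i) (fun z => (N z).adjugate j i) y * τ j y) * E = 0 := by
    rw [← Finset.sum_mul, Finset.sum_comm]
    simp only [← Finset.sum_mul]
    have : ∀ j, ∑ i, delBar (coordVec i) (fun z => (N z).adjugate j i) y = 0 := fun j =>
      sum_wirt_adjugate hΘ j
    simp [this]
  -- The adjugate times ∂̄θ is the determinant, so differentiating the exponential in space
  -- reproduces exactly its derivative in t.
  have hQ : ∑ i, (∑ j, (N y).adjugate j i * τ j y) * (E * (-k * ∑ l, N y i l * (y l - x l))) =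
      (N y).det * (E * -(k * ∑ j, τ j y * (y j - x j))) := by
    have h1 : ∀ j l, ∑ i, (N y).adjugate j i * N y i l = if j = l then (N y).det else 0 :=
      fun j l => by
        have := congrFun (congrFun (Matrix.adjugate_mul (N y)) j) l
        rw [Matrix.mul_apply] at this
        rw [this]; simp [Matrix.one_apply]
    calc _ = -(E * k) * ∑ j, τ j y * ∑ l, (y l - x l) * ∑ i, (N y).adjugate j i * N y i l := by
          simp only [Finset.mul_sum, Finset.sum_mul]
          rw [Finset.sum_comm]
          conv_rhs => rw [Finset.sum_comm]
          refine Finset.sum_congr rfl fun l _ => ?_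
          rw [Finset.sum_comm]
          refine Finset.sum_congr rfl fun j _ => Finset.sum_congr rfl fun i _ => ?_
          ring
      _ = _ := by
          simp only [h1]
          simp only [mul_ite, mul_zero, Finset.sum_ite_eq, Finset.mem_univ, if_true]
          simp only [Finset.mul_sum, ← Finset.sum_neg_distrib]
          refine Finset.sum_congr rfl fun j _ => ?_
          ring
  rw [hP, hQ, zero_add]
  congr 1
  rw [← Finset.sum_mul, Finset.sum_comm]

end Homotopy

/-! ### Integrals of holomorphic functions: orthogonality, mean values, parameters. -/

section HolomorphicIntegrals

open MeasureTheory

variable {n : ℕ} {r : ℝ} {u : Cn n → ℂ}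

/-- Cauchy's estimate on discs in the complex direction v, which stay in a compact thickening of K.
It serves only to justify integrability in the integration by parts. -/
theorem exists_bound_fderiv_of_holomorphic (hu : DifferentiableOn ℂ u (Metric.ball 0 r))
    {K : Set (Cn n)} (hK : IsCompact K) (hKr : K ⊆ Metric.ball 0 r) (v : Cn n) :
    ∃ C : ℝ, ∀ p ∈ K, ‖fderiv ℝ u p v‖ ≤ C := by
  obtain ⟨δ, hδ, hsub⟩ := hK.exists_cthickening_subset_open Metric.isOpen_ball hKr
  obtain ⟨C, hC⟩ := (hK.cthickening (r := δ)).exists_bound_of_continuousOn (hu.continuousOn.mono hsub)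
  have hv : 0 < ‖v‖ + 1 := by positivity
  set ρ := δ / (‖v‖ + 1) with hρ
  have hρ0 : 0 < ρ := by positivity
  refine ⟨C / ρ, fun p hp => ?_⟩
  have hin : ∀ z : ℂ, ‖z‖ ≤ ρ → p + z • v ∈ Metric.cthickening δ K := fun z hz => by
    refine Metric.mem_cthickening_of_dist_le _ p _ _ hp ?_
    rw [dist_eq_norm, add_sub_cancel_left, norm_smul]
    calc ‖z‖ * ‖v‖ ≤ ρ * (‖v‖ + 1) := by gcongr; linarith
      _ = δ := by rw [hρ]; field_simp
  have hd : ∀ z : ℂ, ‖z‖ ≤ ρ → HasDerivAt (fun z : ℂ => u (p + z • v))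
      (fderiv ℂ u (p + z • v) v) z := fun z hz => by
    have h1 : DifferentiableAt ℂ u (p + z • v) :=
      hu.differentiableAt (Metric.isOpen_ball.mem_nhds (hsub (hin z hz)))
    have h2 : HasDerivAt (fun z : ℂ => p + z • v) v z := by
      simpa using ((hasDerivAt_id z).smul_const v).const_add p
    exact h1.hasFDerivAt.comp_hasDerivAt z h2
  have h1 : DiffContOnCl ℂ (fun z : ℂ => u (p + z • v)) (Metric.ball 0 ρ) := by
    refine DifferentiableOn.diffContOnCl fun z hz => ?_
    rw [closure_ball _ hρ0.ne', mem_closedBall_zero_iff] at hz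
    exact (hd z hz).differentiableAt.differentiableWithinAt
  have h2 := Complex.norm_deriv_le_of_forall_mem_sphere_norm_le hρ0 h1 (C := C) fun z hz =>
    hC _ (hin z (by simpa using hz.le))
  have h3 : deriv (fun z : ℂ => u (p + z • v)) 0 = fderiv ℝ u p v := by
    have h4 : DifferentiableAt ℂ u p := hu.differentiableAt (Metric.isOpen_ball.mem_nhds (hKr hp))
    rw [(hd 0 (by simpa using hρ0.le)).deriv, zero_smul, add_zero,
      (h4.hasFDerivAt.restrictScalars ℝ).fderiv]
    rfl
  rwa [h3] at h2

theorem continuous_mul_of_tsupport {X : Type*} [TopologicalSpace X] {f g : X → ℂ} {U : Set X}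
    (hU : IsOpen U) (hf : ContinuousOn f U) (hg : Continuous g) (hgU : tsupport g ⊆ U) :
    Continuous fun y => f y * g y := by
  rw [continuous_iff_continuousAt]
  intro y
  by_cases hy : y ∈ tsupport g
  · exact (hf.continuousAt (hU.mem_nhds (hgU hy))).mul hg.continuousAt
  · have : (fun y => f y * g y) =ᶠ[nhds y] fun _ => 0 := by
      filter_upwards [notMem_tsupport_iff_eventuallyEq.1 hy] with z hz
      simp [hz]
    exact continuousAt_const.congr this.symm

theorem integrable_mul_of_tsupport {f g : Cn n → ℂ} {U : Set (Cn n)}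
    (hU : IsOpen U) (hf : ContinuousOn f U) (hg : Continuous g) (hgU : tsupport g ⊆ U)
    (hgc : HasCompactSupport g) : Integrable fun y => f y * g y :=
  (continuous_mul_of_tsupport hU hf hg hgU).integrable_of_hasCompactSupport (hgc.mul_left)

/-- A holomorphic function is orthogonal to `∂̄`-derivatives of test functions. -/
theorem integral_holomorphic_mul_delBar (hu : DifferentiableOn ℂ u (Metric.ball 0 r))
    {G : Cn n → ℂ} (hG : ContDiff ℝ 1 G) (hGs : tsupport G ⊆ Metric.ball 0 r)
    (hGc : HasCompactSupport G) (v : Cn n) :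
    ∫ y, u y * delBar v G y = 0 := by
  have hGd : Differentiable ℝ G := hG.differentiable (by simp)
  have hud : ∀ y ∈ Metric.ball (0 : Cn n) r, DifferentiableAt ℂ u y := fun y hy =>
    hu.differentiableAt (Metric.isOpen_ball.mem_nhds hy)
  have hG' : ∀ v, Continuous fun y => fderiv ℝ G y v := fun v =>
    (hG.continuous_fderiv (by simp)).clm_apply continuous_const
  have hG's : ∀ v, tsupport (fun y => fderiv ℝ G y v) ⊆ tsupport G := fun v =>
    (tsupport_fderiv_apply_subset ℝ v)
  have hG'c : ∀ v, HasCompactSupport fun y => fderiv ℝ G y v := fun v => hGc.fderiv_apply ℝ v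
  have hI' : ∀ v, Integrable fun y => u y * fderiv ℝ G y v := fun v =>
    integrable_mul_of_tsupport Metric.isOpen_ball hu.continuousOn (hG' v) ((hG's v).trans hGs)
      (hG'c v)
  have hI : Integrable fun y => u y * G y :=
    integrable_mul_of_tsupport Metric.isOpen_ball hu.continuousOn hG.continuous hGs hGc
  have hI'' : ∀ v, Integrable fun y => fderiv ℝ u y v * G y := fun v => by
    obtain ⟨C, hC⟩ := exists_bound_fderiv_of_holomorphic hu hGc hGs v
    have hGi : Integrable G := hG.continuous.integrable_of_hasCompactSupport hGc
    refine (hGi.norm.const_mul C).mono' ?_ (Filter.Eventually.of_forall fun y => ?_)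
    · exact (measurable_fderiv_apply_const ℝ u v).aestronglyMeasurable.mul
        hG.continuous.aestronglyMeasurable
    · rw [norm_mul]
      by_cases hy : y ∈ tsupport G
      · gcongr; exact hC y hy
      · rw [image_eq_zero_of_notMem_tsupport hy]; simp
  have key : ∀ v, ∫ y, u y * fderiv ℝ G y v = -∫ y, fderiv ℝ u y v * G y := fun v =>
    integral_mul_fderiv_eq_neg_fderiv_mul_of_integrable (hI'' v) (hI' v) hI
      (fun y hy => ((hud y (hGs hy)).restrictScalars ℝ)) (fun y _ => hGd y)
  -- Complex linearity of du: after integration by parts the directions v and iv contribute the same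
  -- integral with factors 1 and i² = -1.
  have hmul : ∫ y, fderiv ℝ u y (Complex.I • v) * G y =
      Complex.I * ∫ y, fderiv ℝ u y v * G y := by
    rw [← integral_const_mul]
    refine integral_congr_ae (Filter.Eventually.of_forall fun y => ?_)
    by_cases hy : y ∈ tsupport G
    · have h : fderiv ℝ u y = (fderiv ℂ u y).restrictScalars ℝ :=
        ((hud y (hGs hy)).hasFDerivAt.restrictScalars ℝ).fderiv
      simp only [h, ContinuousLinearMap.coe_restrictScalars', map_smul, smul_eq_mul]
      ring
    · simp only [image_eq_zero_of_notMem_tsupport hy]; simp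
  calc ∫ y, u y * delBar v G y = ∫ y, (2⁻¹ : ℂ) * (u y * fderiv ℝ G y v +
        Complex.I * (u y * fderiv ℝ G y (Complex.I • v))) := by
        refine integral_congr_ae (Filter.Eventually.of_forall fun y => ?_)
        simp only [delBar]; ring
    _ = 0 := by
        rw [integral_const_mul, integral_add (hI' v) ((hI' _).const_mul _), integral_const_mul,
          key, key, hmul]
        linear_combination (-2⁻¹ * ∫ y, fderiv ℝ u y v * G y) * Complex.I_mul_I

/-- The mean value property with respect to weights invariant under unit scalars. -/
theorem integral_holomorphic_mul_radial {x : Cn n} (hu : DifferentiableOn ℂ u (Metric.ball x r))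
    {g : Cn n → ℂ} (hg : Continuous g) (hgs : tsupport g ⊆ Metric.ball 0 r)
    (hgc : HasCompactSupport g) (hrot : ∀ (z : ℂ) (w : Cn n), ‖z‖ = 1 → g (z • w) = g w) :
    ∫ w, u (x + w) * g w = u x * ∫ w, g w := by
  set H : Cn n → ℂ := fun w => u (x + w) * g w with hH
  have hmaps : ∀ w ∈ Metric.ball (0 : Cn n) r, x + w ∈ Metric.ball x r := fun w hw => by
    simpa [dist_eq_norm] using hw
  have hc : ContinuousOn (fun w => u (x + w)) (Metric.ball 0 r) :=
    hu.continuousOn.comp (by fun_prop) hmaps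
  have hHc : Continuous H := continuous_mul_of_tsupport Metric.isOpen_ball hc hg hgs
  have hHs : HasCompactSupport H := hgc.mul_left
  have hH0 : ∀ w, w ∉ Metric.ball (0 : Cn n) r → g w = 0 := fun w hw =>
    image_eq_zero_of_notMem_tsupport fun h => hw (hgs h)
  obtain ⟨C, hC⟩ := hHs.exists_bound_of_continuous hHc
  -- Multiplication by a unit scalar preserves Lebesgue measure, so the integral equals its average
  -- over the circle. After exchanging the integrals, the inner average is a mean value of u on the
  -- complex line through x in direction w.
  have h1 : ∀ θ : ℝ, ∫ w, H (circleMap 0 1 θ • w) = ∫ w, H w := fun θ => by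
    set e : Cn n ≃ₗᵢ[ℝ] Cn n :=
      { toLinearEquiv := (LinearEquiv.smulOfNeZero ℂ (Cn n) (circleMap 0 1 θ)
          (by simp)).restrictScalars ℝ
        norm_map' := fun w => by
          change ‖circleMap 0 1 θ • w‖ = ‖w‖
          rw [norm_smul]; simp }
    exact (e.measurePreserving).integral_comp e.toHomeomorph.measurableEmbedding H
  have hcirc : ∀ w, ∫ θ in (0 : ℝ)..2 * Real.pi, H (circleMap 0 1 θ • w) =
      (2 * Real.pi : ℝ) • (u x * g w) := fun w => by
    have hgw : ∀ θ : ℝ, g (circleMap 0 1 θ • w) = g w := fun θ => hrot _ _ (by simp)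
    simp only [hH, hgw]
    rw [intervalIntegral.integral_mul_const]
    by_cases hw : w ∈ Metric.ball (0 : Cn n) r
    · have hd : DiffContOnCl ℂ (fun z : ℂ => u (x + z • w)) (Metric.ball 0 |1|) := by
        refine DifferentiableOn.diffContOnCl fun z hz => ?_
        rw [abs_one, closure_ball _ one_ne_zero, mem_closedBall_zero_iff] at hz
        have hin : x + z • w ∈ Metric.ball x r := by
          refine hmaps _ ?_
          rw [mem_ball_zero_iff] at hw ⊢
          rw [norm_smul]
          calc ‖z‖ * ‖w‖ ≤ 1 * ‖w‖ := by gcongr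
            _ < r := by rwa [one_mul]
        have h2 : DifferentiableAt ℂ u (x + z • w) :=
          hu.differentiableAt (Metric.isOpen_ball.mem_nhds hin)
        exact (h2.comp z (by fun_prop : DifferentiableAt ℂ (fun z : ℂ => x + z • w) z)
          ).differentiableWithinAt
      have h3 := hd.circleAverage
      rw [Real.circleAverage_def, zero_smul, add_zero] at h3
      rw [← h3, smul_mul_assoc, smul_smul, mul_inv_cancel₀ (by positivity), one_smul]
    · rw [hH0 w hw]; simp
  have hint : Integrable (Function.uncurry fun (θ : ℝ) (w : Cn n) => H (circleMap 0 1 θ • w))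
      ((volume.restrict (Set.uIoc 0 (2 * Real.pi))).prod volume) := by
    have hB : Integrable ((Metric.closedBall (0 : Cn n) r).indicator fun _ => C) :=
      (integrableOn_const (by exact (isCompact_closedBall _ _).measure_lt_top.ne)).integrable_indicator
        Metric.isClosed_closedBall.measurableSet
    have : IsFiniteMeasure (volume.restrict (Set.uIoc 0 (2 * Real.pi))) :=
      ⟨by rw [Measure.restrict_apply_univ, Set.uIoc]; exact measure_Ioc_lt_top⟩
    have hB2 := hB.comp_snd (volume.restrict (Set.uIoc 0 (2 * Real.pi)))
    refine hB2.mono' ?_ (Filter.Eventually.of_forall fun p => ?_)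
    · refine Continuous.aestronglyMeasurable ?_
      have : Continuous fun θ : ℝ => circleMap 0 1 θ := continuous_circleMap 0 1
      change Continuous fun p : ℝ × Cn n => H (circleMap 0 1 p.1 • p.2)
      fun_prop
    · change ‖H (circleMap 0 1 p.1 • p.2)‖ ≤ _
      by_cases hp : p.2 ∈ Metric.closedBall (0 : Cn n) r
      · rw [Set.indicator_of_mem hp]; exact hC _
      · rw [Set.indicator_of_notMem hp]
        simp only [hH]
        rw [hrot _ _ (by simp), hH0 _ fun h => hp (Metric.ball_subset_closedBall h)]
        simp
  have h4 := intervalIntegral_integral_swap hint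
  simp only [h1, hcirc] at h4
  rw [intervalIntegral.integral_const, integral_smul, integral_const_mul, sub_zero] at h4
  exact smul_right_injective ℂ (by positivity : (2 * Real.pi : ℝ) ≠ 0) h4

/-- A mean value inequality for integrals depending on a parameter. -/
theorem norm_integral_sub_le_of_hasDerivAt {h h' : ℝ → Cn n → ℂ} {K : Set (Cn n)}
    (hK : IsCompact K) (hc : ∀ t, ContinuousOn (h t) K)
    (hc' : ContinuousOn (Function.uncurry h') (Set.univ ×ˢ K))
    (h0 : ∀ t, ∀ y ∉ K, h t y = 0) (h0' : ∀ t, ∀ y ∉ K, h' t y = 0)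
    (hd : ∀ t, ∀ y ∈ K, HasDerivAt (fun t => h t y) (h' t y) t) {B : ℝ}
    (hB : ∀ t ∈ Set.Icc (0 : ℝ) 1, ‖∫ y, h' t y‖ ≤ B) :
    ‖(∫ y, h 1 y) - ∫ y, h 0 y‖ ≤ B := by
  have hKm := hK.isClosed.measurableSet
  have hint : ∀ {f : Cn n → ℂ}, ContinuousOn f K → (∀ y ∉ K, f y = 0) → Integrable f :=
    fun {f} hf hf0 => by
      have : f = K.indicator f := by
        funext y
        by_cases hy : y ∈ K
        · rw [Set.indicator_of_mem hy]
        · rw [Set.indicator_of_notMem hy, hf0 y hy]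
      rw [this]
      exact (hf.integrableOn_compact hK).integrable_indicator hKm
  have hder : ∀ t ∈ Set.Icc (0 : ℝ) 1, HasDerivAt (fun t => ∫ y, h t y) (∫ y, h' t y) t := by
    intro t _
    obtain ⟨C, hC⟩ := ((isCompact_closedBall t 1).prod hK).exists_bound_of_continuousOn
      (hc'.mono (Set.prod_mono (Set.subset_univ _) subset_rfl))
    have hb : Integrable (K.indicator fun _ => C) :=
      (integrableOn_const hK.measure_lt_top.ne).integrable_indicator hKm
    refine (hasDerivAt_integral_of_dominated_loc_of_deriv_le (Metric.closedBall_mem_nhds t one_pos)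
      (Filter.Eventually.of_forall fun s => (hint (hc s) (h0 s)).aestronglyMeasurable)
      (hint (hc t) (h0 t)) (F' := h') ?_ (Filter.Eventually.of_forall fun y s hs => ?_) hb
      (Filter.Eventually.of_forall fun y s _ => ?_)).2
    · have : ContinuousOn (h' t) K := hc'.comp (f := fun y => (t, y))
        (by fun_prop) fun y hy => ⟨trivial, hy⟩
      exact (hint this (h0' t)).aestronglyMeasurable
    · by_cases hy : y ∈ K
      · rw [Set.indicator_of_mem hy]; exact hC (s, y) ⟨hs, hy⟩
      · rw [Set.indicator_of_notMem hy, h0' s y hy]; simp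
    · by_cases hy : y ∈ K
      · exact hd s y hy
      · simp only [h0 _ y hy, h0' _ y hy]; exact hasDerivAt_const _ _
  exact norm_image_sub_le_of_norm_deriv_le_segment_01'
    (fun t ht => (hder t ht).hasDerivWithinAt) fun t ht => hB t ⟨ht.1, ht.2.le⟩

end HolomorphicIntegrals

/-! ### Radial cut-offs and truncated gaussians. -/

section RadialCutoff

open MeasureTheory

variable {n : ℕ} {ρ : ℝ}

/-- A smooth radial function which is one on the ball of radius `ρ` and vanishes outside the ball
of radius `3ρ/2`. -/
def radialCutoff (ρ : ℝ) (w : Cn n) : ℝ := Real.smoothTransition (2 - ‖w‖ ^ 2 / ρ ^ 2)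

theorem contDiff_radialCutoff : ContDiff ℝ ∞ (radialCutoff ρ : Cn n → ℝ) := by
  have : ContDiff ℝ ∞ fun w : Cn n => ‖w‖ ^ 2 := contDiff_norm_sq ℝ
  exact Real.smoothTransition.contDiff.comp (contDiff_const.sub (this.div_const _))

theorem radialCutoff_eq_one (hρ : 0 < ρ) {w : Cn n} (hw : ‖w‖ ≤ ρ) : radialCutoff ρ w = 1 := by
  refine Real.smoothTransition.one_of_one_le ?_
  have : ‖w‖ ^ 2 / ρ ^ 2 ≤ 1 := by
    rw [div_le_one (by positivity)]; gcongr
  linarith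

theorem radialCutoff_eq_zero (hρ : 0 < ρ) {w : Cn n} (hw : 3 / 2 * ρ ≤ ‖w‖) :
    radialCutoff ρ w = 0 := by
  refine Real.smoothTransition.zero_of_nonpos ?_
  -- The factor 3/2 suffices because (3/2)² = 9/4 exceeds 2.
  have : 2 ≤ ‖w‖ ^ 2 / ρ ^ 2 := by
    rw [le_div_iff₀ (by positivity)]
    nlinarith
  linarith

theorem radialCutoff_nonneg (w : Cn n) : 0 ≤ radialCutoff ρ w := Real.smoothTransition.nonneg _

theorem radialCutoff_le_one (w : Cn n) : radialCutoff ρ w ≤ 1 := Real.smoothTransition.le_one _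

theorem tsupport_radialCutoff (hρ : 0 < ρ) :
    tsupport (radialCutoff ρ : Cn n → ℝ) ⊆ Metric.closedBall 0 (3 / 2 * ρ) := by
  refine closure_minimal (fun w hw => ?_) Metric.isClosed_closedBall
  by_contra h
  rw [mem_closedBall_zero_iff, not_le] at h
  exact hw (radialCutoff_eq_zero hρ h.le)

theorem radialCutoff_smul {z : ℂ} (hz : ‖z‖ = 1) (w : Cn n) :
    radialCutoff ρ (z • w) = radialCutoff ρ w := by
  simp [radialCutoff, norm_smul, hz]

theorem integral_exp_neg_sq_norm {b : ℝ} (hb : 0 < b) :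
    ∫ w : Cn n, Real.exp (-(b * ‖w‖ ^ 2)) = (Real.pi / b) ^ n := by
  have h := GaussianFourier.integral_rexp_neg_mul_sq_norm (V := Cn n) hb
  have hf : (Module.finrank ℝ (Cn n) : ℝ) / 2 = n := by
    rw [finrank_real_of_complex, finrank_euclideanSpace_fin]; push_cast; ring
  rw [hf, Real.rpow_natCast] at h
  rw [← h]
  simp only [neg_mul]

/-- A non-integrable function has Bochner integral 0 by convention, whereas the known value of the
gaussian integral is positive. -/
theorem integrable_exp_neg_sq_norm {b : ℝ} (hb : 0 < b) :
    Integrable fun w : Cn n => Real.exp (-(b * ‖w‖ ^ 2)) := by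
  by_contra h
  have h1 := integral_exp_neg_sq_norm (n := n) hb
  rw [integral_undef h] at h1
  have : 0 < (Real.pi / b) ^ n := by have := Real.pi_pos; positivity
  linarith

/-- The total mass of the truncated normalised gaussian. -/
def gaussianMass (n : ℕ) (ρ b : ℝ) : ℝ :=
  (b / Real.pi) ^ n * ∫ w : Cn n, radialCutoff ρ w * Real.exp (-(b * ‖w‖ ^ 2))

theorem integrable_cutoff_gaussian {b : ℝ} (hb : 0 < b) :
    Integrable fun w : Cn n => radialCutoff ρ w * Real.exp (-(b * ‖w‖ ^ 2)) := by
  refine (integrable_exp_neg_sq_norm hb).mono' ?_ (Filter.Eventually.of_forall fun w => ?_)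
  · refine Continuous.aestronglyMeasurable ?_
    have := (contDiff_radialCutoff (n := n) (ρ := ρ)).continuous
    fun_prop
  · rw [norm_mul, Real.norm_of_nonneg (radialCutoff_nonneg w), Real.norm_of_nonneg (Real.exp_nonneg _)]
    exact mul_le_of_le_one_left (Real.exp_nonneg _) (radialCutoff_le_one w)

theorem gaussianMass_pos {b : ℝ} (hρ : 0 < ρ) (hb : 0 < b) : 0 < gaussianMass n ρ b := by
  have hpi := Real.pi_pos
  refine mul_pos (by positivity) ?_
  have hc : Continuous fun w : Cn n => radialCutoff ρ w * Real.exp (-(b * ‖w‖ ^ 2)) := by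
    have := (contDiff_radialCutoff (n := n) (ρ := ρ)).continuous
    fun_prop
  refine hc.integral_pos_of_hasCompactSupport_nonneg_nonzero ?_ (fun w => ?_) (x := 0) ?_
  · refine HasCompactSupport.mul_right ?_
    exact HasCompactSupport.of_support_subset_isCompact (isCompact_closedBall 0 (3 / 2 * ρ))
      ((subset_tsupport _).trans (tsupport_radialCutoff hρ))
  · exact mul_nonneg (radialCutoff_nonneg w) (Real.exp_nonneg _)
  · rw [radialCutoff_eq_one hρ (by simpa using hρ.le)]; simp

/-- The defect lives on |w| ≥ ρ, where half of the exponent supplies the small factor. The other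
half is integrated over the whole space, and its wider gaussian produces 2^n. -/
theorem abs_one_sub_gaussianMass_le {b : ℝ} (hρ : 0 < ρ) (hb : 0 < b) :
    |1 - gaussianMass n ρ b| ≤ 2 ^ n * Real.exp (-(b * (ρ ^ 2 / 2))) := by
  have hpi := Real.pi_pos
  have h1 : (1 : ℝ) = (b / Real.pi) ^ n * ∫ w : Cn n, Real.exp (-(b * ‖w‖ ^ 2)) := by
    rw [integral_exp_neg_sq_norm hb, ← mul_pow]
    field_simp; simp
  rw [gaussianMass]
  nth_rewrite 1 [h1]
  rw [← mul_sub, ← integral_sub (integrable_exp_neg_sq_norm hb) (integrable_cutoff_gaussian hb), abs_mul,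
    abs_of_nonneg (by positivity)]
  have h2 : |∫ w : Cn n, (Real.exp (-(b * ‖w‖ ^ 2)) -
      radialCutoff ρ w * Real.exp (-(b * ‖w‖ ^ 2)))| ≤
      ∫ w : Cn n, Real.exp (-(b * (ρ ^ 2 / 2))) * Real.exp (-(b / 2 * ‖w‖ ^ 2)) := by
    rw [← Real.norm_eq_abs]
    refine norm_integral_le_of_norm_le ((integrable_exp_neg_sq_norm (by positivity)).const_mul _)
      (Filter.Eventually.of_forall fun w => ?_)
    have h3 : Real.exp (-(b * ‖w‖ ^ 2)) - radialCutoff ρ w * Real.exp (-(b * ‖w‖ ^ 2)) =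
        (1 - radialCutoff ρ w) * Real.exp (-(b * ‖w‖ ^ 2)) := by ring
    have h4 : 0 ≤ 1 - radialCutoff ρ w := by linarith [radialCutoff_le_one (ρ := ρ) w]
    rw [h3, norm_mul, Real.norm_of_nonneg h4, Real.norm_of_nonneg (Real.exp_nonneg _)]
    rcases le_total ‖w‖ ρ with hw | hw
    · rw [radialCutoff_eq_one hρ hw, sub_self, zero_mul]; positivity
    · rw [← Real.exp_add]
      calc _ ≤ 1 * Real.exp (-(b * ‖w‖ ^ 2)) := by
            gcongr; linarith [radialCutoff_nonneg (ρ := ρ) w]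
        _ ≤ _ := by
            rw [one_mul, Real.exp_le_exp]
            have : ρ ^ 2 ≤ ‖w‖ ^ 2 := by gcongr
            nlinarith
  calc _ ≤ (b / Real.pi) ^ n * ∫ w : Cn n, Real.exp (-(b * (ρ ^ 2 / 2))) *
        Real.exp (-(b / 2 * ‖w‖ ^ 2)) := by gcongr
    _ = _ := by
        rw [integral_const_mul, integral_exp_neg_sq_norm (by positivity)]
        have : (b / Real.pi) ^ n * (Real.pi / (b / 2)) ^ n = 2 ^ n := by
          rw [← mul_pow]; congr 1; field_simp
        linear_combination Real.exp (-(b * (ρ ^ 2 / 2))) * this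

end RadialCutoff

/-! ### Truncated series as functions of y, and their ∂̄-derivatives. -/

section SeriesSlices

variable {n : ℕ} {F : Cn n × Cn n → ℂ} {x y : Cn n}

theorem differentiableAt_monom_right (α : Fin n →₀ ℕ) :
    DifferentiableAt ℂ (fun z : Cn n => monom (z - x) α) y := by
  have : ∀ j, DifferentiableAt ℂ (fun z : Cn n => (z - x) j) y := fun j =>
    differentiableAt_coord_sub x y j
  unfold monom
  fun_prop

theorem contDiffAt_monom_right (α : Fin n →₀ ℕ) :
    ContDiffAt ℝ ∞ (fun z : Cn n => monom (z - x) α) y := by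
  unfold monom
  exact contDiffAt_prod fun j _ => (contDiffAt_coord_sub x y j).pow _

theorem contDiffAt_jetVal_right (hF : ContDiff ℝ ∞ F) (h0 : mixedHessianDet F (x, y) ≠ 0)
    (P : JetPolynomial n) : ContDiffAt ℝ ∞ (fun z => jetVal F (x, z) P) y :=
  (contDiffAt_jetVal hF h0 P).comp y (contDiffAt_const.prodMk contDiffAt_id)

theorem contDiffAt_serVal_right (hF : ContDiff ℝ ∞ F) (h0 : mixedHessianDet F (x, y) ≠ 0)
    (L : ℕ) (G : JetSeries n) : ContDiffAt ℝ ∞ (fun z => serVal F L G (x, z)) y := by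
  unfold serVal
  exact ContDiffAt.sum fun α _ => (contDiffAt_monom_right α).mul (contDiffAt_jetVal_right hF h0 _)

/-- The monomials in w are holomorphic in y, so ∂̄_y acts on coefficients only. Formal and actual
derivatives therefore agree exactly, with no truncation error. -/
theorem delBar_serVal_right (hF : ContDiff ℝ ∞ F) (h0 : mixedHessianDet F (x, y) ≠ 0)
    (L : ℕ) (G : JetSeries n) (i : Fin n) :
    delBar (coordVec i) (fun z => serVal F L G (x, z)) y =
      serVal F L (seriesDeriv i G) (x, y) := by
  have h1 : ∀ α, DifferentiableAt ℝ (fun z : Cn n => monom (z - x) α) y := fun α =>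
    (contDiffAt_monom_right α).differentiableAt (n := ∞) (by simp)
  have h2 : ∀ P : JetPolynomial n, DifferentiableAt ℝ (fun z => jetVal F (x, z) P) y := fun P =>
    (contDiffAt_jetVal_right hF h0 P).differentiableAt (n := ∞) (by simp)
  have h3 : (fun z => serVal F L G (x, z)) = fun z => ∑ α ∈ box n L,
    monom (z - x) α * jetVal F (x, z) (MvPowerSeries.coeff α G) := rfl
  rw [h3, delBar_eq_wirt, wirt_sum _ fun α _ => (h1 α).fun_mul (h2 _)]
  refine Finset.sum_congr rfl fun α _ => ?_
  rw [wirt_mul (h1 α) (h2 _), ← delBar_eq_wirt, delBar_holomorphic (differentiableAt_monom_right α),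
    zero_mul, zero_add]
  change _ = monom (y - x) α * jetVal F (x, y) (jetDeriv i (MvPowerSeries.coeff α G))
  rw [← delBar_jetVal hF h0, delBar_eq_wirt, delBar_eq_wirt]
  rw [wirt_slice_right Complex.I (coordVec i)
    ((contDiffAt_jetVal hF h0 _).differentiableAt (n := ∞) (by simp))]

theorem serVal_sum {ι : Type*} (u : Finset ι) (L : ℕ) (G : ι → JetSeries n) (p : Cn n × Cn n) :
    serVal F L (∑ i ∈ u, G i) p = ∑ i ∈ u, serVal F L (G i) p := by
  unfold serVal
  rw [Finset.sum_comm]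
  refine Finset.sum_congr rfl fun α _ => ?_
  rw [← Finset.mul_sum, ← map_sum]
  congr 2
  exact map_sum (MvPowerSeries.coeff α) G u

end SeriesSlices

/-! ### Bounds for pairings with functions of finite weighted norm. -/

section Pairing

open MeasureTheory

variable {n : ℕ} {F : Cn n × Cn n → ℂ} {φ : Cn n → ℝ} {R r δ ε : ℝ}

/-- A polarized weight `F` of `φ`, with nondegenerate mixed Hessian, whose phase is bounded by
`|x - y|²` on the ball of radius `r`. -/
structure IsPolarizedPhase {n : ℕ} (F : Cn n × Cn n → ℂ) (φ : Cn n → ℝ) (R r δ : ℝ) : Prop where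
  weight : IsPolarizedWeight R F
  det_ne : ∀ p ∈ biball n R, mixedHessianDet F p ≠ 0
  pos : 0 < r
  lt : r < R
  le_half : r ≤ 1 / 2
  delta_pos : 0 < δ
  phase : ∀ x ∈ Metric.ball (0 : Cn n) r, ∀ y ∈ Metric.ball (0 : Cn n) r,
    2 * (F (x, y)).re ≤ φ x + φ y - δ * ‖y - x‖ ^ 2
  diag : ∀ y ∈ Metric.ball (0 : Cn n) R, F (y, y) = φ y
  vol : ∀ y ∈ Metric.ball (0 : Cn n) R, mixedHessianDet F (y, y) = volDensity φ y

theorem IsPolarizedPhase.mem_biball (H : IsPolarizedPhase F φ R r δ) {x y : Cn n}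
    (hx : x ∈ Metric.ball (0 : Cn n) r) (hy : y ∈ Metric.ball (0 : Cn n) r) :
    (x, y) ∈ biball n R :=
  ⟨Metric.ball_subset_ball H.lt.le hx, Metric.ball_subset_ball H.lt.le hy⟩

theorem IsPolarizedPhase.re_diag (H : IsPolarizedPhase F φ R r δ) {y : Cn n}
    (hy : y ∈ Metric.ball (0 : Cn n) R) : (F (y, y)).re = φ y := by
  rw [H.diag y hy, Complex.ofReal_re]

theorem IsPolarizedPhase.continuousOn_weight (H : IsPolarizedPhase F φ R r δ) :
    ContinuousOn φ (Metric.ball 0 R) := by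
  have h : Continuous fun y : Cn n => (F (y, y)).re :=
    Complex.continuous_re.comp (H.weight.smooth.continuous.comp (by fun_prop))
  exact h.continuousOn.congr fun y hy => (H.re_diag hy).symm

theorem IsPolarizedPhase.continuousOn_vol (H : IsPolarizedPhase F φ R r δ) :
    ContinuousOn (volDensity φ) (Metric.ball 0 R) := by
  have h : Continuous fun y : Cn n => (mixedHessianDet F (y, y)).re :=
    Complex.continuous_re.comp ((contDiff_mixedHessianDet H.weight.smooth).continuous.comp
      (by fun_prop))
  exact h.continuousOn.congr fun y hy => by
    change _ = (mixedHessianDet F (y, y)).re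
    rw [H.vol y hy, Complex.ofReal_re]

theorem IsPolarizedPhase.vol_pos (H : IsPolarizedPhase F φ R r δ) {y : Cn n}
    (hy : y ∈ Metric.ball (0 : Cn n) R) : 0 < volDensity φ y := by
  have h := H.weight.hessPos y hy
  rw [H.vol y hy] at h
  exact_mod_cast h

theorem IsPolarizedPhase.exists_vol_lower_bound (H : IsPolarizedPhase F φ R r δ) :
    ∃ c : ℝ, 0 < c ∧ ∀ y ∈ Metric.ball (0 : Cn n) r, c ≤ volDensity φ y := by
  have hsub : Metric.closedBall (0 : Cn n) r ⊆ Metric.ball 0 R := Metric.closedBall_subset_ball H.lt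
  obtain ⟨y₀, h1, h2⟩ := (isCompact_closedBall (0 : Cn n) r).exists_isMinOn
    ⟨0, Metric.mem_closedBall_self H.pos.le⟩ (H.continuousOn_vol.mono hsub)
  exact ⟨volDensity φ y₀, H.vol_pos (hsub h1), fun y hy => h2 (Metric.ball_subset_closedBall hy)⟩

/-- The Cauchy–Schwarz inequality against the constant 1, from nonnegativity of the quadratic
polynomial ∫(f - t)² in t. -/
theorem sq_integral_le_of_integrable_sq {s : Set (Cn n)} (hs : MeasurableSet s)
    (hfin : volume s ≠ ⊤) {f : Cn n → ℝ} (hf : AEStronglyMeasurable f (volume.restrict s))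
    (hf2 : IntegrableOn (fun y => f y ^ 2) s) :
    IntegrableOn f s ∧ (∫ y in s, f y) ^ 2 ≤ volume.real s * ∫ y in s, f y ^ 2 := by
  have h1 : IntegrableOn (fun _ => (1 : ℝ)) s := integrableOn_const hfin
  have hi : IntegrableOn f s := by
    refine (h1.add hf2).mono' hf (Filter.Eventually.of_forall fun y => ?_)
    rw [Real.norm_eq_abs, Pi.add_apply, abs_le]
    constructor <;> nlinarith [sq_nonneg (f y - 1), sq_nonneg (f y + 1)]
  refine ⟨hi, ?_⟩
  have key : ∀ t : ℝ, 0 ≤ (∫ y in s, f y ^ 2) - 2 * t * (∫ y in s, f y) +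
      t ^ 2 * volume.real s := fun t => by
    have h2 : (∫ y in s, f y ^ 2) - 2 * t * (∫ y in s, f y) + t ^ 2 * volume.real s =
        ∫ y in s, (f y - t) ^ 2 := by
      have h3 : (fun y => (f y - t) ^ 2) = fun y => (f y ^ 2 - 2 * t * f y) + t ^ 2 * 1 := by
        funext y; ring
      have h4 : IntegrableOn (fun y => f y ^ 2 - 2 * t * f y) s := hf2.sub (hi.const_mul _)
      rw [h3, integral_add h4 (h1.const_mul _),
        integral_sub hf2 (hi.const_mul _), integral_const_mul, integral_const_mul]
      simp
    rw [h2]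
    exact setIntegral_nonneg hs fun y _ => sq_nonneg _
  set I := ∫ y in s, f y
  set J := ∫ y in s, f y ^ 2
  set V := volume.real s with hV
  have hV0 : 0 ≤ V := measureReal_nonneg
  rcases hV0.eq_or_lt with h0 | h0
  -- With zero volume the polynomial is linear in t and can be nonnegative only if its slope
  -- vanishes.
  · have h3 : I = 0 := by
      by_contra hI
      have := key ((J + 1) / (2 * I))
      rw [← h0] at this
      have h5 : 2 * ((J + 1) / (2 * I)) * I = J + 1 := by field_simp
      linarith
    rw [h3, ← h0]; simp
  · have := key (I / V)
    have h4 : J - 2 * (I / V) * I + (I / V) ^ 2 * V = (V * J - I ^ 2) / V := by field_simp; ring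
    rw [h4, le_div_iff₀ h0] at this
    linarith

/-- The volume density is bounded below on the ball, so Cauchy–Schwarz passes from the weighted L²
norm to an L¹ norm with weight e^{-kφ/2}. -/
theorem IsPolarizedPhase.exists_integral_bound (H : IsPolarizedPhase F φ R r δ) :
    ∃ C : ℝ, 0 ≤ C ∧ ∀ (k : ℕ) (u : Cn n → ℂ), MemWeightedHol φ r k u →
      IntegrableOn (fun y => ‖u y‖ * Real.exp (-(k * (φ y / 2)))) (Metric.ball 0 r) ∧
      ∫ y in Metric.ball (0 : Cn n) r, ‖u y‖ * Real.exp (-(k * (φ y / 2))) ≤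
        C * weightedNorm φ r k u := by
  obtain ⟨c, hc, hcv⟩ := H.exists_vol_lower_bound
  have hV : volume (Metric.ball (0 : Cn n) r) ≠ ⊤ := measure_ball_lt_top.ne
  refine ⟨Real.sqrt (volume.real (Metric.ball (0 : Cn n) r) * c⁻¹), Real.sqrt_nonneg _,
    fun k u hu => ?_⟩
  set f : Cn n → ℝ := fun y => ‖u y‖ * Real.exp (-(k * (φ y / 2))) with hf
  have hφc : ContinuousOn φ (Metric.ball 0 r) :=
    H.continuousOn_weight.mono (Metric.ball_subset_ball H.lt.le)
  have huc := hu.1.continuousOn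
  have hfc : ContinuousOn f (Metric.ball 0 r) :=
    huc.norm.mul (Real.continuous_exp.comp_continuousOn
      ((continuousOn_const.mul (hφc.div_const 2)).neg))
  have hm := hfc.aestronglyMeasurable (μ := volume) Metric.isOpen_ball.measurableSet
  have hle : ∀ y ∈ Metric.ball (0 : Cn n) r, f y ^ 2 ≤
      c⁻¹ * (‖u y‖ ^ 2 * (Real.exp (-(k * φ y)) * volDensity φ y)) := fun y hy => by
    have h1 : f y ^ 2 = ‖u y‖ ^ 2 * Real.exp (-(k * φ y)) := by
      simp only [hf]; rw [mul_pow, ← Real.exp_nat_mul]; congr 2; push_cast; ring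
    have h2 : 1 ≤ c⁻¹ * volDensity φ y := by
      rw [inv_mul_eq_div, le_div_iff₀ hc, one_mul]; exact hcv y hy
    rw [h1]
    calc ‖u y‖ ^ 2 * Real.exp (-(k * φ y)) = ‖u y‖ ^ 2 * Real.exp (-(k * φ y)) * 1 := by ring
      _ ≤ ‖u y‖ ^ 2 * Real.exp (-(k * φ y)) * (c⁻¹ * volDensity φ y) := by gcongr
      _ = _ := by ring
  have hI := hu.2.const_mul c⁻¹
  have hf2 : IntegrableOn (fun y => f y ^ 2) (Metric.ball 0 r) := by
    refine Integrable.mono' hI ((hfc.pow 2).aestronglyMeasurable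
      Metric.isOpen_ball.measurableSet) ?_
    filter_upwards [ae_restrict_mem Metric.isOpen_ball.measurableSet] with y hy
    rw [Real.norm_of_nonneg (sq_nonneg _)]
    exact hle y hy
  obtain ⟨h1, h2⟩ := sq_integral_le_of_integrable_sq Metric.isOpen_ball.measurableSet hV hm hf2
  refine ⟨h1, ?_⟩
  have h3 : ∫ y in Metric.ball (0 : Cn n) r, f y ^ 2 ≤ c⁻¹ *
      ∫ y in Metric.ball (0 : Cn n) r, ‖u y‖ ^ 2 * (Real.exp (-(k * φ y)) * volDensity φ y) := by
    rw [← integral_const_mul]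
    exact setIntegral_mono_on hf2 hI Metric.isOpen_ball.measurableSet hle
  rw [weightedNorm, ← Real.sqrt_mul (by positivity)]
  refine Real.le_sqrt_of_sq_le (h2.trans ?_)
  calc _ ≤ volume.real (Metric.ball (0 : Cn n) r) * (c⁻¹ *
      ∫ y in Metric.ball (0 : Cn n) r, ‖u y‖ ^ 2 * (Real.exp (-(k * φ y)) * volDensity φ y)) := by
        gcongr
    _ = _ := by ring

/-- The functional `Q k u x` is `O(k^s e^{kφ(x)/2}) ‖u‖`, uniformly for `|x| < ε`. -/
def IsSmall (φ : Cn n → ℝ) (r ε : ℝ) (s : ℤ) (Q : ℕ → (Cn n → ℂ) → Cn n → ℂ) : Prop :=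
  ∃ C : ℝ, ∀ k : ℕ, 1 ≤ k → ∀ u : Cn n → ℂ, MemWeightedHol φ r k u →
    ∀ x ∈ Metric.ball (0 : Cn n) ε,
      ‖Q k u x‖ ≤ C * (k : ℝ) ^ s * Real.exp (k * φ x / 2) * weightedNorm φ r k u

variable {s : ℤ} {Q Q' : ℕ → (Cn n → ℂ) → Cn n → ℂ}

theorem IsSmall.add (hQ : IsSmall φ r ε s Q) (hQ' : IsSmall φ r ε s Q') :
    IsSmall φ r ε s (fun k u x => Q k u x + Q' k u x) := by
  obtain ⟨C, hC⟩ := hQ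
  obtain ⟨C', hC'⟩ := hQ'
  refine ⟨C + C', fun k hk u hu x hx => (norm_add_le _ _).trans ?_⟩
  calc _ ≤ _ := add_le_add (hC k hk u hu x hx) (hC' k hk u hu x hx)
    _ = _ := by ring

theorem isSmall_zero : IsSmall φ r ε s (fun _ _ _ => 0) := ⟨0, fun k hk u hu x hx => by simp⟩

theorem IsSmall.sum {ι : Type*} (t : Finset ι) {Q : ι → ℕ → (Cn n → ℂ) → Cn n → ℂ}
    (hQ : ∀ i ∈ t, IsSmall φ r ε s (Q i)) : IsSmall φ r ε s (fun k u x => ∑ i ∈ t, Q i k u x) := by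
  classical
  induction t using Finset.induction_on with
  | empty => simpa using isSmall_zero
  | insert a t ha ih =>
    simp only [Finset.sum_insert ha]
    exact (hQ a (by simp)).add (ih fun i hi => hQ i (by simp [hi]))

theorem IsSmall.congr (hQ : IsSmall φ r ε s Q) (h : ∀ k : ℕ, 1 ≤ k → ∀ u : Cn n → ℂ,
    MemWeightedHol φ r k u → ∀ x ∈ Metric.ball (0 : Cn n) ε, Q' k u x = Q k u x) :
    IsSmall φ r ε s Q' := by
  obtain ⟨C, hC⟩ := hQ
  exact ⟨C, fun k hk u hu x hx => by rw [h k hk u hu x hx]; exact hC k hk u hu x hx⟩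

/-- Multiplication by scalars which are `O(k^a)`. -/
theorem IsSmall.const_mul (hQ : IsSmall φ r ε s Q) {c : ℕ → ℂ} {A : ℝ} {a : ℤ}
    (hc : ∀ k : ℕ, 1 ≤ k → ‖c k‖ ≤ A * (k : ℝ) ^ a) :
    IsSmall φ r ε (a + s) (fun k u x => c k * Q k u x) := by
  obtain ⟨C, hC⟩ := hQ
  refine ⟨A * C, fun k hk u hu x hx => ?_⟩
  have hk0 : (k : ℝ) ≠ 0 := by positivity
  rw [norm_mul]
  calc _ ≤ (A * (k : ℝ) ^ a) * (C * (k : ℝ) ^ s * Real.exp (k * φ x / 2) * weightedNorm φ r k u) :=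
        mul_le_mul (hc k hk) (hC k hk u hu x hx) (norm_nonneg _) ((norm_nonneg _).trans (hc k hk))
    _ = _ := by rw [zpow_add₀ hk0]; ring

theorem IsSmall.mono {t : ℤ} (hQ : IsSmall φ r ε s Q) (hst : s ≤ t) : IsSmall φ r ε t Q := by
  obtain ⟨C, hC⟩ := hQ
  refine ⟨max C 0, fun k hk u hu x hx => (hC k hk u hu x hx).trans ?_⟩
  have hk1 : (1 : ℝ) ≤ k := by exact_mod_cast hk
  have h0 : 0 ≤ weightedNorm φ r k u := Real.sqrt_nonneg _
  gcongr
  · exact le_max_left _ _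

/-- Kernels of size e^{k(φ(x) - φ(y))/2} are the natural scale: the y part is absorbed by u, the x
part is the allowed growth of the error. -/
theorem IsPolarizedPhase.exists_pairing_bound (H : IsPolarizedPhase F φ R r δ) :
    ∃ C : ℝ, 0 ≤ C ∧ ∀ (k : ℕ) (u : Cn n → ℂ), MemWeightedHol φ r k u →
      ∀ (x : Cn n) (A : ℝ) (h : Cn n → ℂ),
        (∀ y ∈ Metric.ball (0 : Cn n) r, ‖h y‖ ≤ A * Real.exp (k * ((φ x - φ y) / 2))) →
        (∀ y ∉ Metric.ball (0 : Cn n) r, h y = 0) →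
        ‖∫ y, u y * h y‖ ≤ C * A * Real.exp (k * φ x / 2) * weightedNorm φ r k u := by
  obtain ⟨C, hC0, hC⟩ := H.exists_integral_bound
  refine ⟨C, hC0, fun k u hu x A h hA h0 => ?_⟩
  have hA0 : 0 ≤ A := by
    have := (norm_nonneg _).trans (hA 0 (Metric.mem_ball_self H.pos))
    exact nonneg_of_mul_nonneg_left this (Real.exp_pos _)
  obtain ⟨h1, h2⟩ := hC k u hu
  have hset : ∫ y, u y * h y = ∫ y in Metric.ball (0 : Cn n) r, u y * h y :=
    (setIntegral_eq_integral_of_forall_compl_eq_zero fun y hy => by rw [h0 y hy, mul_zero]).symm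
  rw [hset]
  have hb : ‖∫ y in Metric.ball (0 : Cn n) r, u y * h y‖ ≤
      ∫ y in Metric.ball (0 : Cn n) r, (A * Real.exp (k * φ x / 2)) *
        (‖u y‖ * Real.exp (-(k * (φ y / 2)))) := by
    refine norm_integral_le_of_norm_le (h1.const_mul _) ?_
    filter_upwards [ae_restrict_mem Metric.isOpen_ball.measurableSet] with y hy
    rw [norm_mul]
    calc ‖u y‖ * ‖h y‖ ≤ ‖u y‖ * (A * Real.exp (k * ((φ x - φ y) / 2))) := by
          gcongr
          exact hA y hy
      _ = _ := by
          have : (k : ℝ) * ((φ x - φ y) / 2) = k * φ x / 2 + -(k * (φ y / 2)) := by ring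
          rw [this, Real.exp_add]; ring
  refine hb.trans ?_
  rw [integral_const_mul]
  calc _ ≤ A * Real.exp (k * φ x / 2) * (C * weightedNorm φ r k u) := by gcongr
    _ = _ := by ring

theorem IsPolarizedPhase.isSmall_integral (H : IsPolarizedPhase F φ R r δ)
    {h : ℕ → Cn n → Cn n → ℂ} {A : ℝ}
    (hA : ∀ k : ℕ, 1 ≤ k → ∀ x ∈ Metric.ball (0 : Cn n) ε, ∀ y ∈ Metric.ball (0 : Cn n) r,
      ‖h k x y‖ ≤ A * (k : ℝ) ^ s * Real.exp (k * ((φ x - φ y) / 2)))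
    (h0 : ∀ k, ∀ x ∈ Metric.ball (0 : Cn n) ε, ∀ y ∉ Metric.ball (0 : Cn n) r, h k x y = 0) :
    IsSmall φ r ε s (fun k u x => ∫ y, u y * h k x y) := by
  obtain ⟨C, hC0, hC⟩ := H.exists_pairing_bound
  refine ⟨C * A, fun k hk u hu x hx => ?_⟩
  refine (hC k u hu x (A * (k : ℝ) ^ s) (h k x) (hA k hk x hx) (h0 k x hx)).trans (le_of_eq ?_)
  ring

/-- Amplitudes which vanish to high order on the diagonal gain powers of `k`. -/
theorem IsPolarizedPhase.isSmall_integral_of_gaussian (H : IsPolarizedPhase F φ R r δ)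
    {h : ℕ → Cn n → Cn n → ℂ} {A δ' : ℝ} (hδ' : 0 < δ') {a b : ℕ}
    (hA : ∀ k : ℕ, 1 ≤ k → ∀ x ∈ Metric.ball (0 : Cn n) ε, ∀ y ∈ Metric.ball (0 : Cn n) r,
      ‖h k x y‖ ≤ A * (k : ℝ) ^ a * ((‖y - x‖ ^ 2) ^ b * Real.exp (-(k * (δ' * ‖y - x‖ ^ 2))) *
        Real.exp (k * ((φ x - φ y) / 2))))
    (h0 : ∀ k, ∀ x ∈ Metric.ball (0 : Cn n) ε, ∀ y ∉ Metric.ball (0 : Cn n) r, h k x y = 0) :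
    IsSmall φ r ε ((a : ℤ) - b) (fun k u x => ∫ y, u y * h k x y) := by
  obtain ⟨C, hC0, hC⟩ := exists_pow_mul_exp_le hδ' b
  refine H.isSmall_integral (A := max A 0 * C) (fun k hk x hx y hy => (hA k hk x hx y hy).trans ?_) h0
  have hk0 : (k : ℝ) ≠ 0 := by positivity
  calc _ ≤ max A 0 * (k : ℝ) ^ a * ((C / (k : ℝ) ^ b) * Real.exp (k * ((φ x - φ y) / 2))) := by
        gcongr
        · exact le_max_left _ _
        · exact hC k hk _ (sq_nonneg _)
    _ = _ := by rw [zpow_sub₀ hk0, zpow_natCast, zpow_natCast]; ring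

end Pairing

/-! ### Localization near x and control of the truncated phase. -/

section LocalizedIntegrals

open MeasureTheory

variable {n : ℕ} {F : Cn n × Cn n → ℂ} {φ : Cn n → ℝ} {R r δ ρ : ℝ} {x y : Cn n} {L : ℕ}

/-- The mean value inequality on the convex half-plane Re z ≤ M, where the derivative of exp is
bounded by e^M. -/
theorem norm_cexp_sub_cexp_le {a b : ℂ} {M : ℝ} (ha : a.re ≤ M) (hb : b.re ≤ M) :
    ‖Complex.exp a - Complex.exp b‖ ≤ Real.exp M * ‖a - b‖ := by
  have hconv : Convex ℝ {z : ℂ | z.re ≤ M} := convex_halfSpace_re_le M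
  refine hconv.norm_image_sub_le_of_norm_hasDerivWithin_le (f := Complex.exp) (f' := Complex.exp)
    (fun z _ => (Complex.hasDerivAt_exp z).hasDerivWithinAt) (fun z hz => ?_) hb ha
  rw [Complex.norm_exp]
  exact Real.exp_le_exp.2 hz

/-- The radial cut-off centred at `x`. -/
def cutoffAt (ρ : ℝ) (x y : Cn n) : ℂ := (radialCutoff ρ (y - x) : ℝ)

theorem contDiff_cutoffAt : ContDiff ℝ ∞ (cutoffAt ρ x) :=
  Complex.ofRealCLM.contDiff.comp (contDiff_radialCutoff.comp (contDiff_id.sub contDiff_const))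

theorem norm_cutoffAt_le : ‖cutoffAt ρ x y‖ ≤ 1 := by
  rw [cutoffAt, Complex.norm_real, Real.norm_of_nonneg (radialCutoff_nonneg _)]
  exact radialCutoff_le_one _

theorem cutoffAt_eq_one (hρ : 0 < ρ) (h : ‖y - x‖ ≤ ρ) : cutoffAt ρ x y = 1 := by
  rw [cutoffAt, radialCutoff_eq_one hρ h, Complex.ofReal_one]

theorem tsupport_cutoffAt (hρ : 0 < ρ) :
    tsupport (cutoffAt ρ x) ⊆ Metric.closedBall x (3 / 2 * ρ) := by
  refine closure_minimal (fun z hz => ?_) Metric.isClosed_closedBall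
  by_contra h
  rw [mem_closedBall_iff_norm, not_le] at h
  exact hz (by rw [cutoffAt, radialCutoff_eq_zero hρ h.le, Complex.ofReal_zero])

theorem cutoffAt_eq_zero (hρ : 0 < ρ) (h : 3 / 2 * ρ < ‖y - x‖) : cutoffAt ρ x y = 0 :=
  image_eq_zero_of_notMem_tsupport fun hy => by
    have := mem_closedBall_iff_norm.1 (tsupport_cutoffAt hρ hy)
    linarith

theorem delBar_cutoffAt_eq_zero (hρ : 0 < ρ) (v : Cn n) (h : 3 / 2 * ρ < ‖y - x‖) :
    delBar v (cutoffAt ρ x) y = 0 := by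
  have h1 : cutoffAt ρ x =ᶠ[nhds y] fun _ => 0 := by
    refine notMem_tsupport_iff_eventuallyEq.1 fun hy => ?_
    have := mem_closedBall_iff_norm.1 (tsupport_cutoffAt hρ hy)
    linarith
  rw [delBar_eq_wirt, wirt_congr h1, wirt_const]

/-- The derivative vanishes for |y - x| < ρ, so any power of |y - x|/ρ can be inserted. This makes
all boundary terms smaller than any prescribed power of 1/k. -/
theorem exists_delBar_cutoffAt_bound (hρ : 0 < ρ) (v : Cn n) (b : ℕ) :
    ∃ C : ℝ, 0 ≤ C ∧ ∀ x y : Cn n, ‖delBar v (cutoffAt ρ x) y‖ ≤ C * (‖y - x‖ ^ 2) ^ b := by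
  have hcs : HasCompactSupport (cutoffAt ρ (0 : Cn n)) :=
    HasCompactSupport.of_support_subset_isCompact (isCompact_closedBall 0 (3 / 2 * ρ))
      ((subset_tsupport _).trans (tsupport_cutoffAt hρ))
  have hc' : Continuous (fderiv ℝ (cutoffAt ρ (0 : Cn n))) :=
    (contDiff_cutoffAt).continuous_fderiv (by simp)
  obtain ⟨B, hB⟩ := (hcs.fderiv (𝕜 := ℝ)).exists_bound_of_continuous hc'
  have hB0 : 0 ≤ B := (norm_nonneg _).trans (hB 0)
  -- The cut-offs are translates of one function, hence the bound is uniform in x.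
  have htr : ∀ x y : Cn n, fderiv ℝ (cutoffAt ρ x) y = fderiv ℝ (cutoffAt ρ (0 : Cn n)) (y - x) :=
    fun x y => by
      rw [← fderiv_comp_sub]
      congr 1; funext z; simp [cutoffAt]
  refine ⟨B * ‖v‖ / (ρ ^ 2) ^ b, by positivity, fun x y => ?_⟩
  rcases lt_or_ge ‖y - x‖ ρ with h | h
  · have h1 : cutoffAt ρ x =ᶠ[nhds y] fun _ => 1 := by
      have : Continuous fun z : Cn n => ‖z - x‖ := by fun_prop
      filter_upwards [this.continuousAt.eventually_lt continuousAt_const h] with z hz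
      exact cutoffAt_eq_one hρ hz.le
    rw [delBar_eq_wirt, wirt_congr h1, wirt_const, norm_zero]
    positivity
  · have h1 : ‖delBar v (cutoffAt ρ x) y‖ ≤ B * ‖v‖ := by
      have h2 : ∀ w : Cn n, ‖fderiv ℝ (cutoffAt ρ x) y w‖ ≤ B * ‖w‖ := fun w => by
        rw [htr]
        exact (ContinuousLinearMap.le_opNorm _ _).trans (by gcongr; exact hB _)
      have h3 := h2 (Complex.I • v)
      rw [norm_smul, Complex.norm_I, one_mul] at h3
      rw [delBar, norm_div, Complex.norm_ofNat, div_le_iff₀ (by norm_num)]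
      refine (norm_add_le _ _).trans ?_
      rw [norm_mul, Complex.norm_I, one_mul]
      linarith [h2 v]
    refine h1.trans ?_
    rw [div_mul_eq_mul_div, le_div_iff₀ (by positivity)]
    gcongr

theorem delBar_cutoffAt_mul {g : Cn n → ℂ} (v : Cn n)
    (hg : y ∈ tsupport (cutoffAt ρ x) → DifferentiableAt ℝ g y) :
    delBar v (fun z => cutoffAt ρ x z * g z) y =
      delBar v (cutoffAt ρ x) y * g y + cutoffAt ρ x y * delBar v g y := by
  by_cases hy : y ∈ tsupport (cutoffAt ρ x)
  · exact wirt_mul ((contDiff_cutoffAt).differentiable (by simp) y) (hg hy)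
  · have h1 := notMem_tsupport_iff_eventuallyEq.1 hy
    have h2 : (fun z => cutoffAt ρ x z * g z) =ᶠ[nhds y] fun _ => 0 := by
      filter_upwards [h1] with z hz
      simp [hz]
    rw [delBar_eq_wirt, wirt_congr h2, wirt_congr h1, image_eq_zero_of_notMem_tsupport hy]
    change _ = wirt Complex.I v (fun _ => 0) y * _ + _
    rw [wirt_const]; ring

/-- The radii add up as r/4 + 3r/16 < r/2; half the radius matters because the given cut-off χ
equals 1 only there. -/
theorem closedBall_subset_of_cutoff (hρ : 0 < ρ) (hρr : 8 * ρ ≤ r)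
    (hx : x ∈ Metric.ball (0 : Cn n) (r / 4)) :
    Metric.closedBall x (3 / 2 * ρ) ⊆ Metric.ball 0 (r / 2) := by
  intro z hz
  rw [mem_closedBall_iff_norm] at hz
  rw [mem_ball_zero_iff] at hx ⊢
  have := norm_add_le (z - x) x
  rw [sub_add_cancel] at this
  linarith

theorem tsupport_cutoffAt_subset (hρ : 0 < ρ) (hρr : 8 * ρ ≤ r)
    (hx : x ∈ Metric.ball (0 : Cn n) (r / 4)) :
    tsupport (cutoffAt ρ x) ⊆ Metric.ball 0 r :=
  (tsupport_cutoffAt hρ).trans ((closedBall_subset_of_cutoff hρ hρr hx).trans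
    (Metric.ball_subset_ball (by linarith)))

theorem hasCompactSupport_cutoffAt (hρ : 0 < ρ) : HasCompactSupport (cutoffAt ρ x) :=
  HasCompactSupport.of_support_subset_isCompact (isCompact_closedBall x (3 / 2 * ρ))
      ((subset_tsupport _).trans (tsupport_cutoffAt hρ))

/-- Localised integration by parts. -/
theorem integral_cutoffAt_mul_delBar {u : Cn n → ℂ} (hu : DifferentiableOn ℂ u (Metric.ball 0 r))
    (hρ : 0 < ρ) (hρr : 8 * ρ ≤ r) (hx : x ∈ Metric.ball (0 : Cn n) (r / 4))
    {g : Fin n → Cn n → ℂ} (hg : ∀ i, ∀ y ∈ Metric.ball (0 : Cn n) r, ContDiffAt ℝ ∞ (g i) y) :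
    ∫ y, u y * (cutoffAt ρ x y * ∑ i, delBar (coordVec i) (g i) y) =
      -∫ y, u y * ∑ i, delBar (coordVec i) (cutoffAt ρ x) y * g i y := by
  have hsub := tsupport_cutoffAt_subset hρ hρr hx
  have hcs := hasCompactSupport_cutoffAt (x := x) hρ
  have hG : ∀ i, ContDiff ℝ ∞ fun z => cutoffAt ρ x z * g i z := fun i => by
    refine contDiff_iff_contDiffAt.2 fun z => ?_
    by_cases hz : z ∈ tsupport (cutoffAt ρ x)
    · exact contDiff_cutoffAt.contDiffAt.mul (hg i z (hsub hz))
    · refine (contDiffAt_const (c := (0 : ℂ))).congr_of_eventuallyEq ?_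
      filter_upwards [notMem_tsupport_iff_eventuallyEq.1 hz] with w hw
      simp [hw]
  have hGs : ∀ i, tsupport (fun z => cutoffAt ρ x z * g i z) ⊆ Metric.ball 0 r := fun i =>
    (tsupport_mul_subset_left (f := cutoffAt ρ x)).trans hsub
  have key : ∀ i, ∫ y, u y * delBar (coordVec i) (fun z => cutoffAt ρ x z * g i z) y = 0 := fun i =>
    integral_holomorphic_mul_delBar hu ((hG i).of_le (by norm_cast)) (hGs i) hcs.mul_right _
  have hmul : ∀ i y, delBar (coordVec i) (fun z => cutoffAt ρ x z * g i z) y =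
      delBar (coordVec i) (cutoffAt ρ x) y * g i y +
        cutoffAt ρ x y * delBar (coordVec i) (g i) y := fun i y =>
    delBar_cutoffAt_mul _ fun hy => (hg i y (hsub hy)).differentiableAt (by simp)
  have hI1 : ∀ i, Integrable fun y => u y * (cutoffAt ρ x y * delBar (coordVec i) (g i) y) := by
    intro i
    have hc : ContinuousOn (fun y => u y * delBar (coordVec i) (g i) y) (Metric.ball 0 r) :=
      hu.continuousOn.mul fun y hy =>
        (contDiffAt_wirt (hg i y hy)).continuousAt.continuousWithinAt
    have := integrable_mul_of_tsupport Metric.isOpen_ball hc contDiff_cutoffAt.continuous hsub hcs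
    exact this.congr (Filter.Eventually.of_forall fun y => by ring)
  have hI2 : ∀ i, Integrable fun y => u y * (delBar (coordVec i) (cutoffAt ρ x) y * g i y) := by
    intro i
    have hD : ContDiff ℝ ∞ (delBar (coordVec i) (cutoffAt ρ x)) := contDiff_wirt contDiff_cutoffAt
    have hDs : tsupport (delBar (coordVec i) (cutoffAt ρ x)) ⊆ tsupport (cutoffAt ρ x) := by
      refine closure_minimal (fun z hz => ?_) (isClosed_tsupport _)
      by_contra h
      refine hz ?_
      rw [delBar_eq_wirt, wirt_congr (notMem_tsupport_iff_eventuallyEq.1 h)]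
      exact wirt_const 0
    have hc : ContinuousOn (fun y => u y * g i y) (Metric.ball 0 r) :=
      hu.continuousOn.mul fun y hy => (hg i y hy).continuousAt.continuousWithinAt
    have := integrable_mul_of_tsupport Metric.isOpen_ball hc hD.continuous (hDs.trans hsub)
      (hcs.mono' ((subset_tsupport _).trans hDs))
    exact this.congr (Filter.Eventually.of_forall fun y => by ring)
  have hsum : (∫ y, u y * ∑ i, delBar (coordVec i) (cutoffAt ρ x) y * g i y) +
      ∫ y, u y * (cutoffAt ρ x y * ∑ i, delBar (coordVec i) (g i) y) = 0 := by
    simp only [Finset.mul_sum]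
    rw [integral_finsetSum _ fun i _ => hI2 i, integral_finsetSum _ fun i _ => hI1 i,
      ← Finset.sum_add_distrib]
    refine Finset.sum_eq_zero fun i _ => ?_
    rw [← integral_add (hI2 i) (hI1 i), ← key i]
    refine integral_congr_ae (Filter.Eventually.of_forall fun y => ?_)
    simp only [hmul]; ring
  linear_combination hsum

/-- The truncation of `ψ(x, ȳ) - ψ(y, ȳ)` given by the Taylor series of `ψ`. -/
def truncPhase (F : Cn n × Cn n → ℂ) (L : ℕ) (x y : Cn n) : ℂ :=
  -∑ j, serVal F L (thetaSeries j) (x, y) * (y j - x j)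

theorem IsPolarizedPhase.jetDomain (H : IsPolarizedPhase F φ R r δ) : JetDomain F (biball n r) :=
  jetDomain_biball H.weight H.lt H.le_half H.det_ne

/-- The Taylor series of ψ(·, ȳ) at x is its constant term plus θ·w, and its truncation approximates
the value at (y, ȳ). -/
theorem IsPolarizedPhase.exists_truncPhase_bound (H : IsPolarizedPhase F φ R r δ) (hL : 1 ≤ L) :
    ∃ C : ℝ, 0 ≤ C ∧ ∀ x ∈ Metric.ball (0 : Cn n) r, ∀ y ∈ Metric.ball (0 : Cn n) r,
      ‖F (x, y) - F (y, y) - truncPhase F L x y‖ ≤ C * ‖y - x‖ ^ L := by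
  obtain ⟨C₁, h1⟩ := exists_taylor_bound H.weight H.lt H.le_half L 0 0
  obtain ⟨C₂, h2⟩ := exists_quot_bound H.jetDomain hL (taylorSeries (n := n) 0 0)
  refine ⟨max (C₁ + C₂) 0, le_max_right _ _, fun x hx y hy => ?_⟩
  have e1 := h1 (x, y) ⟨hx, hy⟩
  have e2 := h2 (x, y) ⟨hx, hy⟩
  have e3 : jetVal F (x, y) (MvPowerSeries.constantCoeff (taylorSeries (n := n) 0 0)) = F (x, y) := by
    rw [constantCoeff_eq, taylorSeries]
    simp [mixedDeriv_zero]
  rw [e3] at e2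
  simp only [mixedDeriv_zero] at e1
  have e4 : F (x, y) - F (y, y) - truncPhase F L x y =
      (serVal F L (taylorSeries 0 0) (x, y) - F (y, y)) - (serVal F L (taylorSeries 0 0) (x, y) -
        (F (x, y) + ∑ j, (y - x) j * serVal F L (seriesQuot j (taylorSeries 0 0)) (x, y))) := by
    rw [truncPhase]
    have : ∑ j, serVal F L (thetaSeries j) (x, y) * (y j - x j) =
        ∑ j, (y - x) j * serVal F L (seriesQuot j (taylorSeries 0 0)) (x, y) :=
      Finset.sum_congr rfl fun j _ => mul_comm _ _
    rw [this]; ring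
  rw [e4]
  calc _ ≤ C₁ * ‖y - x‖ ^ L + C₂ * ‖y - x‖ ^ L := (norm_sub_le _ _).trans (add_le_add e1 e2)
    _ ≤ _ := by rw [← add_mul]; gcongr; exact le_max_left _ _

/-- A radius on which the truncated phase is controlled by the weight. -/
structure IsCutoffRadius (F : Cn n × Cn n → ℂ) (φ : Cn n → ℝ) (r δ : ℝ) (L : ℕ) (ρ : ℝ) : Prop where
  pos : 0 < ρ
  le : 8 * ρ ≤ r
  re_le : ∀ x ∈ Metric.ball (0 : Cn n) r, ∀ y ∈ Metric.ball (0 : Cn n) r, ‖y - x‖ ≤ 2 * ρ →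
    (truncPhase F L x y).re ≤ (φ x - φ y) / 2 - δ / 4 * ‖y - x‖ ^ 2

theorem IsPolarizedPhase.re_sub_le (H : IsPolarizedPhase F φ R r δ)
    (hx : x ∈ Metric.ball (0 : Cn n) r) (hy : y ∈ Metric.ball (0 : Cn n) r) :
    (F (x, y) - F (y, y)).re ≤ (φ x - φ y) / 2 - δ / 2 * ‖y - x‖ ^ 2 := by
  have h1 := H.phase x hx y hy
  rw [Complex.sub_re, H.re_diag (Metric.ball_subset_ball H.lt.le hy)]
  linarith

/-- The truncation error is at least cubic in |y - x|, so near the diagonal it consumes at most half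
of the quadratic gain in the phase bound. -/
theorem IsPolarizedPhase.exists_cutoffRadius (H : IsPolarizedPhase F φ R r δ) (hL : 3 ≤ L) :
    ∃ ρ, IsCutoffRadius F φ r δ L ρ := by
  obtain ⟨C, hC0, hC⟩ := H.exists_truncPhase_bound (by omega : 1 ≤ L)
  have hδ := H.delta_pos
  have hr := H.pos
  -- For |y - x| ≤ 2ρ the second bound makes C|y - x| at most δ/4.
  refine ⟨min (r / 8) (δ / (8 * (C + 1))), by positivity, ?_, fun x hx y hy hxy => ?_⟩
  · have := min_le_left (r / 8) (δ / (8 * (C + 1))); linarith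
  set ρ := min (r / 8) (δ / (8 * (C + 1)))
  set q := ‖y - x‖ with hq
  have hq0 : 0 ≤ q := norm_nonneg _
  have hq1 : q ≤ 1 := H.jetDomain.small (x, y) ⟨hx, hy⟩
  have e1 := hC x hx y hy
  have e2 : -(F (x, y) - F (y, y) - truncPhase F L x y).re ≤ C * q ^ L :=
    (neg_le_abs _).trans ((Complex.abs_re_le_norm _).trans e1)
  have e3 := H.re_sub_le hx hy
  have e4 : C * q ^ L ≤ δ / 4 * q ^ 2 := by
    have h1 : q ^ L ≤ q ^ 3 := pow_le_pow_of_le_one hq0 hq1 hL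
    have h2 : q ≤ 2 * (δ / (8 * (C + 1))) := hxy.trans (by gcongr; exact min_le_right _ _)
    have h3 : C * q ≤ δ / 4 := by
      calc C * q ≤ (C + 1) * (2 * (δ / (8 * (C + 1)))) := by gcongr; linarith
        _ = δ / 4 := by field_simp; norm_num
    calc C * q ^ L ≤ C * q ^ 3 := by gcongr
      _ = C * q * q ^ 2 := by ring
      _ ≤ _ := by gcongr
  rw [Complex.sub_re] at e2
  linarith

theorem norm_sub_of_mem_cutoff (H : IsPolarizedPhase F φ R r δ)
    (hx : x ∈ Metric.ball (0 : Cn n) (r / 4)) : x ∈ Metric.ball (0 : Cn n) r :=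
  Metric.ball_subset_ball (by linarith [H.pos]) hx

/-- Amplitudes times `e^{kΨ}` with the truncated phase give small functionals. -/
theorem IsPolarizedPhase.isSmall_of_truncPhase (H : IsPolarizedPhase F φ R r δ)
    (hρ : IsCutoffRadius F φ r δ L ρ) {h : ℕ → Cn n → Cn n → ℂ} {A : ℝ} {a b : ℕ}
    (hA : ∀ k : ℕ, 1 ≤ k → ∀ x ∈ Metric.ball (0 : Cn n) (r / 4), ∀ y ∈ Metric.ball (0 : Cn n) r,
      ‖y - x‖ ≤ 3 / 2 * ρ → ‖h k x y‖ ≤ A * (k : ℝ) ^ a * ((‖y - x‖ ^ 2) ^ b *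
        Real.exp (k * ((φ x - φ y) / 2 - δ / 4 * ‖y - x‖ ^ 2))))
    (h0 : ∀ (k : ℕ) (x y : Cn n), 3 / 2 * ρ < ‖y - x‖ → h k x y = 0) :
    IsSmall φ r (r / 4) ((a : ℤ) - b) (fun k u x => ∫ y, u y * h k x y) := by
  have hδ := H.delta_pos
  refine H.isSmall_integral_of_gaussian (A := max A 0) (δ' := δ / 4) (by positivity)
    (fun k hk x hx y hy => ?_) fun k x hx y hy => ?_
  · rcases le_or_gt ‖y - x‖ (3 / 2 * ρ) with hq | hq
    · refine (hA k hk x hx y hy hq).trans ?_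
      have : (k : ℝ) * ((φ x - φ y) / 2 - δ / 4 * ‖y - x‖ ^ 2) =
          -(k * (δ / 4 * ‖y - x‖ ^ 2)) + k * ((φ x - φ y) / 2) := by ring
      rw [this, Real.exp_add, ← mul_assoc ((‖y - x‖ ^ 2) ^ b)]
      gcongr
      exact le_max_left _ _
    · rw [h0 k x y hq, norm_zero]; positivity
  · refine h0 k x y ?_
    by_contra hcon
    rw [not_lt] at hcon
    have h1 := closedBall_subset_of_cutoff hρ.pos hρ.le hx (mem_closedBall_iff_norm.2 hcon)
    exact hy (Metric.ball_subset_ball (by linarith [H.pos]) h1)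

theorem integrable_mul_cutoffAt {u : Cn n → ℂ} (hu : DifferentiableOn ℂ u (Metric.ball 0 r))
    (hρ : 0 < ρ) (hρr : 8 * ρ ≤ r) (hx : x ∈ Metric.ball (0 : Cn n) (r / 4))
    {g : Cn n → ℂ} (hg : ContinuousOn g (Metric.ball 0 r)) :
    Integrable fun y => u y * (cutoffAt ρ x y * g y) := by
  have := integrable_mul_of_tsupport Metric.isOpen_ball (hu.continuousOn.mul hg)
    contDiff_cutoffAt.continuous (tsupport_cutoffAt_subset hρ hρr hx)
    (hasCompactSupport_cutoffAt hρ)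
  exact this.congr (Filter.Eventually.of_forall fun y => by simp only [Pi.mul_apply]; ring)

theorem norm_cexp_truncPhase_le (hρ : IsCutoffRadius F φ r δ L ρ) (k : ℕ)
    (hx : x ∈ Metric.ball (0 : Cn n) r) (hy : y ∈ Metric.ball (0 : Cn n) r)
    (hxy : ‖y - x‖ ≤ 2 * ρ) : ‖Complex.exp (k * truncPhase F L x y)‖ ≤
      Real.exp (k * ((φ x - φ y) / 2 - δ / 4 * ‖y - x‖ ^ 2)) := by
  rw [Complex.norm_exp, Real.exp_le_exp, ← Complex.ofReal_natCast, Complex.re_ofReal_mul]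
  gcongr
  exact hρ.re_le x hx y hy hxy

/-- The special case of a cut-off amplitude times `e^{kΨ}`. -/
theorem IsPolarizedPhase.isSmall_cutoff (H : IsPolarizedPhase F φ R r δ)
    (hρ : IsCutoffRadius F φ r δ L ρ) {g : ℕ → Cn n → Cn n → ℂ} {A : ℝ} {a b : ℕ}
    (hA : ∀ k : ℕ, 1 ≤ k → ∀ x ∈ Metric.ball (0 : Cn n) (r / 4), ∀ y ∈ Metric.ball (0 : Cn n) r,
      ‖g k x y‖ ≤ A * (k : ℝ) ^ a * (‖y - x‖ ^ 2) ^ b) :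
    IsSmall φ r (r / 4) ((a : ℤ) - b) (fun k u x => ∫ y, u y *
      (cutoffAt ρ x y * (Complex.exp (k * truncPhase F L x y) * g k x y))) := by
  refine H.isSmall_of_truncPhase hρ (A := A) (fun k hk x hx y hy hxy => ?_) fun k x y hxy => ?_
  · have hx' := norm_sub_of_mem_cutoff H hx
    have h1 := norm_cexp_truncPhase_le hρ k hx' hy (hxy.trans (by linarith [hρ.pos]))
    rw [norm_mul, norm_mul]
    calc _ ≤ 1 * (Real.exp (k * ((φ x - φ y) / 2 - δ / 4 * ‖y - x‖ ^ 2)) *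
          (A * (k : ℝ) ^ a * (‖y - x‖ ^ 2) ^ b)) := by
          gcongr
          · exact norm_cutoffAt_le
          · exact hA k hk x hx y hy
      _ = _ := by ring
  · rw [cutoffAt_eq_zero hρ.pos hxy, zero_mul]

end LocalizedIntegrals

/-! ### From the kernel to the amplitude det(∂̄θ), one small error at a time. -/

section KernelReduction

open MeasureTheory

variable {n : ℕ} {F : Cn n × Cn n → ℂ} {φ : Cn n → ℝ} {R r δ ρ : ℝ} {x y : Cn n} {L : ℕ}

/-- The factor `(k/π)^n`. -/
def normFactor (n k : ℕ) : ℂ := ((k / Real.pi : ℝ) : ℂ) ^ n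

theorem norm_normFactor_le (n k : ℕ) : ‖normFactor n k‖ ≤ (k : ℝ) ^ n := by
  rw [normFactor, norm_pow, Complex.norm_real, Real.norm_of_nonneg (by positivity)]
  gcongr
  exact div_le_self (by positivity) (by linarith [Real.pi_gt_three])

/-- The truncated expansion `b_0 + ⋯ + b_N k^{-N}`. -/
def kernelSum (F : Cn n × Cn n → ℂ) (N k : ℕ) (p : Cn n × Cn n) : ℂ :=
  ∑ m ∈ Finset.range (N + 1), jetVal F p (kernelCoeff n m) * ((k : ℂ) ^ m)⁻¹

theorem norm_inv_natCast_pow_le {k : ℕ} (hk : 1 ≤ k) (m : ℕ) : ‖((k : ℂ) ^ m)⁻¹‖ ≤ 1 := by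
  have hk1 : (1 : ℝ) ≤ k := by exact_mod_cast hk
  rw [norm_inv, norm_pow, Complex.norm_natCast]
  exact inv_le_one_of_one_le₀ (one_le_pow₀ hk1)

theorem IsPolarizedPhase.exists_kernelSum_bound (H : IsPolarizedPhase F φ R r δ) (N : ℕ) :
    ∃ C : ℝ, 0 ≤ C ∧ ∀ k : ℕ, 1 ≤ k → ∀ p ∈ biball n r, ‖kernelSum F N k p‖ ≤ C := by
  choose C hC using fun m => H.jetDomain.bdd (kernelCoeff n m)
  refine ⟨max (∑ m ∈ Finset.range (N + 1), C m) 0, le_max_right _ _, fun k hk p hp => ?_⟩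
  refine le_max_of_le_left ((norm_sum_le _ _).trans (Finset.sum_le_sum fun m _ => ?_))
  rw [norm_mul]
  calc _ ≤ ‖jetVal F p (kernelCoeff n m)‖ * 1 := by
        gcongr; exact norm_inv_natCast_pow_le hk m
    _ ≤ _ := by rw [mul_one]; exact hC m p hp

theorem IsPolarizedPhase.exists_det_diag_bound (H : IsPolarizedPhase F φ R r δ) :
    ∃ C : ℝ, 0 ≤ C ∧ ∀ y ∈ Metric.ball (0 : Cn n) r, ‖mixedHessianDet F (y, y)‖ ≤ C := by
  have hc : Continuous fun p : Cn n × Cn n => mixedHessianDet F (p.2, p.2) :=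
    (contDiff_mixedHessianDet H.weight.smooth).continuous.comp (by fun_prop)
  obtain ⟨C, h0, h⟩ := exists_bound_biball H.lt hc.continuousOn
  exact ⟨C, h0, fun y hy => h (y, y) ⟨hy, hy⟩⟩

/-- Changing the cut-off function away from the diagonal is harmless. -/
theorem IsPolarizedPhase.isSmall_cutoff_sub (H : IsPolarizedPhase F φ R r δ)
    (hρ : IsCutoffRadius F φ r δ L ρ) {χ : Cn n → ℝ} (hχ : IsCutoff r χ) (N : ℕ) :
    IsSmall φ r (r / 4) ((n : ℤ) - (N + 1 : ℕ)) (fun k u x => ∫ y, u y *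
      (((χ y : ℂ) - cutoffAt ρ x y) * (normFactor n k * Complex.exp (k * (F (x, y) - F (y, y))) *
        kernelSum F N k (x, y) * mixedHessianDet F (y, y)))) := by
  obtain ⟨B, hB0, hB⟩ := H.exists_kernelSum_bound N
  obtain ⟨V, hV0, hV⟩ := H.exists_det_diag_bound
  have hδ := H.delta_pos
  have hρ0 := hρ.pos
  have hχc : HasCompactSupport χ :=
    (isCompact_closedBall (0 : Cn n) r).of_isClosed_subset (isClosed_tsupport _)
      (hχ.2.1.trans Metric.ball_subset_closedBall)
  obtain ⟨X, hX⟩ := hχc.exists_bound_of_continuous hχ.1.continuous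
  have hX0 : 0 ≤ X := (norm_nonneg _).trans (hX 0)
  -- Both cut-offs are 1 for |y - x| ≤ ρ, so their difference may be multiplied by any power of |y -
  -- x|/ρ.
  have hcut : ∀ x ∈ Metric.ball (0 : Cn n) (r / 4), ∀ y, ‖(χ y : ℂ) - cutoffAt ρ x y‖ ≤
      (X + 1) / (ρ ^ 2) ^ (N + 1) * (‖y - x‖ ^ 2) ^ (N + 1) := fun x hx y => by
    rcases le_or_gt ‖y - x‖ ρ with h | h
    · have h1 : y ∈ Metric.ball (0 : Cn n) (r / 2) :=
        closedBall_subset_of_cutoff hρ.pos hρ.le hx (mem_closedBall_iff_norm.2 (by linarith))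
      rw [hχ.2.2 y h1, cutoffAt_eq_one hρ.pos h]
      simp; positivity
    · rw [div_mul_eq_mul_div, le_div_iff₀ (by positivity)]
      have h2 : ‖(χ y : ℂ) - cutoffAt ρ x y‖ ≤ X + 1 := by
        refine (norm_sub_le _ _).trans (add_le_add ?_ norm_cutoffAt_le)
        rw [Complex.norm_real]; exact hX y
      gcongr
  refine H.isSmall_integral_of_gaussian (A := (X + 1) / (ρ ^ 2) ^ (N + 1) * B * V) (δ' := δ / 2)
    (by positivity) (fun k hk x hx y hy => ?_) fun k x hx y hy => ?_
  · have hx' := norm_sub_of_mem_cutoff H hx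
    have h1 : ‖Complex.exp (k * (F (x, y) - F (y, y)))‖ ≤
        Real.exp (-(k * (δ / 2 * ‖y - x‖ ^ 2))) * Real.exp (k * ((φ x - φ y) / 2)) := by
      rw [← Real.exp_add, Complex.norm_exp, Real.exp_le_exp, ← Complex.ofReal_natCast,
        Complex.re_ofReal_mul]
      have := mul_le_mul_of_nonneg_left (H.re_sub_le hx' hy) (Nat.cast_nonneg (α := ℝ) k)
      linarith
    rw [norm_mul, norm_mul, norm_mul, norm_mul]
    calc _ ≤ ((X + 1) / (ρ ^ 2) ^ (N + 1) * (‖y - x‖ ^ 2) ^ (N + 1)) * ((k : ℝ) ^ n *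
          (Real.exp (-(k * (δ / 2 * ‖y - x‖ ^ 2))) * Real.exp (k * ((φ x - φ y) / 2))) * B * V) := by
          gcongr
          · exact hcut x hx y
          · exact norm_normFactor_le n k
          · exact hB k hk (x, y) ⟨hx', hy⟩
          · exact hV y hy
      _ = _ := by ring
  · have h1 : χ y = 0 := image_eq_zero_of_notMem_tsupport fun h => hy (hχ.2.1 h)
    have h2 : cutoffAt ρ x y = 0 := image_eq_zero_of_notMem_tsupport fun h =>
      hy (tsupport_cutoffAt_subset hρ.pos hρ.le hx h)
    rw [h1, h2]; simp

theorem sq_pow_half {N : ℕ} (q : ℝ) : q ^ (2 * (N + 2)) = (q ^ 2) ^ (N + 2) := by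
  rw [pow_mul]

/-- Replacing the phase by its truncation. -/
theorem IsPolarizedPhase.isSmall_phase_sub (H : IsPolarizedPhase F φ R r δ) {N : ℕ}
    (hρ : IsCutoffRadius F φ r δ (2 * (N + 2)) ρ) :
    IsSmall φ r (r / 4) ((n : ℤ) - (N + 1 : ℕ)) (fun k u x => ∫ y, u y *
      (cutoffAt ρ x y * ((Complex.exp (k * (F (x, y) - F (y, y))) -
        Complex.exp (k * truncPhase F (2 * (N + 2)) x y)) * (normFactor n k *
        kernelSum F N k (x, y) * mixedHessianDet F (y, y))))) := by
  obtain ⟨B, hB0, hB⟩ := H.exists_kernelSum_bound N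
  obtain ⟨V, hV0, hV⟩ := H.exists_det_diag_bound
  obtain ⟨C, hC0, hC⟩ := H.exists_truncPhase_bound (by omega : 1 ≤ 2 * (N + 2))
  have hδ := H.delta_pos
  -- Comparing the two exponentials costs an extra factor k, hence k^{n+1}. The order N + 2 in |y -
  -- x|² pays for it.
  have key := H.isSmall_of_truncPhase hρ (A := C * B * V) (a := n + 1) (b := N + 2)
    (h := fun k x y => cutoffAt ρ x y * ((Complex.exp (k * (F (x, y) - F (y, y))) -
        Complex.exp (k * truncPhase F (2 * (N + 2)) x y)) * (normFactor n k *
        kernelSum F N k (x, y) * mixedHessianDet F (y, y))))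
    (fun k hk x hx y hy hxy => ?_) fun k x y hxy => ?_
  · refine key.mono ?_
    push_cast; linarith
  · have hx' := norm_sub_of_mem_cutoff H hx
    have hk0 : (0 : ℝ) ≤ k := Nat.cast_nonneg k
    have e1 : ((k : ℂ) * (F (x, y) - F (y, y))).re ≤
        k * ((φ x - φ y) / 2 - δ / 4 * ‖y - x‖ ^ 2) := by
      rw [← Complex.ofReal_natCast, Complex.re_ofReal_mul]
      refine mul_le_mul_of_nonneg_left ((H.re_sub_le hx' hy).trans ?_) hk0
      have : 0 ≤ δ * ‖y - x‖ ^ 2 := by positivity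
      linarith
    have e2 : ((k : ℂ) * truncPhase F (2 * (N + 2)) x y).re ≤
        k * ((φ x - φ y) / 2 - δ / 4 * ‖y - x‖ ^ 2) := by
      rw [← Complex.ofReal_natCast, Complex.re_ofReal_mul]
      exact mul_le_mul_of_nonneg_left (hρ.re_le x hx' y hy (by linarith [hρ.pos])) hk0
    have e3 := norm_cexp_sub_cexp_le e1 e2
    rw [← mul_sub, norm_mul, Complex.norm_natCast] at e3
    have e4 := hC x hx' y hy
    rw [sq_pow_half] at e4
    rw [norm_mul, norm_mul, norm_mul, norm_mul]
    calc _ ≤ 1 * ((Real.exp (k * ((φ x - φ y) / 2 - δ / 4 * ‖y - x‖ ^ 2)) *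
          (k * (C * (‖y - x‖ ^ 2) ^ (N + 2)))) * ((k : ℝ) ^ n * B * V)) := by
          gcongr
          · exact norm_cutoffAt_le
          · exact e3.trans (by gcongr)
          · exact norm_normFactor_le n k
          · exact hB k hk (x, y) ⟨hx', hy⟩
          · exact hV y hy
      _ = _ := by ring
  · simp only [cutoffAt_eq_zero hρ.pos hxy, zero_mul]

/-- Entrywise congruence modulo the ideal of O(|w|^L) functions passes to determinants in the
quotient ring. -/
theorem IsPolarizedPhase.exists_volSeries_bound (H : IsPolarizedPhase F φ R r δ) (L : ℕ) :
    ∃ C : ℝ, ∀ p ∈ biball n r, ‖serVal F L (volSeries n) p - mixedHessianDet F (p.2, p.2)‖ ≤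
      C * ‖p.2 - p.1‖ ^ L := by
  have hK := H.jetDomain
  obtain ⟨C₁, h1⟩ := exists_det_bound hK L
    (Matrix.of fun j i : Fin n => taylorSeries (Pi.single j 1) (Pi.single i 1))
  have hm : ∀ i j : Fin n, (fun p : Cn n × Cn n => mixedDeriv (Pi.single j 1) (Pi.single i 1) F
      (p.2, p.2)) ∈ bddOn (biball n r) := fun i j => by
    obtain ⟨C, -, hC⟩ := exists_bound_biball H.lt (h := fun p : Cn n × Cn n =>
      mixedDeriv (Pi.single j 1) (Pi.single i 1) F (p.2, p.2))
      ((contDiff_mixedDeriv H.weight.smooth _ _).continuous.comp (by fun_prop)).continuousOn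
    exact ⟨C, hC⟩
  set A : Matrix (Fin n) (Fin n) (bddOn (biball n r)) := Matrix.of fun j i =>
    ⟨_, serVal_mem_bddOn hK L (taylorSeries (Pi.single j 1) (Pi.single i 1))⟩
  set B : Matrix (Fin n) (Fin n) (bddOn (biball n r)) := Matrix.of fun j i => ⟨_, hm i j⟩
  have hAB : Ideal.Quotient.mk (errIdeal (biball n r) L) A.det =
      Ideal.Quotient.mk (errIdeal (biball n r) L) B.det := by
    rw [RingHom.map_det, RingHom.map_det]
    congr 1
    ext1 j i
    simp only [RingHom.mapMatrix_apply, Matrix.map_apply]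
    rw [Ideal.Quotient.eq]
    exact exists_taylor_bound H.weight H.lt H.le_half L (Pi.single j 1) (Pi.single i 1)
  obtain ⟨C₂, h2⟩ := exists_bound_of_mk_eq hAB
  refine ⟨C₁ + C₂, fun p hp => ?_⟩
  have e1 := h1 p hp
  have e2 := h2 p hp
  have e3 : A.det.1 p = (Matrix.of fun j i : Fin n =>
      serVal F L (taylorSeries (Pi.single j 1) (Pi.single i 1)) p).det :=
    RingHom.map_det ((Pi.evalRingHom (fun _ => ℂ) p).comp (bddOn (biball n r)).subtype) A
  have e4 : B.det.1 p = mixedHessianDet F (p.2, p.2) := by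
    rw [mixedHessianDet_eq H.weight.smooth]
    exact RingHom.map_det ((Pi.evalRingHom (fun _ => ℂ) p).comp (bddOn (biball n r)).subtype) B
  rw [e3, e4] at e2
  calc _ ≤ _ := norm_sub_le_norm_sub_add_norm_sub _ _ _
    _ ≤ _ := add_le_add e1 e2
    _ = _ := by ring

/-- The part of an amplitude which is removed by integration by parts. -/
def fieldTerm (F : Cn n × Cn n → ℂ) (L m : ℕ) (p : Cn n × Cn n) : ℂ :=
  ∑ i, serVal F L (fieldSeries m (amplitude n m) i) p *
    ∑ j, serVal F L (thetaMatrix n j i) p * (p.2 - p.1) j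

theorem IsPolarizedPhase.exists_kernelCoeff_bound (H : IsPolarizedPhase F φ R r δ) (hL : 1 ≤ L)
    (m : ℕ) : ∃ C : ℝ, 0 ≤ C ∧ ∀ p ∈ biball n r,
      ‖jetVal F p (kernelCoeff n m) * mixedHessianDet F (p.2, p.2) -
        (serVal F L (amplitude n m) p - fieldTerm F L m p)‖ ≤ C * ‖p.2 - p.1‖ ^ L := by
  obtain ⟨C₁, h1⟩ := exists_amplitude_bound H.jetDomain hL m
  obtain ⟨C₂, h2⟩ := H.exists_volSeries_bound L
  obtain ⟨B, hB⟩ := H.jetDomain.bdd (kernelCoeff n m)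
  refine ⟨max (C₁ + B * C₂) 0, le_max_right _ _, fun p hp => ?_⟩
  have e1 := h1 p hp
  have e2 := h2 p hp
  have e3 := hB p hp
  have e4 : jetVal F p (kernelCoeff n m) * mixedHessianDet F (p.2, p.2) -
        (serVal F L (amplitude n m) p - fieldTerm F L m p) =
      (jetVal F p (kernelCoeff n m) * serVal F L (volSeries n) p -
        (serVal F L (amplitude n m) p - fieldTerm F L m p)) - jetVal F p (kernelCoeff n m) *
          (serVal F L (volSeries n) p - mixedHessianDet F (p.2, p.2)) := by ring
  rw [e4]
  refine (norm_sub_le _ _).trans ?_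
  rw [norm_mul]
  calc _ ≤ C₁ * ‖p.2 - p.1‖ ^ L + B * (C₂ * ‖p.2 - p.1‖ ^ L) :=
        add_le_add e1 (mul_le_mul e3 e2 (norm_nonneg _) ((norm_nonneg _).trans e3))
    _ = (C₁ + B * C₂) * ‖p.2 - p.1‖ ^ L := by ring
    _ ≤ _ := by gcongr; exact le_max_left _ _

/-- Replacing the coefficients by amplitudes. -/
theorem IsPolarizedPhase.isSmall_kernelCoeff_sub (H : IsPolarizedPhase F φ R r δ) {N : ℕ}
    (hρ : IsCutoffRadius F φ r δ (2 * (N + 2)) ρ) (m : ℕ) :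
    IsSmall φ r (r / 4) ((n : ℤ) - (N + 1 : ℕ)) (fun k u x => ∫ y, u y *
      (cutoffAt ρ x y * (Complex.exp (k * truncPhase F (2 * (N + 2)) x y) * (normFactor n k *
        ((k : ℂ) ^ m)⁻¹ * (jetVal F (x, y) (kernelCoeff n m) * mixedHessianDet F (y, y) -
        (serVal F (2 * (N + 2)) (amplitude n m) (x, y) -
          fieldTerm F (2 * (N + 2)) m (x, y))))))) := by
  obtain ⟨C, hC0, hC⟩ := H.exists_kernelCoeff_bound (by omega : 1 ≤ 2 * (N + 2)) m
  refine (H.isSmall_cutoff hρ (A := C) (a := n) (b := N + 2) fun k hk x hx y hy => ?_).mono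
    (by push_cast; linarith)
  have e4 := hC (x, y) ⟨norm_sub_of_mem_cutoff H hx, hy⟩
  rw [sq_pow_half] at e4
  rw [norm_mul, norm_mul]
  calc _ ≤ ((k : ℝ) ^ n * 1) * (C * (‖y - x‖ ^ 2) ^ (N + 2)) := by
        gcongr
        · exact norm_normFactor_le n k
        · exact norm_inv_natCast_pow_le hk m
    _ = _ := by ring

theorem IsPolarizedPhase.contDiffAt_serVal (H : IsPolarizedPhase F φ R r δ)
    (hx : x ∈ Metric.ball (0 : Cn n) r) (hy : y ∈ Metric.ball (0 : Cn n) r) (L : ℕ)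
    (G : JetSeries n) : ContDiffAt ℝ ∞ (fun z => serVal F L G (x, z)) y :=
  contDiffAt_serVal_right H.weight.smooth (H.det_ne _ (H.mem_biball hx hy)) L G

theorem IsPolarizedPhase.delBar_serVal (H : IsPolarizedPhase F φ R r δ)
    (hx : x ∈ Metric.ball (0 : Cn n) r) (hy : y ∈ Metric.ball (0 : Cn n) r) (L : ℕ)
    (G : JetSeries n) (i : Fin n) : delBar (coordVec i) (fun z => serVal F L G (x, z)) y =
      serVal F L (seriesDeriv i G) (x, y) :=
  delBar_serVal_right H.weight.smooth (H.det_ne _ (H.mem_biball hx hy)) L G i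

theorem IsPolarizedPhase.contDiffAt_truncPhase (H : IsPolarizedPhase F φ R r δ)
    (hx : x ∈ Metric.ball (0 : Cn n) r) (hy : y ∈ Metric.ball (0 : Cn n) r) (L : ℕ) :
    ContDiffAt ℝ ∞ (truncPhase F L x) y :=
  (ContDiffAt.sum fun j _ => (H.contDiffAt_serVal hx hy L (thetaSeries j)).mul
    (contDiffAt_coord_sub x y j)).neg

theorem IsPolarizedPhase.delBar_truncPhase (H : IsPolarizedPhase F φ R r δ)
    (hx : x ∈ Metric.ball (0 : Cn n) r) (hy : y ∈ Metric.ball (0 : Cn n) r) (L : ℕ) (i : Fin n) :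
    delBar (coordVec i) (truncPhase F L x) y =
      -∑ j, serVal F L (thetaMatrix n j i) (x, y) * (y j - x j) := by
  have h1 : truncPhase F L x = fun z => (-1) * ∑ j, serVal F L (thetaSeries j) (x, z) *
      (z j - x j) := by funext z; rw [truncPhase]; ring
  have hc := fun j => H.contDiffAt_serVal hx hy L (thetaSeries j)
  have hd : DifferentiableAt ℝ (fun z => ∑ j, serVal F L (thetaSeries j) (x, z) *
      (z j - x j)) y := (ContDiffAt.sum fun j _ => (hc j).mul
        (contDiffAt_coord_sub x y j)).differentiableAt (n := ∞) (by simp)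
  rw [h1, delBar_eq_wirt, wirt_const_mul _ hd, ← delBar_eq_wirt, delBar_sum_mul_coord hc]
  simp only [H.delBar_serVal hx hy]
  rw [neg_one_mul]; rfl

/-- The result of integrating by parts along `fieldSeries`. -/
theorem IsPolarizedPhase.integral_fieldTerm (H : IsPolarizedPhase F φ R r δ)
    (hρ : IsCutoffRadius F φ r δ L ρ) {u : Cn n → ℂ} (hu : DifferentiableOn ℂ u (Metric.ball 0 r))
    (hx : x ∈ Metric.ball (0 : Cn n) (r / 4)) (k m : ℕ) :
    ∫ y, u y * (cutoffAt ρ x y * (Complex.exp (k * truncPhase F L x y) *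
      (k * fieldTerm F L m (x, y) - serVal F L (amplitude n (m + 1)) (x, y)))) =
    ∫ y, u y * ∑ i, delBar (coordVec i) (cutoffAt ρ x) y *
      (serVal F L (fieldSeries m (amplitude n m) i) (x, y) *
        Complex.exp (k * truncPhase F L x y)) := by
  have hx' := norm_sub_of_mem_cutoff H hx
  have hE : ∀ y ∈ Metric.ball (0 : Cn n) r,
      -- Smoothness of the exponent is what licenses integration by parts on V e^{kΨ}. As Ψ = -θ·w,
      -- the divergence is (div V - k V·∂̄(θ·w)) e^{kΨ}, and div V is the next amplitude.
      ContDiffAt ℝ ∞ (fun z => (k : ℂ) * truncPhase F L x z) y := fun y hy =>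
    contDiffAt_const.mul (H.contDiffAt_truncPhase hx' hy L)
  have h1 := integral_cutoffAt_mul_delBar hu hρ.pos hρ.le hx
    (g := fun i y => serVal F L (fieldSeries m (amplitude n m) i) (x, y) *
        Complex.exp (k * truncPhase F L x y))
    fun i y hy => (H.contDiffAt_serVal hx' hy L _).mul (hE y hy).cexp
  rw [eq_neg_iff_add_eq_zero, add_comm, ← eq_neg_iff_add_eq_zero] at h1
  rw [h1, ← integral_neg]
  refine integral_congr_ae (Filter.Eventually.of_forall fun y => ?_)
  by_cases hy : y ∈ Metric.ball (0 : Cn n) r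
  · have h2 : ∀ i, delBar (coordVec i) (fun y => serVal F L (fieldSeries m (amplitude n m) i) (x, y) *
        Complex.exp (k * truncPhase F L x y)) y =
        serVal F L (seriesDeriv i (fieldSeries m (amplitude n m) i)) (x, y) *
          Complex.exp (k * truncPhase F L x y) +
        serVal F L (fieldSeries m (amplitude n m) i) (x, y) *
          (Complex.exp (k * truncPhase F L x y) *
            (k * -∑ j, serVal F L (thetaMatrix n j i) (x, y) * (y j - x j))) := fun i => by
      have hd := (hE y hy).differentiableAt (n := ∞) (by simp)
      rw [delBar_eq_wirt, wirt_mul ((H.contDiffAt_serVal hx' hy L _).differentiableAt (by simp))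
        hd.cexp, wirt_cexp hd, wirt_const_mul _
        ((H.contDiffAt_truncPhase hx' hy L).differentiableAt (by simp)), ← delBar_eq_wirt,
        H.delBar_serVal hx' hy, H.delBar_truncPhase hx' hy]
    have h3 : serVal F L (amplitude n (m + 1)) (x, y) =
        ∑ i, serVal F L (seriesDeriv i (fieldSeries m (amplitude n m) i)) (x, y) := by
      rw [← serVal_sum]; rfl
    have h4 : fieldTerm F L m (x, y) = ∑ i, serVal F L (fieldSeries m (amplitude n m) i) (x, y) *
        ∑ j, serVal F L (thetaMatrix n j i) (x, y) * (y j - x j) := rfl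
    simp only [h2]
    have h5 : ∑ i, serVal F L (fieldSeries m (amplitude n m) i) (x, y) *
          (Complex.exp (k * truncPhase F L x y) *
            (k * -∑ j, serVal F L (thetaMatrix n j i) (x, y) * (y j - x j))) =
        -(Complex.exp (k * truncPhase F L x y) * (k * ∑ i,
          serVal F L (fieldSeries m (amplitude n m) i) (x, y) *
          ∑ j, serVal F L (thetaMatrix n j i) (x, y) * (y j - x j))) := by
      rw [Finset.mul_sum, Finset.mul_sum, ← Finset.sum_neg_distrib]
      exact Finset.sum_congr rfl fun i _ => by ring
    rw [h3, h4, Finset.sum_add_distrib, ← Finset.sum_mul, h5]; ring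
  · have : cutoffAt ρ x y = 0 := image_eq_zero_of_notMem_tsupport fun h =>
      hy (tsupport_cutoffAt_subset hρ.pos hρ.le hx h)
    simp [this]

theorem JetDomain.exists_serVal_bound (hK : JetDomain F (biball n r)) (L : ℕ) (G : JetSeries n) :
    ∃ C : ℝ, 0 ≤ C ∧ ∀ p ∈ biball n r, ‖serVal F L G p‖ ≤ C := by
  obtain ⟨C, hC⟩ := serVal_mem_bddOn hK L G
  exact ⟨max C 0, le_max_right _ _, fun p hp => (hC p hp).trans (le_max_left _ _)⟩

theorem norm_mul_inv_pow_le {c : ℂ} {k n : ℕ} (hk : 1 ≤ k) (hc : ‖c‖ ≤ (k : ℝ) ^ n) (m : ℕ) :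
    ‖c * ((k : ℂ) ^ m)⁻¹‖ ≤ 1 * (k : ℝ) ^ ((n : ℤ) - m) := by
  have hk0 : (k : ℝ) ≠ 0 := by positivity
  rw [norm_mul, norm_inv, norm_pow, Complex.norm_natCast, one_mul, zpow_sub₀ hk0, zpow_natCast,
    zpow_natCast, div_eq_mul_inv]
  gcongr

/-- After integration by parts only derivatives of the cut-off remain, and these alone give
k^{-(N+1)}; the prefactor k^{-(m+1)} is merely bounded by 1. -/
theorem IsPolarizedPhase.isSmall_fieldTerm (H : IsPolarizedPhase F φ R r δ)
    (hρ : IsCutoffRadius F φ r δ L ρ) (m N : ℕ) :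
    IsSmall φ r (r / 4) ((n : ℤ) - (N + 1 : ℕ)) (fun k u x => (normFactor n k *
      ((k : ℂ) ^ (m + 1))⁻¹) * ∫ y, u y * (cutoffAt ρ x y * (Complex.exp (k * truncPhase F L x y) *
      (k * fieldTerm F L m (x, y) - serVal F L (amplitude n (m + 1)) (x, y))))) := by
  choose C hC0 hC using fun i => exists_delBar_cutoffAt_bound hρ.pos (coordVec i : Cn n) (N + 1)
  choose B hB0 hB using fun i => H.jetDomain.exists_serVal_bound L
    (fieldSeries m (amplitude n m) i)
  have key := H.isSmall_of_truncPhase hρ (A := ∑ i, C i * B i) (a := 0) (b := N + 1)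
    (h := fun k x y => ∑ i, delBar (coordVec i) (cutoffAt ρ x) y *
      (serVal F L (fieldSeries m (amplitude n m) i) (x, y) *
        Complex.exp (k * truncPhase F L x y))) (fun k hk x hx y hy hxy => ?_) fun k x y hxy => ?_
  · have h1 := key.const_mul (c := fun k => normFactor n k * ((k : ℂ) ^ (m + 1))⁻¹)
      (A := 1) (a := (n : ℤ)) fun k hk => ?_
    · refine (h1.mono (by simp; linarith)).congr fun k hk u hu x hx => ?_
      rw [H.integral_fieldTerm hρ hu.1 hx]
    · rw [norm_mul, one_mul, zpow_natCast]
      exact mul_le_of_le_one_right (by positivity) (norm_inv_natCast_pow_le hk _) |>.trans' (by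
        gcongr; exact norm_normFactor_le n k)
  · have hx' := norm_sub_of_mem_cutoff H hx
    have h2 := norm_cexp_truncPhase_le hρ k hx' hy (hxy.trans (by linarith [hρ.pos]))
    rw [pow_zero, mul_one, Finset.sum_mul]
    refine (norm_sum_le _ _).trans (Finset.sum_le_sum fun i _ => ?_)
    rw [norm_mul, norm_mul]
    calc _ ≤ (C i * (‖y - x‖ ^ 2) ^ (N + 1)) * (B i *
          Real.exp (k * ((φ x - φ y) / 2 - δ / 4 * ‖y - x‖ ^ 2))) := by
          have := hC0 i
          gcongr
          · exact hC i x y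
          · exact hB0 i
          · exact hB i (x, y) ⟨hx', hy⟩
      _ = _ := by ring
  · exact Finset.sum_eq_zero fun i _ => by rw [delBar_cutoffAt_eq_zero hρ.pos _ hxy, zero_mul]

/-- The algorithm stops here: the last amplitude is not divided further, since its prefactor is
already of size k^{n-N-1}. -/
theorem IsPolarizedPhase.isSmall_amplitude (H : IsPolarizedPhase F φ R r δ)
    (hρ : IsCutoffRadius F φ r δ L ρ) (N : ℕ) :
    IsSmall φ r (r / 4) ((n : ℤ) - (N + 1 : ℕ)) (fun k u x => (normFactor n k *
      ((k : ℂ) ^ (N + 1))⁻¹) * ∫ y, u y * (cutoffAt ρ x y * (Complex.exp (k * truncPhase F L x y) *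
        serVal F L (amplitude n (N + 1)) (x, y)))) := by
  obtain ⟨B, hB0, hB⟩ := H.jetDomain.exists_serVal_bound L (amplitude n (N + 1))
  have h1 := H.isSmall_cutoff hρ (g := fun k x y => serVal F L (amplitude n (N + 1)) (x, y))
    (A := B) (a := 0) (b := 0) fun k hk x hx y hy => by
      simpa using hB (x, y) ⟨norm_sub_of_mem_cutoff H hx, hy⟩
  refine (h1.const_mul (c := fun k => normFactor n k * ((k : ℂ) ^ (N + 1))⁻¹) (A := 1)
    (a := (n : ℤ) - (N + 1 : ℕ)) fun k hk => norm_mul_inv_pow_le hk (norm_normFactor_le n k) _).mono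
    (by simp)

/-- The matrix `∂̄θ` of the truncated phase. -/
def truncMatrix (F : Cn n × Cn n → ℂ) (L : ℕ) (x y : Cn n) : Matrix (Fin n) (Fin n) ℂ :=
  Matrix.of fun i j => serVal F L (thetaMatrix n j i) (x, y)

/-- The initial amplitude is the truncation of a formal determinant. The homotopy needs the
determinant of the actual ∂̄-derivatives of the truncated θ instead. -/
theorem IsPolarizedPhase.isSmall_det_sub (H : IsPolarizedPhase F φ R r δ) {N : ℕ}
    (hρ : IsCutoffRadius F φ r δ (2 * (N + 2)) ρ) :
    IsSmall φ r (r / 4) ((n : ℤ) - (N + 1 : ℕ)) (fun k u x => ∫ y, u y *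
      (cutoffAt ρ x y * (Complex.exp (k * truncPhase F (2 * (N + 2)) x y) * (normFactor n k *
        (serVal F (2 * (N + 2)) (amplitude n 0) (x, y) -
          (truncMatrix F (2 * (N + 2)) x y).det))))) := by
  obtain ⟨C, hC⟩ := exists_det_bound H.jetDomain (2 * (N + 2)) (thetaMatrix n)
  refine (H.isSmall_cutoff hρ (A := max C 0) (a := n) (b := N + 2) fun k hk x hx y hy => ?_).mono
    (by push_cast; linarith)
  have e4 := hC (x, y) ⟨norm_sub_of_mem_cutoff H hx, hy⟩
  have e5 : (Matrix.of fun i j => serVal F (2 * (N + 2)) (thetaMatrix n i j) (x, y)).det =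
      (truncMatrix F (2 * (N + 2)) x y).det := by rw [← Matrix.det_transpose]; rfl
  rw [e5] at e4
  rw [norm_mul]
  calc _ ≤ (k : ℝ) ^ n * (max C 0 * (‖y - x‖ ^ 2) ^ (N + 2)) := by
        gcongr
        · exact norm_normFactor_le n k
        · rw [← sq_pow_half]
          exact e4.trans (mul_le_mul_of_nonneg_right (le_max_left _ _) (by positivity))
    _ = _ := by ring

end KernelReduction

/-! ### The model phase and exact reproduction by the mean value property. -/

section ModelPhase

open MeasureTheory

variable {n : ℕ} {F : Cn n × Cn n → ℂ} {φ : Cn n → ℝ} {R r δ ρ c : ℝ} {x y : Cn n} {L : ℕ}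

/-- An explicit derivative along an affine path, visibly continuous in the matrices and exponents;
the divergence form of the same derivative does not show this. -/
theorem hasDerivAt_det_add_mul_exp {ι : Type*} [Fintype ι] [DecidableEq ι] (A B : Matrix ι ι ℂ)
    (a b : ℂ) (t : ℝ) :
    HasDerivAt (fun t : ℝ => (A + (t : ℂ) • B).det * Complex.exp (a + t * b))
      (((∑ j, ∑ i, (A + (t : ℂ) • B).adjugate j i * B i j) + (A + (t : ℂ) • B).det * b) *
        Complex.exp (a + t * b)) t := by
  have hof : HasDerivAt (fun t : ℝ => (t : ℂ)) 1 t := Complex.ofRealCLM.hasDerivAt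
  have h1 : ∀ i j, HasFDerivAt (fun t : ℝ => (A + (t : ℂ) • B) i j)
      (ContinuousLinearMap.toSpanSingleton ℝ (B i j)) t := fun i j => by
    have := (hof.mul_const (B i j)).const_add (A i j)
    rw [one_mul] at this
    exact this.hasFDerivAt
  obtain ⟨f', h2, h3⟩ := exists_hasFDerivAt_det h1
  have h4 := h2.hasDerivAt
  rw [h3] at h4
  have h5 : HasDerivAt (fun t : ℝ => a + t * b) b t := by
    simpa using (hof.mul_const b).const_add a
  refine (h4.mul h5.cexp).congr_deriv ?_
  have h6 : ∀ j, ∑ i, (A + (t : ℂ) • B).adjugate j i * B i j =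
      ((A + (t : ℂ) • B).updateCol j fun i => B i j).det := fun j => sum_adjugate_mul _ _ _
  simp only [h6, ContinuousLinearMap.toSpanSingleton_apply, one_smul]
  ring

/-- The vector `θ` with `θ · w` the first order part of the weight plus `c|w|²`. -/
def modelTheta (F : Cn n × Cn n → ℂ) (c : ℝ) (x : Cn n) (j : Fin n) (z : Cn n) : ℂ :=
  delHol ((coordVec j, 0) : Cn n × Cn n) F (x, x) + c * conj (z j - x j)

theorem contDiff_modelTheta (j : Fin n) : ContDiff ℝ ∞ (modelTheta F c x j) := by
  have h1 : ContDiff ℝ ∞ fun z : Cn n => z j - x j :=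
    contDiff_iff_contDiffAt.2 fun y => contDiffAt_coord_sub x y j
  exact contDiff_const.add (contDiff_const.mul (Complex.conjCLE.contDiff.comp h1))

theorem delBar_modelTheta (i j : Fin n) :
    delBar (coordVec i) (modelTheta F c x j) y = if i = j then (c : ℂ) else 0 := by
  have h1 : HasFDerivAt (fun z : Cn n => conj (z j - x j))
      ((Complex.conjCLE : ℂ →L[ℝ] ℂ).comp ((EuclideanSpace.proj j : Cn n →L[ℂ] ℂ).restrictScalars ℝ))
      y := by
    have h2 : HasFDerivAt (fun z : Cn n => z j - x j)
        ((EuclideanSpace.proj j : Cn n →L[ℂ] ℂ).restrictScalars ℝ) y :=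
      (((EuclideanSpace.proj j : Cn n →L[ℂ] ℂ).restrictScalars ℝ).hasFDerivAt).sub_const _
    exact (Complex.conjCLE : ℂ →L[ℝ] ℂ).hasFDerivAt.comp y h2
  have h3 : HasFDerivAt (modelTheta F c x j) _ y :=
    (h1.const_mul (c : ℂ)).const_add (delHol ((coordVec j, 0) : Cn n × Cn n) F (x, x))
  rw [delBar, h3.fderiv]
  by_cases hij : i = j
  · subst hij
    simp [coordVec]
    linear_combination (-(c : ℂ) / 2) * Complex.I_mul_I
  · simp [coordVec, hij, Ne.symm hij]

/-- Upper second order Taylor bounds on φ show that c = C/2 + δ/4 is large enough: C/2 dominates the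
quadratic part of φ/2 and δ/4 is the required gain. -/
theorem IsPolarizedPhase.exists_modelTheta_re_le (H : IsPolarizedPhase F φ R r δ) :
    ∃ c : ℝ, 0 < c ∧ ∀ x ∈ Metric.ball (0 : Cn n) r, ∀ y ∈ Metric.ball (0 : Cn n) r,
      (-∑ j, modelTheta F c x j y * (y j - x j)).re ≤
        (φ x - φ y) / 2 - δ / 4 * ‖y - x‖ ^ 2 := by
  obtain ⟨C, hC0, hC⟩ := H.weight.exists_linear_bound H.lt
  have hδ := H.delta_pos
  refine ⟨C / 2 + δ / 4, by positivity, fun x hx y hy => ?_⟩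
  have hxR := Metric.ball_subset_ball H.lt.le hx
  have h1 := hC x hx y hy
  rw [H.re_diag hxR, H.re_diag (Metric.ball_subset_ball H.lt.le hy)] at h1
  have h2 : fderiv ℝ F (x, x) (y - x, 0) =
      ∑ j, (y j - x j) * delHol ((coordVec j, 0) : Cn n × Cn n) F (x, x) := by
    rw [fderiv_eq_delHol_add_delBar, (H.weight.flat_left (y - x)).apply_eq_zero hxR, add_zero,
      prod_left_eq_sum, delHol_sum_smul]
    rfl
  have h3 : ∑ j, modelTheta F (C / 2 + δ / 4) x j y * (y j - x j) =
      fderiv ℝ F (x, x) (y - x, 0) + (((C / 2 + δ / 4) * ‖y - x‖ ^ 2 : ℝ) : ℂ) := by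
    rw [h2, EuclideanSpace.norm_sq_eq]
    push_cast
    rw [Finset.mul_sum, ← Finset.sum_add_distrib]
    refine Finset.sum_congr rfl fun j _ => ?_
    have h4 : conj (y j - x j) * (y j - x j) = ((‖(y - x) j‖ : ℝ) : ℂ) ^ 2 := Complex.conj_mul' _
    rw [← h4, modelTheta]
    push_cast
    ring
  rw [h3, Complex.neg_re, Complex.add_re, Complex.ofReal_re]
  linarith

/-- The mean value property evaluates the model integral. -/
theorem integral_model {u : Cn n → ℂ} (hu : DifferentiableOn ℂ u (Metric.ball 0 r))
    (hρ : 0 < ρ) (hρr : 8 * ρ ≤ r) (hx : x ∈ Metric.ball (0 : Cn n) (r / 4)) (k : ℕ) :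
    normFactor n k * ∫ y, u y * (cutoffAt ρ x y * ((c : ℂ) ^ n *
      Complex.exp (-(k * ∑ j, modelTheta F c x j y * (y j - x j))))) =
      (gaussianMass n ρ (k * c) : ℂ) * u x := by
  set a : Fin n → ℂ := fun j => delHol ((coordVec j, 0) : Cn n × Cn n) F (x, x) with ha
  -- The linear part of the phase is holomorphic and is absorbed into u without changing its value
  -- at x; what is left is a radial gaussian.
  set v : Cn n → ℂ := fun z => u z * Complex.exp (-(k * ∑ j, a j * (z j - x j))) with hv
  set g : Cn n → ℂ := fun w =>
    ((radialCutoff ρ w * Real.exp (-(k * c * ‖w‖ ^ 2)) : ℝ) : ℂ) with hg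
  have hsub : Metric.ball x (2 * ρ) ⊆ Metric.ball 0 r := fun z hz => by
    rw [mem_ball_iff_norm] at hz
    rw [mem_ball_zero_iff] at hx ⊢
    have := norm_add_le (z - x) x
    rw [sub_add_cancel] at this
    linarith
  have hvd : DifferentiableOn ℂ v (Metric.ball x (2 * ρ)) := by
    refine (hu.mono hsub).mul fun z _ => DifferentiableAt.differentiableWithinAt ?_
    have := fun j => differentiableAt_coord_sub x z j
    fun_prop
  have hgc : Continuous g := by
    have := (contDiff_radialCutoff (n := n) (ρ := ρ)).continuous
    fun_prop
  have hgs : tsupport g ⊆ Metric.closedBall 0 (3 / 2 * ρ) := by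
    refine closure_minimal (fun w hw => ?_) Metric.isClosed_closedBall
    by_contra h
    rw [mem_closedBall_zero_iff, not_le] at h
    exact hw (by simp only [hg]; rw [radialCutoff_eq_zero hρ h.le]; simp)
  have key := integral_holomorphic_mul_radial hvd hgc
    (hgs.trans (Metric.closedBall_subset_ball (by linarith)))
    ((isCompact_closedBall _ _).of_isClosed_subset (isClosed_tsupport _) hgs)
    fun z w hz => by simp only [hg]; rw [radialCutoff_smul hz, norm_smul, hz, one_mul]
  have hvx : v x = u x := by simp [hv]
  have h1 : ∫ y, u y * (cutoffAt ρ x y * ((c : ℂ) ^ n *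
      Complex.exp (-(k * ∑ j, modelTheta F c x j y * (y j - x j))))) =
      (c : ℂ) ^ n * ∫ w, v (x + w) * g w := by
    rw [← integral_add_left_eq_self _ x, ← integral_const_mul]
    refine integral_congr_ae (Filter.Eventually.of_forall fun w => ?_)
    have h2 : ∑ j, modelTheta F c x j (x + w) * ((x + w) j - x j) =
        ∑ j, a j * ((x + w) j - x j) + ((c * ‖w‖ ^ 2 : ℝ) : ℂ) := by
      rw [EuclideanSpace.norm_sq_eq]
      push_cast
      rw [Finset.mul_sum, ← Finset.sum_add_distrib]
      refine Finset.sum_congr rfl fun j _ => ?_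
      have h4 : conj (w j) * w j = ((‖w j‖ : ℝ) : ℂ) ^ 2 := Complex.conj_mul' _
      rw [← h4, modelTheta, PiLp.add_apply, add_sub_cancel_left]
      ring
    simp only [hv, hg, cutoffAt, h2, add_sub_cancel_left]
    have h3 : -((k : ℂ) * (∑ j, a j * ((x + w) j - x j) + ((c * ‖w‖ ^ 2 : ℝ) : ℂ))) =
        -((k : ℂ) * ∑ j, a j * ((x + w) j - x j)) + ((-(k * c * ‖w‖ ^ 2) : ℝ) : ℂ) := by
      push_cast; ring
    rw [h3, Complex.exp_add]
    push_cast
    ring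
  rw [h1, key, hvx, gaussianMass, normFactor]
  have h5 : ∫ w, g w = ((∫ w : Cn n, radialCutoff ρ w * Real.exp (-(k * c * ‖w‖ ^ 2)) : ℝ) : ℂ) :=
    integral_ofReal
  rw [h5]
  push_cast
  ring

/-- The masses are positive and tend to 1, so the sequence of inverses converges and is bounded. -/
theorem exists_gaussianMass_inv_bound (hρ : 0 < ρ) (hc : 0 < c) :
    ∃ B : ℝ, 0 ≤ B ∧ ∀ k : ℕ, 1 ≤ k → (gaussianMass n ρ (k * c))⁻¹ ≤ B := by
  have hlim : Filter.Tendsto (fun k : ℕ => (gaussianMass n ρ ((k + 1 : ℕ) * c))⁻¹) Filter.atTop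
      (nhds 1) := by
    have h1 : Filter.Tendsto (fun k : ℕ => 1 - gaussianMass n ρ ((k + 1 : ℕ) * c)) Filter.atTop
        (nhds 0) := by
      have h2 : Filter.Tendsto (fun k : ℕ => 2 ^ n *
          Real.exp (-(((k + 1 : ℕ) * c) * (ρ ^ 2 / 2)))) Filter.atTop (nhds (2 ^ n * 0)) := by
        refine Filter.Tendsto.const_mul _ (Real.tendsto_exp_neg_atTop_nhds_zero.comp ?_)
        have h3 : Filter.Tendsto (fun k : ℕ => ((k + 1 : ℕ) : ℝ)) Filter.atTop Filter.atTop :=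
          tendsto_natCast_atTop_atTop.comp (Filter.tendsto_add_atTop_nat 1)
        exact (h3.atTop_mul_const hc).atTop_mul_const (by positivity)
      rw [mul_zero] at h2
      refine squeeze_zero_norm (fun k => ?_) h2
      exact abs_one_sub_gaussianMass_le hρ (by positivity)
    have h4 := (h1.const_sub 1)
    simp only [sub_sub_cancel, sub_zero] at h4
    simpa using h4.inv₀ one_ne_zero
  obtain ⟨B, hB⟩ := hlim.bddAbove_range
  refine ⟨max B 0, le_max_right _ _, fun k hk => le_max_of_le_left ?_⟩
  have := hB ⟨k - 1, rfl⟩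
  simpa [Nat.sub_add_cancel hk] using this

/-- A crude pointwise bound for u itself, obtained by solving the model formula for u(x). It
suffices because it is only multiplied by the exponentially small gaussian defect. -/
theorem IsPolarizedPhase.isSmall_of_model (H : IsPolarizedPhase F φ R r δ)
    (hρ : IsCutoffRadius F φ r δ L ρ) (hc : 0 < c)
    (hm : ∀ x ∈ Metric.ball (0 : Cn n) r, ∀ y ∈ Metric.ball (0 : Cn n) r,
      (-∑ j, modelTheta F c x j y * (y j - x j)).re ≤ (φ x - φ y) / 2 - δ / 4 * ‖y - x‖ ^ 2) :
    IsSmall φ r (r / 4) n (fun _ u x => u x) := by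
  obtain ⟨B, hB0, hB⟩ := exists_gaussianMass_inv_bound (n := n) hρ.pos hc
  have key := H.isSmall_of_truncPhase hρ (A := c ^ n) (a := 0) (b := 0)
    (h := fun k x y => cutoffAt ρ x y * ((c : ℂ) ^ n *
      Complex.exp (-(k * ∑ j, modelTheta F c x j y * (y j - x j)))))
    (fun k hk x hx y hy hxy => ?_) fun k x y hxy => ?_
  · have h1 := key.const_mul (c := fun k => ((gaussianMass n ρ (k * c))⁻¹ : ℝ) * normFactor n k)
      (A := B) (a := (n : ℤ)) fun k hk => ?_
    · refine (h1.mono (by simp)).congr fun k hk u hu x hx => ?_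
      have hk0 : (0 : ℝ) < k := by exact_mod_cast hk
      have h2 := gaussianMass_pos (n := n) hρ.pos (mul_pos hk0 hc)
      have h3 : (gaussianMass n ρ (k * c) : ℂ) ≠ 0 := by exact_mod_cast h2.ne'
      simp only
      rw [mul_assoc, integral_model hu.1 hρ.pos hρ.le hx]
      push_cast
      rw [← mul_assoc, inv_mul_cancel₀ h3, one_mul]
    · have hk0 : (0 : ℝ) < k := by exact_mod_cast hk
      have h2 := gaussianMass_pos (n := n) hρ.pos (mul_pos hk0 hc)
      rw [norm_mul, Complex.norm_real, Real.norm_of_nonneg (by positivity), zpow_natCast]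
      gcongr
      · exact hB k hk
      · exact norm_normFactor_le n k
  · have hx' := norm_sub_of_mem_cutoff H hx
    rw [norm_mul, norm_mul, norm_pow, Complex.norm_real, Real.norm_of_nonneg hc.le, pow_zero,
      pow_zero, one_mul, mul_one, Complex.norm_exp]
    calc _ ≤ 1 * (c ^ n * Real.exp (k * ((φ x - φ y) / 2 - δ / 4 * ‖y - x‖ ^ 2))) := by
          gcongr
          · exact norm_cutoffAt_le
          · rw [← mul_neg, ← Complex.ofReal_natCast, Complex.re_ofReal_mul]
            gcongr
            exact hm x hx' y hy
      _ = _ := one_mul _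
  · simp only [cutoffAt_eq_zero hρ.pos hxy, zero_mul]

theorem IsPolarizedPhase.isSmall_gaussian_defect (H : IsPolarizedPhase F φ R r δ)
    (hρ : IsCutoffRadius F φ r δ L ρ) (hc : 0 < c)
    (hm : ∀ x ∈ Metric.ball (0 : Cn n) r, ∀ y ∈ Metric.ball (0 : Cn n) r,
      (-∑ j, modelTheta F c x j y * (y j - x j)).re ≤ (φ x - φ y) / 2 - δ / 4 * ‖y - x‖ ^ 2)
    (N : ℕ) : IsSmall φ r (r / 4) ((n : ℤ) - (N + 1 : ℕ))
      (fun k u x => (1 - (gaussianMass n ρ (k * c) : ℂ)) * u x) := by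
  have hρ0 := hρ.pos
  obtain ⟨C, hC0, hC⟩ := exists_pow_mul_exp_le (δ := c * (ρ ^ 2 / 2)) (by positivity) (N + 1)
  have h1 := (H.isSmall_of_model hρ hc hm).const_mul
    (c := fun k => 1 - (gaussianMass n ρ (k * c) : ℂ)) (A := 2 ^ n * C) (a := -((N + 1 : ℕ) : ℤ))
    fun k hk => ?_
  · exact h1.mono (by linarith)
  · have hk0 : (0 : ℝ) < k := by exact_mod_cast hk
    have h2 := abs_one_sub_gaussianMass_le (n := n) hρ.pos (mul_pos hk0 hc)
    have h3 := hC k hk 1 zero_le_one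
    rw [one_pow, one_mul, mul_one] at h3
    rw [← Complex.ofReal_one, ← Complex.ofReal_sub, Complex.norm_real, Real.norm_eq_abs, zpow_neg,
      zpow_natCast]
    calc _ ≤ _ := h2
      _ = 2 ^ n * Real.exp (-(k * (c * (ρ ^ 2 / 2)))) := by ring_nf
      _ ≤ 2 ^ n * (C / (k : ℝ) ^ (N + 1)) := by gcongr
      _ = _ := by ring

end ModelPhase

/-! ### Deformation of the truncated phase to the model phase. -/

section Deformation

open MeasureTheory

variable {n : ℕ} {F : Cn n × Cn n → ℂ} {φ : Cn n → ℝ} {R r δ ρ c : ℝ} {x y : Cn n} {L : ℕ}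

/-- An entry of the adjugate is a determinant with entries at most max(B, 1), one column being a
basis vector. -/
theorem exists_adjugate_bound (n : ℕ) (B : ℝ) :
    ∃ C : ℝ, 0 ≤ C ∧ ∀ A : Matrix (Fin n) (Fin n) ℂ, (∀ i j, ‖A i j‖ ≤ B) →
      ∀ i j, ‖A.adjugate j i‖ ≤ C := by
  refine ⟨(Fintype.card (Fin n)).factorial • (max B 1) ^ Fintype.card (Fin n), by positivity,
    fun A hA i j => ?_⟩
  rw [adjugate_eq_det_updateCol]
  refine Matrix.det_le (abv := NormedField.toAbsoluteValue ℂ) fun a b => ?_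
  change ‖(A.updateCol j (Pi.single i (1 : ℂ))) a b‖ ≤ max B 1
  rw [Matrix.updateCol_apply]
  split_ifs
  · rw [Pi.single_apply]
    split_ifs <;> simp
  · exact (hA a b).trans (le_max_left _ _)

/-- The vector interpolating between the truncated phase and the model phase. -/
def deformTheta (F : Cn n × Cn n → ℂ) (L : ℕ) (c t : ℝ) (x : Cn n) (j : Fin n) (z : Cn n) : ℂ :=
  serVal F L (thetaSeries j) (x, z) +
    t * (modelTheta F c x j z - serVal F L (thetaSeries j) (x, z))

/-- The primitive of the variation of the deformed integrand. -/
def deformField (F : Cn n × Cn n → ℂ) (L : ℕ) (c t : ℝ) (k : ℕ) (x : Cn n) (i : Fin n) (z : Cn n) :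
    ℂ :=
  (∑ j, (Matrix.of fun i j => delBar (coordVec i) (deformTheta F L c t x j) z).adjugate j i *
    (modelTheta F c x j z - serVal F L (thetaSeries j) (x, z))) *
      Complex.exp (-(k * ∑ j, deformTheta F L c t x j z * (z j - x j)))

/-- The deformed integrand. -/
def deformKernel (F : Cn n × Cn n → ℂ) (L : ℕ) (c t : ℝ) (k : ℕ) (x z : Cn n) : ℂ :=
  (Matrix.of fun i j => delBar (coordVec i) (deformTheta F L c t x j) z).det *
    Complex.exp (-(k * ∑ j, deformTheta F L c t x j z * (z j - x j)))

theorem IsPolarizedPhase.contDiffAt_deformTheta (H : IsPolarizedPhase F φ R r δ)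
    (hx : x ∈ Metric.ball (0 : Cn n) r) (hy : y ∈ Metric.ball (0 : Cn n) r) (t : ℝ) (j : Fin n) :
    ContDiffAt ℝ ∞ (deformTheta F L c t x j) y :=
  (H.contDiffAt_serVal hx hy L _).add (contDiffAt_const.mul
    ((contDiff_modelTheta j).contDiffAt.sub (H.contDiffAt_serVal hx hy L _)))

theorem IsPolarizedPhase.delBar_deformTheta (H : IsPolarizedPhase F φ R r δ)
    (hx : x ∈ Metric.ball (0 : Cn n) r) (hy : y ∈ Metric.ball (0 : Cn n) r) (t : ℝ) (i j : Fin n) :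
    delBar (coordVec i) (deformTheta F L c t x j) y =
      serVal F L (thetaMatrix n j i) (x, y) + t * ((if i = j then (c : ℂ) else 0) -
        serVal F L (thetaMatrix n j i) (x, y)) := by
  have h1 := (H.contDiffAt_serVal hx hy L (thetaSeries j)).differentiableAt (n := ∞) (by simp)
  have h2 := (contDiff_modelTheta (F := F) (c := c) (x := x) j).contDiffAt (x := y)
    |>.differentiableAt (n := ∞) (by simp)
  have h3 : deformTheta F L c t x j = fun z => (1 - t : ℂ) * serVal F L (thetaSeries j) (x, z) +
      t * modelTheta F c x j z := by funext z; rw [deformTheta]; ring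
  have h4 : delBar (coordVec i) (fun z => serVal F L (thetaSeries j) (x, z)) y =
      serVal F L (thetaMatrix n j i) (x, y) := H.delBar_serVal hx hy L _ i
  rw [h3, delBar_eq_wirt, wirt_add (h1.const_mul _) (h2.const_mul _), wirt_const_mul _ h1,
    wirt_const_mul _ h2, ← delBar_eq_wirt, delBar_modelTheta, h4]
  ring

theorem IsPolarizedPhase.contDiffAt_deformField (H : IsPolarizedPhase F φ R r δ)
    (hx : x ∈ Metric.ball (0 : Cn n) r) (hy : y ∈ Metric.ball (0 : Cn n) r) (t : ℝ) (k : ℕ)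
    (i : Fin n) : ContDiffAt ℝ ∞ (deformField F L c t k x i) y := by
  have h1 := fun j => H.contDiffAt_deformTheta (L := L) (c := c) hx hy t j
  refine ContDiffAt.mul (ContDiffAt.sum fun j _ => ContDiffAt.mul ?_
    ((contDiff_modelTheta j).contDiffAt.sub (H.contDiffAt_serVal hx hy L _))) ?_
  · exact contDiffAt_adjugate (fun i j => contDiffAt_wirt (h1 j)) i j
  · exact ContDiffAt.cexp (contDiffAt_const.mul (ContDiffAt.sum fun j _ => (h1 j).mul
      (contDiffAt_coord_sub x y j))).neg

theorem IsPolarizedPhase.exists_deformField_bound (H : IsPolarizedPhase F φ R r δ)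
    (hρ : IsCutoffRadius F φ r δ L ρ)
    (hm : ∀ x ∈ Metric.ball (0 : Cn n) r, ∀ y ∈ Metric.ball (0 : Cn n) r,
      (-∑ j, modelTheta F c x j y * (y j - x j)).re ≤ (φ x - φ y) / 2 - δ / 4 * ‖y - x‖ ^ 2) :
    ∃ C : ℝ, 0 ≤ C ∧ ∀ t ∈ Set.Icc (0 : ℝ) 1, ∀ k : ℕ, ∀ x ∈ Metric.ball (0 : Cn n) r,
      ∀ y ∈ Metric.ball (0 : Cn n) r, ‖y - x‖ ≤ 2 * ρ → ∀ i, ‖deformField F L c t k x i y‖ ≤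
        C * Real.exp (k * ((φ x - φ y) / 2 - δ / 4 * ‖y - x‖ ^ 2)) := by
  choose M hM0 hM using fun i j => H.jetDomain.exists_serVal_bound L (thetaMatrix n j i)
  choose T hT0 hT using fun j => H.jetDomain.exists_serVal_bound L (thetaSeries (n := n) j)
  have hcd : ∀ j : Fin n, Continuous fun p : Cn n × Cn n =>
      delHol ((coordVec j, 0) : Cn n × Cn n) F (p.1, p.1) := fun j => by
    rw [delHol_eq_wirt]
    exact (contDiff_wirt H.weight.smooth).continuous.comp (by fun_prop)
  choose D hD0 hD using fun j => exists_bound_biball H.lt (hcd j).continuousOn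
  set B : ℝ := |c| + ∑ i, ∑ j, M i j with hB
  obtain ⟨A, hA0, hA⟩ := exists_adjugate_bound n B
  refine ⟨∑ j, A * (D j + |c| + T j), Finset.sum_nonneg fun j _ => mul_nonneg hA0
    (by have := hD0 j; have := hT0 j; positivity), fun t ht k x hx y hy hxy i => ?_⟩
  have hMle : ∀ i j, M i j ≤ ∑ i, ∑ j, M i j := fun i j =>
    (Finset.single_le_sum (fun j _ => hM0 i j) (Finset.mem_univ j)).trans
      (Finset.single_le_sum (f := fun i => ∑ j, M i j)
        (fun i _ => Finset.sum_nonneg fun j _ => hM0 i j) (Finset.mem_univ i))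
  have hent : ∀ i j, ‖(Matrix.of fun i j => delBar (coordVec i) (deformTheta F L c t x j) y) i j‖ ≤
      B := fun i j => by
    have e1 : delBar (coordVec i) (deformTheta F L c t x j) y =
        ((1 - t : ℝ) : ℂ) * serVal F L (thetaMatrix n j i) (x, y) +
          (t : ℂ) * (if i = j then (c : ℂ) else 0) := by
      rw [H.delBar_deformTheta hx hy]; push_cast; ring
    rw [Matrix.of_apply, e1]
    refine (norm_add_le _ _).trans ?_
    rw [norm_mul, norm_mul, Complex.norm_real, Complex.norm_real,
      Real.norm_of_nonneg (by linarith [ht.2] : 0 ≤ 1 - t), Real.norm_of_nonneg ht.1]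
    have e2 : ‖(if i = j then (c : ℂ) else 0)‖ ≤ |c| := by split_ifs <;> simp
    have e3 := (hM i j (x, y) ⟨hx, hy⟩).trans (hMle i j)
    have e4 : 0 ≤ ‖serVal F L (thetaMatrix n j i) (x, y)‖ := norm_nonneg _
    have e5 : 0 ≤ ‖(if i = j then (c : ℂ) else 0)‖ := norm_nonneg _
    nlinarith [ht.1, ht.2]
  have hτ : ∀ j, ‖modelTheta F c x j y - serVal F L (thetaSeries j) (x, y)‖ ≤ D j + |c| + T j :=
    fun j => by
      refine (norm_sub_le _ _).trans (add_le_add ((norm_add_le _ _).trans (add_le_add ?_ ?_)) ?_)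
      · exact hD j (x, x) ⟨hx, hx⟩
      · rw [norm_mul, Complex.norm_real, Real.norm_eq_abs, RCLike.norm_conj]
        refine mul_le_of_le_one_right (abs_nonneg _) ?_
        exact (PiLp.norm_apply_le (y - x) j).trans (H.jetDomain.small (x, y) ⟨hx, hy⟩)
      · exact hT j (x, y) ⟨hx, hy⟩
  -- The deformed phase is a convex combination of the truncated and the model phase, and both obey
  -- the same bound.
  have hre : (-((k : ℂ) * ∑ j, deformTheta F L c t x j y * (y j - x j))).re ≤
      k * ((φ x - φ y) / 2 - δ / 4 * ‖y - x‖ ^ 2) := by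
    have e1 : -((k : ℂ) * ∑ j, deformTheta F L c t x j y * (y j - x j)) =
        ((k : ℝ) : ℂ) * (((1 - t : ℝ) : ℂ) * truncPhase F L x y +
          (t : ℂ) * -∑ j, modelTheta F c x j y * (y j - x j)) := by
      rw [truncPhase, Complex.ofReal_natCast, ← mul_neg]
      congr 1
      simp only [deformTheta, Finset.mul_sum, ← Finset.sum_neg_distrib, ← Finset.sum_add_distrib]
      refine Finset.sum_congr rfl fun j _ => ?_
      push_cast; ring
    rw [e1, Complex.re_ofReal_mul, Complex.add_re, Complex.re_ofReal_mul, Complex.re_ofReal_mul]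
    have e2 := hρ.re_le x hx y hy hxy
    have e3 := hm x hx y hy
    have h0 := ht.1
    have h1 : 0 ≤ 1 - t := by linarith [ht.2]
    have e4 := mul_le_mul_of_nonneg_left e2 h1
    have e5 := mul_le_mul_of_nonneg_left e3 h0
    refine mul_le_mul_of_nonneg_left ?_ (Nat.cast_nonneg k)
    linarith
  rw [deformField, norm_mul, Complex.norm_exp]
  refine mul_le_mul ?_ (Real.exp_le_exp.2 hre) (Real.exp_nonneg _) (Finset.sum_nonneg fun j _ =>
    mul_nonneg hA0 (by have := hD0 j; have := hT0 j; positivity))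
  refine (norm_sum_le _ _).trans (Finset.sum_le_sum fun j _ => ?_)
  rw [norm_mul]
  refine mul_le_mul ?_ ?_ (norm_nonneg _) hA0
  · exact hA _ hent i j
  · exact hτ j

theorem IsPolarizedPhase.norm_integral_deformKernel_sub_le (H : IsPolarizedPhase F φ R r δ)
    (hρ : IsCutoffRadius F φ r δ L ρ) {u : Cn n → ℂ} (hu : DifferentiableOn ℂ u (Metric.ball 0 r))
    (hx : x ∈ Metric.ball (0 : Cn n) (r / 4)) (k : ℕ) {B : ℝ}
    (hB : ∀ t ∈ Set.Icc (0 : ℝ) 1, ‖∫ y, u y * ∑ i, delBar (coordVec i) (cutoffAt ρ x) y *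
      deformField F L c t k x i y‖ ≤ B) :
    ‖(∫ y, u y * (cutoffAt ρ x y * deformKernel F L c 1 k x y)) -
      ∫ y, u y * (cutoffAt ρ x y * deformKernel F L c 0 k x y)‖ ≤ B := by
  have hx' := norm_sub_of_mem_cutoff H hx
  set K := Metric.closedBall x (3 / 2 * ρ) with hK
  have hKr : K ⊆ Metric.ball 0 r := (closedBall_subset_of_cutoff hρ.pos hρ.le hx).trans
    (Metric.ball_subset_ball (by linarith [H.pos]))
  set A : Cn n → Matrix (Fin n) (Fin n) ℂ := fun y =>
    Matrix.of fun i j => serVal F L (thetaMatrix n j i) (x, y) with hA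
  set A' : Cn n → Matrix (Fin n) (Fin n) ℂ := fun y =>
    Matrix.of fun i j => (if i = j then (c : ℂ) else 0) - serVal F L (thetaMatrix n j i) (x, y)
    with hA'
  set a : Cn n → ℂ := fun y => k * truncPhase F L x y with ha
  set b : Cn n → ℂ := fun y =>
    -(k * ∑ j, (modelTheta F c x j y - serVal F L (thetaSeries j) (x, y)) * (y j - x j)) with hb
  set d : ℝ → Cn n → ℂ := fun t y => ((∑ j, ∑ i, (A y + (t : ℂ) • A' y).adjugate j i * A' y i j) +
    (A y + (t : ℂ) • A' y).det * b y) * Complex.exp (a y + t * b y) with hd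
  have hker : ∀ t : ℝ, ∀ y ∈ Metric.ball (0 : Cn n) r, deformKernel F L c t k x y =
      (A y + (t : ℂ) • A' y).det * Complex.exp (a y + t * b y) := fun t y hy => by
    rw [deformKernel]
    congr 2
    · ext i j
      simp only [Matrix.of_apply, Matrix.add_apply, Matrix.smul_apply, smul_eq_mul, hA, hA']
      exact H.delBar_deformTheta hx' hy t i j
    · simp only [ha, hb, truncPhase, deformTheta, ← mul_neg, Finset.mul_sum,
        ← Finset.sum_neg_distrib, ← Finset.sum_add_distrib]
      exact Finset.sum_congr rfl fun j _ => by ring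
  have hder : ∀ t : ℝ, ∀ y ∈ Metric.ball (0 : Cn n) r,
      HasDerivAt (fun t => deformKernel F L c t k x y) (d t y) t := fun t y hy => by
    refine (hasDerivAt_det_add_mul_exp (A y) (A' y) (a y) (b y) t).congr_of_eventuallyEq ?_
    exact Filter.Eventually.of_forall fun t => hker t y hy
  -- The explicit derivative and the divergence are derivatives of the same function of t, hence
  -- equal; the first gives continuity and the second integration by parts.
  have hdiv : ∀ t : ℝ, ∀ y ∈ Metric.ball (0 : Cn n) r,
      d t y = ∑ i, delBar (coordVec i) (deformField F L c t k x i) y := fun t y hy =>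
    (hder t y hy).unique (hasDerivAt_det_mul_exp (k : ℂ) t
      (fun j => H.contDiffAt_serVal hx' hy L (thetaSeries j))
      fun j => (contDiff_modelTheta j).contDiffAt.sub (H.contDiffAt_serVal hx' hy L _))
  have hsc : ∀ G : JetSeries n, ContinuousOn (fun y => serVal F L G (x, y)) K := fun G y hy =>
    (H.contDiffAt_serVal hx' (hKr hy) L G).continuousAt.continuousWithinAt
  have hmc : ∀ j, Continuous (modelTheta F c x j) := fun j => (contDiff_modelTheta j).continuous
  have hwc : ∀ j, Continuous fun y : Cn n => y j - x j := fun j => by fun_prop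
  have hAc : ContinuousOn A K := continuousOn_pi.2 fun i => continuousOn_pi.2 fun j => hsc _
  have hA'c : ContinuousOn A' K := continuousOn_pi.2 fun i => continuousOn_pi.2 fun j =>
    continuousOn_const.sub (hsc _)
  have hac : ContinuousOn a K := continuousOn_const.mul fun y hy =>
    (H.contDiffAt_truncPhase hx' (hKr hy) L).continuousAt.continuousWithinAt
  have hbc : ContinuousOn b K := (continuousOn_const.mul (continuousOn_finsetSum _ fun j _ =>
    ((hmc j).continuousOn.sub (hsc _)).mul (hwc j).continuousOn)).neg
  have hfst : ContinuousOn (fun p : ℝ × Cn n => (p.1 : ℂ)) (Set.univ ×ˢ K) := by fun_prop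
  have hsnd : Set.MapsTo (fun p : ℝ × Cn n => p.2) (Set.univ ×ˢ K) K := fun p hp => hp.2
  have hA2 := hAc.comp (f := fun p : ℝ × Cn n => p.2) continuousOn_snd hsnd
  have hA'2 := hA'c.comp (f := fun p : ℝ × Cn n => p.2) continuousOn_snd hsnd
  have ha2 := hac.comp (f := fun p : ℝ × Cn n => p.2) continuousOn_snd hsnd
  have hb2 := hbc.comp (f := fun p : ℝ × Cn n => p.2) continuousOn_snd hsnd
  have hAA : ContinuousOn (fun p : ℝ × Cn n => A p.2 + (p.1 : ℂ) • A' p.2) (Set.univ ×ˢ K) :=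
    hA2.add (hfst.smul hA'2)
  have hdet : ContinuousOn (fun p : ℝ × Cn n => (A p.2 + (p.1 : ℂ) • A' p.2).det)
      (Set.univ ×ˢ K) := (Continuous.matrix_det continuous_id).comp_continuousOn hAA
  have hadj : ∀ i j, ContinuousOn (fun p : ℝ × Cn n =>
      (A p.2 + (p.1 : ℂ) • A' p.2).adjugate j i) (Set.univ ×ˢ K) := fun i j =>
    ((Continuous.matrix_adjugate continuous_id).matrix_elem j i).comp_continuousOn hAA
  have hexp : ContinuousOn (fun p : ℝ × Cn n => Complex.exp (a p.2 + p.1 * b p.2))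
      (Set.univ ×ˢ K) := (ha2.add (hfst.mul hb2)).cexp
  have hdc : ContinuousOn (fun p : ℝ × Cn n => d p.1 p.2) (Set.univ ×ˢ K) := by
    refine ContinuousOn.mul (ContinuousOn.add (continuousOn_finsetSum _ fun j _ =>
      continuousOn_finsetSum _ fun i _ => (hadj i j).mul ?_) (hdet.mul hb2)) hexp
    exact (continuousOn_pi.1 (continuousOn_pi.1 hA'2 i) j)
  have huK : ContinuousOn u K := hu.continuousOn.mono hKr
  have hcc : Continuous (cutoffAt ρ x) := contDiff_cutoffAt.continuous
  have hu2 := huK.comp (f := fun p : ℝ × Cn n => p.2) continuousOn_snd hsnd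
  have hz : ∀ y ∉ K, cutoffAt ρ x y = 0 := fun y hy => by
    rw [hK, mem_closedBall_iff_norm, not_le] at hy
    exact cutoffAt_eq_zero hρ.pos hy
  refine norm_integral_sub_le_of_hasDerivAt
    (h := fun t y => u y * (cutoffAt ρ x y * deformKernel F L c t k x y))
    (h' := fun t y => u y * (cutoffAt ρ x y * d t y)) (isCompact_closedBall x (3 / 2 * ρ))
    (fun t => ?_) ?_ (fun t y hy => ?_) (fun t y hy => ?_) (fun t y hy => ?_) fun t ht => ?_
  · exact huK.mul (hcc.continuousOn.mul (((hdet.mul hexp).comp (f := fun y : Cn n => (t, y))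
      (by fun_prop) fun y hy => ⟨Set.mem_univ _, hy⟩).congr fun y hy => hker t y (hKr hy)))
  · exact hu2.mul ((hcc.comp continuous_snd).continuousOn.mul hdc)
  · rw [hz y hy]; simp
  · rw [hz y hy]; simp
  · exact ((hder t y (hKr hy)).const_mul _).const_mul _
  · have h1 := integral_cutoffAt_mul_delBar hu hρ.pos hρ.le hx
      (g := fun i => deformField F L c t k x i)
      fun i y hy => H.contDiffAt_deformField hx' hy t k i
    have h2 : ∫ y, u y * (cutoffAt ρ x y * d t y) = ∫ y, u y * (cutoffAt ρ x y *
        ∑ i, delBar (coordVec i) (deformField F L c t k x i) y) := by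
      refine integral_congr_ae (Filter.Eventually.of_forall fun y => ?_)
      by_cases hy : y ∈ K
      · simp only [hdiv t y (hKr hy)]
      · simp only [hz y hy, zero_mul]
    rw [h2, h1, norm_neg]
    exact hB t ht

/-- The t-derivative integrates by parts to a term containing ∂̄ of the cut-off, supported at |y -
x| ≥ ρ, where the gaussian factor beats every power of k uniformly in t. -/
theorem IsPolarizedPhase.isSmall_deform (H : IsPolarizedPhase F φ R r δ)
    (hρ : IsCutoffRadius F φ r δ L ρ)
    (hm : ∀ x ∈ Metric.ball (0 : Cn n) r, ∀ y ∈ Metric.ball (0 : Cn n) r,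
      (-∑ j, modelTheta F c x j y * (y j - x j)).re ≤ (φ x - φ y) / 2 - δ / 4 * ‖y - x‖ ^ 2)
    (N : ℕ) : IsSmall φ r (r / 4) ((n : ℤ) - (N + 1 : ℕ)) (fun k u x => normFactor n k *
      ((∫ y, u y * (cutoffAt ρ x y * deformKernel F L c 1 k x y)) -
        ∫ y, u y * (cutoffAt ρ x y * deformKernel F L c 0 k x y))) := by
  obtain ⟨P, hP0, hP⟩ := H.exists_pairing_bound
  obtain ⟨D, hD0, hD⟩ := H.exists_deformField_bound hρ hm
  choose C hC0 hC using fun i => exists_delBar_cutoffAt_bound hρ.pos (coordVec i : Cn n) (N + 1)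
  have hδ := H.delta_pos
  obtain ⟨E, hE0, hE⟩ := exists_pow_mul_exp_le (δ := δ / 4) (by positivity) (N + 1)
  have hS0 : 0 ≤ ∑ i, C i := Finset.sum_nonneg fun i _ => hC0 i
  have key : IsSmall φ r (r / 4) (-((N + 1 : ℕ) : ℤ)) (fun k u x =>
      ((∫ y, u y * (cutoffAt ρ x y * deformKernel F L c 1 k x y)) -
        ∫ y, u y * (cutoffAt ρ x y * deformKernel F L c 0 k x y))) := by
    refine ⟨P * ((∑ i, C i) * D * E), fun k hk u hu x hx => ?_⟩
    have hx' := norm_sub_of_mem_cutoff H hx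
    have h1 := H.norm_integral_deformKernel_sub_le hρ (c := c) hu.1 hx k
      (B := P * ((∑ i, C i) * D * (E / (k : ℝ) ^ (N + 1))) * Real.exp (k * φ x / 2) *
        weightedNorm φ r k u) fun t ht => ?_
    · refine h1.trans (le_of_eq ?_)
      rw [zpow_neg, zpow_natCast]; ring
    · refine hP k u hu x _ _ (fun y hy => ?_) fun y hy => ?_
      · rcases le_or_gt ‖y - x‖ (3 / 2 * ρ) with hq | hq
        · rw [Finset.sum_mul, Finset.sum_mul, Finset.sum_mul]
          refine (norm_sum_le _ _).trans (Finset.sum_le_sum fun i _ => ?_)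
          rw [norm_mul]
          have e1 : (k : ℝ) * ((φ x - φ y) / 2 - δ / 4 * ‖y - x‖ ^ 2) =
            -(k * (δ / 4 * ‖y - x‖ ^ 2)) + k * ((φ x - φ y) / 2) := by ring
          have e2 := hD t ht k x hx' y hy (by linarith [hρ.pos]) i
          rw [e1, Real.exp_add] at e2
          have := hC0 i
          calc _ ≤ (C i * (‖y - x‖ ^ 2) ^ (N + 1)) * (D *
                (Real.exp (-(k * (δ / 4 * ‖y - x‖ ^ 2))) * Real.exp (k * ((φ x - φ y) / 2)))) := by
                gcongr
                exact hC i x y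
            _ = C i * D * ((‖y - x‖ ^ 2) ^ (N + 1) * Real.exp (-(k * (δ / 4 * ‖y - x‖ ^ 2)))) *
                Real.exp (k * ((φ x - φ y) / 2)) := by ring
            _ ≤ _ := by
                gcongr
                exact hE k hk _ (sq_nonneg _)
        · rw [Finset.sum_eq_zero fun i _ => by rw [delBar_cutoffAt_eq_zero hρ.pos _ hq, zero_mul],
            norm_zero]
          positivity
      · refine Finset.sum_eq_zero fun i _ => ?_
        rw [delBar_cutoffAt_eq_zero hρ.pos, zero_mul]
        by_contra hcon
        rw [not_lt] at hcon
        have h1 := closedBall_subset_of_cutoff hρ.pos hρ.le hx (mem_closedBall_iff_norm.2 hcon)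
        exact hy (Metric.ball_subset_ball (by linarith [H.pos]) h1)
  refine (key.const_mul (c := normFactor n) (A := 1) (a := (n : ℤ)) fun k hk => ?_).mono
    (by linarith)
  rw [one_mul, zpow_natCast]
  exact norm_normFactor_le n k

theorem IsPolarizedPhase.deformKernel_zero (H : IsPolarizedPhase F φ R r δ)
    (hx : x ∈ Metric.ball (0 : Cn n) r) (hy : y ∈ Metric.ball (0 : Cn n) r) (k : ℕ) :
    deformKernel F L c 0 k x y =
      (truncMatrix F L x y).det * Complex.exp (k * truncPhase F L x y) := by
  rw [deformKernel]
  congr 2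
  · ext i j
    rw [Matrix.of_apply, H.delBar_deformTheta hx hy]
    simp [truncMatrix]
  · simp [truncPhase, deformTheta]

theorem IsPolarizedPhase.deformKernel_one (H : IsPolarizedPhase F φ R r δ)
    (hx : x ∈ Metric.ball (0 : Cn n) r) (hy : y ∈ Metric.ball (0 : Cn n) r) (k : ℕ) :
    deformKernel F L c 1 k x y = (c : ℂ) ^ n *
      Complex.exp (-(k * ∑ j, modelTheta F c x j y * (y j - x j))) := by
  rw [deformKernel]
  congr 1
  · have : (Matrix.of fun i j => delBar (coordVec i) (deformTheta F L c 1 x j) y) =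
        (c : ℂ) • (1 : Matrix (Fin n) (Fin n) ℂ) := by
      ext i j
      rw [Matrix.of_apply, H.delBar_deformTheta hx hy]
      simp [Matrix.one_apply]
    rw [this]; simp
  · simp [deformTheta]

end Deformation

/-! ### Assembly of the reproducing property. -/

section Reproduction

open MeasureTheory

variable {n : ℕ} {F : Cn n × Cn n → ℂ} {φ : Cn n → ℝ} {R r δ ρ c ε : ℝ} {x y : Cn n} {L : ℕ}

theorem IsSmall.neg {s : ℤ} {Q : ℕ → (Cn n → ℂ) → Cn n → ℂ} (hQ : IsSmall φ r ε s Q) :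
    IsSmall φ r ε s (fun k u x => -Q k u x) := by
  obtain ⟨C, hC⟩ := hQ
  exact ⟨C, fun k hk u hu x hx => by rw [norm_neg]; exact hC k hk u hu x hx⟩

/-- Integration of a holomorphic function against a cut-off weight. -/
def cutoffIntegral (ρ : ℝ) (u : Cn n → ℂ) (x : Cn n) (g : Cn n → ℂ) : ℂ :=
  ∫ y, u y * (cutoffAt ρ x y * g y)

theorem cutoffIntegral_const_mul (u g : Cn n → ℂ) (a : ℂ) :
    cutoffIntegral ρ u x (fun y => a * g y) = a * cutoffIntegral ρ u x g := by
  rw [cutoffIntegral, cutoffIntegral, ← integral_const_mul]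
  exact integral_congr_ae (Filter.Eventually.of_forall fun y => by ring)

theorem neg_mul_cutoffIntegral (u g : Cn n → ℂ) (a : ℂ) :
    -(a * cutoffIntegral ρ u x g) = cutoffIntegral ρ u x (fun y => (-a) * g y) := by
  rw [cutoffIntegral_const_mul, neg_mul]

theorem cutoffIntegral_add {u : Cn n → ℂ} (hu : DifferentiableOn ℂ u (Metric.ball 0 r))
    (hρ : 0 < ρ) (hρr : 8 * ρ ≤ r) (hx : x ∈ Metric.ball (0 : Cn n) (r / 4)) {g h : Cn n → ℂ}
    (hg : ContinuousOn g (Metric.ball 0 r)) (hh : ContinuousOn h (Metric.ball 0 r)) :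
    cutoffIntegral ρ u x (g + h) = cutoffIntegral ρ u x g + cutoffIntegral ρ u x h := by
  rw [cutoffIntegral, cutoffIntegral, cutoffIntegral, ← integral_add
    (integrable_mul_cutoffAt hu hρ hρr hx hg) (integrable_mul_cutoffAt hu hρ hρr hx hh)]
  exact integral_congr_ae (Filter.Eventually.of_forall fun y => by
    simp only [Pi.add_apply]; ring)

theorem cutoffIntegral_sum {ι : Type*} (t : Finset ι) {u : Cn n → ℂ}
    (hu : DifferentiableOn ℂ u (Metric.ball 0 r))
    (hρ : 0 < ρ) (hρr : 8 * ρ ≤ r) (hx : x ∈ Metric.ball (0 : Cn n) (r / 4)) {g : ι → Cn n → ℂ}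
    (hg : ∀ i ∈ t, ContinuousOn (g i) (Metric.ball 0 r)) :
    cutoffIntegral ρ u x (fun y => ∑ i ∈ t, g i y) = ∑ i ∈ t, cutoffIntegral ρ u x (g i) := by
  simp only [cutoffIntegral]
  rw [← integral_finsetSum _ fun i hi => integrable_mul_cutoffAt hu hρ hρr hx (hg i hi)]
  exact integral_congr_ae (Filter.Eventually.of_forall fun y => by
    simp only [Finset.mul_sum])

theorem cutoffIntegral_congr {u g h : Cn n → ℂ} (hρ : 0 < ρ) (hρr : 8 * ρ ≤ r)
    (hx : x ∈ Metric.ball (0 : Cn n) (r / 4))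
    (hgh : ∀ y ∈ Metric.ball (0 : Cn n) r, g y = h y) :
    cutoffIntegral ρ u x g = cutoffIntegral ρ u x h := by
  refine integral_congr_ae (Filter.Eventually.of_forall fun y => ?_)
  by_cases hy : y ∈ Metric.ball (0 : Cn n) r
  · simp only [hgh y hy]
  · have : cutoffAt ρ x y = 0 :=
      image_eq_zero_of_notMem_tsupport fun h => hy (tsupport_cutoffAt_subset hρ hρr hx h)
    simp only [this, zero_mul]

/-- The kernel against which holomorphic functions are integrated, including the volume. -/
def reproKernel (F : Cn n × Cn n → ℂ) (N k : ℕ) (x y : Cn n) : ℂ :=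
  normFactor n k * Complex.exp (k * (F (x, y) - F (y, y))) * kernelSum F N k (x, y) *
    mixedHessianDet F (y, y)

/-- On the ball φ(y) = F(y, y) and the volume density is the mixed Hessian determinant at (y, y), so
weight and volume merge with the kernel. -/
theorem IsPolarizedPhase.weightedInner_eq (H : IsPolarizedPhase F φ R r δ) {χ : Cn n → ℝ}
    (hχ : IsCutoff r χ) (u : Cn n → ℂ) (N k : ℕ) (x : Cn n) :
    weightedInner φ r k (fun y => (χ y : ℂ) * u y) (fun y => conj (polarKernel F N k (x, y))) =
      ∫ y, u y * ((χ y : ℂ) * reproKernel F N k x y) := by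
  have h0 : ∀ y ∉ Metric.ball (0 : Cn n) r, χ y = 0 := fun y hy =>
    image_eq_zero_of_notMem_tsupport fun h => hy (hχ.2.1 h)
  rw [weightedInner, setIntegral_eq_integral_of_forall_compl_eq_zero fun y hy => by
    simp [h0 y hy]]
  refine integral_congr_ae (Filter.Eventually.of_forall fun y => ?_)
  by_cases hy : y ∈ Metric.ball (0 : Cn n) r
  · have hyR := Metric.ball_subset_ball H.lt.le hy
    have e1 : ((Real.exp (-(k * φ y)) * volDensity φ y : ℝ) : ℂ) =
        Complex.exp (-(k * F (y, y))) * mixedHessianDet F (y, y) := by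
      rw [H.diag y hyR, H.vol y hyR]; push_cast; rfl
    have e2 : Complex.exp (k * (F (x, y) - F (y, y))) =
        Complex.exp (k * F (x, y)) * Complex.exp (-(k * F (y, y))) := by
      rw [← Complex.exp_add]; congr 1; ring
    simp only [Complex.conj_conj, e1, reproKernel, e2, polarKernel, kernelSum, normFactor]
    ring
  · simp [h0 y hy]

/-- The division algorithm as algebra: with D the amplitudes and T the removed terms, each k T_m is
traded for the next amplitude, leaving the first and a last one with factor k^{-(N+1)}. -/
theorem sum_inv_pow_telescope {k : ℂ} (hk : k ≠ 0) (D T : ℕ → ℂ) (N : ℕ) :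
    ∑ m ∈ Finset.range (N + 1), (k ^ m)⁻¹ * (D m - T m) =
      D 0 - ∑ m ∈ Finset.range (N + 1), (k ^ (m + 1))⁻¹ * (k * T m - D (m + 1)) -
        (k ^ (N + 1))⁻¹ * D (N + 1) := by
  induction N with
  | zero => simp; field_simp; ring
  | succ N ih => rw [Finset.sum_range_succ, ih, Finset.sum_range_succ _ (N + 1)]; field_simp; ring

theorem IsPolarizedPhase.continuousOn_fieldTerm (H : IsPolarizedPhase F φ R r δ)
    (hx : x ∈ Metric.ball (0 : Cn n) r) (L m : ℕ) :
    ContinuousOn (fun y => fieldTerm F L m (x, y)) (Metric.ball 0 r) := by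
  have hs : ∀ G : JetSeries n, ContinuousOn (fun y => serVal F L G (x, y)) (Metric.ball 0 r) :=
    fun G y hy => (H.contDiffAt_serVal hx hy L G).continuousAt.continuousWithinAt
  refine continuousOn_finsetSum _ fun i _ => (hs _).mul (continuousOn_finsetSum _ fun j _ =>
    (hs _).mul ?_)
  exact Continuous.continuousOn (by fun_prop)

theorem IsPolarizedPhase.continuousOn_reproKernel (H : IsPolarizedPhase F φ R r δ)
    (hx : x ∈ Metric.ball (0 : Cn n) r) (N k : ℕ) :
    ContinuousOn (reproKernel F N k x) (Metric.ball 0 r) := by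
  have hF := H.weight.smooth.continuous
  have h1 : Continuous fun y => Complex.exp (k * (F (x, y) - F (y, y))) := by fun_prop
  have h2 : ContinuousOn (fun y => kernelSum F N k (x, y)) (Metric.ball 0 r) :=
    continuousOn_finsetSum _ fun m _ => ContinuousOn.mul (fun y hy => (contDiffAt_jetVal_right
      H.weight.smooth (H.det_ne _ (H.mem_biball hx hy)) _).continuousAt.continuousWithinAt)
      continuousOn_const
  have h3 : Continuous fun y => mixedHessianDet F (y, y) :=
    (contDiff_mixedHessianDet H.weight.smooth).continuous.comp (by fun_prop)
  exact ((continuousOn_const.mul h1.continuousOn).mul h2).mul h3.continuousOn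

/-- The ledger of errors: change of cut-off, truncation of the phase, coefficients against
amplitudes, boundary terms of the division steps, last amplitude, determinant; the final term starts
the homotopy. -/
theorem IsPolarizedPhase.integral_reproKernel (H : IsPolarizedPhase F φ R r δ) {N : ℕ}
    (hρ : IsCutoffRadius F φ r δ (2 * (N + 2)) ρ) {χ : Cn n → ℝ} (hχ : IsCutoff r χ)
    {u : Cn n → ℂ} (hu : DifferentiableOn ℂ u (Metric.ball 0 r))
    (hx : x ∈ Metric.ball (0 : Cn n) (r / 4)) {k : ℕ} (hk : 1 ≤ k) (c : ℝ) :
    ∫ y, u y * ((χ y : ℂ) * reproKernel F N k x y) =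
      (∫ y, u y * (((χ y : ℂ) - cutoffAt ρ x y) * reproKernel F N k x y)) +
      (cutoffIntegral ρ u x (fun y => (Complex.exp (k * (F (x, y) - F (y, y))) -
        Complex.exp (k * truncPhase F (2 * (N + 2)) x y)) * (normFactor n k *
        kernelSum F N k (x, y) * mixedHessianDet F (y, y))) +
      (∑ m ∈ Finset.range (N + 1), cutoffIntegral ρ u x (fun y =>
        Complex.exp (k * truncPhase F (2 * (N + 2)) x y) * (normFactor n k *
        ((k : ℂ) ^ m)⁻¹ * (jetVal F (x, y) (kernelCoeff n m) * mixedHessianDet F (y, y) -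
        (serVal F (2 * (N + 2)) (amplitude n m) (x, y) -
          fieldTerm F (2 * (N + 2)) m (x, y))))) +
      (∑ m ∈ Finset.range (N + 1), -((normFactor n k * ((k : ℂ) ^ (m + 1))⁻¹) *
        cutoffIntegral ρ u x (fun y => Complex.exp (k * truncPhase F (2 * (N + 2)) x y) *
        (k * fieldTerm F (2 * (N + 2)) m (x, y) -
          serVal F (2 * (N + 2)) (amplitude n (m + 1)) (x, y)))) +
      (-((normFactor n k * ((k : ℂ) ^ (N + 1))⁻¹) * cutoffIntegral ρ u x (fun y =>
        Complex.exp (k * truncPhase F (2 * (N + 2)) x y) *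
        serVal F (2 * (N + 2)) (amplitude n (N + 1)) (x, y))) +
      (cutoffIntegral ρ u x (fun y => Complex.exp (k * truncPhase F (2 * (N + 2)) x y) *
        (normFactor n k * (serVal F (2 * (N + 2)) (amplitude n 0) (x, y) -
          (truncMatrix F (2 * (N + 2)) x y).det))) +
      normFactor n k * cutoffIntegral ρ u x (deformKernel F (2 * (N + 2)) c 0 k x)))))) := by
  have hx' := norm_sub_of_mem_cutoff H hx
  have hk0 : (k : ℂ) ≠ 0 := Nat.cast_ne_zero.2 (by omega)
  set L := 2 * (N + 2) with hL
  have hF := H.weight.smooth.continuous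
  have cX : ContinuousOn (fun y => Complex.exp (k * (F (x, y) - F (y, y)))) (Metric.ball 0 r) :=
    Continuous.continuousOn (by fun_prop)
  have cJ : ∀ P : JetPolynomial n, ContinuousOn (fun y => jetVal F (x, y) P) (Metric.ball 0 r) :=
    fun P y hy => (contDiffAt_jetVal_right H.weight.smooth (H.det_ne _ (H.mem_biball hx' hy))
      _).continuousAt.continuousWithinAt
  have cS : ContinuousOn (fun y => kernelSum F N k (x, y)) (Metric.ball 0 r) :=
    continuousOn_finsetSum _ fun m _ => (cJ _).mul continuousOn_const
  have cV : ContinuousOn (fun y => mixedHessianDet F (y, y)) (Metric.ball 0 r) :=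
    ((contDiff_mixedHessianDet H.weight.smooth).continuous.comp (by fun_prop)).continuousOn
  have cs : ∀ G : JetSeries n, ContinuousOn (fun y => serVal F L G (x, y)) (Metric.ball 0 r) :=
    fun G y hy => (H.contDiffAt_serVal hx' hy L G).continuousAt.continuousWithinAt
  have cp : ContinuousOn (truncPhase F L x) (Metric.ball 0 r) :=
    fun y hy => (H.contDiffAt_truncPhase hx' hy L).continuousAt.continuousWithinAt
  have ce : ContinuousOn (fun y => Complex.exp (k * truncPhase F L x y)) (Metric.ball 0 r) :=
    (continuousOn_const.mul cp).cexp
  have cT := fun m => H.continuousOn_fieldTerm hx' L m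
  have cdet : ContinuousOn (fun y => (truncMatrix F L x y).det) (Metric.ball 0 r) := by
    have : ContinuousOn (truncMatrix F L x) (Metric.ball 0 r) :=
      continuousOn_pi.2 fun i => continuousOn_pi.2 fun j => cs _
    exact (Continuous.matrix_det continuous_id).comp_continuousOn this
  have cR := H.continuousOn_reproKernel hx' N k
  have cd : ContinuousOn (deformKernel F L c 0 k x) (Metric.ball 0 r) :=
    (cdet.mul ce).congr fun y hy => H.deformKernel_zero hx' hy k
  have c2 : ContinuousOn (fun y => (Complex.exp (k * (F (x, y) - F (y, y))) -
        Complex.exp (k * truncPhase F L x y)) * (normFactor n k *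
        kernelSum F N k (x, y) * mixedHessianDet F (y, y))) (Metric.ball 0 r) :=
    (cX.sub ce).mul ((continuousOn_const.mul cS).mul cV)
  have c3 : ∀ m, ContinuousOn (fun y => Complex.exp (k * truncPhase F L x y) * (normFactor n k *
        ((k : ℂ) ^ m)⁻¹ * (jetVal F (x, y) (kernelCoeff n m) * mixedHessianDet F (y, y) -
        (serVal F L (amplitude n m) (x, y) - fieldTerm F L m (x, y))))) (Metric.ball 0 r) :=
    fun m => ce.mul (continuousOn_const.mul (((cJ _).mul cV).sub ((cs _).sub (cT m))))
  have c4 : ∀ m, ContinuousOn (fun y => Complex.exp (k * truncPhase F L x y) *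
        (k * fieldTerm F L m (x, y) - serVal F L (amplitude n (m + 1)) (x, y)))
        (Metric.ball 0 r) :=
    fun m => ce.mul ((continuousOn_const.mul (cT m)).sub (cs _))
  have c5 : ContinuousOn (fun y => Complex.exp (k * truncPhase F L x y) *
      serVal F L (amplitude n (N + 1)) (x, y)) (Metric.ball 0 r) := ce.mul (cs _)
  have c6 : ContinuousOn (fun y => Complex.exp (k * truncPhase F L x y) *
        (normFactor n k * (serVal F L (amplitude n 0) (x, y) - (truncMatrix F L x y).det)))
        (Metric.ball 0 r) := ce.mul (continuousOn_const.mul ((cs _).sub cdet))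
  have cmul : ∀ (a : ℂ) (g : Cn n → ℂ), ContinuousOn g (Metric.ball 0 r) →
      ContinuousOn (fun y => a * g y) (Metric.ball 0 r) := fun a g hg => continuousOn_const.mul hg
  have c7 := cmul (normFactor n k) _ cd
  have c5' := cmul (-(normFactor n k * ((k : ℂ) ^ (N + 1))⁻¹)) _ c5
  have c4' := fun m => cmul (-(normFactor n k * ((k : ℂ) ^ (m + 1))⁻¹)) _ (c4 m)
  have c3s := continuousOn_finsetSum (Finset.range (N + 1)) fun m _ => c3 m
  have c4s := continuousOn_finsetSum (Finset.range (N + 1)) fun m _ => c4' m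
  have split : ∫ y, u y * ((χ y : ℂ) * reproKernel F N k x y) =
      (∫ y, u y * (((χ y : ℂ) - cutoffAt ρ x y) * reproKernel F N k x y)) +
        cutoffIntegral ρ u x (reproKernel F N k x) := by
    have i1 : Integrable fun y => u y * (cutoffAt ρ x y * reproKernel F N k x y) :=
      integrable_mul_cutoffAt hu hρ.pos hρ.le hx cR
    have i2 : Integrable fun y => u y * ((χ y : ℂ) * reproKernel F N k x y) := by
      have hs : tsupport (fun y => (χ y : ℂ)) ⊆ tsupport χ :=
        closure_mono fun y hy => by
          simp only [Function.mem_support] at hy ⊢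
          exact fun h => hy (by rw [h]; simp)
      have := integrable_mul_of_tsupport (f := fun y => u y * reproKernel F N k x y)
        (g := fun y => (χ y : ℂ)) Metric.isOpen_ball (hu.continuousOn.mul cR)
        (Complex.continuous_ofReal.comp hχ.1.continuous) (hs.trans hχ.2.1)
        (IsCompact.of_isClosed_subset (isCompact_closedBall (0 : Cn n) r) (isClosed_tsupport _)
          ((hs.trans hχ.2.1).trans Metric.ball_subset_closedBall))
      exact this.congr (Filter.Eventually.of_forall fun y => by ring)
    have h1 : ∫ y, u y * (((χ y : ℂ) - cutoffAt ρ x y) * reproKernel F N k x y) =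
        ∫ y, (u y * ((χ y : ℂ) * reproKernel F N k x y) -
          u y * (cutoffAt ρ x y * reproKernel F N k x y)) :=
      integral_congr_ae (Filter.Eventually.of_forall fun y => by ring)
    rw [h1, integral_sub i2 i1, cutoffIntegral, sub_add_cancel]
  rw [split]
  congr 1
  simp only [neg_mul_cutoffIntegral]
  rw [← cutoffIntegral_const_mul]
  rw [← cutoffIntegral_sum _ hu hρ.pos hρ.le hx fun m _ => c3 m,
    ← cutoffIntegral_sum _ hu hρ.pos hρ.le hx fun m _ => c4' m,
    ← cutoffIntegral_add hu hρ.pos hρ.le hx c6 c7,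
    ← cutoffIntegral_add hu hρ.pos hρ.le hx c5' (c6.add c7),
    ← cutoffIntegral_add hu hρ.pos hρ.le hx c4s (c5'.add (c6.add c7)),
    ← cutoffIntegral_add hu hρ.pos hρ.le hx c3s (c4s.add (c5'.add (c6.add c7))),
    ← cutoffIntegral_add hu hρ.pos hρ.le hx c2 (c3s.add (c4s.add (c5'.add (c6.add c7))))]
  refine cutoffIntegral_congr hρ.pos hρ.le hx fun y hy => ?_
  simp only [Pi.add_apply]
  rw [H.deformKernel_zero hx' hy]
  have tel := sum_inv_pow_telescope hk0 (fun m => serVal F L (amplitude n m) (x, y))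
    (fun m => fieldTerm F L m (x, y)) N
  set E := Complex.exp (k * truncPhase F L x y)
  set V := mixedHessianDet F (y, y)
  have e3 : ∑ m ∈ Finset.range (N + 1), E * (normFactor n k * ((k : ℂ) ^ m)⁻¹ *
      (jetVal F (x, y) (kernelCoeff n m) * V - (serVal F L (amplitude n m) (x, y) -
        fieldTerm F L m (x, y)))) = E * normFactor n k * (kernelSum F N k (x, y) * V -
      ∑ m ∈ Finset.range (N + 1), ((k : ℂ) ^ m)⁻¹ * (serVal F L (amplitude n m) (x, y) -
        fieldTerm F L m (x, y))) := by
    rw [kernelSum, Finset.sum_mul, ← Finset.sum_sub_distrib, Finset.mul_sum]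
    exact Finset.sum_congr rfl fun m _ => by ring
  have e4 : ∑ m ∈ Finset.range (N + 1), -(normFactor n k * ((k : ℂ) ^ (m + 1))⁻¹) *
      (E * (k * fieldTerm F L m (x, y) - serVal F L (amplitude n (m + 1)) (x, y))) =
      -(E * normFactor n k) * ∑ m ∈ Finset.range (N + 1), ((k : ℂ) ^ (m + 1))⁻¹ *
        (k * fieldTerm F L m (x, y) - serVal F L (amplitude n (m + 1)) (x, y)) := by
    rw [Finset.mul_sum]
    exact Finset.sum_congr rfl fun m _ => by ring
  rw [e3, e4, tel, reproKernel]
  ring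

/-- The asymptotic reproducing property of the polarized kernel. -/
theorem IsPolarizedPhase.isReproducingKernelMod (H : IsPolarizedPhase F φ R r δ) {χ : Cn n → ℝ}
    (hχ : IsCutoff r χ) (N : ℕ) :
    IsReproducingKernelMod φ r (r / 4) χ ((n : ℤ) - N - 1)
      (fun k x y => polarKernel F N k (x, y)) := by
  -- Order 2(N + 2) gives (|w|²)^{N+2}, hence k^{-(N+2)}; one power is lost when comparing
  -- exponentials.
  obtain ⟨ρ, hρ⟩ := H.exists_cutoffRadius (L := 2 * (N + 2)) (by omega)
  obtain ⟨c, hc, hm⟩ := H.exists_modelTheta_re_le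
  have main := ((H.isSmall_gaussian_defect hρ hc hm N).add (H.isSmall_deform hρ hm N)).add
    (((H.isSmall_cutoff_sub hρ hχ N).add ((H.isSmall_phase_sub hρ).add
      ((IsSmall.sum (Finset.range (N + 1)) fun m _ => H.isSmall_kernelCoeff_sub hρ m).add
      ((IsSmall.sum (Finset.range (N + 1)) fun m _ => (H.isSmall_fieldTerm hρ m N).neg).add
      ((H.isSmall_amplitude hρ N).neg.add (H.isSmall_det_sub hρ)))))).neg)
  have hs : (n : ℤ) - N - 1 = (n : ℤ) - (N + 1 : ℕ) := by push_cast; ring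
  rw [hs]
  refine IsSmall.congr main fun k hk u hu x hx => ?_
  have hx' := norm_sub_of_mem_cutoff H hx
  have h1 : normFactor n k * cutoffIntegral ρ u x (deformKernel F (2 * (N + 2)) c 1 k x) =
      (gaussianMass n ρ (k * c) : ℂ) * u x := by
    rw [← integral_model (F := F) hu.1 hρ.pos hρ.le hx k]
    congr 1
    exact cutoffIntegral_congr hρ.pos hρ.le hx fun y hy => H.deformKernel_one hx' hy k
  have h2 := H.integral_reproKernel hρ hχ hu.1 hx hk c
  have h3 := H.weightedInner_eq hχ u N k x
  rw [h3, h2]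
  simp only [cutoffIntegral] at h1 ⊢
  simp only [reproKernel]
  rw [mul_sub, h1]
  ring

end Reproduction

/-! ### Mixed derivatives and kernels depend only on local values. -/

section Locality

variable {V : Type*} [NormedAddCommGroup V] [NormedSpace ℂ V] {f g : V → ℂ} {U : Set V}

theorem Set.EqOn.wirt (h : Set.EqOn f g U) (hU : IsOpen U) (s : ℂ) (v : V) :
    Set.EqOn (wirt s v f) (wirt s v g) U := fun _ hp =>
  wirt_congr (Filter.eventuallyEq_of_mem (hU.mem_nhds hp) h)

theorem Set.EqOn.foldr_wirt {ι : Type*} (h : Set.EqOn f g U) (hU : IsOpen U) (s : ℂ)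
    (e : ι → V) (α : ι → ℕ) (l : List ι) :
    Set.EqOn (l.foldr (fun j G => (_root_.wirt s (e j))^[α j] G) f)
      (l.foldr (fun j G => (_root_.wirt s (e j))^[α j] G) g) U := by
  have it : ∀ (j : ι) (m : ℕ) (f g : V → ℂ), Set.EqOn f g U →
      Set.EqOn ((_root_.wirt s (e j))^[m] f) ((_root_.wirt s (e j))^[m] g) U := fun j m => by
    induction m with
    | zero => exact fun f g h => h
    | succ m ih => exact fun f g h => ih _ _ (h.wirt hU s (e j))
  induction l with
  | nil => exact h
  | cons j l ih => exact it j _ _ _ ih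

variable {n : ℕ} {F G : Cn n × Cn n → ℂ} {S : Set (Cn n × Cn n)}

theorem Set.EqOn.mixedDeriv (h : Set.EqOn F G S) (hS : IsOpen S) (α β : Fin n → ℕ) :
    Set.EqOn (mixedDeriv α β F) (mixedDeriv α β G) S := by
  unfold _root_.mixedDeriv
  simp only [delHol_eq_wirt, delBar_eq_wirt]
  exact (h.foldr_wirt hS _ _ _ _).foldr_wirt hS _ _ _ _

theorem Set.EqOn.mixedHessianDet (h : Set.EqOn F G S) (hS : IsOpen S) :
    Set.EqOn (mixedHessianDet F) (mixedHessianDet G) S := fun p hp => by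
  simp only [_root_.mixedHessianDet]
  congr 2
  ext i j
  simp only [delHol_eq_wirt, delBar_eq_wirt]
  exact ((h.wirt hS _ _).wirt hS _ _) hp

theorem Set.EqOn.jetVal (h : Set.EqOn F G S) (hS : IsOpen S) {p : Cn n × Cn n} (hp : p ∈ S) :
    jetVal F p = jetVal G p := by
  simp only [_root_.jetVal, h.mixedHessianDet hS hp, fun α β => h.mixedDeriv hS α β hp]

theorem asymptoticKernel_eq_polarKernel {ψ : Cn n × Cn n → ℂ} (h : Set.EqOn F (polarized ψ) S)
    (hS : IsOpen S) (N k : ℕ) {p : Cn n × Cn n} (hp : p ∈ S) :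
    asymptoticKernel (kernelCoeff n) ψ N k p.1 p.2 = polarKernel F N k p := by
  simp only [asymptoticKernel, polarKernel, evalAt_eq_jetVal, h.jetVal hS hp, h hp]
  rfl

end Locality

/-! ### From an almost holomorphic extension to polarized weights and phases. -/

section Polarization

variable {n : ℕ} {G : Cn n × Cn n → ℂ} {y : Cn n}

/-- Conjugation of the second variable. -/
def conjSnd (n : ℕ) : (Cn n × Cn n) ≃L[ℝ] (Cn n × Cn n) :=
  LinearEquiv.toContinuousLinearEquiv
    { toFun := fun p => (p.1, conjVec p.2)
      invFun := fun p => (p.1, conjVec p.2)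
      map_add' := fun p q => by
        refine Prod.ext rfl ?_
        ext j
        simp [conjVec]
      map_smul' := fun a p => by
        refine Prod.ext rfl ?_
        ext j
        simp [conjVec]
      left_inv := fun p => by
        refine Prod.ext rfl ?_
        ext j
        simp [conjVec]
      right_inv := fun p => by
        refine Prod.ext rfl ?_
        ext j
        simp [conjVec] }

theorem conjSnd_apply (p : Cn n × Cn n) : conjSnd n p = (p.1, conjVec p.2) := rfl

theorem polarized_eq_comp (ψ : Cn n × Cn n → ℂ) : polarized ψ = ψ ∘ conjSnd n := rfl

theorem conjVec_smul (c : ℂ) (v : Cn n) : conjVec (c • v) = conj c • conjVec v := by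
  ext j; simp [conjVec]

theorem conjVec_zero : conjVec (0 : Cn n) = 0 := by
  ext j; simp [conjVec]

theorem delBar_polarized (ψ : Cn n × Cn n → ℂ) (v : Cn n) :
    delBar ((v, 0) : Cn n × Cn n) (polarized ψ) = delBar (v, 0) ψ ∘ conjSnd n := by
  funext p
  rw [Function.comp_apply, delBar, delBar, polarized_eq_comp, (conjSnd n).comp_right_fderiv]
  simp [conjSnd_apply, conjVec_zero]

/-- Conjugation in the second variable is antilinear, so it exchanges ∂ and ∂̄ there; almost
holomorphy of ψ thus means that ∂_y of ψ(x, ȳ) is flat. -/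
theorem delHol_polarized (ψ : Cn n × Cn n → ℂ) (v : Cn n) :
    delHol ((0, v) : Cn n × Cn n) (polarized ψ) = delBar (0, conjVec v) ψ ∘ conjSnd n := by
  funext p
  rw [Function.comp_apply, delHol, delBar, polarized_eq_comp, (conjSnd n).comp_right_fderiv]
  have h1 : conjSnd n (0, v) = (0, conjVec v) := rfl
  have h2 : conjSnd n (Complex.I • (0, v)) = -(Complex.I • ((0, conjVec v) : Cn n × Cn n)) := by
    rw [conjSnd_apply]
    refine Prod.ext ?_ ?_
    · change Complex.I • (0 : Cn n) = -(Complex.I • (0 : Cn n))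
      simp only [smul_zero, neg_zero]
    · change conjVec (Complex.I • v) = -(Complex.I • conjVec v)
      rw [conjVec_smul, Complex.conj_I, neg_smul]
  simp only [ContinuousLinearMap.comp_apply, ContinuousLinearEquiv.coe_coe, h1, h2, map_neg]
  ring

theorem iteratedFDeriv_comp_equiv_eq_zero {V : Type*} [NormedAddCommGroup V] [NormedSpace ℝ V]
    (e : V ≃L[ℝ] V) {f : V → ℂ} {m : ℕ} {p : V} (h : iteratedFDeriv ℝ m f (e p) = 0) :
    iteratedFDeriv ℝ m (f ∘ e) p = 0 := by
  have := e.iteratedFDerivWithin_comp_right (𝕜 := ℝ) f uniqueDiffOn_univ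
    (x := p) (Set.mem_univ _) m
  rw [Set.preimage_univ, iteratedFDerivWithin_univ, iteratedFDerivWithin_univ, h] at this
  rw [this]
  ext
  simp

theorem wirt_diag (s : ℂ) (v : Cn n) (hG : DifferentiableAt ℝ G (y, y)) :
    wirt s v (fun z => G (z, z)) y =
      wirt s ((v, 0) : Cn n × Cn n) G (y, y) + wirt s ((0, v) : Cn n × Cn n) G (y, y) := by
  have h1 : HasFDerivAt (fun z : Cn n => (z, z))
      ((ContinuousLinearMap.id ℝ (Cn n)).prod (ContinuousLinearMap.id ℝ (Cn n))) y :=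
    (hasFDerivAt_id y).prodMk (hasFDerivAt_id y)
  have h2 : fderiv ℝ (fun z => G (z, z)) y = _ := (HasFDerivAt.comp (g := G) (f := fun z => (z, z)) y hG.hasFDerivAt h1).fderiv
  have h3 : ∀ w : Cn n, fderiv ℝ (fun z => G (z, z)) y w =
      fderiv ℝ G (y, y) (w, 0) + fderiv ℝ G (y, y) (0, w) := fun w => by
    rw [h2, ← map_add]; simp
  rw [wirt, wirt, wirt, h3, h3]
  simp only [Prod.smul_mk, smul_zero]
  ring

/-- The complex Hessian is the mixed Hessian of an almost holomorphic extension. -/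
theorem complexHessian_eq_of_flat {F : Cn n × Cn n → ℂ} {φ : Cn n → ℝ} {R : ℝ}
    (hF : ContDiff ℝ ∞ F) (hd : ∀ y ∈ Metric.ball (0 : Cn n) R, F (y, y) = φ y)
    (hX : ∀ j, FlatOn R (delBar ((coordVec j, 0) : Cn n × Cn n) F))
    (hY : ∀ j, FlatOn R (delHol ((0, coordVec j) : Cn n × Cn n) F))
    (hy : y ∈ Metric.ball (0 : Cn n) R) :
    complexHessian φ y = Matrix.of fun i j : Fin n => delHol ((coordVec i, 0) : Cn n × Cn n)
      (delBar ((0, coordVec j) : Cn n × Cn n) F) (y, y) := by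
  have h1 : ∀ j : Fin n, Set.EqOn (delBar (coordVec j) fun z => (φ z : ℂ))
      (fun z => delBar ((0, coordVec j) : Cn n × Cn n) F (z, z)) (Metric.ball 0 R) := fun j => by
    have e : Set.EqOn (fun z => (φ z : ℂ)) (fun z => F (z, z)) (Metric.ball (0 : Cn n) R) :=
      fun z hz => (hd z hz).symm
    intro z hz
    rw [delBar_eq_wirt, e.wirt Metric.isOpen_ball _ _ hz, wirt_diag _ _
      (hF.differentiable (by simp)).differentiableAt]
    have := (hX j).apply_eq_zero hz
    rw [delBar_eq_wirt] at this
    rw [this, zero_add]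
    rfl
  ext i j
  rw [complexHessian, Matrix.of_apply, Matrix.of_apply, delHol_eq_wirt,
    (h1 j).wirt Metric.isOpen_ball _ _ hy, wirt_diag (G := delBar ((0, coordVec j) : Cn n × Cn n) F)
      _ _ ((contDiff_wirt hF).differentiable (by simp)).differentiableAt]
  -- Commuting the derivatives puts ∂_{y_i} directly on F, where it is flat on the diagonal.
  have h2 : wirt (-Complex.I) ((0, coordVec i) : Cn n × Cn n)
      (delBar ((0, coordVec j) : Cn n × Cn n) F) (y, y) = 0 := by
    rw [delBar_eq_wirt, wirt_comm hF.contDiffAt]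
    have := ((hY i).wirt Complex.I ((0, coordVec j) : Cn n × Cn n)).apply_eq_zero hy
    rwa [delHol_eq_wirt] at this
  rw [h2, add_zero, delHol_eq_wirt]

/-- Multiplication by a bump function. It permits work with globally smooth functions throughout,
and gives the compact support needed for Borel summation. -/
theorem exists_smooth_eqOn_ball {V : Type*} [NormedAddCommGroup V] [NormedSpace ℝ V]
    [FiniteDimensional ℝ V] {f : V → ℂ} {R : ℝ} (hR : 0 < R)
    (hf : ContDiffOn ℝ ∞ f (Metric.ball 0 R)) :
    ∃ F : V → ℂ, ContDiff ℝ ∞ F ∧ HasCompactSupport F ∧ Set.EqOn F f (Metric.ball 0 (R / 4)) := by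
  let b : ContDiffBump (0 : V) := ⟨R / 4, R / 2, by linarith, by linarith⟩
  refine ⟨fun p => (b p : ℝ) • f p, contDiff_iff_contDiffAt.2 fun p => ?_,
    b.hasCompactSupport.smul_right, fun p hp => ?_⟩
  · by_cases hp : p ∈ Metric.ball (0 : V) R
    · exact b.contDiffAt.smul (hf.contDiffAt (Metric.isOpen_ball.mem_nhds hp))
    · have h0 : (fun p => (b p : ℝ) • f p) =ᶠ[nhds p] fun _ => 0 := by
        have hc : (tsupport b)ᶜ ∈ nhds p := by
          refine (isClosed_tsupport _).isOpen_compl.mem_nhds fun h => hp ?_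
          rw [b.tsupport_eq] at h
          exact Metric.closedBall_subset_ball (by change R / 2 < R; linarith) h
        filter_upwards [hc] with q hq
        rw [image_eq_zero_of_notMem_tsupport hq, zero_smul]
      exact contDiffAt_const.congr_of_eventuallyEq h0
  · simp only [b.one_of_mem_closedBall (Metric.ball_subset_closedBall hp), one_smul]

theorem biball_eq_ball (R : ℝ) : biball n R = Metric.ball (0 : Cn n × Cn n) R := by
  rw [biball, ball_prod_same]; rfl

/-- A smooth function agreeing with a polarized almost holomorphic extension has flat
antiholomorphic derivatives. -/
theorem IsAlmostHolExtension.flatOn_wirt {Ω : Set (Cn n)} {φ : Cn n → ℝ}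
    {W : Set (Cn n × Cn n)} {ψ F : Cn n × Cn n → ℂ} (hψ : IsAlmostHolExtension Ω φ W ψ)
    {R : ℝ} (hF : ContDiff ℝ ∞ F) (hΩ : Metric.ball (0 : Cn n) R ⊆ Ω)
    (hW : ∀ p ∈ biball n R, conjSnd n p ∈ W) (he : Set.EqOn F (polarized ψ) (biball n R))
    {s : ℂ} {v w : Cn n × Cn n} (hw : wirt s v (polarized ψ) = delBar w ψ ∘ conjSnd n) :
    FlatOn R (wirt s v F) := by
  refine ⟨(contDiff_wirt hF).contDiffOn, fun y hy m => ?_⟩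
  have e : wirt s v F =ᶠ[nhds (y, y)] delBar w ψ ∘ conjSnd n := by
    rw [← hw]
    exact Filter.eventuallyEq_of_mem (isOpen_biball.mem_nhds ⟨hy, hy⟩) (he.wirt isOpen_biball s v)
  have hc : conjSnd n (y, y) = (y, conjVec y) := conjSnd_apply (y, y)
  have hm := hW (y, y) ⟨hy, hy⟩
  rw [hc] at hm
  have h0 : iteratedFDeriv ℝ m (delBar w ψ) (conjSnd n (y, y)) = 0 := by
    rw [hc]
    exact hψ.flat y (hΩ hy) hm w m
  have h1 := iteratedFDeriv_comp_equiv_eq_zero (conjSnd n) h0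
  have h2 := (e.iteratedFDeriv ℝ m).eq_of_nhds
  exact h2.trans h1

/-- Successive shrinking: into the domains, then to where the Hessian determinant is nonzero off the
diagonal, then to where the phase bound holds. R and δ do not depend on r, so one extension serves
all radii up to r₀. -/
theorem IsAlmostHolExtension.exists_isPolarizedPhase {Ω : Set (Cn n)} {φ : Cn n → ℝ}
    {W : Set (Cn n × Cn n)} {ψ : Cn n × Cn n → ℂ} (hψ : IsAlmostHolExtension Ω φ W ψ)
    (hΩ : IsOpen Ω) (h0 : (0 : Cn n) ∈ Ω) (hφ : IsSmoothStrictlyPSHOn φ Ω) :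
    ∃ (F : Cn n × Cn n → ℂ) (R r₀ δ : ℝ), 0 < r₀ ∧ Metric.ball (0 : Cn n) R ⊆ Ω ∧
      (∀ p ∈ biball n R, conjSnd n p ∈ W) ∧ Set.EqOn F (polarized ψ) (biball n R) ∧
      ∀ r, 0 < r → r ≤ r₀ → IsPolarizedPhase F φ R r δ := by
  have hW : IsOpen (conjSnd n ⁻¹' W) := hψ.isOpen.preimage (conjSnd n).continuous
  have hW0 : (0 : Cn n × Cn n) ∈ conjSnd n ⁻¹' W := by
    rw [Set.mem_preimage, map_zero]; exact hψ.zero_mem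
  obtain ⟨R₁, hR₁, hb₁⟩ := Metric.isOpen_iff.1 hW 0 hW0
  obtain ⟨R₂, hR₂, hb₂⟩ := Metric.isOpen_iff.1 hΩ 0 h0
  have hsm : ContDiffOn ℝ ∞ (polarized ψ) (Metric.ball 0 R₁) :=
    hψ.smooth.comp (conjSnd n).contDiff.contDiffOn hb₁
  obtain ⟨F, hF, -, hFe⟩ := exists_smooth_eqOn_ball hR₁ hsm
  have base : ∀ R, 0 < R → R ≤ R₁ / 4 → R ≤ R₂ → Metric.ball (0 : Cn n) R ⊆ Ω ∧
      (∀ p ∈ biball n R, conjSnd n p ∈ W) ∧ Set.EqOn F (polarized ψ) (biball n R) ∧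
      (∀ y ∈ Metric.ball (0 : Cn n) R, F (y, y) = φ y) ∧
      (∀ j, FlatOn R (delBar ((coordVec j, 0) : Cn n × Cn n) F)) ∧
      (∀ j, FlatOn R (delHol ((0, coordVec j) : Cn n × Cn n) F)) := by
    intro R hR h1 h2
    have s1 : Metric.ball (0 : Cn n) R ⊆ Ω := (Metric.ball_subset_ball h2).trans hb₂
    have s2 : ∀ p ∈ biball n R, conjSnd n p ∈ W := fun p hp => hb₁ (by
      rw [biball_eq_ball] at hp; exact Metric.ball_subset_ball (by linarith) hp)
    have s3 : Set.EqOn F (polarized ψ) (biball n R) := fun p hp => hFe (by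
      rw [biball_eq_ball] at hp; exact Metric.ball_subset_ball (by linarith) hp)
    refine ⟨s1, s2, s3, fun y hy => ?_, fun j => ?_,
      fun j => ?_⟩
    · have hm := s2 (y, y) ⟨hy, hy⟩
      rw [conjSnd_apply] at hm
      have he : F (y, y) = polarized ψ (y, y) := s3 (show (y, y) ∈ biball n R from ⟨hy, hy⟩)
      rw [he, polarized]
      exact hψ.extends_phi y (s1 hy) hm
    · have := delBar_polarized ψ (coordVec j)
      rw [delBar_eq_wirt] at this ⊢
      exact hψ.flatOn_wirt hF s1 s2 s3 this
    · have := delHol_polarized ψ (coordVec j)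
      rw [delHol_eq_wirt] at this ⊢
      exact hψ.flatOn_wirt hF s1 s2 s3 this
  set R₃ := min (R₁ / 4) R₂ with hR₃
  have hR₃0 : 0 < R₃ := lt_min (by linarith) hR₂
  obtain ⟨-, -, -, d3, x3, y3⟩ := base R₃ hR₃0 (min_le_left _ _) (min_le_right _ _)
  have hess : ∀ y ∈ Metric.ball (0 : Cn n) R₃, complexHessian φ y =
      Matrix.of fun i j : Fin n => delHol ((coordVec i, 0) : Cn n × Cn n)
        (delBar ((0, coordVec j) : Cn n × Cn n) F) (y, y) := fun y hy =>
    complexHessian_eq_of_flat hF d3 x3 y3 hy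
  have hsub : Metric.ball (0 : Cn n) R₃ ⊆ Ω := (Metric.ball_subset_ball (min_le_right _ _)).trans hb₂
  have hpos : ∀ y ∈ Metric.ball (0 : Cn n) R₃, 0 < mixedHessianDet F (y, y) := fun y hy => by
    have := (hφ.2 y (hsub hy)).det_pos
    rwa [hess y hy] at this
  have hdet0 : mixedHessianDet F 0 ≠ 0 := (hpos 0 (Metric.mem_ball_self hR₃0)).ne'
  obtain ⟨R₄, hR₄, hb₄⟩ := Metric.isOpen_iff.1 (isOpen_ne_fun
    (contDiff_mixedHessianDet hF).continuous continuous_const) 0 hdet0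
  set R := min R₃ R₄ with hR
  have hR0 : 0 < R := lt_min hR₃0 hR₄
  have hRR : Metric.ball (0 : Cn n) R ⊆ Metric.ball 0 R₃ := Metric.ball_subset_ball (min_le_left _ _)
  obtain ⟨s1, s2, s3, d, hX, hY⟩ := base R hR0 ((min_le_left _ _).trans (min_le_left _ _))
    ((min_le_left _ _).trans (min_le_right _ _))
  have hw : IsPolarizedWeight R F :=
    { pos := hR0
      smooth := hF
      real := fun y hy => by rw [d y hy, Complex.ofReal_im]
      flatX := hX
      flatY := hY
      posDef := by
        have h := hess 0 (Metric.mem_ball_self hR₃0)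
        rw [← h]
        exact hφ.2 0 h0
      hessPos := fun y hy => hpos y (hRR hy) }
  obtain ⟨δ, hδ, r₁, hr₁, hr₁R, hph⟩ := hw.exists_phase_bound
  refine ⟨F, R, min r₁ (1 / 2), δ, lt_min hr₁ (by norm_num), s1, s2, s3, fun r hr hr' => ?_⟩
  have hrr : r ≤ r₁ := hr'.trans (min_le_left _ _)
  have hin : Metric.ball (0 : Cn n) r ⊆ Metric.ball 0 r₁ := Metric.ball_subset_ball hrr
  have hinR : Metric.ball (0 : Cn n) r ⊆ Metric.ball 0 R :=
    Metric.ball_subset_ball (hrr.trans hr₁R.le)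
  exact
    { weight := hw
      det_ne := fun p hp => hb₄ (by
        rw [biball_eq_ball] at hp; exact Metric.ball_subset_ball (min_le_right _ _) hp)
      pos := hr
      lt := hrr.trans_lt hr₁R
      le_half := hr'.trans (min_le_right _ _)
      delta_pos := hδ
      phase := fun x hx y hy => by
        have := hph x (hin hx) y (hin hy)
        rwa [d x (hinR hx), d y (hinR hy), Complex.ofReal_re, Complex.ofReal_re] at this
      diag := d
      vol := fun y hy => by
        have h1 := hpos y (hRR hy)
        have h2 : (complexHessian φ y).det = mixedHessianDet F (y, y) := by
          rw [hess y (hRR hy)]; rfl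
        rw [volDensity, h2]
        exact Complex.ext rfl (by simpa using (Complex.pos_iff.1 h1).2.symm) }

end Polarization

/-! ### Borel summation of the formal holomorphic extension. -/

section BorelExtension

variable {E : Type*} [NormedAddCommGroup E] [NormedSpace ℝ E] {f : E → ℂ} {g : E × E → ℂ}
  {m j : ℕ} {q : E × E} {t : ℝ}

/-- Scaling of the second component. -/
def scaleSnd (E : Type*) [NormedAddCommGroup E] [NormedSpace ℝ E] (t : ℝ) :
    (E × E) →L[ℝ] (E × E) :=
  (ContinuousLinearMap.fst ℝ E E).prod (t • ContinuousLinearMap.snd ℝ E E)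

theorem scaleSnd_apply (q : E × E) : scaleSnd E t q = (q.1, t • q.2) := rfl

theorem norm_scaleSnd_le (ht : 1 ≤ t) : ‖scaleSnd E t‖ ≤ t := by
  refine ContinuousLinearMap.opNorm_le_bound _ (by linarith) fun q => ?_
  rw [scaleSnd_apply, Prod.norm_def]
  refine max_le ?_ ?_
  · calc ‖q.1‖ ≤ 1 * ‖q‖ := by rw [one_mul]; exact norm_fst_le q
      _ ≤ t * ‖q‖ := by gcongr
  · rw [norm_smul, Real.norm_of_nonneg (by linarith)]
    gcongr
    exact norm_snd_le q

theorem norm_iteratedFDeriv_comp_scaleSnd_le (hg : ContDiff ℝ ∞ g) (ht : 1 ≤ t) (j : ℕ) (q : E × E) :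
    ‖iteratedFDeriv ℝ j (g ∘ scaleSnd E t) q‖ ≤
      ‖iteratedFDeriv ℝ j g (scaleSnd E t q)‖ * t ^ j := by
  rw [(scaleSnd E t).iteratedFDeriv_comp_right hg q (by norm_cast; exact le_top)]
  refine (ContinuousMultilinearMap.norm_compContinuousLinearMap_le _ _).trans ?_
  rw [Finset.prod_const, Finset.card_univ, Fintype.card_fin]
  have := norm_scaleSnd_le (E := E) ht
  gcongr

/-- `g` is homogeneous of degree `m` in the second component. -/
def IsHomogeneousSnd (m : ℕ) (g : E × E → ℂ) : Prop :=
  ∀ t : ℝ, ∀ q, g (scaleSnd E t q) = (t : ℂ) ^ m * g q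

/-- Scaling by 2 fixes (a, 0), multiplies g by 2^m and costs a j-th derivative at most 2^j; for j <
m this forces the derivative to vanish. -/
theorem IsHomogeneousSnd.iteratedFDeriv_eq_zero (hh : IsHomogeneousSnd m g) (hg : ContDiff ℝ ∞ g)
    (hj : j < m) (a : E) : iteratedFDeriv ℝ j g (a, 0) = 0 := by
  have h1 : g ∘ scaleSnd E 2 = ((2 : ℝ) ^ m) • g := by
    funext q
    rw [Function.comp_apply, hh, Pi.smul_apply, Complex.real_smul]
    push_cast; rfl
  have h2 := norm_iteratedFDeriv_comp_scaleSnd_le hg (one_le_two) j ((a, 0) : E × E)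
  have h3 : scaleSnd E 2 ((a, 0) : E × E) = (a, 0) := by rw [scaleSnd_apply, smul_zero]
  rw [h1, iteratedFDeriv_const_smul_apply (hg.contDiffAt.of_le (by norm_cast; exact le_top)), h3,
    norm_smul, Real.norm_of_nonneg (by positivity)] at h2
  have h4 : (2 : ℝ) ^ j < 2 ^ m := pow_lt_pow_right₀ (by norm_num) hj
  rw [← norm_le_zero_iff]
  by_contra h5
  rw [not_le] at h5
  nlinarith

theorem IsHomogeneousSnd.fderiv_scaleSnd (hh : IsHomogeneousSnd m g) (hg : ContDiff ℝ ∞ g)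
    (t : ℝ) (q v : E × E) : fderiv ℝ g (scaleSnd E t q) (scaleSnd E t v) =
      (t : ℂ) ^ m * fderiv ℝ g q v := by
  have hd := hg.differentiable (by simp)
  have h1 : g ∘ scaleSnd E t = fun q => (t : ℂ) ^ m * g q := funext fun q => hh t q
  have h2 := ((hd (scaleSnd E t q)).hasFDerivAt.comp q (scaleSnd E t).hasFDerivAt).fderiv
  rw [h1, ((hd q).hasFDerivAt.const_mul _).fderiv] at h2
  have := congrArg (fun A => A v) h2
  simpa using this.symm

/-- The terms of the formal holomorphic extension `∑ (iᵐ / m!) Dᵐf(a)(c, …, c)`. -/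
def extTerm (f : E → ℂ) : ℕ → E × E → ℂ
  | 0 => fun q => f q.1
  | m + 1 => fun q => (Complex.I / (m + 1 : ℕ)) * fderiv ℝ (extTerm f m) q (q.2, 0)

theorem contDiff_extTerm (hf : ContDiff ℝ ∞ f) : ∀ m, ContDiff ℝ ∞ (extTerm f m)
  | 0 => hf.comp contDiff_fst
  | m + 1 => contDiff_const.mul (((contDiff_extTerm hf m).fderiv_right (by simp)).clm_apply
      (contDiff_snd.prodMk contDiff_const))

theorem isHomogeneousSnd_extTerm (hf : ContDiff ℝ ∞ f) : ∀ m, IsHomogeneousSnd m (extTerm f m)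
  | 0 => fun t q => by simp [extTerm, scaleSnd_apply]
  | m + 1 => fun t q => by
    have h1 := (isHomogeneousSnd_extTerm hf m).fderiv_scaleSnd (contDiff_extTerm hf m) t q (q.2, 0)
    have h2 : (((scaleSnd E t q).2, 0) : E × E) = t • scaleSnd E t (q.2, 0) := by
      simp [scaleSnd_apply]
    change Complex.I / (m + 1 : ℕ) * fderiv ℝ (extTerm f m) (scaleSnd E t q)
      ((scaleSnd E t q).2, 0) =
      t ^ (m + 1) * (Complex.I / (m + 1 : ℕ) * fderiv ℝ (extTerm f m) q (q.2, 0))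
    rw [h2, map_smul, h1, Complex.real_smul]
    ring

theorem extTerm_eq_zero {U : Set E} (hU : IsOpen U) (hf : ∀ a ∈ U, f a = 0) :
    ∀ (m : ℕ) (q : E × E), q.1 ∈ U → extTerm f m q = 0
  | 0, q, hq => hf q.1 hq
  | m + 1, q, hq => by
    have h : extTerm f m =ᶠ[nhds q] fun _ => 0 :=
      Filter.eventuallyEq_of_mem ((hU.preimage continuous_fst).mem_nhds hq) fun p hp =>
        extTerm_eq_zero hU hf m p hp
    change Complex.I / (m + 1 : ℕ) * fderiv ℝ (extTerm f m) q (q.2, 0) = 0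
    rw [h.fderiv_eq]
    simp

/-- The Cauchy–Riemann equations linking consecutive terms, by induction from the recursive
definition and the symmetry of second derivatives. Through them the ∂̄-derivative of a partial sum
telescopes to its last term. -/
theorem fderiv_extTerm_snd (hf : ContDiff ℝ ∞ f) (γ : E) : ∀ (m : ℕ) (q : E × E),
    fderiv ℝ (extTerm f (m + 1)) q (0, γ) = Complex.I * fderiv ℝ (extTerm f m) q (γ, 0) := by
  have hd : ∀ m, Differentiable ℝ (fderiv ℝ (extTerm f m)) := fun m =>
    ((contDiff_extTerm hf m).fderiv_right (m := ∞) (by simp)).differentiable (by simp)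
  have key : ∀ (m : ℕ) (q v : E × E), fderiv ℝ (extTerm f (m + 1)) q v =
      (Complex.I / (m + 1 : ℕ)) * (fderiv ℝ (fderiv ℝ (extTerm f m)) q v (q.2, 0) +
        fderiv ℝ (extTerm f m) q (v.2, 0)) := fun m q v => by
    have h2 : HasFDerivAt (fun q : E × E => ((q.2, 0) : E × E))
        ((ContinuousLinearMap.snd ℝ E E).prod 0) q :=
      (ContinuousLinearMap.snd ℝ E E).hasFDerivAt.prodMk (hasFDerivAt_const (0 : E) q)
    have h3 := (((hd m q).hasFDerivAt.clm_apply h2).const_mul (Complex.I / (m + 1 : ℕ) : ℂ)).fderiv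
    have h4 : extTerm f (m + 1) = fun q => (Complex.I / (m + 1 : ℕ)) *
      fderiv ℝ (extTerm f m) q (q.2, 0) := rfl
    rw [h4, h3]
    simp [add_comm, mul_add]
  have symm : ∀ (m : ℕ) (q v w : E × E), fderiv ℝ (fderiv ℝ (extTerm f m)) q v w =
      fderiv ℝ (fderiv ℝ (extTerm f m)) q w v := fun m q v w =>
    ((contDiff_extTerm hf m).contDiffAt.isSymmSndFDerivAt (by
      simp only [minSmoothness_of_isRCLikeNormedField]; norm_cast)) v w
  intro m
  induction m with
  | zero =>
    intro q
    have h1 : ∀ q : E × E, fderiv ℝ (extTerm f 0) q (0, γ) = 0 := fun q => by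
      have : HasFDerivAt (extTerm f 0) ((fderiv ℝ f q.1).comp (ContinuousLinearMap.fst ℝ E E)) q :=
        HasFDerivAt.comp q (hf.differentiable (by simp) q.1).hasFDerivAt hasFDerivAt_fst
      rw [this.fderiv]; simp
    have h2 : fderiv ℝ (fderiv ℝ (extTerm f 0)) q (0, γ) (q.2, 0) = 0 := by
      rw [symm]
      have h3 := ((hd 0 q).hasFDerivAt.clm_apply (hasFDerivAt_const ((0, γ) : E × E) q)).fderiv
      have h4 : (fun q => fderiv ℝ (extTerm f 0) q (0, γ)) = fun _ => 0 := funext h1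
      rw [h4, fderiv_fun_const] at h3
      have := congrArg (fun A => A (q.2, 0)) h3
      simpa using this.symm
    rw [key, h2]
    simp
  | succ m ih =>
    intro q
    have h2 : fderiv ℝ (fderiv ℝ (extTerm f (m + 1))) q (0, γ) (q.2, 0) =
        Complex.I * fderiv ℝ (fderiv ℝ (extTerm f m)) q (q.2, 0) (γ, 0) := by
      rw [symm]
      have h3 := ((hd (m + 1) q).hasFDerivAt.clm_apply
        (hasFDerivAt_const ((0, γ) : E × E) q)).fderiv
      have h4 : (fun q => fderiv ℝ (extTerm f (m + 1)) q (0, γ)) =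
        fun q => Complex.I * fderiv ℝ (extTerm f m) q (γ, 0) := funext ih
      have h5 := (((hd m q).hasFDerivAt.clm_apply
        (hasFDerivAt_const ((γ, 0) : E × E) q)).const_mul Complex.I).fderiv
      rw [h4, h5] at h3
      have := congrArg (fun A => A (q.2, 0)) h3
      simpa using this.symm
    have h6 := key m q (γ, 0)
    rw [key, h2, symm]
    have h7 : fderiv ℝ (fderiv ℝ (extTerm f m)) q (γ, 0) (q.2, 0) =
        (m + 1 : ℕ) / Complex.I * fderiv ℝ (extTerm f (m + 1)) q (γ, 0) := by
      rw [h6]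
      have : ((m + 1 : ℕ) : ℂ) ≠ 0 := Nat.cast_ne_zero.2 (by omega)
      simp only [Prod.mk_zero_zero, map_zero, add_zero]
      field_simp
    rw [h7]
    have : ((m + 1 + 1 : ℕ) : ℂ) ≠ 0 := Nat.cast_ne_zero.2 (by omega)
    have hI := Complex.I_ne_zero
    field_simp
    push_cast
    ring

/-- The antiholomorphic derivative of the partial sums of the formal extension. -/
theorem fderiv_sum_extTerm (hf : ContDiff ℝ ∞ f) (α γ : E) (M : ℕ) (q : E × E) :
    fderiv ℝ (fun q => ∑ m ∈ Finset.range (M + 1), extTerm f m q) q (α, γ) +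
      Complex.I * fderiv ℝ (fun q => ∑ m ∈ Finset.range (M + 1), extTerm f m q) q (-γ, α) =
    fderiv ℝ (extTerm f M) q (α, 0) + Complex.I * fderiv ℝ (extTerm f M) q (-γ, 0) := by
  have hd : ∀ m, DifferentiableAt ℝ (extTerm f m) q := fun m =>
    (contDiff_extTerm hf m).differentiable (by simp) q
  have hs : ∀ (m : ℕ) (α γ : E), fderiv ℝ (extTerm f m) q (α, γ) =
      fderiv ℝ (extTerm f m) q (α, 0) + fderiv ℝ (extTerm f m) q (0, γ) := fun m α γ => by
    rw [← map_add]; simp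
  induction M with
  | zero =>
    have h1 : ∀ γ, fderiv ℝ (extTerm f 0) q (0, γ) = 0 := fun γ => by
      have : HasFDerivAt (extTerm f 0) ((fderiv ℝ f q.1).comp (ContinuousLinearMap.fst ℝ E E)) q :=
        HasFDerivAt.comp q (hf.differentiable (by simp) q.1).hasFDerivAt hasFDerivAt_fst
      rw [this.fderiv]; simp
    simp only [zero_add, Finset.sum_range_one]
    rw [hs 0 α γ, hs 0 (-γ) α, h1, h1, add_zero, add_zero]
  | succ M ih =>
    have h1 : fderiv ℝ (fun q => ∑ m ∈ Finset.range (M + 1 + 1), extTerm f m q) q =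
        fderiv ℝ (fun q => ∑ m ∈ Finset.range (M + 1), extTerm f m q) q +
          fderiv ℝ (extTerm f (M + 1)) q := by
      simp only [Finset.sum_range_succ _ (M + 1)]
      exact fderiv_fun_add (DifferentiableAt.fun_sum fun m _ => hd m) (hd _)
    have h2 : ∀ β : E, fderiv ℝ (extTerm f M) q (-β, 0) = -fderiv ℝ (extTerm f M) q (β, 0) :=
      fun β => by rw [← map_neg]; simp
    rw [h1, add_apply, add_apply, hs (M + 1) α γ, hs (M + 1) (-γ) α, fderiv_extTerm_snd hf,
      fderiv_extTerm_snd hf]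
    rw [h2] at ih
    linear_combination ih + fderiv ℝ (extTerm f M) q (α, 0) * Complex.I_mul_I

/-- The localized terms of the extension. -/
def borelTerm (f : E → ℂ) (χ : E → ℝ) (l : ℝ) (m : ℕ) (q : E × E) : ℂ :=
  extTerm f m q * (χ (l • q.2) : ℂ)

theorem contDiff_borelTerm (hf : ContDiff ℝ ∞ f) {χ : E → ℝ} (hχ : ContDiff ℝ ∞ χ) (l : ℝ) (m : ℕ) :
    ContDiff ℝ ∞ (borelTerm f χ l m) :=
  (contDiff_extTerm hf m).mul (Complex.ofRealCLM.contDiff.comp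
    (hχ.comp (contDiff_const.smul contDiff_snd)))

/-- By homogeneity the localized term is l^{-m} times a fixed compactly supported function rescaled
by l, so derivatives of order j < m are O(l^{j-m}) and become small for large l. -/
theorem exists_borelTerm_bound (hf : ContDiff ℝ ∞ f) (hfc : HasCompactSupport f) {χ : E → ℝ}
    (hχ : ContDiff ℝ ∞ χ) (hχc : HasCompactSupport χ) (m : ℕ) :
    ∃ l : ℝ, 0 < l ∧ ∀ j < m, ∀ q, ‖iteratedFDeriv ℝ j (borelTerm f χ l m) q‖ ≤ (1 / 2) ^ m := by
  set h := borelTerm f χ 1 m with hh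
  have hs : ContDiff ℝ ∞ h := contDiff_borelTerm hf hχ 1 m
  have hc : HasCompactSupport h := by
    refine HasCompactSupport.intro (hfc.isCompact.prod hχc.isCompact) fun q hq => ?_
    rw [hh, borelTerm, one_smul]
    by_cases h1 : q.1 ∈ tsupport f
    · have h2 : q.2 ∉ tsupport χ := fun h2 => hq ⟨h1, h2⟩
      rw [image_eq_zero_of_notMem_tsupport h2]; simp
    · rw [extTerm_eq_zero (isClosed_tsupport f).isOpen_compl
        (fun a ha => image_eq_zero_of_notMem_tsupport ha) m q h1, zero_mul]
  have hb : ∀ j : ℕ, ∃ C : ℝ, ∀ q, ‖iteratedFDeriv ℝ j h q‖ ≤ C := fun j =>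
    (hs.continuous_iteratedFDeriv (m := j)
      (by norm_cast; exact le_top)).bounded_above_of_compact_support (hc.iteratedFDeriv j)
  choose C hC using hb
  have hC0 : ∀ j, 0 ≤ C j := fun j => (norm_nonneg _).trans (hC j 0)
  set S := ∑ j ∈ Finset.range m, C j with hS
  have hS0 : 0 ≤ S := Finset.sum_nonneg fun j _ => hC0 j
  have h2 : (1 : ℝ) ≤ 2 ^ m := one_le_pow₀ (by norm_num)
  -- Since l ≥ 1 and j < m, the bound l^{j-m}S is at most S/l, which this choice makes at most
  -- 2^{-m}.
  set l : ℝ := 2 ^ m * (1 + S) with hl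
  have hl1 : 1 ≤ l := by nlinarith
  have hl0 : 0 < l := by linarith
  refine ⟨l, hl0, fun j hj q => ?_⟩
  have e1 : borelTerm f χ l m = ((l ^ m)⁻¹ : ℝ) • (h ∘ scaleSnd E l) := by
    funext q
    rw [Pi.smul_apply, Function.comp_apply, hh, borelTerm, borelTerm, one_smul,
      isHomogeneousSnd_extTerm hf m, Complex.real_smul, scaleSnd_apply]
    push_cast
    have : (l : ℂ) ≠ 0 := by exact_mod_cast hl0.ne'
    field_simp
  have hcs : ContDiff ℝ ∞ (h ∘ scaleSnd E l) := hs.comp (scaleSnd E l).contDiff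
  rw [e1, iteratedFDeriv_const_smul_apply (hcs.contDiffAt.of_le (by norm_cast; exact le_top)),
    norm_smul, Real.norm_of_nonneg (by positivity)]
  have e2 : C j ≤ S := Finset.single_le_sum (fun j _ => hC0 j) (Finset.mem_range.2 hj)
  have e3 : l ^ j * l ≤ l ^ m := by
    rw [← pow_succ]; exact pow_le_pow_right₀ hl1 hj
  calc (l ^ m)⁻¹ * ‖iteratedFDeriv ℝ j (h ∘ scaleSnd E l) q‖
      ≤ (l ^ j * l)⁻¹ * (S * l ^ j) := by
        have h3 := (norm_iteratedFDeriv_comp_scaleSnd_le hs hl1 j q).trans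
          (mul_le_mul_of_nonneg_right ((hC j _).trans e2) (by positivity))
        gcongr
    _ = S / l := by field_simp
    _ ≤ (1 / 2) ^ m := by
        rw [div_le_iff₀ hl0, hl, one_div, inv_pow, inv_mul_cancel_left₀ (by positivity)]
        linarith

theorem iteratedFDeriv_pair_eq_zero {V : Type*} [NormedAddCommGroup V] [NormedSpace ℝ V]
    {G : V → ℂ} (hG : ContDiff ℝ ∞ G) {q : V} (h : iteratedFDeriv ℝ (j + 1) G q = 0) (v w : V) :
    iteratedFDeriv ℝ j (fun q => fderiv ℝ G q v + Complex.I * fderiv ℝ G q w) q = 0 := by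
  let Λ : (V →L[ℝ] ℂ) →L[ℝ] ℂ :=
    ContinuousLinearMap.apply ℝ ℂ v + Complex.I • ContinuousLinearMap.apply ℝ ℂ w
  have h1 : (fun q => fderiv ℝ G q v + Complex.I * fderiv ℝ G q w) = Λ ∘ fderiv ℝ G := by
    funext q
    simp [Λ]
  have h2 : ContDiffAt ℝ ∞ (fderiv ℝ G) q := hG.contDiffAt.fderiv_right (by simp)
  have h3 : iteratedFDeriv ℝ j (fderiv ℝ G) q = 0 := by
    rw [← norm_eq_zero, norm_iteratedFDeriv_fderiv, h, norm_zero]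
  rw [h1, Λ.iteratedFDeriv_comp_left (h2.of_le (m := j) (by norm_cast; exact le_top)) le_rfl, h3]
  ext; simp

/-- A compactly supported smooth function on a real vector space extends to its complexification,
almost holomorphically along the real subspace. -/
theorem exists_almostHolomorphic [FiniteDimensional ℝ E] (hf : ContDiff ℝ ∞ f)
    (hfc : HasCompactSupport f) :
    ∃ G : E × E → ℂ, ContDiff ℝ ∞ G ∧ (∀ a, G (a, 0) = f a) ∧ ∀ (α γ a : E) (j : ℕ),
      iteratedFDeriv ℝ j (fun q => fderiv ℝ G q (α, γ) + Complex.I * fderiv ℝ G q (-γ, α))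
        (a, 0) = 0 := by
  let χ : ContDiffBump (0 : E) := ⟨1, 2, by norm_num, by norm_num⟩
  choose l hl0 hl using exists_borelTerm_bound hf hfc χ.contDiff χ.hasCompactSupport
  set T : ℕ → E × E → ℂ := fun m => borelTerm f χ (l m) m with hT
  have hTs : ∀ m, ContDiff ℝ ∞ (T m) := fun m => contDiff_borelTerm hf χ.contDiff _ m
  have hsum : Summable fun m : ℕ => (1 / 2 : ℝ) ^ m := summable_geometric_two
  -- The neighbourhood depends on m, so only finitely many cut-offs can be removed at once; hence
  -- the split into partial sum and tail.
  have hloc : ∀ (m : ℕ) (a : E), T m =ᶠ[nhds (a, 0)] extTerm f m := fun m a => by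
    have hc : Filter.Tendsto (fun q : E × E => l m • q.2) (nhds (a, 0)) (nhds 0) := by
      have : Continuous fun q : E × E => l m • q.2 := by fun_prop
      simpa using this.tendsto (a, 0)
    filter_upwards [hc.eventually χ.eventuallyEq_one] with q hq
    rw [hT]
    simp only [borelTerm, hq, Pi.one_apply, Complex.ofReal_one, mul_one]
  have hTz : ∀ (m j : ℕ), j < m → ∀ a : E, iteratedFDeriv ℝ j (T m) (a, 0) = 0 := fun m j hj a => by
    rw [((hloc m a).iteratedFDeriv ℝ j).eq_of_nhds]
    exact (isHomogeneousSnd_extTerm hf m).iteratedFDeriv_eq_zero (contDiff_extTerm hf m) hj a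
  have hsm : ContDiff ℝ ∞ fun q => ∑' m, T m q := by
    refine contDiff_tsum_of_eventually (v := fun _ m => (1 / 2 : ℝ) ^ m) hTs (fun _ _ => hsum)
      fun k _ => ?_
    rw [Nat.cofinite_eq_atTop]
    filter_upwards [Filter.eventually_gt_atTop k] with m hm q
    exact hl m k hm q
  -- Terms of degree above M have vanishing derivatives up to order M on the real subspace, and
  -- summability lets these pass through the series.
  have htail : ∀ M : ℕ, (∀ q, ∑' m, T m q = (∑ m ∈ Finset.range (M + 1), T m q) +
      ∑' m, T (m + (M + 1)) q) ∧ ContDiff ℝ ∞ (fun q => ∑' m, T (m + (M + 1)) q) ∧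
      ∀ j ≤ M, ∀ a : E, iteratedFDeriv ℝ j (fun q => ∑' m, T (m + (M + 1)) q) (a, 0) = 0 := by
    intro M
    have hb : ∀ (k m : ℕ) (q : E × E), k ≤ M →
        ‖iteratedFDeriv ℝ k (T (m + (M + 1))) q‖ ≤ (1 / 2) ^ m := fun k m q hk =>
      (hl (m + (M + 1)) k (by omega) q).trans
        (pow_le_pow_of_le_one (by norm_num) (by norm_num) (by omega))
    refine ⟨fun q => ?_, ?_, fun j hj a => ?_⟩
    · refine (Summable.sum_add_tsum_nat_add (f := fun m => T m q) (M + 1) ?_).symm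
      refine (summable_nat_add_iff 1).1 (Summable.of_norm_bounded hsum fun m => ?_)
      have := hl (m + 1) 0 (by omega) q
      rw [norm_iteratedFDeriv_zero] at this
      exact this.trans (pow_le_pow_of_le_one (by norm_num) (by norm_num) (by omega))
    · refine contDiff_tsum_of_eventually (v := fun _ m => (1 / 2 : ℝ) ^ m) (fun m => hTs _)
        (fun _ _ => hsum) fun k _ => ?_
      rw [Nat.cofinite_eq_atTop]
      filter_upwards [Filter.eventually_gt_atTop k] with m hm q
      exact (hl _ k (by omega) q).trans
        (pow_le_pow_of_le_one (by norm_num) (by norm_num) (by omega))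
    · rw [iteratedFDeriv_tsum_apply (N := (M : ℕ∞)) (v := fun _ m => (1 / 2 : ℝ) ^ m)
        (fun m => (hTs _).of_le (by norm_cast; exact le_top)) (fun _ _ => hsum)
        (fun k m q hk => hb k m q (by exact_mod_cast hk)) (by exact_mod_cast hj)]
      rw [tsum_congr fun m => hTz (m + (M + 1)) j (by omega) a, tsum_zero]
  refine ⟨fun q => ∑' m, T m q, hsm, fun a => ?_, fun α γ a j => ?_⟩
  · obtain ⟨h1, -, h3⟩ := htail 0
    have h4 := h3 0 le_rfl a
    rw [← norm_eq_zero, norm_iteratedFDeriv_zero, norm_eq_zero] at h4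
    refine (h1 _).trans ?_
    rw [h4, zero_add, Finset.sum_range_one, (hloc 0 a).eq_of_nhds, add_zero]
    rfl
  -- For j derivatives of ∂̄G the split is after degree j + 1: the tail is flat to order j + 1, and
  -- ∂̄ of the partial sum is homogeneous of degree j + 1 > j.
  · obtain ⟨h1, h2, h3⟩ := htail (j + 1)
    set P : E × E → ℂ := fun q => ∑ m ∈ Finset.range (j + 1 + 1), T m q with hP
    set Q : E × E → ℂ := fun q => ∑' m, T (m + (j + 1 + 1)) q with hQ
    have hPs : ContDiff ℝ ∞ P := ContDiff.sum fun m _ => hTs m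
    set Z : (E × E → ℂ) → E × E → ℂ := fun G q =>
      fderiv ℝ G q (α, γ) + Complex.I * fderiv ℝ G q (-γ, α) with hZ
    have hZs : ∀ G, ContDiff ℝ ∞ G → ContDiff ℝ ∞ (Z G) := fun G hG =>
      ((hG.fderiv_right (by simp)).clm_apply contDiff_const).add
        (contDiff_const.mul ((hG.fderiv_right (by simp)).clm_apply contDiff_const))
    have e1 : Z (fun q => ∑' m, T m q) = Z P + Z Q := by
      have : (fun q => ∑' m, T m q) = fun q => P q + Q q := funext h1
      rw [this]
      funext q
      simp only [hZ, Pi.add_apply]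
      rw [fderiv_fun_add (hPs.differentiable (by simp) q) (h2.differentiable (by simp) q), add_apply,
        add_apply]
      ring
    have e2 : Z P =ᶠ[nhds (a, 0)] fun q => fderiv ℝ (extTerm f (j + 1)) q (α, 0) +
        Complex.I * fderiv ℝ (extTerm f (j + 1)) q (-γ, 0) := by
      have h4 : P =ᶠ[nhds (a, 0)] fun q => ∑ m ∈ Finset.range (j + 1 + 1), extTerm f m q := by
        have : ∀ᶠ q in nhds ((a, 0) : E × E), ∀ m ∈ Finset.range (j + 1 + 1),
            T m q = extTerm f m q :=
          (Finset.eventually_all _).2 fun m _ => hloc m a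
        filter_upwards [this] with q hq
        exact Finset.sum_congr rfl hq
      filter_upwards [h4.eventuallyEq_nhds] with q hq
      simp only [hZ]
      rw [hq.fderiv_eq]
      exact fderiv_sum_extTerm hf α γ (j + 1) q
    have hom : IsHomogeneousSnd (j + 1) (fun q => fderiv ℝ (extTerm f (j + 1)) q (α, 0) +
        Complex.I * fderiv ℝ (extTerm f (j + 1)) q (-γ, 0)) := fun t q => by
      have h5 : ∀ β : E, fderiv ℝ (extTerm f (j + 1)) (scaleSnd E t q) (β, 0) =
          (t : ℂ) ^ (j + 1) * fderiv ℝ (extTerm f (j + 1)) q (β, 0) := fun β => by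
        rw [← (isHomogeneousSnd_extTerm hf (j + 1)).fderiv_scaleSnd (contDiff_extTerm hf _),
          scaleSnd_apply (β, 0), smul_zero]
      simp only [h5]
      ring
    have homs : ContDiff ℝ ∞ (fun q => fderiv ℝ (extTerm f (j + 1)) q (α, 0) +
        Complex.I * fderiv ℝ (extTerm f (j + 1)) q (-γ, 0)) :=
      (((contDiff_extTerm hf _).fderiv_right (by simp)).clm_apply contDiff_const).add
        (contDiff_const.mul (((contDiff_extTerm hf _).fderiv_right (by simp)).clm_apply
          contDiff_const))
    have hle : ((j : ℕ) : WithTop ℕ∞) ≤ ∞ := by norm_cast; exact le_top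
    change iteratedFDeriv ℝ j (Z fun q => ∑' m, T m q) (a, 0) = 0
    rw [e1, iteratedFDeriv_add_apply ((hZs P hPs).contDiffAt.of_le hle)
      ((hZs Q h2).contDiffAt.of_le hle), (e2.iteratedFDeriv ℝ j).eq_of_nhds,
      hom.iteratedFDeriv_eq_zero homs (Nat.lt_succ_self j), zero_add]
    exact iteratedFDeriv_pair_eq_zero h2 (h3 (j + 1) le_rfl a) _ _

end BorelExtension

/-! ### Existence of almost holomorphic extensions. -/

section Existence

variable {n : ℕ}

/-- Coordinates on `ℂⁿ × ℂⁿ` in which `{z = x̄}` is the real subspace of the complexification of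
`ℂⁿ`. -/
def realCoords (n : ℕ) : (Cn n × Cn n) ≃L[ℝ] (Cn n × Cn n) :=
  LinearEquiv.toContinuousLinearEquiv
    { toFun := fun p => ((2⁻¹ : ℂ) • (p.1 + conjVec p.2),
        (-(Complex.I / 2) : ℂ) • (p.1 - conjVec p.2))
      invFun := fun q => (q.1 + Complex.I • q.2, conjVec (q.1 - Complex.I • q.2))
      map_add' := fun p q => by
        refine Prod.ext ?_ ?_ <;> ext j <;> simp [conjVec] <;> ring
      map_smul' := fun a p => by
        refine Prod.ext ?_ ?_ <;> ext j <;> simp [conjVec] <;> ring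
      left_inv := fun p => by
        refine Prod.ext ?_ ?_ <;> ext j <;> simp [conjVec, Complex.conj_ofNat] <;> ring_nf <;>
          simp <;> ring
      right_inv := fun p => by
        refine Prod.ext ?_ ?_ <;> ext j <;> simp [conjVec] <;> ring_nf <;> simp }

theorem realCoords_apply (p : Cn n × Cn n) : realCoords n p = ((2⁻¹ : ℂ) • (p.1 + conjVec p.2),
    (-(Complex.I / 2) : ℂ) • (p.1 - conjVec p.2)) := rfl

theorem conjVec_conjVec (y : Cn n) : conjVec (conjVec y) = y := by
  ext j; simp [conjVec]

theorem realCoords_diag (y : Cn n) : realCoords n (y, conjVec y) = (y, 0) := by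
  rw [realCoords_apply, conjVec_conjVec, sub_self, smul_zero, ← two_smul ℂ y, smul_smul]
  norm_num

theorem realCoords_I_smul (v : Cn n × Cn n) :
    realCoords n (Complex.I • v) = (-(realCoords n v).2, (realCoords n v).1) := by
  rw [realCoords_apply, realCoords_apply]
  refine Prod.ext ?_ ?_ <;> ext j <;> simp [conjVec] <;> ring_nf <;> simp <;> ring

theorem exists_isAlmostHolExtension {Ω : Set (Cn n)} {φ : Cn n → ℝ} (hΩ : IsOpen Ω)
    (h0 : (0 : Cn n) ∈ Ω) (hφ : ContDiffOn ℝ ∞ φ Ω) :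
    ∃ (W : Set (Cn n × Cn n)) (ψ : Cn n × Cn n → ℂ), IsAlmostHolExtension Ω φ W ψ := by
  obtain ⟨R, hR, hb⟩ := Metric.isOpen_iff.1 hΩ 0 h0
  have hs : ContDiffOn ℝ ∞ (fun y => (φ y : ℂ)) (Metric.ball 0 R) :=
    Complex.ofRealCLM.contDiff.comp_contDiffOn (hφ.mono hb)
  obtain ⟨f, hf, hfc, hfe⟩ := exists_smooth_eqOn_ball hR hs
  obtain ⟨G, hG, hG0, hGf⟩ := exists_almostHolomorphic hf hfc
  -- A cylinder over the ball where the cut-off function still equals φ; the extension itself is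
  -- smooth everywhere.
  refine ⟨Prod.fst ⁻¹' Metric.ball 0 (R / 4), G ∘ realCoords n,
    { isOpen := Metric.isOpen_ball.preimage continuous_fst
      zero_mem := Metric.mem_ball_self (by linarith)
      smooth := (hG.comp (realCoords n).contDiff).contDiffOn
      extends_phi := fun y _ hy => ?_
      flat := fun y _ _ v m => ?_ }⟩
  · rw [Function.comp_apply, realCoords_diag, hG0]
    exact hfe hy
  · have h1 : delBar v (G ∘ realCoords n) = (fun q => (1 / 2 : ℝ) • (fderiv ℝ G q (realCoords n v) +
        Complex.I * fderiv ℝ G q (-(realCoords n v).2, (realCoords n v).1))) ∘ realCoords n := by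
      funext p
      rw [delBar, (realCoords n).comp_right_fderiv, Function.comp_apply]
      simp only [ContinuousLinearMap.comp_apply, ContinuousLinearEquiv.coe_coe, realCoords_I_smul,
        Complex.real_smul]
      push_cast
      ring
    have h2 := hGf (realCoords n v).1 (realCoords n v).2 y m
    rw [h1]
    refine iteratedFDeriv_comp_equiv_eq_zero _ ?_
    rw [realCoords_diag]
    have hZ : ContDiff ℝ ∞ (fun q => fderiv ℝ G q (realCoords n v) +
        Complex.I * fderiv ℝ G q (-(realCoords n v).2, (realCoords n v).1)) :=
      ((hG.fderiv_right (by simp)).clm_apply contDiff_const).add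
        (contDiff_const.mul ((hG.fderiv_right (by simp)).clm_apply contDiff_const))
    exact (iteratedFDeriv_const_smul_apply
      (hZ.contDiffAt.of_le (by norm_cast; exact le_top))).trans 
      ((congrArg (fun A => (1 / 2 : ℝ) • A) h2).trans (smul_zero _))

end Existence

/-! ### Almost holomorphy of the asymptotic kernel. -/

section AlmostHolomorphicKernel

variable {n : ℕ} {F : Cn n × Cn n → ℂ} {φ : Cn n → ℝ} {R r δ : ℝ}

theorem IsPolarizedPhase.isAlmostHolKernel (H : IsPolarizedPhase F φ R r δ)
    {ψ : Cn n × Cn n → ℂ} (he : Set.EqOn F (polarized ψ) (biball n R)) (N : ℕ) :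
    IsAlmostHolKernel φ r (asymptoticKernel (kernelCoeff n) ψ N) := by
  have hd : ∀ x ∈ Metric.ball (0 : Cn n) r, (F (x, x)).re = φ x := fun x hx =>
    H.re_diag (Metric.ball_subset_ball H.lt.le hx)
  have hph : ∀ x ∈ Metric.ball (0 : Cn n) r, ∀ y ∈ Metric.ball (0 : Cn n) r,
      2 * (F (x, y)).re ≤ (F (x, x)).re + (F (y, y)).re - δ * ‖y - x‖ ^ 2 := fun x hx y hy => by
    rw [hd x hx, hd y hy]; exact H.phase x hx y hy
  have key : ∀ (s : ℂ) (v : Fin n → Cn n × Cn n), (∀ j, FlatOn R (wirt s (v j) F)) → ∀ l M : ℕ,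
      ∃ C : ℝ, 0 ≤ C ∧ ∀ k : ℕ, 1 ≤ k → ∀ x ∈ Metric.ball (0 : Cn n) r,
        ∀ y ∈ Metric.ball (0 : Cn n) r, ∀ j : Fin n,
        Real.exp (-(k * (φ x / 2 + φ y / 2))) * ‖iteratedFDeriv ℝ l (wirt s (v j)
          (fun p => asymptoticKernel (kernelCoeff n) ψ N k p.1 p.2)) (x, y)‖ ≤ C / (k : ℝ) ^ M := by
    intro s v hv l M
    have hneg := fun j => isNegligible_wirt_polarKernel H.weight.smooth H.det_ne (hv j) H.lt
      H.delta_pos hph N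
    choose C hC using fun j => (hneg j).bound l M
    refine ⟨∑ j, |C j|, Finset.sum_nonneg fun j _ => abs_nonneg _, fun k hk x hx y hy j => ?_⟩
    have e : Set.EqOn (fun p => asymptoticKernel (kernelCoeff n) ψ N k p.1 p.2)
        (polarKernel F N k) (biball n R) := fun p hp =>
      asymptoticKernel_eq_polarKernel he isOpen_biball N k hp
    have e1 := (e.wirt isOpen_biball s (v j)).eventuallyEq_of_mem
      (isOpen_biball.mem_nhds (H.mem_biball hx hy))
    have h1 := hC j k hk x hx y hy
    rw [hd x hx, hd y hy, ← (e1.iteratedFDeriv ℝ l).eq_of_nhds] at h1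
    refine h1.trans ?_
    gcongr
    exact (le_abs_self _).trans
      (Finset.single_le_sum (f := fun j => |C j|) (fun j _ => abs_nonneg _) (Finset.mem_univ j))
  intro l M
  obtain ⟨C, hC0, hC⟩ := key Complex.I (fun j => (coordVec j, 0)) H.weight.flatX l M
  obtain ⟨D, hD0, hD⟩ := key (-Complex.I) (fun j => (0, coordVec j))
    (fun j => by rw [← delHol_eq_wirt]; exact H.weight.flatY j) l M
  refine ⟨C + D, fun k hk x hx y hy j => ⟨(hC k hk x hx y hy j).trans ?_, ?_⟩⟩
  · gcongr; linarith
  · rw [delHol_eq_wirt]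
    refine (hD k hk x hx y hy j).trans ?_
    gcongr; linarith

end AlmostHolomorphicKernel

/-! ### The proposition. -/

theorem proposition2p6 (n : ℕ) :
    ∃ P : ℕ → JetPolynomial n, P 0 = 1 ∧
      ∀ (Ω : Set (Cn n)) (φ : Cn n → ℝ), IsOpen Ω → (0 : Cn n) ∈ Ω →
        IsSmoothStrictlyPSHOn φ Ω →
        (∃ (W : Set (Cn n × Cn n)) (ψ : Cn n × Cn n → ℂ), IsAlmostHolExtension Ω φ W ψ) ∧
        ∀ (W : Set (Cn n × Cn n)) (ψ : Cn n × Cn n → ℂ), IsAlmostHolExtension Ω φ W ψ →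
          ∃ r₀ : ℝ, 0 < r₀ ∧ Metric.ball (0 : Cn n) r₀ ⊆ Ω ∧
            (∀ x ∈ Metric.ball (0 : Cn n) r₀, ∀ y ∈ Metric.ball (0 : Cn n) r₀,
              (x, conjVec y) ∈ W ∧ mixedHessianDet (polarized ψ) (x, y) ≠ 0) ∧
            (∀ r : ℝ, 0 < r → r ≤ r₀ → ∃ ε : ℝ, 0 < ε ∧ ε < r ∧
              ∀ χ : Cn n → ℝ, IsCutoff r χ → ∀ N : ℕ,
                IsReproducingKernelMod φ r ε χ ((n : ℤ) - N - 1) (asymptoticKernel P ψ N)) ∧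
            (∀ N : ℕ, IsAlmostHolKernel φ r₀ (asymptoticKernel P ψ N)) := by
  refine ⟨kernelCoeff n, by simp [kernelCoeff, leadCoeff], fun Ω φ hΩ h0 hφ =>
    ⟨exists_isAlmostHolExtension hΩ h0 hφ.1, fun W ψ hψ => ?_⟩⟩
  obtain ⟨F, R, r₀, δ, hr₀, hRΩ, hW, he, H⟩ := hψ.exists_isPolarizedPhase hΩ h0 hφ
  have H₀ := H r₀ hr₀ le_rfl
  -- The choice ε = r/4 depends neither on χ nor on N; the localization radius ρ, which does depend
  -- on N, stays inside the constants.
  refine ⟨r₀, hr₀, (Metric.ball_subset_ball H₀.lt.le).trans hRΩ, fun x hx y hy =>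
    ⟨hW (x, y) (H₀.mem_biball hx hy), ?_⟩, fun r hr hr' => ⟨r / 4, by linarith, by linarith,
    fun χ hχ N => ?_⟩, fun N => H₀.isAlmostHolKernel he N⟩
  · rw [← he.mixedHessianDet isOpen_biball (H₀.mem_biball hx hy)]
    exact H₀.det_ne _ (H₀.mem_biball hx hy)
  · have Hr := H r hr hr'
    obtain ⟨C, hC⟩ := Hr.isReproducingKernelMod hχ N
    refine ⟨C, fun k hk u hu x hx => ?_⟩
    refine le_trans (le_of_eq ?_) (hC k hk u hu x hx)
    congr 2
    rw [weightedInner, weightedInner]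
    refine MeasureTheory.setIntegral_congr_fun measurableSet_ball fun y hy => ?_
    have hxr : x ∈ Metric.ball (0 : Cn n) r := Metric.ball_subset_ball (by linarith) hx
    have := asymptoticKernel_eq_polarKernel he isOpen_biball N k (Hr.mem_biball hxr hy)
    simp only [this]
end
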